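/- **Theorem (order of the contact Lie group variational integrator).** Let $G$ be a finite-dimensional real Lie group with Lie algebra $\mathfrak g$, and left-trivialize, so that $T^*G\times\mathbb R\cong G\times\mathfrak g^*\times\mathbb R$. Let $L:G\times\mathfrak g\times\mathbb R\to\mathbb R$ be a smooth hyperregular contact Lagrangian, i.e. the Legendre transform $(g,\xi,z)\mapsto(g,\tfrac{\delta L}{\delta\xi},z)$ is a diffeomorphism onto $G\times\mathfrak g^*\times\mathbb R$. The Euler–Poincaré–Herglotz equations are $$\dot g=T_eL_g(\xi),\qquad \dot z=L,\qquad \frac{d}{dt}\frac{\delta L}{\delta\xi}=\mathrm{ad}^*_\xi\frac{\delta L}{\delta\xi}+T_e^*L_g\Bigl(\frac{\delta L}{\delta g}\Bigr)+\frac{\partial L}{\partial z}\,\frac{\delta L}{\delta\xi}.$$ The exact solution in phase space is $y(t)=(g(t),p(t),z(t))$ with $p=\delta L/\delta\xi$. For small $h>0$ the exact discrete contact Lagrangian is $L_h^{e}(g_0,g_1,z_0)=\int_0^hL(g,\xi,z)\,dt$, taken along the (locally unique) solution on $[0,h]$ with $g(0)=g_0$, $z(0)=z_0$, $g(h)=g_1$.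 Let $R:\mathfrak g\to G$ be a retraction ($R(0)=e$, $dR_0=\mathrm{id}$, smooth near $0$). Let $L_d=L_d(h;g_0,g_1,z_0)$ be a discrete Lagrangian that is smooth in the sense that $(h,g,\xi,z)\mapsto L_d(h;g,gR(h\xi),z)$, $h>0$, extends to a smooth function on a neighbourhood of $\{h=0\}$. Let $r\ge1$ be an integer, and suppose that $L_d=L_h^{e}+O(h^{r+1})$ as $h\to0$, uniformly on compacts: for every compact $K\subset G\times\mathfrak g\times\mathbb R$ there are $C$ and $h_0>0$ with $|L_d(h;g(0),g(h),z(0))-\int_0^hL\,dt|\le Ch^{r+1}$ for all $0<h\le h_0$ and all solutions on $[0,h]$ with $(g(0),\xi(0),z(0))\in K$. A *discrete step* $(g_0,p_0,z_0)\mapsto(g_1,p_1,z_1)$ is defined through the type-II generating function $S_d=z+L_d(h;g,g',z)-\langle p_1,R^{-1}(g_1^{-1}g')\rangle$: at $(g,g',z)=(g_0,g_1,z_0)$, $$\partial_{g'}S_d=0,\qquad \partial_gS_d=-(\partial_zS_d)\,p_0,\qquad z_1=S_d .$$ Equivalently, in left-trivialized derivatives, $p_1=D_2L_d$, $(1+\partial_zL_d)\,p_0=-D_1L_d$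 and $z_1=z_0+L_d$. The *discrete flow* generated by $L_d$ is a family of maps $F_h$ of $T^*G\times\mathbb R$ such that for every compact $K$ there are a compact $B\subset\mathfrak g$ and $h_0>0$ for which, whenever $0<h\le h_0$ and $y\in K$, $y\mapsto F_h(y)$ is a discrete step with $g_1=g_0R(h\xi)$ for some $\xi\in B$. Then: 1. (Discrete Herglotz principle.) For all compact $K\subset G\times\mathbb R$, $B\subset\mathfrak g$ there is $h_0>0$ such that for $0<h\le h_0$, every $N$, and every discrete curve $(g_k)_{k=0}^N$ with $z_{k+1}=z_k+L_d(h;g_k,g_{k+1},z_k)$, $(g_k,z_k)\in K$ and $g_{k+1}\in g_kR(hB)$: the discrete action $\sum_{k<N}L_d(h;g_k,g_{k+1},z_k)=z_N-z_0$ is stationary under variations of the interior nodes $g_1,\dots,g_{N-1}$ if and only if there are momenta $p_0,\dots,p_N$ making each $(g_k,p_k,z_k)\mapsto(g_{k+1},p_{k+1},z_{k+1})$ a discrete step. 2. (Well-posedness.) A discrete flow exists, and any two discrete flows agree on each compact set for all sufficiently small $h$. 3. (Local error.) For every discrete flow $F$ and every compact $K\subset T^*G\times\mathbb R$ there are $C$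 and $h_0>0$ such that for $0<h\le h_0$ and $y\in K$ the exact solution with $y(0)=y$ exists on $[0,h]$, and $F_h(y)$ differs from $y(h)$ by at most $Ch^{r+1}$. 4. (Global error: order $r$.) For every discrete flow $F$ and every exact solution $y$ on $[0,T]$, $T>0$, there are $C$ and $h_0>0$ such that whenever $Nh=T$, $0<h\le h_0$ and $0\le k\le N$, $F_h^k(y(0))$ differs from $y(kh)$ by at most $Ch^{r}$. In particular the error in $(g_N,p_N,z_N)$ at time $T$ is $O(h^r)$. Here $(g,p,z)$ differs from $(g',p',z')$ by at most $\varepsilon$ if $g=g'R(\eta)$ with $\|\eta\|\le\varepsilon$, $\|p-p'\|\le\varepsilon$ and $|z-z'|\le\varepsilon$. -/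

import Mathlib

open scoped Manifold ContDiff

noncomputable section

namespace ContactLGVI

/-! Throughout, `G` is a Lie group modelled on the finite-dimensional real space `E`. Mathlib's Lie
algebra `GroupLieAlgebra 𝓘(ℝ, E) G`, the tangent space of `G` at `1`, is by definition the vector
space `E`, with the Lie bracket of left-invariant vector fields. We write `E` for it (this gives
access to its norm) and `E →L[ℝ] ℝ` for its dual. Everything is left-trivialized: `TG × ℝ` is
`G × E × ℝ`, and `T*G × ℝ` is `G × (E →L[ℝ] ℝ) × ℝ`. -/

/-- Points `(g, p, z)` of the left-trivialized contact phase space `T*G × ℝ`. -/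
abbrev State (E : Type*) [NormedAddCommGroup E] [NormedSpace ℝ E] (G : Type*) : Type _ :=
  G × (E →L[ℝ] ℝ) × ℝ

section Continuous

variable {E : Type*} [NormedAddCommGroup E] [NormedSpace ℝ E]
  {G : Type*} [TopologicalSpace G] [ChartedSpace E G] [Group G]

/-- The Lie bracket of the Lie algebra of `G`. -/
def bracket (G : Type*) [TopologicalSpace G] [ChartedSpace E G] [Group G] (ξ η : E) : E :=
  (⁅(show GroupLieAlgebra 𝓘(ℝ, E) G from ξ), (show GroupLieAlgebra 𝓘(ℝ, E) G from η)⁆ :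
    GroupLieAlgebra 𝓘(ℝ, E) G)

/-- `p` is the left-trivialized differential at `g` of `f : G → ℝ`: the differential at the
identity of `x ↦ f (g x)`, that is `T_e^* L_g (df(g))`. -/
def HasLeftDerivAt (f : G → ℝ) (p : E →L[ℝ] ℝ) (g : G) : Prop :=
  HasMFDerivAt 𝓘(ℝ, E) 𝓘(ℝ, ℝ) (fun x : G => f (g * x)) 1 p

/-- The left-trivialized differential `T_e^* L_g (δf/δg)` of `f : G → ℝ` at `g`. -/
def leftDeriv (f : G → ℝ) (g : G) : E →L[ℝ] ℝ :=
  mfderiv 𝓘(ℝ, E) 𝓘(ℝ, ℝ) (fun x : G => f (g * x)) 1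

/-- The tangent vector `T_e L_g (ξ)` at `g`; Mathlib's tangent spaces of `G` are copies of `E`. -/
def leftTranslate (g : G) (ξ : E) : E :=
  mulInvariantVectorField (I := 𝓘(ℝ, E)) (G := G) ξ g

/-- The differential `s ↦ s T_e L_g (ξ)` at any time of a curve passing through `g` with velocity
`T_e L_g (ξ)`. -/
def leftVelocity (g : G) (ξ : E) : ℝ →L[ℝ] E :=
  ContinuousLinearMap.toSpanSingleton ℝ (leftTranslate g ξ)

/-- The momentum `μ = δL/δξ (g, ξ, z)`. -/
def momentum (L : G → E → ℝ → ℝ) (g : G) (ξ : E) (z : ℝ) : E →L[ℝ] ℝ :=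
  fderiv ℝ (fun η => L g η z) ξ

/-- The left-trivialized contact Lagrangian `L` is smooth on `G × 𝔤 × ℝ`. -/
def IsSmoothLagrangian (L : G → E → ℝ → ℝ) : Prop :=
  ContMDiff (𝓘(ℝ, E).prod (𝓘(ℝ, E).prod 𝓘(ℝ, ℝ))) 𝓘(ℝ, ℝ) ∞
    (fun x : G × E × ℝ => L x.1 x.2.1 x.2.2)

/-- The Legendre transform `(g, ξ, z) ↦ (g, δL/δξ, z)` is a global smooth diffeomorphism. -/
def IsHyperregular (L : G → E → ℝ → ℝ) : Prop :=
  ∃ Φ : Diffeomorph (𝓘(ℝ, E).prod (𝓘(ℝ, E).prod 𝓘(ℝ, ℝ)))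
      (𝓘(ℝ, E).prod (𝓘(ℝ, E →L[ℝ] ℝ).prod 𝓘(ℝ, ℝ))) (G × E × ℝ) (State E G) ∞,
    ∀ x : G × E × ℝ, Φ x = (x.1, momentum L x.1 x.2.1 x.2.2, x.2.2)

/-- `(g(t), ξ(t), z(t))` solves the Euler--Poincaré--Herglotz equations on `[0, T]`:
`g' = T_e L_g (ξ)`, `z' = L`, and
`d/dt (δL/δξ) = ad*_ξ (δL/δξ) + T_e^* L_g (δL/δg) + (∂L/∂z) δL/δξ`.
The last equation is tested against every `η` of the Lie algebra; `(ad*_ξ μ) η = μ [ξ, η]`. -/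
structure IsEPHSolution (L : G → E → ℝ → ℝ) (T : ℝ) (g : ℝ → G) (ξ : ℝ → E) (z : ℝ → ℝ) :
    Prop where
  position_eq : ∀ t ∈ Set.Icc 0 T,
    HasMFDerivWithinAt 𝓘(ℝ, ℝ) 𝓘(ℝ, E) g (Set.Icc 0 T) t (leftVelocity (E := E) (g t) (ξ t))
  action_eq : ∀ t ∈ Set.Icc 0 T, HasDerivWithinAt z (L (g t) (ξ t) (z t)) (Set.Icc 0 T) t
  momentum_eq : ∀ t ∈ Set.Icc 0 T, ∀ η : E,
    HasDerivWithinAt (fun s => momentum L (g s) (ξ s) (z s) η)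
      (momentum L (g t) (ξ t) (z t) (bracket G (ξ t) η)
        + leftDeriv (fun x => L x (ξ t) (z t)) (g t) η
        + momentum L (g t) (ξ t) (z t) η * deriv (fun s => L (g t) (ξ t) s) (z t))
      (Set.Icc 0 T) t

/-- The exact solution at time `t`, in momentum variables, as a point of `T*G × ℝ`. -/
def phaseState (L : G → E → ℝ → ℝ) (g : ℝ → G) (ξ : ℝ → E) (z : ℝ → ℝ) (t : ℝ) : State E G :=
  (g t, momentum L (g t) (ξ t) (z t), z t)

/-- The graph of the exact discrete contact Lagrangian: `v = L_h^e (g₀, g₁, z₀)`, that is,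
`v = ∫₀ʰ L(g(t), ξ(t), z(t)) dt` for a solution on `[0, h]` with `g(0) = g₀`, `z(0) = z₀`,
`g(h) = g₁`. The boundary value problem has a unique solution only locally (on a compact group,
long solutions may wind around); the compact set `K` of initial data `(g(0), ξ(0), z(0))` singles
out the local branch. -/
def IsExactDiscreteLagrangian (L : G → E → ℝ → ℝ) (K : Set (G × E × ℝ)) (h : ℝ) (g₀ g₁ : G)
    (z₀ v : ℝ) : Prop :=
  ∃ (g : ℝ → G) (ξ : ℝ → E) (z : ℝ → ℝ), IsEPHSolution L h g ξ z ∧ (g 0, ξ 0, z 0) ∈ K ∧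
    g 0 = g₀ ∧ g h = g₁ ∧ z 0 = z₀ ∧ v = ∫ t in (0 : ℝ)..h, L (g t) (ξ t) (z t)

/-- `L_d (g₀, g₁, z₀) = L_h^e (g₀, g₁, z₀) + O(h^m)` as `h → 0`, uniformly on compact sets.
A discrete Lagrangian is written `Ld h g₀ g₁ z₀`, with time step `h`. -/
def AgreesWithExact (L : G → E → ℝ → ℝ) (Ld : ℝ → G → G → ℝ → ℝ) (m : ℕ) : Prop :=
  ∀ K : Set (G × E × ℝ), IsCompact K → ∃ C h₀ : ℝ, 0 < h₀ ∧ ∀ h ∈ Set.Ioc 0 h₀,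
    ∀ (g₀ g₁ : G) (z₀ v : ℝ), IsExactDiscreteLagrangian L K h g₀ g₁ z₀ v →
      |Ld h g₀ g₁ z₀ - v| ≤ C * h ^ m

end Continuous

section Discrete

variable {E : Type*} [NormedAddCommGroup E] [NormedSpace ℝ E]
  {G : Type*} [TopologicalSpace G] [ChartedSpace E G] [Group G]

/-- A retraction `R : 𝔤 → G`: `R(0) = e`, `dR_0 = id`, and `R` is smooth near `0`. -/
structure IsRetraction (R : E → G) : Prop where
  map_zero : R 0 = 1
  smooth : ∃ U ∈ nhds (0 : E), ContMDiffOn 𝓘(ℝ, E) 𝓘(ℝ, E) ∞ R U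
  deriv_zero : HasMFDerivAt 𝓘(ℝ, E) 𝓘(ℝ, E) R 0 (ContinuousLinearMap.id ℝ E)

/-- `L_d` is smooth in all its arguments, the step `h` included. Since `L_h^e` and its
approximations are singular in `(g₀, g₁)` as `h → 0`, smoothness means smoothness in the variables
`(h, g, ξ, z)`, where `g₁ = g R(h ξ)`, up to and across `h = 0`. -/
def IsSmoothDiscreteLagrangian (R : E → G) (Ld : ℝ → G → G → ℝ → ℝ) : Prop :=
  ∃ (ℓ : ℝ × G × E × ℝ → ℝ) (W : Set (ℝ × G × E × ℝ)), IsOpen W ∧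
    (∀ (g : G) (ξ : E) (z : ℝ), ((0 : ℝ), g, ξ, z) ∈ W) ∧
    ContMDiffOn (𝓘(ℝ, ℝ).prod (𝓘(ℝ, E).prod (𝓘(ℝ, E).prod 𝓘(ℝ, ℝ)))) 𝓘(ℝ, ℝ) ∞ ℓ W ∧
    ∀ (h : ℝ) (g : G) (ξ : E) (z : ℝ), 0 < h → (h, g, ξ, z) ∈ W →
      Ld h g (g * R (h • ξ)) z = ℓ (h, g, ξ, z)

/-- The cost `z_k` of a discrete curve: `z_{k+1} = z_k + L_d (g_k, g_{k+1}, z_k)`. -/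
def herglotzCost (Ld : ℝ → G → G → ℝ → ℝ) (h : ℝ) (gs : ℕ → G) (z₀ : ℝ) : ℕ → ℝ
  | 0 => z₀
  | k + 1 => herglotzCost Ld h gs z₀ k + Ld h (gs k) (gs (k + 1)) (herglotzCost Ld h gs z₀ k)

/-- The discrete Herglotz principle for `g_0, …, g_N`: the discrete action
`∑_{k<N} L_d (g_k, g_{k+1}, z_k) = z_N - z_0` is stationary under variations of the interior nodes
`g_1, …, g_{N-1}`, with `z_0`, `g_0` and `g_N` fixed. -/
def DiscreteHerglotzPrinciple (Ld : ℝ → G → G → ℝ → ℝ) (h : ℝ) (N : ℕ) (gs : ℕ → G) (z₀ : ℝ) :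
    Prop :=
  ∀ k : ℕ, 0 < k → k < N →
    HasLeftDerivAt (E := E)
      (fun x => herglotzCost Ld h (Function.update gs k x) z₀ N - z₀) 0 (gs k)

/-- The type-II contact generating function
`S_d = z + L_d (g, g', z) - ⟨p₁, R⁻¹(g₁⁻¹ g')⟩`, where the trial endpoint `g'` near `g₁` is written
`g' = g₁ R(η)`. -/
def generatingFunction (R : E → G) (Ld : ℝ → G → G → ℝ → ℝ) (h : ℝ) (g₁ : G) (p₁ : E →L[ℝ] ℝ)
    (g : G) (η : E) (z : ℝ) : ℝ :=
  z + Ld h g (g₁ * R η) z - p₁ η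

/-- One step `(g₀, p₀, z₀) ↦ (g₁, p₁, z₁)` of the discrete flow generated by `L_d`: the endpoint
`g₁` is a critical point of `S_d`, `∂_g S_d = -c p₀` with `c = ∂_z S_d`, and `z₁ = S_d`. As the
differential of `R` at `0` is the identity, this says `p₁ = D_2 L_d`,
`(1 + ∂_z L_d) p₀ = -D_1 L_d` and `z₁ = z₀ + L_d`, so that `dz₁ - p₁ dg₁ = c (dz₀ - p₀ dg₀)` along
the step. Equating the two formulas for the momentum at a node gives the discrete Herglotz
equation. -/
def IsDiscreteStep (R : E → G) (Ld : ℝ → G → G → ℝ → ℝ) (h : ℝ) (y₀ y₁ : State E G) : Prop :=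
  ∃ c : ℝ,
    HasFDerivAt (fun η : E => generatingFunction R Ld h y₁.1 y₁.2.1 y₀.1 η y₀.2.2)
      (0 : E →L[ℝ] ℝ) 0 ∧
    HasLeftDerivAt (fun g : G => generatingFunction R Ld h y₁.1 y₁.2.1 g 0 y₀.2.2)
      (-(c • y₀.2.1)) y₀.1 ∧
    HasDerivAt (fun z : ℝ => generatingFunction R Ld h y₁.1 y₁.2.1 y₀.1 0 z) c y₀.2.2 ∧
    y₁.2.2 = generatingFunction R Ld h y₁.1 y₁.2.1 y₀.1 0 y₀.2.2

/-- `F h` is the discrete flow on `T*G × ℝ` generated by `L_d`. The step equations are solved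
locally: on each compact set of states, for all small `h`, the point `F h y` is reached from `y` by
a step whose discrete velocity `ξ = R⁻¹(g₀⁻¹ g₁) / h` stays in a compact set. -/
def IsDiscreteFlow (R : E → G) (Ld : ℝ → G → G → ℝ → ℝ) (F : ℝ → State E G → State E G) : Prop :=
  ∀ K : Set (State E G), IsCompact K → ∃ (B : Set E) (h₀ : ℝ), IsCompact B ∧ 0 < h₀ ∧
    ∀ h ∈ Set.Ioc 0 h₀, ∀ y ∈ K, IsDiscreteStep R Ld h y (F h y) ∧
      ∃ ξ ∈ B, (F h y).1 = y.1 * R (h • ξ)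

/-- The error between `y` and `y'` is at most `ε` in left-trivialized local coordinates: with
`g = g' R(η)`, each of `η`, `p - p'` and `z - z'` has norm at most `ε`. -/
def ErrorLE (R : E → G) (ε : ℝ) (y y' : State E G) : Prop :=
  (∃ η : E, ‖η‖ ≤ ε ∧ y.1 = y'.1 * R η) ∧ ‖y.2.1 - y'.2.1‖ ≤ ε ∧ |y.2.2 - y'.2.2| ≤ ε

end Discrete

end ContactLGVI

end

/-!
The proof works in the charts `x ↦ a R(x)` of `G` around a base state (`IsGroupChart`). There the
group is a germ of a group law on `𝔤` (`IsLocalGroup`), and the Euler--Poincaré--Herglotz equations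
become the equations of an ordinary vector field in the variables `(x, p, z)` (`ephField`).

*Local error.* The difference between `L_d` and the exact discrete Lagrangian is only assumed to be
`O(h^(r+1))`, while the step equations contain the derivatives of `L_d`. The exact discrete
Lagrangian is replaced by one that is smooth up to `h = 0` by construction: there is a flow that is
polynomial in time and solves the equations up to order `r + 1` (`exists_approxFlow`). It is close
enough to the exact flow that the defect of `L_d` along it is still `O(h^(r+1))`. The defect is now
a smooth germ, so by Hadamard's lemma it is `h^(r+1)` times a smooth germ (`exists_eq_pow_smul`),
and its derivatives are `O(h^(r+1))` as well. The flow of the Euler--Poincaré--Herglotz equations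
rescales the contact form `dz - p · g⁻¹dg` (`eventually_lieDeriv_contactForm`), and the approximate
flow does so up to `O(h^(r+2))`. Comparison with the differential of the defect shows that the
approximate flow satisfies the equations of a discrete step up to small residuals
(`exists_stepEquation_residual`).

Since `L_d` vanishes for `h = 0` and its derivative in `h` is `L`, it is `h` times a smooth function
`lam` with `lam = L` for `h = 0`. Hence the equation for the discrete velocity is a smooth
perturbation of the Legendre transform, which is invertible. So it has a solution
(`eventually_exists_isFlatStep`), which depends in a Lipschitz way on the data
(`exists_norm_sub_le_stepVel`); this gives uniqueness, and turns the residuals into the local error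
`O(h^(r+1))` (`exists_flatStep_error`).

*Uniformity.* The step equation also excludes discrete velocities away from the Legendre velocity,
as long as they stay in a compact set (`IsExtension.eventually_velocity_mem`). By compactness, the
local statements hold uniformly on compact sets of states (`IsExtension.exists_isStepRegular`),
which gives the well-posedness and the local error.

*Discrete Herglotz principle.* By the chain rule along the recursion for `z_k`, a variation of an
interior node changes `z_N` by a positive multiple of `(1 + ∂_z L_d) D_2 L_d + D_1 L_d`
(`exists_hasFDerivAt_herglotzCost`). This expression vanishes exactly when the final momentum of the
step before the node is the initial momentum of the step after it.

*Global error.* Along exact solutions the left-invariant difference of two states grows at most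
exponentially (`exists_stability_of_isCompact`). Therefore the `T/h` local errors, transported by
the exact flow, add up to `O(h^r)` (`IsExtension.exists_global_error`).
-/

open scoped Manifold ContDiff

noncomputable section

namespace ContactLGVI

open Set Filter Topology MeasureTheory

/-! ### Hadamard quotients of smooth germs -/

section Hadamard

/-- The Hadamard quotient `(e(t, Y) - e(0, Y)) / t`, with the value `∂ₜ e(0, Y)` at `t = 0`. -/
def hadamard {P F : Type*} [NormedAddCommGroup F] [NormedSpace ℝ F] (e : ℝ × P → F)
    (q : ℝ × P) : F :=
  dslope (fun t => e (t, q.2)) 0 q.1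

lemma hadamard_spec {P F : Type*} [NormedAddCommGroup F] [NormedSpace ℝ F] (e : ℝ × P → F)
    (q : ℝ × P) : e q = e (0, q.2) + q.1 • hadamard e q := by
  have := sub_smul_dslope (fun t => e (t, q.2)) 0 q.1
  simp only [sub_zero] at this
  rw [hadamard, this]; simp

variable {P F : Type*} [NormedAddCommGroup P] [NormedSpace ℝ P]
  [NormedAddCommGroup F] [NormedSpace ℝ F]

lemma contDiff_parametric_integral [CompleteSpace F] {n : ℕ} {φ : P → ℝ → F}
    (hφ : ContDiff ℝ n (fun q : P × ℝ => φ q.1 q.2)) :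
    ContDiff ℝ n (fun p => ∫ s in (0 : ℝ)..1, φ p s) := by
  obtain ⟨χ, hχ⟩ : ∃ χ : ContDiffBump (0 : ℝ), χ.rIn = 1 := ⟨⟨1, 2, by norm_num, by norm_num⟩, rfl⟩
  have hχc : HasCompactSupport (fun x : ℝ => χ x) := χ.hasCompactSupport
  -- the integral is the convolution at `0` of the indicator of `(0, 1]` with a cut-off of
  -- `s ↦ φ p (-s)`
  have key := contDiffOn_convolution_right_with_param (𝕜 := ℝ) (μ := (volume : Measure ℝ)) (n := n)
    (f := (Ioc (0 : ℝ) 1).indicator (fun _ => (1 : ℝ)))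
    (ContinuousLinearMap.lsmul ℝ ℝ : ℝ →L[ℝ] F →L[ℝ] F)
    (g := fun (p : P) (x : ℝ) => χ x • φ p (-x)) (s := univ) (k := tsupport (fun x : ℝ => χ x))
    isOpen_univ hχc (fun p x _ hx => by simp [image_eq_zero_of_notMem_tsupport hx])
    ((integrable_indicator_iff measurableSet_Ioc).2 (by simp)).locallyIntegrable
    (by
      refine ContDiff.contDiffOn ?_
      refine ContDiff.smul (χ.contDiff.comp contDiff_snd) ?_
      exact hφ.comp (contDiff_fst.prodMk contDiff_snd.neg))
  rw [univ_prod_univ, contDiffOn_univ] at key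
  have := key.comp (contDiff_id.prodMk (contDiff_const (c := (0 : ℝ))) : ContDiff ℝ n
    (fun p : P => (p, (0 : ℝ))))
  convert! this using 1
  funext p
  simp only [Function.comp, MeasureTheory.convolution, ContinuousLinearMap.lsmul_apply,
    zero_sub, neg_neg]
  rw [intervalIntegral.integral_of_le zero_le_one, ← integral_indicator measurableSet_Ioc]
  refine integral_congr_ae (Eventually.of_forall fun s => ?_)
  by_cases hs : s ∈ Ioc (0 : ℝ) 1
  · have : χ (-s) = 1 := χ.one_of_mem_closedBall (by
      rw [hχ, mem_closedBall_zero_iff, norm_neg, Real.norm_eq_abs, abs_of_pos hs.1]; exact hs.2)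
    simp [hs, this]
  · simp [hs]

lemma exists_contDiff_eventuallyEq [FiniteDimensional ℝ P] {f : P → F} {a : P} {n : ℕ}
    (hf : ContDiffAt ℝ n f a) : ∃ g : P → F, ContDiff ℝ n g ∧ g =ᶠ[𝓝 a] f := by
  have : ∀ᶠ x in 𝓝 a, ContDiffAt ℝ n f x := hf.eventually (by simp)
  obtain ⟨r, hr, hsub⟩ := Metric.eventually_nhds_iff_ball.1 this
  let b : ContDiffBump a := ⟨r / 3, r / 2, by positivity, by linarith⟩
  refine ⟨fun x => b x • f x, contDiff_iff_contDiffAt.2 fun x => ?_, ?_⟩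
  · by_cases hx : x ∈ Metric.ball a r
    · exact b.contDiff.contDiffAt.smul (hsub x hx)
    · have : (fun x => b x • f x) =ᶠ[𝓝 x] fun _ => 0 := by
        have hx' : x ∈ (tsupport b)ᶜ := by
          rw [b.tsupport_eq]
          intro h
          exact hx (Metric.closedBall_subset_ball (by show r / 2 < r; linarith) h)
        filter_upwards [(isClosed_tsupport b).isOpen_compl.mem_nhds hx'] with y hy
        simp [image_eq_zero_of_notMem_tsupport hy]
      exact contDiffAt_const.congr_of_eventuallyEq this
  · filter_upwards [b.eventuallyEq_one] with x hx
    simp [hx]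

/-- **Hadamard's lemma**: the quotient by the first variable of a smooth germ is smooth. It is the
mean `∫₀¹ ∂ₜ e(s t, Y) ds`. -/
lemma contDiffAt_hadamard [FiniteDimensional ℝ P] [CompleteSpace F] {e : ℝ × P → F} {Y : P}
    (he : ContDiffAt ℝ ∞ e (0, Y)) : ContDiffAt ℝ ∞ (hadamard e) (0, Y) := by
  rw [contDiffAt_infty]
  intro n
  obtain ⟨g, hg, hge⟩ := exists_contDiff_eventuallyEq (contDiffAt_infty.1 he (n + 1))
  have hd : ContDiff ℝ n (fun q : ℝ × P => fderiv ℝ g q (1, 0)) :=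
    (hg.fderiv_right (by norm_cast)).clm_apply contDiff_const
  have hI : ContDiff ℝ n (fun q : ℝ × P => ∫ s in (0 : ℝ)..1, fderiv ℝ g (s * q.1, q.2) (1, 0)) :=
    contDiff_parametric_integral (φ := fun (q : ℝ × P) s => fderiv ℝ g (s * q.1, q.2) (1, 0))
      (hd.comp ((contDiff_snd.mul (contDiff_fst.comp contDiff_fst)).prodMk
        (contDiff_snd.comp contDiff_fst)))
  refine hI.contDiffAt.congr_of_eventuallyEq ?_
  obtain ⟨r, hr, hball⟩ := Metric.eventually_nhds_iff_ball.1 hge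
  filter_upwards [Metric.ball_mem_nhds ((0 : ℝ), Y) hr] with q hq
  have hq1 : |q.1| < r ∧ dist q.2 Y < r := by
    simpa [Prod.dist_eq] using hq
  have hgt : ∀ t : ℝ, |t| < r → g (t, q.2) = e (t, q.2) := fun t ht =>
    hball _ (by simpa [Prod.dist_eq] using ⟨ht, hq1.2⟩)
  have hder : ∀ t : ℝ, HasDerivAt (fun t => g (t, q.2)) (fderiv ℝ g (t, q.2) (1, 0)) t := by
    intro t
    have h1 := (hg.differentiable (by norm_cast) (t, q.2)).hasFDerivAt
    have h2 : HasDerivAt (fun t : ℝ => (t, q.2)) ((1 : ℝ), (0 : P)) t :=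
      (hasDerivAt_id t).prodMk (hasDerivAt_const t q.2)
    exact h1.comp_hasDerivAt t h2
  have hcont : Continuous fun t : ℝ => fderiv ℝ g (t, q.2) (1, 0) :=
    hd.continuous.comp (by fun_prop)
  by_cases h0 : q.1 = 0
  · have : hadamard e q = deriv (fun t => e (t, q.2)) 0 := by
      rw [hadamard, h0, dslope_same]
    rw [this, h0]
    simp only [mul_zero, intervalIntegral.integral_const, sub_zero, one_smul]
    rw [← (hder 0).deriv]
    refine EventuallyEq.deriv_eq ?_
    filter_upwards [Metric.ball_mem_nhds (0 : ℝ) hr] with t ht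
    exact (hgt t (by simpa using ht)).symm
  · have hft : ∫ t in (0 : ℝ)..q.1, fderiv ℝ g (t, q.2) (1, 0) = g (q.1, q.2) - g (0, q.2) :=
      intervalIntegral.integral_eq_sub_of_hasDerivAt (fun t _ => hder t)
        (hcont.intervalIntegrable _ _)
    have hsub := intervalIntegral.integral_comp_mul_right (a := 0) (b := 1)
      (fun t => fderiv ℝ g (t, q.2) (1, 0)) h0
    simp only [zero_mul, one_mul] at hsub
    rw [hsub, hft, hgt _ hq1.1, hgt 0 (by simpa using hr), hadamard, dslope_of_ne _ h0]
    simp [slope_def_module]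

/-- A smooth germ that is `O(tᵐ)` for `t > 0` is `tᵐ` times a smooth germ. In particular its
derivatives in the remaining variables are `O(tᵐ)` as well. -/
lemma exists_eq_pow_smul [FiniteDimensional ℝ P] [CompleteSpace F] {Y : P} {C : ℝ} {m : ℕ}
    {e : ℝ × P → F} (he : ContDiffAt ℝ ∞ e (0, Y))
    (hb : ∀ᶠ q in 𝓝 ((0 : ℝ), Y), 0 < q.1 → ‖e q‖ ≤ C * q.1 ^ m) :
    ∃ e' : ℝ × P → F, ContDiffAt ℝ ∞ e' (0, Y) ∧ ∀ᶠ q in 𝓝 ((0 : ℝ), Y), e q = q.1 ^ m • e' q := by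
  induction m generalizing e with
  | zero => exact ⟨e, he, by simp⟩
  | succ m ih =>
    have h0 : ∀ᶠ Y' in 𝓝 Y, e (0, Y') = 0 := by
      have hc : ∀ᶠ q in 𝓝 ((0 : ℝ), Y), ContinuousAt e q :=
        ((contDiffAt_infty.1 he 0).eventually (by simp)).mono fun q hq => hq.continuousAt
      have hcb := (hc.and hb.eventually_nhds)
      have hin : Tendsto (fun Y' : P => ((0 : ℝ), Y')) (𝓝 Y) (𝓝 (0, Y)) :=
        (Continuous.prodMk_right (0 : ℝ)).tendsto Y
      filter_upwards [hin.eventually hcb] with Y' hY'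
      have hc' : Tendsto (fun t : ℝ => e (t, Y')) (𝓝[>] 0) (𝓝 (e (0, Y'))) := by
        have : Tendsto (fun t : ℝ => (t, Y')) (𝓝 0) (𝓝 (0, Y')) :=
          (Continuous.prodMk_left Y').tendsto 0
        exact (hY'.1.tendsto.comp this).mono_left nhdsWithin_le_nhds
      have hb' : ∀ᶠ t : ℝ in 𝓝[>] 0, ‖e (t, Y')‖ ≤ C * t ^ (m + 1) := by
        have : Tendsto (fun t : ℝ => (t, Y')) (𝓝 0) (𝓝 (0, Y')) :=
          (Continuous.prodMk_left Y').tendsto 0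
        filter_upwards [nhdsWithin_le_nhds (this.eventually hY'.2), self_mem_nhdsWithin]
          with t ht ht'
        exact ht ht'
      have hz : Tendsto (fun t : ℝ => C * t ^ (m + 1)) (𝓝[>] 0) (𝓝 0) := by
        have : Continuous fun t : ℝ => C * t ^ (m + 1) := by fun_prop
        simpa using (this.tendsto 0).mono_left nhdsWithin_le_nhds
      exact tendsto_nhds_unique hc' (squeeze_zero_norm' hb' hz)
    have h0' : ∀ᶠ q in 𝓝 ((0 : ℝ), Y), e q = q.1 • hadamard e q := by
      have : Tendsto (fun q : ℝ × P => q.2) (𝓝 (0, Y)) (𝓝 Y) := continuous_snd.tendsto _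
      filter_upwards [this.eventually h0] with q hq
      have := hadamard_spec e q
      rwa [hq, zero_add] at this
    obtain ⟨e', he', heq⟩ := ih (contDiffAt_hadamard he) (by
      filter_upwards [h0', hb] with q h1 h2 hq
      have h3 := h2 hq
      rw [h1, norm_smul, Real.norm_eq_abs, abs_of_pos hq, pow_succ', ← mul_assoc, mul_comm C,
        mul_assoc] at h3
      exact le_of_mul_le_mul_left h3 hq)
    refine ⟨e', he', ?_⟩
    filter_upwards [h0', heq] with q h1 h2
    rw [h1, h2, smul_smul, ← pow_succ']

end Hadamard

/-! ### Approximate flows and Grönwall's inequality -/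

section FlatODE

lemma eventually_forall_Icc {S : Type*} [PseudoMetricSpace S] {Y : S} {P : ℝ × S → Prop}
    (h : ∀ᶠ q in 𝓝 ((0 : ℝ), Y), P q) :
    ∀ᶠ q in 𝓝 ((0 : ℝ), Y), ∀ t ∈ Icc 0 q.1, P (t, q.2) := by
  obtain ⟨r, hr, hball⟩ := Metric.eventually_nhds_iff_ball.1 h
  filter_upwards [Metric.ball_mem_nhds ((0 : ℝ), Y) hr] with q hq t ht
  have hq1 : |q.1| < r ∧ dist q.2 Y < r := by simpa [Prod.dist_eq] using hq
  refine hball _ ?_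
  simp only [Metric.mem_ball, Prod.dist_eq, max_lt_iff, Real.dist_0_eq_abs]
  refine ⟨?_, hq1.2⟩
  rw [abs_of_nonneg ht.1]
  exact ht.2.trans_lt ((le_abs_self _).trans_lt hq1.1)

variable {S : Type*} [NormedAddCommGroup S] [NormedSpace ℝ S]

lemma gronwallBound_le {δ K ε x : ℝ} (hK : 0 ≤ K) (hε : 0 ≤ ε) :
    gronwallBound δ K ε x ≤ (δ + ε * x) * Real.exp (K * x) := by
  rcases hK.eq_or_lt with rfl | hK
  · simp [gronwallBound_K0]
  · rw [gronwallBound_of_K_ne_0 hK.ne', add_mul]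
    have h1 : Real.exp (K * x) - 1 ≤ K * x * Real.exp (K * x) := by
      have h := mul_le_mul_of_nonneg_right (Real.add_one_le_exp (-(K * x)))
        (Real.exp_pos (K * x)).le
      rw [← Real.exp_add] at h
      simp only [neg_add_cancel, Real.exp_zero] at h
      linarith
    have h2 : ε / K * (Real.exp (K * x) - 1) ≤ ε / K * (K * x * Real.exp (K * x)) := by gcongr
    have h3 : ε / K * (K * x * Real.exp (K * x)) = ε * x * Real.exp (K * x) := by
      field_simp
    show δ * Real.exp (K * x) + ε / K * (Real.exp (K * x) - 1) ≤ _
    linarith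

lemma hasDerivWithinAt_Ici_of_Icc {b : ℝ → S} {b' : S} {h t : ℝ} (ht : t ∈ Ico 0 h)
    (hb : HasDerivWithinAt b b' (Icc 0 h) t) : HasDerivWithinAt b b' (Ici t) t :=
  hb.mono_of_mem_nhdsWithin (Icc_mem_nhdsGE_of_mem ht)

/-- Grönwall's inequality on `[0, h]`, with the bound in a form convenient for `h → 0`. -/
lemma norm_le_of_norm_deriv_le {b b' : ℝ → S} {h K ε δ : ℝ} (hh : 0 ≤ h) (hK : 0 ≤ K)
    (hε : 0 ≤ ε) (hb : ∀ t ∈ Icc 0 h, HasDerivWithinAt b (b' t) (Icc 0 h) t) (h0 : ‖b 0‖ ≤ δ)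
    (hbd : ∀ t ∈ Icc 0 h, ‖b' t‖ ≤ K * ‖b t‖ + ε) :
    ‖b h‖ ≤ (δ + ε * h) * Real.exp (K * h) := by
  have := norm_le_gronwallBound_of_norm_deriv_right_le (a := 0) (b := h) (K := K) (ε := ε) (δ := δ)
    (fun t ht => (hb t ht).continuousWithinAt)
    (fun t ht => hasDerivWithinAt_Ici_of_Icc ht (hb t (Ico_subset_Icc_self ht))) h0
    (fun t ht => hbd t (Ico_subset_Icc_self ht)) h (right_mem_Icc.2 hh)
  rw [sub_zero] at this
  exact this.trans (gronwallBound_le hK hε)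

/-- `Φ` is an approximate flow of order `k` of the vector field `f` near `Y`: it is smooth in
`(t, Y)`, and the residual `∂ₜΦ - f(Φ)` is `tᵏ` times the smooth germ `σ`. -/
structure IsApproxFlow (f : S → S) (Y : S) (k : ℕ) (Φ σ : ℝ × S → S) : Prop where
  smooth : ContDiffAt ℝ ∞ Φ (0, Y)
  smooth_residual : ContDiffAt ℝ ∞ σ (0, Y)
  init : ∀ Z, Φ (0, Z) = Z
  residual : ∀ᶠ q in 𝓝 ((0 : ℝ), Y), fderiv ℝ Φ q (1, 0) = f (Φ q) + q.1 ^ k • σ q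

/-- Approximate flows exist to every order. Unlike for the exact flow, smoothness in `(t, Y)` holds
by construction, as the approximate flow is a polynomial in `t`. -/
lemma exists_approxFlow [FiniteDimensional ℝ S] {f : S → S} {Y : S} (hf : ContDiffAt ℝ ∞ f Y)
    (k : ℕ) : ∃ Φ σ : ℝ × S → S, IsApproxFlow f Y k Φ σ := by
  induction k with
  | zero =>
    refine ⟨fun q => q.2, fun q => -f q.2, contDiffAt_snd, ?_, fun _ => rfl, ?_⟩
    · exact (ContDiffAt.comp ((0 : ℝ), Y) (g := f) (f := Prod.snd) hf contDiffAt_snd).neg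
    · filter_upwards with q
      rw [show (fun q : ℝ × S => q.2) = Prod.snd from rfl, fderiv_snd]
      simp
  | succ k ih =>
    obtain ⟨Φ, σ, hΦ, hσ, h0, hres⟩ := ih
    have hσ0 : ContDiffAt ℝ ∞ (fun q : ℝ × S => σ (0, q.2)) (0, Y) :=
      ContDiffAt.comp ((0 : ℝ), Y) (g := σ) (f := fun q : ℝ × S => ((0 : ℝ), q.2)) hσ (by fun_prop)
    -- the correction `-t^(k+1)/(k+1) σ(0, Y)` cancels the leading term of the residual
    let c : ℝ × S → ℝ := fun q => q.1 ^ (k + 1) / (k + 1)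
    have hc : ContDiff ℝ ∞ c := by fun_prop
    have hc0 : c (0, Y) = 0 := by simp [c]
    -- the Hadamard quotient of `e` in `w.1` is the change of `f` caused by the correction
    let e : ℝ × (ℝ × S) → S := fun w => f (Φ w.2 - w.1 • σ (0, w.2.2))
    have he : ContDiffAt ℝ ∞ e (0, (0, Y)) := by
      have h1 : ContDiffAt ℝ ∞ (fun w : ℝ × (ℝ × S) => Φ w.2 - w.1 • σ (0, w.2.2)) (0, (0, Y)) :=
        (ContDiffAt.comp (0, (0, Y)) (g := Φ) hΦ contDiffAt_snd).sub
          (contDiffAt_fst.smul (ContDiffAt.comp (0, (0, Y)) (g := fun q : ℝ × S => σ (0, q.2))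
            (f := Prod.snd) hσ0 contDiffAt_snd))
      refine ContDiffAt.comp (0, (0, Y)) (g := f) ?_ h1
      simpa [h0] using hf
    refine ⟨fun q => Φ q - c q • σ (0, q.2),
      fun q => hadamard σ q - ((k : ℝ) + 1)⁻¹ • hadamard e (c q, q), ?_, ?_, ?_, ?_⟩
    · exact hΦ.sub (hc.contDiffAt.smul hσ0)
    · refine (contDiffAt_hadamard hσ).sub (contDiffAt_const.smul ?_)
      refine ContDiffAt.comp ((0 : ℝ), Y) (g := hadamard e) (f := fun q => (c q, q)) ?_
        (hc.contDiffAt.prodMk contDiffAt_id)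
      rw [hc0]; exact contDiffAt_hadamard he
    · intro Z; simp [h0, c]
    · have hΦd : ∀ᶠ q in 𝓝 ((0 : ℝ), Y), DifferentiableAt ℝ Φ q :=
        ((hΦ.of_le (m := 1) (by exact_mod_cast le_top)).eventually (by simp)).mono fun q hq =>
          hq.differentiableAt one_ne_zero
      have hσd : ∀ᶠ q in 𝓝 ((0 : ℝ), Y), DifferentiableAt ℝ σ (0, q.2) := by
        have h1 := ((hσ.of_le (m := 1) (by exact_mod_cast le_top)).eventually (by simp))
        have h2 : Tendsto (fun q : ℝ × S => ((0 : ℝ), q.2)) (𝓝 (0, Y)) (𝓝 (0, Y)) := by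
          have : Continuous (fun q : ℝ × S => ((0 : ℝ), q.2)) := by fun_prop
          simpa using this.tendsto (0, Y)
        exact (h2.eventually h1).mono fun q hq => hq.differentiableAt one_ne_zero
      filter_upwards [hres, hΦd, hσd] with q hq hq1 hq2
      have d1 : HasDerivAt (fun t : ℝ => Φ (q.1 + t, q.2)) (fderiv ℝ Φ q (1, 0)) 0 := by
        have h1 : HasDerivAt (fun t : ℝ => (q.1 + t, q.2)) ((1 : ℝ), (0 : S)) 0 :=
          ((hasDerivAt_id _).const_add _).prodMk (hasDerivAt_const _ _)
        have h2 : HasFDerivAt Φ (fderiv ℝ Φ q) (q.1 + 0, q.2) := by simpa using hq1.hasFDerivAt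
        exact h2.comp_hasDerivAt _ h1
      have d2 : HasDerivAt (fun t : ℝ => (c (q.1 + t, q.2)) • σ (0, q.2))
          (q.1 ^ k • σ (0, q.2)) 0 := by
        refine HasDerivAt.smul_const ?_ _
        have h1 : HasDerivAt (fun t : ℝ => q.1 + t) 1 0 := (hasDerivAt_id _).const_add _
        have h2 := (h1.fun_pow (k + 1)).div_const ((k : ℝ) + 1)
        convert! h2 using 1
        have : (k : ℝ) + 1 ≠ 0 := by positivity
        push_cast
        field_simp
        simp
      have hdiff : DifferentiableAt ℝ (fun q : ℝ × S => Φ q - c q • σ (0, q.2)) q := by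
        refine hq1.sub ((hc.differentiable (by simp) q).smul ?_)
        exact DifferentiableAt.comp q (g := σ) (f := fun q : ℝ × S => ((0 : ℝ), q.2)) hq2
          (by fun_prop)
      have d3 : HasDerivAt (fun t : ℝ => Φ (q.1 + t, q.2) - c (q.1 + t, q.2) • σ (0, q.2))
          (fderiv ℝ (fun q : ℝ × S => Φ q - c q • σ (0, q.2)) q (1, 0)) 0 := by
        have h1 : HasDerivAt (fun t : ℝ => (q.1 + t, q.2)) ((1 : ℝ), (0 : S)) 0 :=
          ((hasDerivAt_id _).const_add _).prodMk (hasDerivAt_const _ _)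
        have h2 : HasFDerivAt (fun q : ℝ × S => Φ q - c q • σ (0, q.2))
            (fderiv ℝ (fun q : ℝ × S => Φ q - c q • σ (0, q.2)) q) (q.1 + 0, q.2) := by
          simpa using hdiff.hasFDerivAt
        exact h2.comp_hasDerivAt _ h1
      rw [d3.unique (d1.sub d2), hq]
      have e1 := hadamard_spec e (c q, q)
      have e2 := hadamard_spec σ q
      have e3 : e (0, q) = f (Φ q) := by simp [e]
      have e4 : e (c q, q) = f (Φ q - c q • σ (0, q.2)) := rfl
      dsimp only at e1
      rw [e3, e4] at e1
      rw [e1, e2]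
      simp only [c, smul_sub, smul_add, smul_smul]
      rw [← pow_succ, div_eq_mul_inv]
      abel

/-- Short-time solutions with all initial values near `Y`, inside a prescribed neighbourhood. -/
lemma eventually_exists_solution [CompleteSpace S] {f : S → S} {Y : S} (hf : ContDiffAt ℝ 1 f Y)
    {U : Set S} (hU : U ∈ 𝓝 Y) :
    ∀ᶠ q in 𝓝 ((0 : ℝ), Y), 0 < q.1 → ∃ y : ℝ → S, y 0 = q.2 ∧
      ∀ t ∈ Icc 0 q.1, y t ∈ U ∧ HasDerivWithinAt y (f (y t)) (Icc 0 q.1) t := by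
  obtain ⟨ε, hε, a, r, L, K, hr, hpl⟩ := IsPicardLindelof.of_contDiffAt_one hf
  obtain ⟨y, hy, hcont⟩ :=
    (hpl 0).exists_forall_mem_closedBall_eq_hasDerivWithinAt_continuousOn
  have hnb : Metric.closedBall Y r ×ˢ Icc (0 - ε) (0 + ε) ∈ 𝓝 (Y, (0 : ℝ)) :=
    prod_mem_nhds (Metric.closedBall_mem_nhds _ (by exact_mod_cast hr))
      (Icc_mem_nhds (by linarith) (by linarith))
  have hca : ContinuousAt y (Y, 0) := hcont.continuousAt hnb
  have hy0 : y (Y, 0) = Y := (hy Y (Metric.mem_closedBall_self r.2)).1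
  have hU' : ∀ᶠ q in 𝓝 ((0 : ℝ), Y), y (q.2, q.1) ∈ U := by
    have : Tendsto (fun q : ℝ × S => (q.2, q.1)) (𝓝 (0, Y)) (𝓝 (Y, 0)) :=
      (continuous_snd.prodMk continuous_fst).tendsto (0, Y)
    refine (hca.tendsto.comp this).eventually ?_
    rw [hy0]; exact hU
  have hb : ∀ᶠ q in 𝓝 ((0 : ℝ), Y), q.2 ∈ Metric.closedBall Y r ∧ q.1 < ε := by
    have h1 : Tendsto (fun q : ℝ × S => q.2) (𝓝 (0, Y)) (𝓝 Y) := continuous_snd.tendsto _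
    have h2 : Tendsto (fun q : ℝ × S => q.1) (𝓝 (0, Y)) (𝓝 0) := continuous_fst.tendsto (0, Y)
    exact (h1.eventually (Metric.closedBall_mem_nhds _ (by exact_mod_cast hr))).and
      (h2.eventually (gt_mem_nhds hε))
  filter_upwards [eventually_forall_Icc hU', hb] with q h1 h2 hq
  refine ⟨fun t => y (q.2, t), (hy q.2 h2.1).1, fun t ht => ⟨h1 t ht, ?_⟩⟩
  have hsub : Icc 0 q.1 ⊆ Icc (0 - ε) (0 + ε) :=
    Icc_subset_Icc (by linarith) (by linarith)
  exact ((hy q.2 h2.1).2 t (hsub ht)).mono hsub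

/-- Solutions agree with an approximate flow of order `k` up to `O(hᵏ⁺¹)`. -/
lemma exists_approxFlow_error {f : S → S} {Y : S} (hf : ContDiffAt ℝ 1 f Y) {k : ℕ}
    {Φ σ : ℝ × S → S} (hA : IsApproxFlow f Y k Φ σ) :
    ∃ (U : Set S) (C : ℝ), U ∈ 𝓝 Y ∧ 0 ≤ C ∧
      ∀ᶠ q in 𝓝 ((0 : ℝ), Y), 0 < q.1 → ∀ y : ℝ → S, y 0 = q.2 →
      (∀ t ∈ Icc 0 q.1, y t ∈ U ∧ HasDerivWithinAt y (f (y t)) (Icc 0 q.1) t) →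
      ‖y q.1 - Φ q‖ ≤ C * q.1 ^ (k + 1) := by
  obtain ⟨hΦ, hσ, h0, hres⟩ := hA
  obtain ⟨K, U, hU, hK⟩ := hf.exists_lipschitzOnWith
  have hΦd : ∀ᶠ q in 𝓝 ((0 : ℝ), Y), DifferentiableAt ℝ Φ q :=
    ((hΦ.of_le (m := 1) (by exact_mod_cast le_top)).eventually (by simp)).mono fun q hq =>
      hq.differentiableAt one_ne_zero
  have hΦU : ∀ᶠ q in 𝓝 ((0 : ℝ), Y), Φ q ∈ U := by
    refine hΦ.continuousAt.eventually ?_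
    rw [h0]; exact hU
  have hσb : ∀ᶠ q in 𝓝 ((0 : ℝ), Y), ‖σ q‖ < ‖σ (0, Y)‖ + 1 :=
    hσ.continuousAt.norm.eventually (gt_mem_nhds (by linarith))
  have h1 : ∀ᶠ q in 𝓝 ((0 : ℝ), Y), q.1 < 1 :=
    (continuous_fst.tendsto ((0 : ℝ), Y)).eventually (gt_mem_nhds one_pos)
  refine ⟨U, (‖σ (0, Y)‖ + 1) * Real.exp K, hU, by positivity, ?_⟩
  filter_upwards [eventually_forall_Icc (hres.and (hΦd.and (hΦU.and hσb))), h1]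
    with q hq h1 hpos y hy0 hy
  have hder : ∀ t ∈ Icc 0 q.1, HasDerivAt (fun t : ℝ => Φ (t, q.2))
      (f (Φ (t, q.2)) + t ^ k • σ (t, q.2)) t := by
    intro t ht
    obtain ⟨e1, e2, -⟩ := hq t ht
    rw [← e1]
    exact e2.hasFDerivAt.comp_hasDerivAt t ((hasDerivAt_id t).prodMk (hasDerivAt_const t q.2))
  have := norm_le_of_norm_deriv_le (b := fun t => y t - Φ (t, q.2))
    (b' := fun t => f (y t) - (f (Φ (t, q.2)) + t ^ k • σ (t, q.2))) (h := q.1) (K := K)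
    (ε := (‖σ (0, Y)‖ + 1) * q.1 ^ k) (δ := 0) hpos.le K.2 (by positivity)
    (fun t ht => (hy t ht).2.sub (hder t ht).hasDerivWithinAt) (by simp [hy0, h0]) (fun t ht => by
      obtain ⟨-, -, e3, e4⟩ := hq t ht
      have hl := hK.norm_sub_le (hy t ht).1 e3
      have : ‖t ^ k • σ (t, q.2)‖ ≤ (‖σ (0, Y)‖ + 1) * q.1 ^ k := by
        rw [norm_smul, mul_comm, norm_pow, Real.norm_eq_abs, abs_of_nonneg ht.1]
        have := pow_le_pow_left₀ ht.1 ht.2 k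
        gcongr
        exact pow_nonneg ht.1 k
      rw [← sub_sub]
      exact (norm_sub_le _ _).trans (add_le_add hl this))
  refine this.trans ?_
  have : Real.exp (K * q.1) ≤ Real.exp K := by
    apply Real.exp_le_exp.2
    have := K.2
    nlinarith [K.coe_nonneg]
  calc (0 + (‖σ (0, Y)‖ + 1) * q.1 ^ k * q.1) * Real.exp (K * q.1)
      ≤ (0 + (‖σ (0, Y)‖ + 1) * q.1 ^ k * q.1) * Real.exp K := by gcongr
    _ = _ := by ring

end FlatODE

/-! ### Transport of one-forms by an approximate flow -/

section Germs

lemma eventually_norm_le {S F : Type*} [TopologicalSpace S] [NormedAddCommGroup F] {f : S → F}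
    {a : S} (h : ContinuousAt f a) :
    ∀ᶠ x in 𝓝 a, ‖f x‖ ≤ ‖f a‖ + 1 :=
  (h.norm.eventually (gt_mem_nhds (by linarith : ‖f a‖ < ‖f a‖ + 1))).mono fun _ hx => hx.le

variable {S F : Type*} [NormedAddCommGroup S] [NormedSpace ℝ S]
  [NormedAddCommGroup F] [NormedSpace ℝ F]

lemma contDiffAt_fderiv {f : S → F} {a : S} (h : ContDiffAt ℝ ∞ f a) :
    ContDiffAt ℝ ∞ (fderiv ℝ f) a := h.fderiv_right (by simp)

lemma eventually_contDiffAt {f : S → F} {a : S} (h : ContDiffAt ℝ ∞ f a) (n : ℕ) :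
    ∀ᶠ x in 𝓝 a, ContDiffAt ℝ n f x := (contDiffAt_infty.1 h n).eventually (by simp)

lemma eventually_differentiableAt {f : S → F} {a : S} (h : ContDiffAt ℝ ∞ f a) :
    ∀ᶠ x in 𝓝 a, DifferentiableAt ℝ f x :=
  (eventually_contDiffAt h 1).mono fun _ hx => hx.differentiableAt one_ne_zero

end Germs

section Transport

variable {S : Type*} [NormedAddCommGroup S] [NormedSpace ℝ S]

/-- The pullback of the one-form `α` by the time-`t` map `Φ(t, ·)`, at `Y`. -/
def pullbackForm (α : S → S →L[ℝ] ℝ) (Φ : ℝ × S → S) (q : ℝ × S) : S →L[ℝ] ℝ :=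
  (α (Φ q)).comp ((fderiv ℝ Φ q).comp (ContinuousLinearMap.inr ℝ ℝ S))

/-- If the Lie derivative of the one-form `α` along `f` is `κ α`, then an approximate flow of `f`
of order `k` preserves the kernel of `α` up to `O(tᵏ⁺¹)`. The conformal factor is read off from
a constant vector field `e` with `α(e) = 1`. -/
lemma exists_pullbackForm_error {f : S → S} {α : S → S →L[ℝ] ℝ} {κ : S → ℝ} {e Y : S} {k : ℕ}
    {Φ σ : ℝ × S → S} (hf : ContDiffAt ℝ ∞ f Y) (hα : ContDiffAt ℝ ∞ α Y)
    (hκ : ContinuousAt κ Y) (he : ∀ Z, α Z e = 1)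
    (hLie : ∀ᶠ Z in 𝓝 Y, ∀ δ, fderiv ℝ α Z (f Z) δ + α Z (fderiv ℝ f Z δ) = κ Z * α Z δ)
    (hA : IsApproxFlow f Y k Φ σ) :
    ∃ C : ℝ, 0 ≤ C ∧ ∀ᶠ q in 𝓝 ((0 : ℝ), Y), 0 < q.1 →
      ‖pullbackForm α Φ q - pullbackForm α Φ q e • α q.2‖ ≤ C * q.1 ^ (k + 1) := by
  obtain ⟨hΦ, hσ, h0, hres⟩ := hA
  have hΦY : Tendsto Φ (𝓝 (0, Y)) (𝓝 Y) := by
    have := hΦ.continuousAt.tendsto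
    rwa [h0] at this
  let a := pullbackForm α Φ
  let τ : ℝ × S → S →L[ℝ] ℝ := fun q =>
    (fderiv ℝ α (Φ q) (σ q)).comp ((fderiv ℝ Φ q).comp (ContinuousLinearMap.inr ℝ ℝ S)) +
      (α (Φ q)).comp ((fderiv ℝ σ q).comp (ContinuousLinearMap.inr ℝ ℝ S))
  have hαΦ : ContDiffAt ℝ ∞ (fun q => α (Φ q)) (0, Y) :=
    ContDiffAt.comp (0, Y) (g := α) (by rw [h0]; exact hα) hΦ
  have ha : ContDiffAt ℝ ∞ a (0, Y) :=
    hαΦ.clm_comp ((contDiffAt_fderiv hΦ).clm_comp contDiffAt_const)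
  have hτ : ContinuousAt τ (0, Y) := by
    have h1 : ContDiffAt ℝ ∞ (fun q => fderiv ℝ α (Φ q)) (0, Y) :=
      ContDiffAt.comp (0, Y) (g := fderiv ℝ α) (by rw [h0]; exact contDiffAt_fderiv hα) hΦ
    exact (((h1.clm_apply hσ).clm_comp ((contDiffAt_fderiv hΦ).clm_comp contDiffAt_const)).add
      (hαΦ.clm_comp ((contDiffAt_fderiv hσ).clm_comp contDiffAt_const))).continuousAt
  have hαY : ContinuousAt (fun q : ℝ × S => α q.2) (0, Y) :=
    ContinuousAt.comp (x := ((0 : ℝ), Y)) (g := α) (f := Prod.snd) hα.continuousAt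
      continuousAt_snd
  -- the pullback `a` satisfies `∂ₜ a = κ(Φ) a + tᵏ τ`: exchange the second derivatives of `Φ`
  have hder : ∀ᶠ q in 𝓝 ((0 : ℝ), Y), fderiv ℝ a q (1, 0) = κ (Φ q) • a q + q.1 ^ k • τ q := by
    filter_upwards [hres.eventually_nhds, eventually_contDiffAt hΦ 2,
      eventually_differentiableAt hσ, hΦY.eventually hLie,
      hΦY.eventually (eventually_differentiableAt hf),
      hΦY.eventually (eventually_differentiableAt hα), eventually_differentiableAt ha]
      with q h1 h2 h3 h4 h5 h6 h7
    ext δ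
    have dΦ : HasFDerivAt Φ (fderiv ℝ Φ q) q := (h2.differentiableAt two_ne_zero).hasFDerivAt
    have ddΦ : HasFDerivAt (fderiv ℝ Φ) (fderiv ℝ (fderiv ℝ Φ) q) q :=
      ((h2.fderiv_right (m := 1) (by norm_num)).differentiableAt one_ne_zero).hasFDerivAt
    have hsymm : fderiv ℝ (fderiv ℝ Φ) q (1, 0) (0, δ) = fderiv ℝ (fderiv ℝ Φ) q (0, δ) (1, 0) :=
      (h2.isSymmSndFDerivAt (by simp)).eq _ _
    have dres : fderiv ℝ (fderiv ℝ Φ) q (0, δ) (1, 0) =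
        fderiv ℝ f (Φ q) (fderiv ℝ Φ q (0, δ)) + q.1 ^ k • fderiv ℝ σ q (0, δ) := by
      have e1 : HasFDerivAt (fun q => fderiv ℝ Φ q (1, 0)) _ q :=
        ddΦ.clm_apply (hasFDerivAt_const ((1 : ℝ), (0 : S)) q)
      have e2 : HasFDerivAt (fun q : ℝ × S => f (Φ q) + q.1 ^ k • σ q) _ q :=
        (h5.hasFDerivAt.comp q dΦ).add
          (HasFDerivAt.smul ((hasFDerivAt_fst (𝕜 := ℝ) (E := ℝ) (F := S) (p := q)).pow k)
            h3.hasFDerivAt)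
      have e3 := e1.unique (e2.congr_of_eventuallyEq h1)
      have e4 := congrArg (fun T => T (0, δ)) e3
      simpa using e4
    have d1 : HasFDerivAt (fun q => α (Φ q) (fderiv ℝ Φ q (0, δ))) _ q :=
      (h6.hasFDerivAt.comp q dΦ).clm_apply (ddΦ.clm_apply (hasFDerivAt_const ((0 : ℝ), δ) q))
    have d2 : HasFDerivAt (fun q => a q δ) _ q :=
      h7.hasFDerivAt.clm_apply (hasFDerivAt_const δ q)
    have e5 := congrArg (fun T => T ((1 : ℝ), (0 : S))) (d2.unique d1)
    have e6 : fderiv ℝ α (Φ q) (f (Φ q) + q.1 ^ k • σ q) =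
        fderiv ℝ α (Φ q) (fderiv ℝ Φ q (1, 0)) := by
      rw [h1.self_of_nhds]
    simp at e5
    rw [e5, hsymm, dres, ← e6]
    have := h4 (fderiv ℝ Φ q (0, δ))
    simp only [map_add, map_smul, _root_.add_apply, _root_.smul_apply, a, τ, pullbackForm,
      ContinuousLinearMap.comp_apply, ContinuousLinearMap.inr_apply, smul_eq_mul]
    linear_combination this
  have hdiff := eventually_differentiableAt ha
  have hκb : ∀ᶠ q in 𝓝 ((0 : ℝ), Y), |κ (Φ q)| ≤ |κ Y| + 1 :=
    hΦY.eventually (eventually_norm_le hκ)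
  have hτb := eventually_norm_le (f := fun q : ℝ × S => τ q - τ q e • α q.2)
    (hτ.sub ((hτ.clm_apply continuousAt_const).smul hαY))
  set M := ‖τ (0, Y) - τ (0, Y) e • α Y‖ + 1
  have hinit : ∀ᶠ q in 𝓝 ((0 : ℝ), Y), DifferentiableAt ℝ Φ q := eventually_differentiableAt hΦ
  have h1 : ∀ᶠ q in 𝓝 ((0 : ℝ), Y), q.1 < 1 :=
    (continuous_fst.tendsto ((0 : ℝ), Y)).eventually (gt_mem_nhds one_pos)
  refine ⟨M * Real.exp (|κ Y| + 1), by positivity, ?_⟩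
  filter_upwards [eventually_forall_Icc (hder.and (hdiff.and (hκb.and (hτb.and hinit)))), h1]
    with q hq h1 hpos
  -- `a(t) - a(t)(e) α` vanishes for `t = 0` and satisfies an equation of the same form
  have hd : ∀ t ∈ Icc 0 q.1, HasDerivAt (fun t => a (t, q.2) - a (t, q.2) e • α q.2)
      (κ (Φ (t, q.2)) • (a (t, q.2) - a (t, q.2) e • α q.2) +
        t ^ k • (τ (t, q.2) - τ (t, q.2) e • α q.2)) t := by
    intro t ht
    obtain ⟨e1, e2, -⟩ := hq t ht
    have e3 : HasDerivAt (fun t => a (t, q.2))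
        (κ (Φ (t, q.2)) • a (t, q.2) + t ^ k • τ (t, q.2)) t := by
      rw [← e1]
      exact e2.hasFDerivAt.comp_hasDerivAt t ((hasDerivAt_id t).prodMk (hasDerivAt_const t q.2))
    have e4 : HasDerivAt (fun t => a (t, q.2) e)
        ((κ (Φ (t, q.2)) • a (t, q.2) + t ^ k • τ (t, q.2)) e) t := by
      simpa using e3.clm_apply (hasDerivAt_const t e)
    have e5 := e3.sub (e4.smul_const (α q.2))
    convert! e5 using 1
    ext δ
    simp
    ring
  have := norm_le_of_norm_deriv_le (b := fun t => a (t, q.2) - a (t, q.2) e • α q.2)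
    (h := q.1) (K := |κ Y| + 1) (ε := M * q.1 ^ k) (δ := 0) hpos.le (by positivity)
    (by positivity) (fun t ht => (hd t ht).hasDerivWithinAt)
    (by
      obtain ⟨-, -, -, -, e3⟩ := hq 0 (left_mem_Icc.2 hpos.le)
      have e4 : (fderiv ℝ Φ (0, q.2)).comp (ContinuousLinearMap.inr ℝ ℝ S) =
          ContinuousLinearMap.id ℝ S := by
        have e5 : HasFDerivAt (fun Z : S => Φ (0, Z)) _ q.2 :=
          HasFDerivAt.comp (g := Φ) q.2 e3.hasFDerivAt (hasFDerivAt_prodMk_right (0 : ℝ) q.2)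
        refine e5.unique ?_
        simp only [h0]
        exact hasFDerivAt_id _
      simp [a, pullbackForm, e4, h0, he])
    (fun t ht => by
      obtain ⟨-, -, e3, e4, -⟩ := hq t ht
      refine (norm_add_le _ _).trans (add_le_add ?_ ?_)
      · rw [norm_smul, Real.norm_eq_abs]; gcongr
      · rw [norm_smul, mul_comm, norm_pow, Real.norm_eq_abs, abs_of_nonneg ht.1]
        have := pow_le_pow_left₀ ht.1 ht.2 k
        gcongr
        exact pow_nonneg ht.1 k)
  refine this.trans ?_
  have : Real.exp ((|κ Y| + 1) * q.1) ≤ Real.exp (|κ Y| + 1) := by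
    apply Real.exp_le_exp.2
    nlinarith [abs_nonneg (κ Y)]
  calc (0 + M * q.1 ^ k * q.1) * Real.exp ((|κ Y| + 1) * q.1)
      ≤ (0 + M * q.1 ^ k * q.1) * Real.exp (|κ Y| + 1) := by gcongr
    _ = _ := by ring

end Transport

/-! ### Local Lie groups -/

section LocalGroup

variable {E : Type*} [NormedAddCommGroup E] [NormedSpace ℝ E]

/-- The differential at `0` of the left translation `u ↦ m(x, u)`. -/
def leftD (m : E × E → E) (x : E) : E →L[ℝ] E :=
  (fderiv ℝ m (x, 0)).comp (ContinuousLinearMap.inr ℝ E E)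

/-- The differential at `0` of the right translation `u ↦ m(u, v)`. -/
def rightD (m : E × E → E) (v : E) : E →L[ℝ] E :=
  (fderiv ℝ m (0, v)).comp (ContinuousLinearMap.inl ℝ E E)

/-- The inverse of `leftD m x`: the left Maurer--Cartan form at `x`. -/
def leftDInv (m : E × E → E) (x : E) : E →L[ℝ] E := (leftD m x).inverse

/-- `m` is the germ at `0` of a group law in a chart, `N(x, y) = x⁻¹ y` is the left division, and
`br` is the Lie bracket: `[ξ, η]` for the left-invariant fields `x ↦ leftD m x ξ`. -/
structure IsLocalGroup (m N : E × E → E) (br : E →L[ℝ] E →L[ℝ] E) : Prop where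
  mul_smooth : ContDiffAt ℝ ∞ m (0, 0)
  div_smooth : ContDiffAt ℝ ∞ N (0, 0)
  mul_zero : ∀ᶠ x in 𝓝 (0 : E), m (x, 0) = x
  zero_mul : ∀ᶠ x in 𝓝 (0 : E), m (0, x) = x
  mul_div : ∀ᶠ q in 𝓝 ((0 : E), (0 : E)), m (q.1, N q) = q.2
  div_mul : ∀ᶠ q in 𝓝 ((0 : E), (0 : E)), N (q.1, m q) = q.2
  assoc : ∀ᶠ q in 𝓝 ((0 : E), (0 : E), (0 : E)),
    m (m (q.1, q.2.1), q.2.2) = m (q.1, m (q.2.1, q.2.2))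
  bracket_eq : ∀ᶠ x in 𝓝 (0 : E), ∀ ξ η, leftD m x (br ξ η) =
    fderiv ℝ (leftD m) x (leftD m x ξ) η - fderiv ℝ (leftD m) x (leftD m x η) ξ

namespace IsLocalGroup

variable {m N : E × E → E} {br : E →L[ℝ] E →L[ℝ] E} (hG : IsLocalGroup m N br)
include hG

lemma mul_zero_zero : m (0, 0) = 0 := hG.mul_zero.self_of_nhds

lemma div_self_zero : N (0, 0) = 0 := by
  have := hG.div_mul.self_of_nhds
  simpa [hG.mul_zero_zero] using this

lemma tendsto_mul : Tendsto m (𝓝 (0, 0)) (𝓝 0) := by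
  have := hG.mul_smooth.continuousAt.tendsto
  rwa [hG.mul_zero_zero] at this

lemma tendsto_div : Tendsto N (𝓝 (0, 0)) (𝓝 0) := by
  have := hG.div_smooth.continuousAt.tendsto
  rwa [hG.div_self_zero] at this

lemma contDiffAt_leftD : ContDiffAt ℝ ∞ (leftD m) 0 := by
  have h : ContDiffAt ℝ ∞ (fun x : E => fderiv ℝ m (x, 0)) 0 :=
    ContDiffAt.comp (0 : E) (g := fderiv ℝ m) (f := fun x : E => (x, (0 : E)))
      (contDiffAt_fderiv hG.mul_smooth) (by fun_prop)
  exact h.clm_comp contDiffAt_const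

lemma contDiffAt_rightD : ContDiffAt ℝ ∞ (rightD m) 0 := by
  have h : ContDiffAt ℝ ∞ (fun x : E => fderiv ℝ m (0, x)) 0 :=
    ContDiffAt.comp (0 : E) (g := fderiv ℝ m) (f := fun x : E => ((0 : E), x))
      (contDiffAt_fderiv hG.mul_smooth) (by fun_prop)
  exact h.clm_comp contDiffAt_const

lemma eventually_hasFDerivAt_mul :
    ∀ᶠ q in 𝓝 ((0 : E), (0 : E)), HasFDerivAt m (fderiv ℝ m q) q :=
  (eventually_differentiableAt hG.mul_smooth).mono fun _ hq => hq.hasFDerivAt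

lemma eventually_hasFDerivAt_mul_right :
    ∀ᶠ x in 𝓝 (0 : E), HasFDerivAt (fun u => m (x, u)) (leftD m x) 0 := by
  have h : Tendsto (fun x : E => (x, (0 : E))) (𝓝 0) (𝓝 (0, 0)) :=
    (Continuous.prodMk_left (0 : E)).tendsto 0
  filter_upwards [h.eventually hG.eventually_hasFDerivAt_mul] with x hx
  exact HasFDerivAt.comp (g := m) 0 hx (hasFDerivAt_prodMk_right x 0)

lemma eventually_hasFDerivAt_mul_left :
    ∀ᶠ v in 𝓝 (0 : E), HasFDerivAt (fun u => m (u, v)) (rightD m v) 0 := by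
  have h : Tendsto (fun x : E => ((0 : E), x)) (𝓝 0) (𝓝 (0, 0)) :=
    (Continuous.prodMk_right (0 : E)).tendsto 0
  filter_upwards [h.eventually hG.eventually_hasFDerivAt_mul] with x hx
  exact HasFDerivAt.comp (g := m) 0 hx (hasFDerivAt_prodMk_left 0 x)

lemma leftD_zero : leftD m 0 = ContinuousLinearMap.id ℝ E :=
  hG.eventually_hasFDerivAt_mul_right.self_of_nhds.unique
    ((hasFDerivAt_id (0 : E)).congr_of_eventuallyEq hG.zero_mul)

lemma rightD_zero : rightD m 0 = ContinuousLinearMap.id ℝ E :=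
  hG.eventually_hasFDerivAt_mul_left.self_of_nhds.unique
    ((hasFDerivAt_id (0 : E)).congr_of_eventuallyEq hG.mul_zero)

lemma contDiffAt_leftDInv [CompleteSpace E] : ContDiffAt ℝ ∞ (leftDInv m) 0 := by
  refine ContDiffAt.comp (0 : E) (g := ContinuousLinearMap.inverse) ?_ hG.contDiffAt_leftD
  rw [hG.leftD_zero]
  exact contDiffAt_map_inverse (ContinuousLinearEquiv.refl ℝ E)

lemma eventually_invertible_leftD [CompleteSpace E] :
    ∀ᶠ x in 𝓝 (0 : E), (leftD m x).IsInvertible := by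
  have h1 : ContinuousAt (leftD m) 0 := hG.contDiffAt_leftD.continuousAt
  have h2 := h1.eventually (by
    rw [hG.leftD_zero]; exact (ContinuousLinearEquiv.refl ℝ E).nhds)
  exact h2.mono fun x hx => hx

lemma eventually_invertible_rightD [CompleteSpace E] :
    ∀ᶠ x in 𝓝 (0 : E), (rightD m x).IsInvertible := by
  have h1 : ContinuousAt (rightD m) 0 := hG.contDiffAt_rightD.continuousAt
  have h2 := h1.eventually (by
    rw [hG.rightD_zero]; exact (ContinuousLinearEquiv.refl ℝ E).nhds)
  exact h2.mono fun x hx => hx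

lemma eventually_leftDInv_leftD [CompleteSpace E] :
    ∀ᶠ x in 𝓝 (0 : E), ∀ ξ, leftDInv m x (leftD m x ξ) = ξ :=
  hG.eventually_invertible_leftD.mono fun _ hx _ => hx.inverse_apply_eq.2 rfl

lemma eventually_leftD_leftDInv [CompleteSpace E] :
    ∀ᶠ x in 𝓝 (0 : E), ∀ ξ, leftD m x (leftDInv m x ξ) = ξ :=
  hG.eventually_invertible_leftD.mono fun _ hx _ => (hx.inverse_apply_eq.1 rfl).symm

/-- In left trivialization the group law has differential `(η₀, δv) ↦ A(v) η₀ + δv`, up to the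
left Maurer--Cartan form at `v`; here `A(v)` is the differential of right translation by `v`. -/
lemma eventually_fderiv_mul [CompleteSpace E] :
    ∀ᶠ q in 𝓝 ((0 : E), (0 : E)), ∀ δx δv, fderiv ℝ m q (δx, δv) =
      leftD m (m q) (leftDInv m q.2 (rightD m q.2 (leftDInv m q.1 δx) + δv)) := by
  have t1 : Tendsto (fun q : E × E => q.1) (𝓝 (0, 0)) (𝓝 0) := continuous_fst.tendsto _
  have t2 : Tendsto (fun q : E × E => q.2) (𝓝 (0, 0)) (𝓝 0) := continuous_snd.tendsto _
  have tassoc1 : ∀ᶠ q in 𝓝 ((0 : E), (0 : E)), ∀ᶠ u in 𝓝 (0 : E),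
      m (m (q.1, q.2), u) = m (q.1, m (q.2, u)) := by
    have h : Tendsto (fun w : (E × E) × E => (w.1.1, w.1.2, w.2)) (𝓝 ((0, 0), 0))
        (𝓝 (0, 0, 0)) := by
      have : Continuous (fun w : (E × E) × E => (w.1.1, w.1.2, w.2)) := by fun_prop
      exact this.tendsto ((0, 0), 0)
    have := h.eventually hG.assoc
    rw [nhds_prod_eq] at this
    exact this.curry
  have tassoc2 : ∀ᶠ q in 𝓝 ((0 : E), (0 : E)), ∀ᶠ u in 𝓝 (0 : E),
      m (m (q.1, u), q.2) = m (q.1, m (u, q.2)) := by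
    have h : Tendsto (fun w : (E × E) × E => (w.1.1, w.2, w.1.2)) (𝓝 ((0, 0), 0))
        (𝓝 (0, 0, 0)) := by
      have : Continuous (fun w : (E × E) × E => (w.1.1, w.2, w.1.2)) := by fun_prop
      exact this.tendsto ((0, 0), 0)
    have := h.eventually hG.assoc
    rw [nhds_prod_eq] at this
    exact this.curry
  filter_upwards [tassoc1, tassoc2, hG.eventually_hasFDerivAt_mul,
    hG.tendsto_mul.eventually hG.eventually_hasFDerivAt_mul_right,
    t1.eventually hG.eventually_hasFDerivAt_mul_right,
    t2.eventually hG.eventually_hasFDerivAt_mul_right,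
    t2.eventually hG.eventually_hasFDerivAt_mul_left,
    t1.eventually hG.mul_zero, t2.eventually hG.mul_zero, t2.eventually hG.zero_mul,
    t1.eventually hG.eventually_leftD_leftDInv, t2.eventually hG.eventually_leftD_leftDInv]
    with q a1 a2 hm hmq h1 h2 h3 z1 z2 z3 i1 i2 δx δv
  -- the differentials at `u = 0` of `(x v) u = x (v u)` and of `(x u) v = x (u v)`
  have hv : ∀ w, fderiv ℝ m q (0, leftD m q.2 w) = leftD m (m q) w := by
    intro w
    have e1 : HasFDerivAt (fun u => m (q.1, m (q.2, u))) _ 0 :=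
      HasFDerivAt.comp (g := m) (f := fun u => (q.1, m (q.2, u))) (0 : E) (g' := fderiv ℝ m q)
        (by simpa [z2] using hm) ((hasFDerivAt_const q.1 (0 : E)).prodMk h2)
    have e2 := e1.unique (hmq.congr_of_eventuallyEq (a1.mono fun u hu => hu.symm))
    simpa using congrArg (fun T => T w) e2
  have hx : ∀ w, fderiv ℝ m q (leftD m q.1 w, 0) = fderiv ℝ m q (0, rightD m q.2 w) := by
    intro w
    have e1 : HasFDerivAt (fun u => m (m (q.1, u), q.2)) _ 0 :=
      HasFDerivAt.comp (g := m) (f := fun u => (m (q.1, u), q.2)) (0 : E) (g' := fderiv ℝ m q)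
        (by simpa [z1] using hm) (h1.prodMk (hasFDerivAt_const q.2 (0 : E)))
    have e2 : HasFDerivAt (fun u => m (q.1, m (u, q.2))) _ 0 :=
      HasFDerivAt.comp (g := m) (f := fun u => (q.1, m (u, q.2))) (0 : E) (g' := fderiv ℝ m q)
        (by simpa [z3] using hm) ((hasFDerivAt_const q.1 (0 : E)).prodMk h3)
    have e3 := e1.unique (e2.congr_of_eventuallyEq a2)
    simpa using congrArg (fun T => T w) e3
  have hsplit : ((δx, δv) : E × E) = (δx, 0) + (0, δv) := by simp
  rw [hsplit, map_add, ← i1 δx, hx, ← map_add, i1 δx, Prod.mk_add_mk, add_zero]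
  rw [← hv, i2]

/-- The differential at `0` of `u ↦ u⁻¹ v`, obtained from `m(u, N(u, v)) = v`. -/
lemma eventually_hasFDerivAt_div [CompleteSpace E] :
    ∀ᶠ v in 𝓝 (0 : E), HasFDerivAt (fun u => N (u, v)) (-rightD m v) 0 := by
  have hin : Tendsto (fun v : E => ((0 : E), v)) (𝓝 0) (𝓝 (0, 0)) :=
    (Continuous.prodMk_right (0 : E)).tendsto 0
  have hmd : ∀ᶠ v in 𝓝 (0 : E), ∀ᶠ u in 𝓝 (0 : E), m (u, N (u, v)) = v := by
    have h : Tendsto (fun w : E × E => (w.2, w.1)) (𝓝 (0, 0)) (𝓝 (0, 0)) := by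
      have : Continuous (fun w : E × E => (w.2, w.1)) := by fun_prop
      exact this.tendsto (0, 0)
    have := h.eventually hG.mul_div
    rw [nhds_prod_eq] at this
    exact this.curry
  have hN0 : ∀ᶠ v in 𝓝 (0 : E), N (0, v) = v := by
    have h2 := hin.eventually hG.div_mul
    filter_upwards [h2, hG.zero_mul] with v e1 e2
    simpa [e2] using e1
  have hz : ∀ᶠ v in 𝓝 (0 : E), ∀ᶠ w in 𝓝 v, m (0, w) = w := hG.zero_mul.eventually_nhds
  filter_upwards [hmd, hN0, hz, hin.eventually (eventually_differentiableAt hG.div_smooth),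
    hin.eventually hG.eventually_hasFDerivAt_mul] with v h1 h2 h3 h4 h5
  have d1 : HasFDerivAt (fun u => N (u, v)) _ 0 :=
    HasFDerivAt.comp (g := N) 0 h4.hasFDerivAt (hasFDerivAt_prodMk_left (0 : E) v)
  have d2 : HasFDerivAt (fun u => m (u, N (u, v))) _ 0 :=
    HasFDerivAt.comp (g := m) (f := fun u => (u, N (u, v))) (0 : E) (g' := fderiv ℝ m (0, v))
      (by simpa [h2] using h5) ((hasFDerivAt_id (0 : E)).prodMk d1)
  have d3 := d2.unique ((hasFDerivAt_const v (0 : E)).congr_of_eventuallyEq h1)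
  have d4 : HasFDerivAt (fun w => m (0, w)) _ v :=
    HasFDerivAt.comp (g := m) v h5 (hasFDerivAt_prodMk_right (0 : E) v)
  have d5 := d4.unique ((hasFDerivAt_id v).congr_of_eventuallyEq h3)
  convert! d1 using 1
  ext w
  have e1 := congrArg (fun T => T w) d3
  have e2 := congrArg (fun T => T (fderiv ℝ N (0, v) (w, 0))) d5
  simp only [ContinuousLinearMap.comp_apply, ContinuousLinearMap.prod_apply,
    ContinuousLinearMap.id_apply, ContinuousLinearMap.inl_apply, ContinuousLinearMap.inr_apply,
    _root_.zero_apply] at e1 e2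
  have e3 : ((w, fderiv ℝ N (0, v) (w, 0)) : E × E) =
      (w, 0) + (0, fderiv ℝ N (0, v) (w, 0)) := by simp
  rw [e3, map_add, e2] at e1
  simp only [rightD, _root_.neg_apply, ContinuousLinearMap.comp_apply,
    ContinuousLinearMap.inl_apply]
  exact neg_eq_of_add_eq_zero_right e1

end IsLocalGroup

end LocalGroup

/-! ### The contact vector field in a chart -/

section ContactField

variable {E : Type*} [NormedAddCommGroup E] [NormedSpace ℝ E]

/-- Points `(x, p, z)` of phase space in a chart of the group. -/
abbrev FlatState (E : Type*) [NormedAddCommGroup E] [NormedSpace ℝ E] : Type _ :=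
  E × (E →L[ℝ] ℝ) × ℝ

/-- The restriction of a covector on `E × E × ℝ` to the position directions. -/
def dX (D : E × E × ℝ →L[ℝ] ℝ) : E →L[ℝ] ℝ := D.comp (ContinuousLinearMap.inl ℝ E (E × ℝ))

/-- The restriction of a covector on `E × E × ℝ` to the velocity directions. -/
def dV (D : E × E × ℝ →L[ℝ] ℝ) : E →L[ℝ] ℝ :=
  D.comp ((ContinuousLinearMap.inr ℝ E (E × ℝ)).comp (ContinuousLinearMap.inl ℝ E ℝ))

/-- The last coefficient of a covector on `E × E × ℝ`. -/
def dZ (D : E × E × ℝ →L[ℝ] ℝ) : ℝ := D (0, 0, 1)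

lemma covector_apply (D : E × E × ℝ →L[ℝ] ℝ) (x ξ : E) (z : ℝ) :
    D (x, ξ, z) = dX D x + dV D ξ + z * dZ D := by
  have : ((x, ξ, z) : E × E × ℝ) = (x, 0, 0) + (0, ξ, 0) + z • (0, 0, 1) := by simp
  rw [this, map_add, map_add, map_smul]
  simp only [dX, dV, dZ, ContinuousLinearMap.comp_apply, smul_eq_mul]
  rfl

lemma contDiff_dX : ContDiff ℝ ∞ (dX : (E × E × ℝ →L[ℝ] ℝ) → _) :=
  contDiff_id.clm_comp contDiff_const

lemma contDiff_dV : ContDiff ℝ ∞ (dV : (E × E × ℝ →L[ℝ] ℝ) → _) :=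
  contDiff_id.clm_comp contDiff_const

lemma contDiff_dZ : ContDiff ℝ ∞ (dZ : (E × E × ℝ →L[ℝ] ℝ) → _) :=
  contDiff_id.clm_apply contDiff_const

/-- The point `(x, Ξ(x, p, z), z)` of velocity phase space. -/
def velPt (Ξ : FlatState E → E) (Y : FlatState E) : E × E × ℝ := (Y.1, Ξ Y, Y.2.2)

/-- Near `Y`, the velocity `Ξ` inverts the Legendre transform of the Lagrangian `Lf`. -/
structure IsLegendre (Lf : E × E × ℝ → ℝ) (Ξ : FlatState E → E) (Y : FlatState E) : Prop where
  smooth_lagrangian : ContDiffAt ℝ ∞ Lf (velPt Ξ Y)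
  smooth_velocity : ContDiffAt ℝ ∞ Ξ Y
  momentum_velocity : ∀ᶠ Z in 𝓝 Y, dV (fderiv ℝ Lf (velPt Ξ Z)) = Z.2.1
  velocity_momentum : ∀ᶠ w in 𝓝 (velPt Ξ Y), Ξ (w.1, dV (fderiv ℝ Lf w), w.2.2) = w.2.1

/-- The Euler--Poincaré--Herglotz vector field in a chart, in momentum variables. -/
def ephField (m : E × E → E) (br : E →L[ℝ] E →L[ℝ] E) (Lf : E × E × ℝ → ℝ) (Ξ : FlatState E → E)
    (Y : FlatState E) : FlatState E :=
  (leftD m Y.1 (Ξ Y),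
    Y.2.1.comp (br (Ξ Y)) + (dX (fderiv ℝ Lf (velPt Ξ Y))).comp (leftD m Y.1) +
      dZ (fderiv ℝ Lf (velPt Ξ Y)) • Y.2.1,
    Lf (velPt Ξ Y))

/-- The contact form `dz - p · (x⁻¹ dx)` in a chart. -/
def contactForm (m : E × E → E) (Y : FlatState E) : FlatState E →L[ℝ] ℝ :=
  (ContinuousLinearMap.snd ℝ (E →L[ℝ] ℝ) ℝ).comp (ContinuousLinearMap.snd ℝ E ((E →L[ℝ] ℝ) × ℝ)) -
    (Y.2.1.comp (leftDInv m Y.1)).comp (ContinuousLinearMap.fst ℝ E ((E →L[ℝ] ℝ) × ℝ))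

lemma contactForm_apply (m : E × E → E) (Y δ : FlatState E) :
    contactForm m Y δ = δ.2.2 - Y.2.1 (leftDInv m Y.1 δ.1) := rfl

variable {m N : E × E → E} {br : E →L[ℝ] E →L[ℝ] E} {Lf : E × E × ℝ → ℝ} {Ξ : FlatState E → E}
  {p : E →L[ℝ] ℝ} {z : ℝ}

lemma contDiffAt_fst_comp {F : Type*} [NormedAddCommGroup F] [NormedSpace ℝ F] {f : E → F}
    (hf : ContDiffAt ℝ ∞ f 0) : ContDiffAt ℝ ∞ (fun Y : FlatState E => f Y.1) (0, p, z) :=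
  ContDiffAt.comp ((0, p, z) : FlatState E) (g := f) (f := Prod.fst) hf contDiffAt_fst

lemma IsLegendre.contDiffAt_velPt {Y : FlatState E} (hL : IsLegendre Lf Ξ Y) :
    ContDiffAt ℝ ∞ (velPt Ξ) Y :=
  contDiffAt_fst.prodMk (hL.smooth_velocity.prodMk (contDiffAt_snd.comp _ contDiffAt_snd))

lemma contDiffAt_contactForm [CompleteSpace E] (hG : IsLocalGroup m N br) :
    ContDiffAt ℝ ∞ (contactForm m) (0, p, z) := by
  have h1 : ContDiffAt ℝ ∞ (fun Y : FlatState E => Y.2.1) (0, p, z) := by fun_prop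
  exact contDiffAt_const.sub
    ((h1.clm_comp (contDiffAt_fst_comp hG.contDiffAt_leftDInv)).clm_comp contDiffAt_const)

lemma contDiffAt_ephField (hG : IsLocalGroup m N br)
    (hL : IsLegendre Lf Ξ (0, p, z)) : ContDiffAt ℝ ∞ (ephField m br Lf Ξ) (0, p, z) := by
  have h1 : ContDiffAt ℝ ∞ (fun Y : FlatState E => Y.2.1) (0, p, z) := by fun_prop
  have hM : ContDiffAt ℝ ∞ (fun Y : FlatState E => leftD m Y.1) (0, p, z) :=
    contDiffAt_fst_comp hG.contDiffAt_leftD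
  have hD : ContDiffAt ℝ ∞ (fun Y : FlatState E => fderiv ℝ Lf (velPt Ξ Y)) (0, p, z) :=
    ContDiffAt.comp ((0, p, z) : FlatState E) (g := fderiv ℝ Lf)
      (contDiffAt_fderiv hL.smooth_lagrangian) hL.contDiffAt_velPt
  have hbr : ContDiffAt ℝ ∞ (fun Y : FlatState E => br (Ξ Y)) (0, p, z) :=
    br.contDiff.contDiffAt.comp _ hL.smooth_velocity
  refine (hM.clm_apply hL.smooth_velocity).prodMk (ContDiffAt.prodMk ?_ ?_)
  · exact ((h1.clm_comp hbr).add ((ContDiffAt.comp (0, p, z) (g := dX)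
      (contDiff_dX (E := E)).contDiffAt hD).clm_comp hM)).add
      ((ContDiffAt.comp (0, p, z) (g := dZ) (contDiff_dZ (E := E)).contDiffAt hD).smul h1)
  · exact ContDiffAt.comp ((0, p, z) : FlatState E) (g := Lf) hL.smooth_lagrangian
      hL.contDiffAt_velPt

/-- The Euler--Poincaré--Herglotz field is a contact field: its flow rescales the contact form,
at the infinitesimal rate `∂L/∂z`. -/
lemma eventually_lieDeriv_contactForm [CompleteSpace E] (hG : IsLocalGroup m N br)
    (hL : IsLegendre Lf Ξ (0, p, z)) : ∀ᶠ Y in 𝓝 ((0, p, z) : FlatState E), ∀ δ,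
    fderiv ℝ (contactForm m) Y (ephField m br Lf Ξ Y) δ +
      contactForm m Y (fderiv ℝ (ephField m br Lf Ξ) Y δ) =
    dZ (fderiv ℝ Lf (velPt Ξ Y)) * contactForm m Y δ := by
  have t1 : Tendsto (fun Y : FlatState E => Y.1) (𝓝 (0, p, z)) (𝓝 0) := continuous_fst.tendsto _
  have tv := hL.contDiffAt_velPt.continuousAt.tendsto
  filter_upwards [t1.eventually (eventually_differentiableAt hG.contDiffAt_leftD),
    t1.eventually hG.eventually_leftDInv_leftD, t1.eventually hG.eventually_leftD_leftDInv,
    t1.eventually hG.eventually_leftDInv_leftD.eventually_nhds,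
    t1.eventually (eventually_differentiableAt hG.contDiffAt_leftDInv),
    t1.eventually hG.bracket_eq, eventually_differentiableAt hL.smooth_velocity,
    tv.eventually (eventually_differentiableAt hL.smooth_lagrangian),
    eventually_differentiableAt (contDiffAt_ephField hG hL), hL.momentum_velocity,
    eventually_differentiableAt (contDiffAt_contactForm hG)]
    with Y hM hBM hMB hBM' hB hbr hΞ hLf hf hmom hα' δ
  obtain ⟨x, p', z'⟩ := Y
  obtain ⟨u, π, w⟩ := δ
  dsimp only at hM hBM hMB hBM' hB hbr hmom
  set D := fderiv ℝ Lf (velPt Ξ (x, p', z')) with hD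
  set ξ := Ξ (x, p', z') with hξ
  set dΞ := fderiv ℝ Ξ (x, p', z') with hdΞ
  have dfst : HasFDerivAt (fun Y : FlatState E => Y.1) (ContinuousLinearMap.fst ℝ E _)
      (x, p', z') :=
    hasFDerivAt_fst
  -- the differential of the inverse `leftDInv`
  have hdB : ∀ a b, fderiv ℝ (leftDInv m) x a (leftD m x b) =
      -leftDInv m x (fderiv ℝ (leftD m) x a b) := by
    intro a b
    have e1 : HasFDerivAt (fun x => leftDInv m x (leftD m x b)) _ x :=
      hB.hasFDerivAt.clm_apply (hM.hasFDerivAt.clm_apply (hasFDerivAt_const b x))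
    have e2 := e1.unique ((hasFDerivAt_const b x).congr_of_eventuallyEq
      (hBM'.mono fun y hy => hy b))
    have e3 := congrArg (fun T => T a) e2
    simp at e3
    exact eq_neg_of_add_eq_zero_right e3
  -- the first and last components of the differential of the field
  have hfx : (fderiv ℝ (ephField m br Lf Ξ) (x, p', z') (u, π, w)).1 =
      fderiv ℝ (leftD m) x u ξ + leftD m x (dΞ (u, π, w)) := by
    have e1 : HasFDerivAt (fun Y => (ephField m br Lf Ξ Y).1) _ (x, p', z') := hf.hasFDerivAt.fst
    have e0 : HasFDerivAt (fun Y : FlatState E => leftD m Y.1) _ (x, p', z') :=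
      HasFDerivAt.comp (g := leftD m) (x, p', z') hM.hasFDerivAt dfst
    have e2 : HasFDerivAt (fun Y => leftD m Y.1 (Ξ Y)) _ (x, p', z') :=
      e0.clm_apply hΞ.hasFDerivAt
    have e3 := congrArg (fun T => T (u, π, w)) (e1.unique e2)
    simp at e3
    rw [e3]; abel
  have hfz : (fderiv ℝ (ephField m br Lf Ξ) (x, p', z') (u, π, w)).2.2 =
      D (u, dΞ (u, π, w), w) := by
    have e1 : HasFDerivAt (fun Y => (ephField m br Lf Ξ Y).2.2) _ (x, p', z') :=
      hf.hasFDerivAt.snd.snd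
    have e2 : HasFDerivAt (fun Y => Lf (velPt Ξ Y)) _ (x, p', z') :=
      HasFDerivAt.comp (g := Lf) (f := velPt Ξ) (x, p', z') hLf.hasFDerivAt
        (dfst.prodMk (hΞ.hasFDerivAt.prodMk
          (hasFDerivAt_snd (𝕜 := ℝ) (p := ((x, p', z') : FlatState E))).snd))
    have e3 := congrArg (fun T => T (u, π, w)) (e1.unique e2)
    simpa using e3
  -- the differential of the contact form
  have hα : ∀ v δ : FlatState E, fderiv ℝ (contactForm m) (x, p', z') v δ =
      -(v.2.1 (leftDInv m x δ.1) + p' (fderiv ℝ (leftDInv m) x v.1 δ.1)) := by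
    intro v δ
    have e0 : HasFDerivAt (fun Y : FlatState E => leftDInv m Y.1) _ (x, p', z') :=
      HasFDerivAt.comp (g := leftDInv m) (x, p', z') hB.hasFDerivAt dfst
    have dp : HasFDerivAt (fun Y : FlatState E => Y.2.1) _ (x, p', z') :=
      (hasFDerivAt_snd (𝕜 := ℝ) (p := ((x, p', z') : FlatState E))).fst
    have e1 : HasFDerivAt (fun Y : FlatState E => δ.2.2 - Y.2.1 (leftDInv m Y.1 δ.1)) _
        (x, p', z') :=
      (hasFDerivAt_const _ _).sub (dp.clm_apply (e0.clm_apply (hasFDerivAt_const _ _)))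
    have e2 : HasFDerivAt (fun Y : FlatState E => contactForm m Y δ) _ (x, p', z') :=
      hα'.hasFDerivAt.clm_apply (hasFDerivAt_const δ _)
    have e3 := congrArg (fun T => T v) (e2.unique e1)
    simp at e3
    rw [e3]
    ring
  have hu : leftD m x (leftDInv m x u) = u := hMB u
  -- the bracket in the momentum equation is the antisymmetric part of the derivative of `leftD m`
  have key := congrArg p' (congrArg (leftDInv m x) (hbr ξ (leftDInv m x u)))
  rw [hBM, hu, map_sub, map_sub] at key
  have hdB' := hdB (leftD m x ξ) (leftDInv m x u)
  rw [hu] at hdB'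
  have e1 : (ephField m br Lf Ξ (x, p', z')).1 = leftD m x ξ := rfl
  have e2 : (ephField m br Lf Ξ (x, p', z')).2.1 (leftDInv m x u) =
      p' (br ξ (leftDInv m x u)) + dX D u + dZ D * p' (leftDInv m x u) := by
    simp [ephField, ← hD, ← hξ, hu]
  rw [hα, contactForm_apply, contactForm_apply, hfx, hfz, e1, e2, hdB', covector_apply, hmom,
    map_add, hBM, map_add, map_neg]
  dsimp only
  linear_combination -key

end ContactField

/-! ### The discrete velocity and the contact form along the exact flow -/

section ExactStep

variable {E : Type*} [NormedAddCommGroup E] [NormedSpace ℝ E]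
  {m N : E × E → E} {br : E →L[ℝ] E →L[ℝ] E} {Lf : E × E × ℝ → ℝ} {Ξ : FlatState E → E}
  {p : E →L[ℝ] ℝ} {z : ℝ} {k : ℕ} {Φ σ : ℝ × FlatState E → FlatState E}

lemma tendsto_prodMk_zero {S : Type*} [TopologicalSpace S] {Y : S} :
    Tendsto (fun Y : S => ((0 : ℝ), Y)) (𝓝 Y) (𝓝 (0, Y)) :=
  (Continuous.prodMk_right (0 : ℝ)).tendsto Y

lemma IsApproxFlow.contDiffAt_fst (hA : IsApproxFlow (ephField m br Lf Ξ) (0, p, z) k Φ σ) :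
    ContDiffAt ℝ ∞ (fun q => (q.2.1, (Φ q).1)) (0, (0, p, z)) := by
  have h1 : ContDiffAt ℝ ∞ (fun q : ℝ × FlatState E => q.2.1) (0, (0, p, z)) := by fun_prop
  exact h1.prodMk hA.smooth.fst

lemma IsApproxFlow.tendsto_fst (hA : IsApproxFlow (ephField m br Lf Ξ) (0, p, z) k Φ σ) :
    Tendsto (fun q => (q.2.1, (Φ q).1)) (𝓝 (0, (0, p, z))) (𝓝 (0, 0)) := by
  have := hA.contDiffAt_fst.continuousAt.tendsto
  simpa [hA.init] using this

/-- The displacement of the approximate flow is `m(x, h ζ)` for a velocity `ζ` that is smooth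
across `h = 0`, where it is the velocity of the flow. -/
lemma exists_discreteVelocity [FiniteDimensional ℝ E] (hG : IsLocalGroup m N br)
    (hA : IsApproxFlow (ephField m br Lf Ξ) (0, p, z) k Φ σ) (hk : 0 < k) :
    ∃ ζ : ℝ × FlatState E → E, ContDiffAt ℝ ∞ ζ (0, (0, p, z)) ∧
      (∀ᶠ Y in 𝓝 ((0, p, z) : FlatState E), ζ (0, Y) = Ξ Y) ∧
      ∀ᶠ q in 𝓝 ((0 : ℝ), ((0, p, z) : FlatState E)),
        N (q.2.1, (Φ q).1) = q.1 • ζ q ∧ (Φ q).1 = m (q.2.1, q.1 • ζ q) := by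
  let v : ℝ × FlatState E → E := fun q => N (q.2.1, (Φ q).1)
  have hv : ContDiffAt ℝ ∞ v (0, (0, p, z)) :=
    ContDiffAt.comp (0, (0, p, z)) (g := N) (by simpa [hA.init] using hG.div_smooth)
      hA.contDiffAt_fst
  have hζ : ContDiffAt ℝ ∞ (hadamard v) (0, (0, p, z)) := contDiffAt_hadamard hv
  have t1 : Tendsto (fun Y : FlatState E => Y.1) (𝓝 (0, p, z)) (𝓝 0) := continuous_fst.tendsto _
  have hv0 : ∀ᶠ Y in 𝓝 ((0, p, z) : FlatState E), v (0, Y) = 0 := by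
    have t2 : Tendsto (fun Y : FlatState E => (Y.1, (0 : E))) (𝓝 (0, p, z)) (𝓝 (0, 0)) := by
      have : Continuous (fun Y : FlatState E => (Y.1, (0 : E))) := by fun_prop
      exact this.tendsto _
    filter_upwards [t2.eventually hG.div_mul, t1.eventually hG.mul_zero] with Y h1 h2
    simp only [v, hA.init]
    rwa [h2] at h1
  have hvζ : ∀ᶠ q in 𝓝 ((0 : ℝ), ((0, p, z) : FlatState E)), v q = q.1 • hadamard v q := by
    filter_upwards [(continuous_snd.tendsto ((0 : ℝ), ((0, p, z) : FlatState E))).eventually hv0]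
      with q hq
    rw [hadamard_spec v q, hq, zero_add]
  have hX : ∀ᶠ q in 𝓝 ((0 : ℝ), ((0, p, z) : FlatState E)),
      (Φ q).1 = m (q.2.1, q.1 • hadamard v q) := by
    filter_upwards [hvζ, hA.tendsto_fst.eventually hG.mul_div] with q h1 h2
    rw [← h1]; exact h2.symm
  refine ⟨hadamard v, hζ, ?_, hvζ.and hX⟩
  have hz := tendsto_prodMk_zero (Y := ((0, p, z) : FlatState E))
  filter_upwards [hz.eventually hX.eventually_nhds, hz.eventually hA.residual,
    hz.eventually (eventually_differentiableAt hA.smooth),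
    hz.eventually (eventually_differentiableAt hζ),
    t1.eventually ((Continuous.prodMk_left (0 : E)).tendsto (0 : E) |>.eventually
      hG.eventually_hasFDerivAt_mul), t1.eventually hG.eventually_leftDInv_leftD]
    with Y h1 h2 h3 h4 h5 h6
  have hc : HasDerivAt (fun t : ℝ => (t, Y)) ((1 : ℝ), (0 : FlatState E)) 0 :=
    (hasDerivAt_id _).prodMk (hasDerivAt_const _ _)
  have d1 : HasDerivAt (fun t : ℝ => (Φ (t, Y)).1) (leftD m Y.1 (Ξ Y)) 0 := by
    have e1 : HasDerivAt (fun t : ℝ => Φ (t, Y)) (fderiv ℝ Φ (0, Y) (1, 0)) 0 :=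
      HasFDerivAt.comp_hasDerivAt (l := Φ) 0 h3.hasFDerivAt hc
    have e2 : HasDerivAt (fun t : ℝ => (Φ (t, Y)).1) (fderiv ℝ Φ (0, Y) (1, 0)).1 0 :=
      HasFDerivAt.comp_hasDerivAt (l := Prod.fst)
        (l' := ContinuousLinearMap.fst ℝ E ((E →L[ℝ] ℝ) × ℝ)) 0 hasFDerivAt_fst e1
    rw [h2] at e2
    simpa [hA.init, hk.ne', ephField] using e2
  have d2 : HasDerivAt (fun t : ℝ => t • hadamard v (t, Y)) (hadamard v (0, Y)) 0 := by
    have e1 : HasDerivAt (fun t : ℝ => hadamard v (t, Y)) (fderiv ℝ (hadamard v) (0, Y) (1, 0)) 0 :=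
      HasFDerivAt.comp_hasDerivAt (l := hadamard v) 0 h4.hasFDerivAt hc
    simpa using (hasDerivAt_id' (0 : ℝ)).fun_smul e1
  have d3 : HasDerivAt (fun t : ℝ => m (Y.1, t • hadamard v (t, Y)))
      (leftD m Y.1 (hadamard v (0, Y))) 0 := by
    have := HasFDerivAt.comp_hasDerivAt (l := m) (l' := fderiv ℝ m (Y.1, 0)) (0 : ℝ)
      (f := fun t : ℝ => (Y.1, t • hadamard v (t, Y))) (by simpa using h5)
      ((hasDerivAt_const (0 : ℝ) Y.1).prodMk d2)
    exact this
  have h1' : ∀ᶠ t in 𝓝 (0 : ℝ), (Φ (t, Y)).1 = m (Y.1, t • hadamard v (t, Y)) :=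
    hc.continuousAt.eventually h1
  have := d1.unique (d3.congr_of_eventuallyEq h1')
  rw [← h6 (Ξ Y), this, h6]

/-- The point of velocity phase space at which the discrete Lagrangian is evaluated. -/
def velArg (ζ : ℝ × FlatState E → E) (q : ℝ × FlatState E) : E × E × ℝ := (q.2.1, ζ q, q.2.2.2)

lemma contDiffAt_velArg {ζ : ℝ × FlatState E → E} (hζ : ContDiffAt ℝ ∞ ζ (0, (0, p, z))) :
    ContDiffAt ℝ ∞ (fun q => (q.1, velArg ζ q)) (0, (0, p, z)) := by
  have h1 : ContDiffAt ℝ ∞ (fun q : ℝ × FlatState E => q.2.1) (0, (0, p, z)) := by fun_prop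
  have h2 : ContDiffAt ℝ ∞ (fun q : ℝ × FlatState E => q.2.2.2) (0, (0, p, z)) := by fun_prop
  exact contDiffAt_fst.prodMk (h1.prodMk (hζ.prodMk h2))

/-- In a chart: `ℓ(h, x, ξ, z)` agrees with the exact discrete Lagrangian up to `O(hʳ⁺¹)`, along all
solutions that stay in a neighbourhood of the base point and whose discrete velocity
`h⁻¹ N(x(0), x(h))` is near the velocity at the base point. -/
def FlatAgrees (m N : E × E → E) (br : E →L[ℝ] E →L[ℝ] E) (Lf : E × E × ℝ → ℝ)
    (Ξ : FlatState E → E) (ℓ : ℝ × (E × E × ℝ) → ℝ) (Y : FlatState E) (r : ℕ) : Prop :=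
  ∃ (U : Set (FlatState E)) (W : Set (ℝ × (E × E × ℝ))) (C : ℝ), U ∈ 𝓝 Y ∧
    W ∈ 𝓝 (0, velPt Ξ Y) ∧ ∀ᶠ q in 𝓝 ((0 : ℝ), Y), 0 < q.1 → ∀ y : ℝ → FlatState E, y 0 = q.2 →
      (∀ t ∈ Icc 0 q.1, y t ∈ U ∧
        HasDerivWithinAt y (ephField m br Lf Ξ (y t)) (Icc 0 q.1) t) →
      (q.1, (q.2.1, q.1⁻¹ • N (q.2.1, (y q.1).1), q.2.2.2)) ∈ W →
      |ℓ (q.1, (q.2.1, q.1⁻¹ • N (q.2.1, (y q.1).1), q.2.2.2)) - ((y q.1).2.2 - q.2.2.2)| ≤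
        C * q.1 ^ (r + 1)

/-- Along the approximate flow, `ℓ` agrees with the increment of the action up to `O(hʳ⁺¹)`. This
holds along exact solutions, and an approximate flow of order `r + 1` changes the endpoint by
`O(hʳ⁺²)`, hence the discrete velocity by `O(hʳ⁺¹)`. -/
lemma exists_defect_bound [FiniteDimensional ℝ E] (hG : IsLocalGroup m N br)
    (hL : IsLegendre Lf Ξ (0, p, z)) {ℓ : ℝ × (E × E × ℝ) → ℝ} {r : ℕ}
    (hℓ : ContDiffAt ℝ ∞ ℓ (0, velPt Ξ (0, p, z)))
    (hag : FlatAgrees m N br Lf Ξ ℓ (0, p, z) r)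
    (hA : IsApproxFlow (ephField m br Lf Ξ) (0, p, z) (r + 1) Φ σ)
    {ζ : ℝ × FlatState E → E} (hζ : ContDiffAt ℝ ∞ ζ (0, (0, p, z)))
    (hζ0 : ζ (0, (0, p, z)) = Ξ (0, p, z))
    (hNζ : ∀ᶠ q in 𝓝 ((0 : ℝ), ((0, p, z) : FlatState E)), N (q.2.1, (Φ q).1) = q.1 • ζ q) :
    ∃ C : ℝ, ∀ᶠ q in 𝓝 ((0 : ℝ), ((0, p, z) : FlatState E)), 0 < q.1 →
      ‖ℓ (q.1, velArg ζ q) - ((Φ q).2.2 - q.2.2.2)‖ ≤ C * q.1 ^ (r + 1) := by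
  obtain ⟨U₀, W₀, C₀, hU₀, hW₀, hC₀⟩ := hag
  have hf : ContDiffAt ℝ 1 (ephField m br Lf Ξ) (0, p, z) :=
    contDiffAt_infty.1 (contDiffAt_ephField hG hL) 1
  obtain ⟨U₁, C₁, hU₁, hC₁0, hC₁⟩ := exists_approxFlow_error hf hA
  obtain ⟨K, s, hs, hK⟩ :=
    (contDiffAt_infty.1 hG.div_smooth 1 : ContDiffAt ℝ 1 N _).exists_lipschitzOnWith
  obtain ⟨K', s', hs', hK'⟩ := (contDiffAt_infty.1 hℓ 1 : ContDiffAt ℝ 1 ℓ _).exists_lipschitzOnWith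
  obtain ⟨ρ, hρ, hball⟩ := Metric.mem_nhds_iff.1 hs
  obtain ⟨ρ', hρ', hball'⟩ := Metric.mem_nhds_iff.1 (inter_mem hs' hW₀)
  have hJ : Tendsto (fun q => (q.1, velArg ζ q)) (𝓝 (0, (0, p, z)))
      (𝓝 (0, velPt Ξ (0, p, z))) := by
    have := (contDiffAt_velArg hζ).continuousAt.tendsto
    simpa only [velArg, velPt, hζ0] using this
  have hsol := eventually_exists_solution hf (inter_mem hU₀ hU₁)
  have hcont : ∀ c : ℝ, Tendsto (fun q : ℝ × FlatState E => c * q.1 ^ (r + 1)) (𝓝 (0, (0, p, z)))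
      (𝓝 0) := by
    intro c
    have : Continuous (fun q : ℝ × FlatState E => c * q.1 ^ (r + 1)) := by fun_prop
    simpa using this.tendsto (0, (0, p, z))
  have hlt1 : ∀ᶠ q in 𝓝 ((0 : ℝ), ((0, p, z) : FlatState E)), q.1 < 1 :=
    (continuous_fst.tendsto ((0 : ℝ), ((0, p, z) : FlatState E))).eventually (gt_mem_nhds one_pos)
  refine ⟨C₀ + K' * (K * C₁) + C₁, ?_⟩
  filter_upwards [hC₀, hC₁, hsol, hNζ, hlt1, (hcont C₁).eventually (gt_mem_nhds (half_pos hρ)),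
    (hcont (K * C₁)).eventually (gt_mem_nhds (half_pos hρ')),
    hA.tendsto_fst.eventually (Metric.ball_mem_nhds _ (half_pos hρ)),
    hJ.eventually (Metric.ball_mem_nhds _ (half_pos hρ'))] with q e0 e1 e2 e3 e4 e5 e6 e7 e8 hq
  obtain ⟨y, hy0, hy⟩ := e2 hq
  have f1 := e1 hq y hy0 fun t ht => ⟨(hy t ht).1.2, (hy t ht).2⟩
  have hpow : q.1 ^ (r + 1 + 1) ≤ q.1 ^ (r + 1) :=
    pow_le_pow_of_le_one hq.le e4.le (Nat.le_succ _)
  have f1' : ‖y q.1 - Φ q‖ ≤ C₁ * q.1 ^ (r + 1) := f1.trans (by gcongr)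
  have fx : ‖(y q.1).1 - (Φ q).1‖ ≤ ‖y q.1 - Φ q‖ := norm_fst_le (y q.1 - Φ q)
  have fz : |(y q.1).2.2 - (Φ q).2.2| ≤ ‖y q.1 - Φ q‖ :=
    (norm_snd_le (y q.1 - Φ q).2).trans (norm_snd_le (y q.1 - Φ q))
  -- the exact endpoint and its discrete velocity
  have g1 : ((q.2.1, (y q.1).1) : E × E) ∈ Metric.ball (0, 0) ρ := by
    have : dist ((q.2.1, (y q.1).1) : E × E) (q.2.1, (Φ q).1) ≤ ‖y q.1 - Φ q‖ := by
      rw [Prod.dist_eq]; simpa [dist_eq_norm] using fx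
    have e7' : dist ((q.2.1, (Φ q).1) : E × E) (0, 0) < ρ / 2 := e7
    have := dist_triangle ((q.2.1, (y q.1).1) : E × E) (q.2.1, (Φ q).1) (0, 0)
    rw [Metric.mem_ball]; linarith
  have g2 : ((q.2.1, (Φ q).1) : E × E) ∈ Metric.ball (0, 0) ρ :=
    Metric.ball_subset_ball (by linarith) e7
  have g3 : ‖N (q.2.1, (y q.1).1) - N (q.2.1, (Φ q).1)‖ ≤ K * (C₁ * q.1 ^ (r + 1 + 1)) := by
    refine (hK.norm_sub_le (hball g1) (hball g2)).trans ?_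
    gcongr
    simpa using fx.trans f1
  have g4 : ‖q.1⁻¹ • N (q.2.1, (y q.1).1) - ζ q‖ ≤ K * C₁ * q.1 ^ (r + 1) := by
    have : q.1⁻¹ • N (q.2.1, (y q.1).1) - ζ q =
        q.1⁻¹ • (N (q.2.1, (y q.1).1) - N (q.2.1, (Φ q).1)) := by
      rw [e3, smul_sub, smul_smul, inv_mul_cancel₀ hq.ne', one_smul]
    rw [this, norm_smul, norm_inv, Real.norm_eq_abs, abs_of_pos hq]
    calc q.1⁻¹ * ‖N (q.2.1, (y q.1).1) - N (q.2.1, (Φ q).1)‖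
        ≤ q.1⁻¹ * (K * (C₁ * q.1 ^ (r + 1 + 1))) := by gcongr
      _ = _ := by field_simp; ring
  set w : ℝ × (E × E × ℝ) := (q.1, (q.2.1, q.1⁻¹ • N (q.2.1, (y q.1).1), q.2.2.2)) with hw
  have g5 : ‖w - (q.1, velArg ζ q)‖ ≤ K * C₁ * q.1 ^ (r + 1) := by
    have : w - (q.1, velArg ζ q) = (0, 0, q.1⁻¹ • N (q.2.1, (y q.1).1) - ζ q, 0) := by
      simp [hw, velArg]
    rw [this]
    simpa [Prod.norm_def] using g4
  have g6 : w ∈ Metric.ball ((0 : ℝ), velPt Ξ (0, p, z)) ρ' := by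
    have e8' : dist (q.1, velArg ζ q) ((0 : ℝ), velPt Ξ (0, p, z)) < ρ' / 2 := e8
    have := dist_triangle w (q.1, velArg ζ q) ((0 : ℝ), velPt Ξ (0, p, z))
    have g5' : dist w (q.1, velArg ζ q) ≤ _ := (dist_eq_norm _ _).trans_le g5
    rw [Metric.mem_ball]; linarith
  have f0 := e0 hq y hy0 (fun t ht => ⟨(hy t ht).1.1, (hy t ht).2⟩) (hball' g6).2
  have g7 := hK'.norm_sub_le (hball' g6).1 (hball' (Metric.ball_subset_ball (by linarith) e8)).1
  have g8 : ‖ℓ w - ℓ (q.1, velArg ζ q)‖ ≤ K' * (K * C₁ * q.1 ^ (r + 1)) :=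
    g7.trans (by gcongr)
  rw [Real.norm_eq_abs] at g8 ⊢
  have hsplit : ℓ (q.1, velArg ζ q) - ((Φ q).2.2 - q.2.2.2) =
      (ℓ w - ((y q.1).2.2 - q.2.2.2)) - (ℓ w - ℓ (q.1, velArg ζ q)) +
        ((y q.1).2.2 - (Φ q).2.2) := by ring
  rw [hsplit]
  refine (abs_add_le _ _).trans ((add_le_add_left (abs_sub _ _) _).trans ?_)
  have f2 := fz.trans f1'
  calc _ ≤ C₀ * q.1 ^ (r + 1) + K' * (K * C₁ * q.1 ^ (r + 1)) + C₁ * q.1 ^ (r + 1) := by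
        gcongr
    _ = _ := by ring

end ExactStep

/-! ### The defect of the discrete Lagrangian -/

section Covectors

variable {Q S S' : Type*} [TopologicalSpace Q] [NormedAddCommGroup S] [NormedSpace ℝ S]
  [NormedAddCommGroup S'] [NormedSpace ℝ S']

/-- Composition with a linear map near an invertible one controls the norm of covectors. -/
lemma exists_norm_le_norm_comp {T : Q → S →L[ℝ] S'} {q₀ : Q} (hT : ContinuousAt T q₀)
    (e : S ≃L[ℝ] S') (he : T q₀ = e) :
    ∃ C : ℝ, 0 ≤ C ∧ ∀ᶠ q in 𝓝 q₀, ∀ w : S' →L[ℝ] ℝ, ‖w‖ ≤ C * ‖w.comp (T q)‖ := by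
  set c := ‖(e.symm : S' →L[ℝ] S)‖
  have hlim : Tendsto (fun q => ‖T q - e‖ * c) (𝓝 q₀) (𝓝 0) := by
    have h : Tendsto (fun q => ‖T q - (e : S →L[ℝ] S')‖) (𝓝 q₀) (𝓝 0) := by
      simpa [he] using (hT.tendsto.sub_const (e : S →L[ℝ] S')).norm
    simpa using h.mul_const c
  refine ⟨2 * c, by positivity, ?_⟩
  filter_upwards [hlim.eventually (gt_mem_nhds (by norm_num : (0 : ℝ) < 1 / 2))] with q hq w
  have hw : w = (w.comp (T q)).comp (e.symm : S' →L[ℝ] S) -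
      w.comp ((T q - (e : S →L[ℝ] S')).comp (e.symm : S' →L[ℝ] S)) := by
    ext y; simp
  have h1 : ‖(w.comp (T q)).comp (e.symm : S' →L[ℝ] S)‖ ≤ ‖w.comp (T q)‖ * c :=
    ContinuousLinearMap.opNorm_comp_le _ _
  have h2 : ‖w.comp ((T q - (e : S →L[ℝ] S')).comp (e.symm : S' →L[ℝ] S))‖ ≤
      ‖w‖ * (‖T q - e‖ * c) :=
    (ContinuousLinearMap.opNorm_comp_le _ _).trans
      (mul_le_mul_of_nonneg_left (ContinuousLinearMap.opNorm_comp_le _ _) (norm_nonneg _))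
  have h3 : ‖w‖ ≤ ‖w.comp (T q)‖ * c + ‖w‖ * (‖T q - e‖ * c) := by
    calc ‖w‖ = _ := congrArg _ hw
      _ ≤ _ := norm_sub_le _ _
      _ ≤ _ := add_le_add h1 h2
  have h4 : ‖w‖ * (‖T q - e‖ * c) ≤ ‖w‖ * (1 / 2) := by gcongr
  linarith

end Covectors

section ExactStep

variable {E : Type*} [NormedAddCommGroup E] [NormedSpace ℝ E]
  {m N : E × E → E} {br : E →L[ℝ] E →L[ℝ] E} {Lf : E × E × ℝ → ℝ} {Ξ : FlatState E → E}
  {p : E →L[ℝ] ℝ} {z : ℝ} {k : ℕ} {Φ σ : ℝ × FlatState E → FlatState E}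
  {ζ : ℝ × FlatState E → E} {ℓ : ℝ × (E × E × ℝ) → ℝ} {r : ℕ}

/-- The Legendre transform `(x, ξ, z) ↦ (x, ∂L/∂ξ, z)` in a chart. -/
def momPt (Lf : E × E × ℝ → ℝ) (w : E × E × ℝ) : FlatState E := (w.1, dV (fderiv ℝ Lf w), w.2.2)

lemma IsLegendre.momPt_velPt {Y : FlatState E} (hL : IsLegendre Lf Ξ Y) :
    ∀ᶠ Z in 𝓝 Y, momPt Lf (velPt Ξ Z) = Z :=
  hL.momentum_velocity.mono fun Z hZ => by
    rw [momPt, hZ]; rfl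

lemma IsLegendre.velPt_momPt {Y : FlatState E} (hL : IsLegendre Lf Ξ Y) :
    ∀ᶠ w in 𝓝 (velPt Ξ Y), velPt Ξ (momPt Lf w) = w :=
  hL.velocity_momentum.mono fun w hw => by
    rw [velPt]; show (w.1, Ξ (w.1, dV (fderiv ℝ Lf w), w.2.2), w.2.2) = w
    rw [hw]

lemma IsLegendre.contDiffAt_momPt {Y : FlatState E} (hL : IsLegendre Lf Ξ Y) :
    ContDiffAt ℝ ∞ (momPt Lf) (velPt Ξ Y) := by
  refine contDiffAt_fst.prodMk (ContDiffAt.prodMk ?_ (contDiffAt_snd.comp _ contDiffAt_snd))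
  exact ContDiffAt.comp (velPt Ξ Y) (g := dV) (contDiff_dV (E := E)).contDiffAt
    (contDiffAt_fderiv hL.smooth_lagrangian)

lemma IsLegendre.tendsto_momPt {Y : FlatState E} (hL : IsLegendre Lf Ξ Y) :
    Tendsto (momPt Lf) (𝓝 (velPt Ξ Y)) (𝓝 Y) := by
  have := hL.contDiffAt_momPt.continuousAt.tendsto
  rwa [hL.momPt_velPt.self_of_nhds] at this

/-- The Legendre transform has an invertible differential. -/
lemma IsLegendre.exists_equiv {Y : FlatState E} (hL : IsLegendre Lf Ξ Y) :
    ∃ e : FlatState E ≃L[ℝ] E × E × ℝ, HasFDerivAt (velPt Ξ) (e : FlatState E →L[ℝ] E × E × ℝ) Y ∧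
      HasFDerivAt (momPt Lf) (e.symm : E × E × ℝ →L[ℝ] FlatState E) (velPt Ξ Y) := by
  have d1 := (hL.contDiffAt_velPt.differentiableAt (by simp)).hasFDerivAt
  have d2 := (hL.contDiffAt_momPt.differentiableAt (by simp)).hasFDerivAt
  have hY : momPt Lf (velPt Ξ Y) = Y := hL.momPt_velPt.self_of_nhds
  have c1 := (HasFDerivAt.comp (g := momPt Lf) Y d2 d1).unique
    ((hasFDerivAt_id Y).congr_of_eventuallyEq hL.momPt_velPt)
  have c2 := (HasFDerivAt.comp (g := velPt Ξ) (g' := fderiv ℝ (velPt Ξ) Y) (velPt Ξ Y)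
    (by rw [hY]; exact d1) d2).unique
    ((hasFDerivAt_id _).congr_of_eventuallyEq hL.velPt_momPt)
  refine ⟨ContinuousLinearEquiv.equivOfInverse (fderiv ℝ (velPt Ξ) Y)
    (fderiv ℝ (momPt Lf) (velPt Ξ Y)) (fun v => congrArg (fun T => T v) c1)
    (fun v => congrArg (fun T => T v) c2), d1, d2⟩

/-- `ℓ(h, x, ξ, z)` generates the approximate flow `Φ` up to `O(hʳ⁺¹)`, by a smooth multiple of
`hʳ⁺¹`. -/
def IsDefect (ℓ : ℝ × (E × E × ℝ) → ℝ) (Φ : ℝ × FlatState E → FlatState E)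
    (ζ : ℝ × FlatState E → E) (Y : FlatState E) (r : ℕ) (e : ℝ × FlatState E → ℝ) : Prop :=
  ContDiffAt ℝ ∞ e (0, Y) ∧ ∀ᶠ q in 𝓝 ((0 : ℝ), Y),
    ℓ (q.1, velArg ζ q) - ((Φ q).2.2 - q.2.2.2) = q.1 ^ (r + 1) • e q

/-- At order `0` in `h`, the defect equation says that `ℓ` vanishes for `h = 0`. -/
lemma eventually_lagrangian_zero (hL : IsLegendre Lf Ξ (0, p, z))
    (hA : IsApproxFlow (ephField m br Lf Ξ) (0, p, z) k Φ σ)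
    (hζ0 : ∀ᶠ Y in 𝓝 ((0, p, z) : FlatState E), ζ (0, Y) = Ξ Y) {e : ℝ × FlatState E → ℝ}
    (he : IsDefect ℓ Φ ζ (0, p, z) r e) :
    ∀ᶠ w in 𝓝 (velPt Ξ (0, p, z)), ℓ (0, w) = 0 := by
  have h1 : ∀ᶠ Y in 𝓝 ((0, p, z) : FlatState E), ℓ (0, velPt Ξ Y) = 0 := by
    filter_upwards [hζ0, tendsto_prodMk_zero.eventually he.2] with Y e1 e2
    simpa [velArg, velPt, e1, hA.init] using e2
  filter_upwards [hL.tendsto_momPt.eventually h1, hL.velPt_momPt] with w e1 e2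
  rwa [e2] at e1

/-- At order `1` in `h`, the defect equation says that the derivative of `ℓ` in `h` is the
Lagrangian. -/
lemma eventually_hadamard_lagrangian [FiniteDimensional ℝ E] (hL : IsLegendre Lf Ξ (0, p, z))
    (hr : 0 < r) (hk : 0 < k) (hℓ : ContDiffAt ℝ ∞ ℓ (0, velPt Ξ (0, p, z)))
    (hA : IsApproxFlow (ephField m br Lf Ξ) (0, p, z) k Φ σ)
    (hζ : ContDiffAt ℝ ∞ ζ (0, (0, p, z)))
    (hζ0 : ∀ᶠ Y in 𝓝 ((0, p, z) : FlatState E), ζ (0, Y) = Ξ Y) {e : ℝ × FlatState E → ℝ}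
    (he : IsDefect ℓ Φ ζ (0, p, z) r e) :
    ∀ᶠ w in 𝓝 (velPt Ξ (0, p, z)), hadamard ℓ (0, w) = Lf w := by
  have hℓ0 := eventually_lagrangian_zero hL hA hζ0 he
  have hJ : Tendsto (fun q => (q.1, velArg ζ q)) (𝓝 (0, (0, p, z)))
      (𝓝 (0, velPt Ξ (0, p, z))) := by
    have := (contDiffAt_velArg hζ).continuousAt.tendsto
    simpa only [velArg, velPt, hζ0.self_of_nhds] using this
  have hJ2 : Tendsto (fun q => velArg ζ q) (𝓝 (0, (0, p, z))) (𝓝 (velPt Ξ (0, p, z))) :=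
    (continuous_snd.tendsto _).comp hJ
  have hfac : ∀ᶠ q in 𝓝 ((0 : ℝ), ((0, p, z) : FlatState E)),
      ℓ (q.1, velArg ζ q) = q.1 • hadamard ℓ (q.1, velArg ζ q) := by
    filter_upwards [hJ2.eventually hℓ0] with q hq
    rw [hadamard_spec ℓ (q.1, velArg ζ q), hq, zero_add]
  have hμ : ContDiffAt ℝ ∞ (fun q => hadamard ℓ (q.1, velArg ζ q)) (0, (0, p, z)) :=
    ContDiffAt.comp (0, (0, p, z)) (g := hadamard ℓ) (by
      have := contDiffAt_hadamard hℓ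
      simpa only [velArg, velPt, hζ0.self_of_nhds] using this) (contDiffAt_velArg hζ)
  have h1 : ∀ᶠ Y in 𝓝 ((0, p, z) : FlatState E), hadamard ℓ (0, velPt Ξ Y) = Lf (velPt Ξ Y) := by
    have hz := tendsto_prodMk_zero (Y := ((0, p, z) : FlatState E))
    filter_upwards [hζ0, hz.eventually he.2.eventually_nhds, hz.eventually hfac.eventually_nhds,
      hz.eventually (eventually_differentiableAt hμ),
      hz.eventually (eventually_differentiableAt he.1),
      hz.eventually (eventually_differentiableAt hA.smooth), hz.eventually hA.residual]
      with Y e1 e2 e3 e4 e5 e6 e7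
    have hc : HasDerivAt (fun t : ℝ => (t, Y)) ((1 : ℝ), (0 : FlatState E)) 0 :=
      (hasDerivAt_id _).prodMk (hasDerivAt_const _ _)
    have d1 : HasDerivAt (fun t : ℝ => t • hadamard ℓ (t, velArg ζ (t, Y)))
        (hadamard ℓ (0, velPt Ξ Y)) 0 := by
      have h := HasFDerivAt.comp_hasDerivAt (l := fun q => hadamard ℓ (q.1, velArg ζ q)) 0
        e4.hasFDerivAt hc
      have h' := (hasDerivAt_id' (0 : ℝ)).fun_smul h
      simpa [velArg, velPt, e1] using h'
    have d2 : HasDerivAt (fun t : ℝ => (Φ (t, Y)).2.2 - Y.2.2) (Lf (velPt Ξ Y)) 0 := by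
      have h := HasFDerivAt.comp_hasDerivAt (l := Φ) 0 e6.hasFDerivAt hc
      have h' := HasFDerivAt.comp_hasDerivAt (l := fun Z : FlatState E => Z.2.2) 0
        (hasFDerivAt_snd (𝕜 := ℝ) (p := Φ (0, Y))).snd h
      rw [e7] at h'
      simpa [hA.init, hk.ne', ephField] using h'.sub_const Y.2.2
    have d3 : HasDerivAt (fun t : ℝ => t ^ (r + 1) • e (t, Y)) 0 0 := by
      have h := HasFDerivAt.comp_hasDerivAt (l := e) 0 e5.hasFDerivAt hc
      have h' := (hasDerivAt_pow (r + 1) (0 : ℝ)).fun_smul h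
      simpa [hr.ne'] using h'
    have heq : ∀ᶠ t in 𝓝 (0 : ℝ), t • hadamard ℓ (t, velArg ζ (t, Y)) =
        ((Φ (t, Y)).2.2 - Y.2.2) + t ^ (r + 1) • e (t, Y) := by
      filter_upwards [hc.continuousAt.eventually e2, hc.continuousAt.eventually e3] with t f1 f2
      rw [← f1, ← f2]; ring
    have := d1.unique ((d2.add d3).congr_of_eventuallyEq heq)
    simpa using this
  filter_upwards [hL.tendsto_momPt.eventually h1, hL.velPt_momPt] with w e1 e2
  rwa [e2] at e1

lemma norm_dV_le (D : E × E × ℝ →L[ℝ] ℝ) : ‖dV D‖ ≤ ‖D‖ :=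
  ContinuousLinearMap.opNorm_le_bound _ (norm_nonneg _) fun η => by
    simpa [dV] using D.le_opNorm (0, η, 0)

lemma norm_dX_le (D : E × E × ℝ →L[ℝ] ℝ) : ‖dX D‖ ≤ ‖D‖ :=
  ContinuousLinearMap.opNorm_le_bound _ (norm_nonneg _) fun η => by
    simpa [dX, Prod.norm_def] using D.le_opNorm (η, 0)

lemma norm_dZ_le (D : E × E × ℝ →L[ℝ] ℝ) : ‖dZ D‖ ≤ ‖D‖ := by
  simpa [dZ] using D.le_opNorm (0, 0, 1)

/-- The differential in `(x, ξ, z)` of the discrete Lagrangian per unit time. -/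
def slopeD (lam : ℝ × (E × E × ℝ) → ℝ) (u : ℝ × (E × E × ℝ)) : E × E × ℝ →L[ℝ] ℝ :=
  (fderiv ℝ lam u).comp (ContinuousLinearMap.inr ℝ ℝ (E × E × ℝ))

set_option maxHeartbeats 1000000 in
/-- The exact step satisfies the equations of the discrete step up to `O(hʳ)` and `O(hʳ⁺¹)`: the
differential of the defect is `O(hʳ⁺¹)`, the approximate flow preserves the contact form up to a
factor, and `(δx, δp, δz) ↦ (δx, δζ, δz)` is invertible, so the coefficients can be compared. -/
lemma exists_stepEquation_residual [FiniteDimensional ℝ E] (hG : IsLocalGroup m N br)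
    (hL : IsLegendre Lf Ξ (0, p, z)) (hℓ : ContDiffAt ℝ ∞ ℓ (0, velPt Ξ (0, p, z)))
    (hA : IsApproxFlow (ephField m br Lf Ξ) (0, p, z) (r + 1) Φ σ)
    (hζ : ContDiffAt ℝ ∞ ζ (0, (0, p, z)))
    (hζ0 : ∀ᶠ Y in 𝓝 ((0, p, z) : FlatState E), ζ (0, Y) = Ξ Y)
    (hX : ∀ᶠ q in 𝓝 ((0 : ℝ), ((0, p, z) : FlatState E)), (Φ q).1 = m (q.2.1, q.1 • ζ q))
    {e : ℝ × FlatState E → ℝ} (he : IsDefect ℓ Φ ζ (0, p, z) r e) :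
    ∃ C : ℝ, 0 ≤ C ∧ ∀ᶠ q in 𝓝 ((0 : ℝ), ((0, p, z) : FlatState E)), 0 < q.1 →
      ‖dV (slopeD (hadamard ℓ) (q.1, velArg ζ q)) -
        (Φ q).2.1.comp (leftDInv m (q.1 • ζ q))‖ ≤ C * q.1 ^ r ∧
      ‖(1 + q.1 * dZ (slopeD (hadamard ℓ) (q.1, velArg ζ q))) • q.2.2.1 +
        q.1 • (dX (slopeD (hadamard ℓ) (q.1, velArg ζ q))).comp (leftD m q.2.1) -
        ((Φ q).2.1.comp (leftDInv m (q.1 • ζ q))).comp (rightD m (q.1 • ζ q))‖ ≤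
          C * q.1 ^ (r + 1) := by
  have hdef := he.2
  have hJ : Tendsto (fun q => (q.1, velArg ζ q)) (𝓝 (0, (0, p, z)))
      (𝓝 (0, velPt Ξ (0, p, z))) := by
    have := (contDiffAt_velArg hζ).continuousAt.tendsto
    simpa only [velArg, velPt, hζ0.self_of_nhds] using this
  have hfac : ∀ᶠ q in 𝓝 ((0 : ℝ), ((0, p, z) : FlatState E)),
      ℓ (q.1, velArg ζ q) = q.1 • hadamard ℓ (q.1, velArg ζ q) := by
    filter_upwards [((continuous_snd.tendsto _).comp hJ).eventually
      (eventually_lagrangian_zero hL hA hζ0 he)] with q hq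
    have hq' : ℓ (0, velArg ζ q) = 0 := hq
    rw [hadamard_spec ℓ (q.1, velArg ζ q), hq', zero_add]
  -- the linear map `(δx, δp, δz) ↦ (δx, δζ, δz)`
  let T : ℝ × FlatState E → FlatState E →L[ℝ] E × E × ℝ := fun q =>
    (ContinuousLinearMap.fst ℝ E ((E →L[ℝ] ℝ) × ℝ)).prod
      (((fderiv ℝ ζ q).comp (ContinuousLinearMap.inr ℝ ℝ (FlatState E))).prod
        ((ContinuousLinearMap.snd ℝ (E →L[ℝ] ℝ) ℝ).comp
          (ContinuousLinearMap.snd ℝ E ((E →L[ℝ] ℝ) × ℝ))))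
  obtain ⟨eq, heq, -⟩ := hL.exists_equiv
  have hT : ContinuousAt T (0, (0, p, z)) := by
    have h1 : ContinuousAt (fun q => (fderiv ℝ ζ q).comp
        (ContinuousLinearMap.inr ℝ ℝ (FlatState E))) (0, (0, p, z)) :=
      (contDiffAt_fderiv hζ).continuousAt.clm_comp continuousAt_const
    have h2 : T = fun q => ContinuousLinearMap.prodₗᵢ ℝ
        (ContinuousLinearMap.fst ℝ E ((E →L[ℝ] ℝ) × ℝ), ContinuousLinearMap.prodₗᵢ ℝ
        (((fderiv ℝ ζ q).comp (ContinuousLinearMap.inr ℝ ℝ (FlatState E))),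
        ((ContinuousLinearMap.snd ℝ (E →L[ℝ] ℝ) ℝ).comp
          (ContinuousLinearMap.snd ℝ E ((E →L[ℝ] ℝ) × ℝ))))) := rfl
    rw [h2]
    refine (ContinuousLinearMap.prodₗᵢ ℝ).continuous.continuousAt.comp
      (continuousAt_const.prodMk ((ContinuousLinearMap.prodₗᵢ ℝ).continuous.continuousAt.comp
        (h1.prodMk continuousAt_const)))
  have hTe : T (0, (0, p, z)) = eq := by
    have h1 : HasFDerivAt (fun Y : FlatState E => ζ (0, Y))
        ((fderiv ℝ ζ (0, (0, p, z))).comp (ContinuousLinearMap.inr ℝ ℝ (FlatState E))) (0, p, z) :=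
      HasFDerivAt.comp (g := ζ) ((0, p, z) : FlatState E)
        (hζ.differentiableAt (by simp)).hasFDerivAt (hasFDerivAt_prodMk_right (0 : ℝ) _)
    have h2 : HasFDerivAt (velPt Ξ) (T (0, (0, p, z))) (0, p, z) := by
      refine HasFDerivAt.prodMk hasFDerivAt_fst (HasFDerivAt.prodMk ?_ ?_)
      · exact h1.congr_of_eventuallyEq (hζ0.mono fun Y hY => hY.symm)
      · exact (hasFDerivAt_snd (𝕜 := ℝ) (p := ((0, p, z) : FlatState E))).snd
    exact h2.unique heq
  obtain ⟨C₁, hC₁0, hC₁⟩ := exists_norm_le_norm_comp hT eq hTe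
  obtain ⟨C₂, hC₂0, hC₂⟩ := exists_pullbackForm_error (e := ((0, 0, 1) : FlatState E))
    (κ := fun Y => dZ (fderiv ℝ Lf (velPt Ξ Y)))
    (contDiffAt_ephField hG hL) (contDiffAt_contactForm hG)
    (ContinuousAt.comp (g := dZ) (contDiff_dZ (E := E)).continuous.continuousAt
      (ContinuousAt.comp (g := fderiv ℝ Lf) (contDiffAt_fderiv hL.smooth_lagrangian).continuousAt
        hL.contDiffAt_velPt.continuousAt))
    (fun Z => by simp [contactForm_apply]) (eventually_lieDeriv_contactForm hG hL) hA
  set Y₀ : FlatState E := (0, p, z) with hY₀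
  have hx0 : ContinuousAt (fun q : ℝ × FlatState E => q.2.1) (0, Y₀) := by fun_prop
  have hv : Tendsto (fun q : ℝ × FlatState E => (q.2.1, q.1 • ζ q)) (𝓝 (0, Y₀)) (𝓝 (0, 0)) := by
    have : ContinuousAt (fun q : ℝ × FlatState E => (q.2.1, q.1 • ζ q)) (0, Y₀) :=
      hx0.prodMk (continuousAt_fst.smul hζ.continuousAt)
    simpa [hY₀] using this.tendsto
  have hp0 : ContinuousAt (fun q : ℝ × FlatState E => q.2.2.1) (0, Y₀) := by fun_prop
  have hMx : ContinuousAt (fun q : ℝ × FlatState E => leftD m q.2.1) (0, Y₀) :=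
    ContinuousAt.comp (g := leftD m) hG.contDiffAt_leftD.continuousAt hx0
  have hBx : ContinuousAt (fun q : ℝ × FlatState E => leftDInv m q.2.1) (0, Y₀) :=
    ContinuousAt.comp (g := leftDInv m) hG.contDiffAt_leftDInv.continuousAt hx0
  have hde := (contDiffAt_fderiv he.1).continuousAt
  set cM := ‖leftD m ((0 : ℝ), Y₀).2.1‖ + 1
  set cB := ‖leftDInv m ((0 : ℝ), Y₀).2.1‖ + 1
  set cp := ‖((0 : ℝ), Y₀).2.2.1‖ + 1
  set ce := ‖fderiv ℝ e (0, Y₀)‖ + 1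
  have hcM : 0 ≤ cM := by positivity
  have hcB : 0 ≤ cB := by positivity
  have hcp : 0 ≤ cp := by positivity
  have hce : 0 ≤ ce := by positivity
  set CW := C₁ * (ce + C₂)
  have hCW : 0 ≤ CW := by positivity
  refine ⟨max CW ((1 + cp * cB) * cM * CW), le_max_of_le_left hCW, ?_⟩
  filter_upwards [hC₁, hC₂, hdef.eventually_nhds, hfac.eventually_nhds, hX.eventually_nhds,
    hJ.eventually (eventually_differentiableAt (contDiffAt_hadamard hℓ)),
    eventually_differentiableAt hA.smooth, eventually_differentiableAt hζ,
    eventually_differentiableAt he.1, hv.eventually hG.eventually_hasFDerivAt_mul,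
    hv.eventually hG.eventually_fderiv_mul,
    (hG.tendsto_mul.comp hv).eventually hG.eventually_leftDInv_leftD,
    (continuous_fst.tendsto (((0 : ℝ), Y₀))).eventually (gt_mem_nhds one_pos),
    eventually_norm_le hMx, eventually_norm_le hBx, eventually_norm_le hp0, eventually_norm_le hde,
    hx0.tendsto.eventually hG.eventually_leftDInv_leftD]
    with q b1 b2 b3 b4 b5 b6 b7 b8 b9 b10 b11 b12 b13 b14 b15 b16 b17 b18 hq
  obtain ⟨h, x₀, p₀, z₀⟩ := q
  dsimp only at *
  set q : ℝ × FlatState E := (h, x₀, p₀, z₀)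
  set D := slopeD (hadamard ℓ) (h, velArg ζ q) with hD
  set P := (Φ q).2.1
  set v := h • ζ q
  set B₀ := leftDInv m x₀
  set c := pullbackForm (contactForm m) Φ q (0, 0, 1)
  -- as a covector on `(δx, δζ, δz)`, `W` contains the residuals of the step equations; evaluated
  -- along the approximate flow it is the differential of the defect plus the defect of contactness
  let W : E × E × ℝ →L[ℝ] ℝ := h • D + (1 - c) • (ContinuousLinearMap.snd ℝ E ℝ).comp
      (ContinuousLinearMap.snd ℝ E (E × ℝ)) -
    (P.comp (leftDInv m v)).comp (((rightD m v).comp B₀).comp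
      (ContinuousLinearMap.fst ℝ E (E × ℝ)) +
      h • (ContinuousLinearMap.fst ℝ E ℝ).comp (ContinuousLinearMap.snd ℝ E (E × ℝ))) +
    c • (p₀.comp B₀).comp (ContinuousLinearMap.fst ℝ E (E × ℝ))
  have hW : W.comp (T q) = h ^ (r + 1) • (fderiv ℝ e q).comp
      (ContinuousLinearMap.inr ℝ ℝ (FlatState E)) +
        (pullbackForm (contactForm m) Φ q - c • contactForm m (x₀, p₀, z₀)) := by
    refine ContinuousLinearMap.ext fun δ => ?_
    obtain ⟨u, π, s⟩ := δ
    set dζ := fderiv ℝ ζ q (0, u, π, s) with hdζ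
    set dΦ := fderiv ℝ Φ q (0, u, π, s) with hdΦ
    have dx : HasFDerivAt (fun q : ℝ × FlatState E => q.2.1) _ q :=
      (hasFDerivAt_snd (𝕜 := ℝ) (p := q)).fst
    have dz : HasFDerivAt (fun q : ℝ × FlatState E => q.2.2.2) _ q :=
      (hasFDerivAt_snd (𝕜 := ℝ) (p := q)).snd.snd
    have d0 : HasFDerivAt (fun q : ℝ × FlatState E => q.1) _ q := hasFDerivAt_fst (𝕜 := ℝ) (p := q)
    have dJ : HasFDerivAt (fun q => (q.1, velArg ζ q)) _ q :=
      d0.prodMk (dx.prodMk (b8.hasFDerivAt.prodMk dz))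
    have dlam : HasFDerivAt (fun q => hadamard ℓ (q.1, velArg ζ q)) _ q :=
      HasFDerivAt.comp (g := hadamard ℓ) q b6.hasFDerivAt dJ
    -- the differential of the defect
    have i1 : h * D (u, dζ, s) = h ^ (r + 1) * fderiv ℝ e q (0, u, π, s) + (dΦ.2.2 - s) := by
      have l1 := d0.fun_smul dlam
      have dpow : HasFDerivAt (fun q : ℝ × FlatState E => q.1 ^ (r + 1)) _ q :=
        HasDerivAt.comp_hasFDerivAt (h₂ := fun t : ℝ => t ^ (r + 1)) q (hasDerivAt_pow (r + 1) h) d0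
      have l2 : HasFDerivAt (fun q : ℝ × FlatState E => q.1 ^ (r + 1) • e q +
          ((Φ q).2.2 - q.2.2.2)) _ q :=
        (dpow.fun_smul b9.hasFDerivAt).add (b7.hasFDerivAt.snd.snd.sub dz)
      have l3 := l1.unique (l2.congr_of_eventuallyEq (by
        filter_upwards [b3, b4] with q f1 f2
        rw [← f1, ← f2]; ring))
      have l4 := congrArg (fun S => S (0, u, π, s)) l3
      simpa [q, hD, slopeD, hdζ, hdΦ] using l4
    -- the differential of the endpoint
    have i2 : leftDInv m (Φ q).1 dΦ.1 = leftDInv m v (rightD m v (B₀ u) + h • dζ) := by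
      have l1 : HasFDerivAt (fun q => m (q.2.1, q.1 • ζ q)) _ q :=
        HasFDerivAt.comp (g := m) q b10 (dx.prodMk (d0.fun_smul b8.hasFDerivAt))
      have l2 := b7.hasFDerivAt.fst.unique (l1.congr_of_eventuallyEq b5)
      have l3 : dΦ.1 = fderiv ℝ m (x₀, v) (u, h • dζ) := by
        simpa [q, hdζ, hdΦ] using congrArg (fun S => S (0, u, π, s)) l2
      rw [l3, b11, b5.self_of_nhds]
      exact b12 _
    have i3 : pullbackForm (contactForm m) Φ q (u, π, s) =
        dΦ.2.2 - P (leftDInv m v (rightD m v (B₀ u) + h • dζ)) := by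
      rw [← i2]; rfl
    have i4 : W (u, dζ, s) = h * D (u, dζ, s) + s -
        P (leftDInv m v (rightD m v (B₀ u) + h • dζ)) - c * (s - p₀ (B₀ u)) := by
      simp [W]; ring
    have i5 : (W.comp (T q)) (u, π, s) = W (u, dζ, s) := rfl
    rw [i5, i4, i1, _root_.add_apply, _root_.sub_apply, i3]
    simp [contactForm_apply, B₀]
    ring
  have hWn : ‖W‖ ≤ CW * h ^ (r + 1) := by
    refine (b1 W).trans ?_
    rw [hW, mul_assoc]
    refine mul_le_mul_of_nonneg_left ((norm_add_le _ _).trans ?_) hC₁0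
    rw [add_mul]
    refine add_le_add ?_ ((b2 hq).trans ?_)
    · rw [norm_smul, norm_pow, Real.norm_eq_abs, abs_of_pos hq, mul_comm]
      refine mul_le_mul_of_nonneg_right ?_ (by positivity)
      refine ((ContinuousLinearMap.opNorm_comp_le _ _).trans ?_).trans b17
      exact mul_le_of_le_one_right (norm_nonneg _) (ContinuousLinearMap.norm_inr_le_one _ _ _)
    · exact mul_le_mul_of_nonneg_left (pow_le_pow_of_le_one hq.le b13.le (Nat.le_succ _)) hC₂0
  -- the residuals are read off from the coefficients of `W`
  have hdV : dV W = h • (dV D - P.comp (leftDInv m v)) := by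
    ext η; simp [W, dV]; ring
  have hdX : (dX W + dZ W • p₀.comp B₀).comp (leftD m x₀) =
      (1 + h * dZ D) • p₀ + h • (dX D).comp (leftD m x₀) -
        (P.comp (leftDInv m v)).comp (rightD m v) := by
    ext η; simp [W, dX, dZ, B₀, b18]; ring
  constructor
  · have h1 : ‖dV W‖ ≤ ‖W‖ := norm_dV_le W
    rw [hdV, norm_smul, Real.norm_eq_abs, abs_of_pos hq] at h1
    have h2 := h1.trans hWn
    rw [pow_succ', ← mul_assoc, mul_comm CW, mul_assoc] at h2
    exact (le_of_mul_le_mul_left h2 hq).trans (by gcongr; exact le_max_left _ _)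
  · rw [← hdX]
    have h1 : ‖dX W + dZ W • p₀.comp B₀‖ ≤ (1 + cp * cB) * ‖W‖ := by
      refine (norm_add_le _ _).trans ?_
      rw [add_mul, one_mul, norm_smul, mul_comm ‖dZ W‖]
      exact add_le_add (norm_dX_le W) (mul_le_mul ((ContinuousLinearMap.opNorm_comp_le _ _).trans
        (mul_le_mul b16 b15 (norm_nonneg _) hcp)) (norm_dZ_le W) (norm_nonneg _) (by positivity))
    calc _ ≤ ‖dX W + dZ W • p₀.comp B₀‖ * ‖leftD m x₀‖ := ContinuousLinearMap.opNorm_comp_le _ _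
      _ ≤ ((1 + cp * cB) * (CW * h ^ (r + 1))) * cM :=
        mul_le_mul (h1.trans (mul_le_mul_of_nonneg_left hWn (by positivity))) b14 (norm_nonneg _)
          (by positivity)
      _ = ((1 + cp * cB) * cM * CW) * h ^ (r + 1) := by ring
      _ ≤ _ := by gcongr; exact le_max_right _ _

end ExactStep

/-! ### The equations of a discrete step in a chart -/

section FlatStep

variable {E : Type*} [NormedAddCommGroup E] [NormedSpace ℝ E]
  {m N : E × E → E} {br : E →L[ℝ] E →L[ℝ] E} {Lf : E × E × ℝ → ℝ} {Ξ : FlatState E → E}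
  {p : E →L[ℝ] ℝ} {z : ℝ} {lam : ℝ × (E × E × ℝ) → ℝ} {ℓ : ℝ × (E × E × ℝ) → ℝ} {r : ℕ}

/-- The coefficient `1 + ∂L_d/∂z`, where `L_d = h lam`. -/
def stepScale (lam : ℝ × (E × E × ℝ) → ℝ) (q : ℝ × (E × E × ℝ)) : ℝ :=
  1 + q.1 * dZ (slopeD lam q)

/-- The covector `-D_1 L_d`, where `L_d = h lam` at the nodes `x` and `m(x, h ξ)`. -/
def initialMom (m : E × E → E) (lam : ℝ × (E × E × ℝ) → ℝ) (q : ℝ × (E × E × ℝ)) : E →L[ℝ] ℝ :=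
  (dV (slopeD lam q)).comp (rightD m (q.1 • q.2.2.1)) -
    q.1 • (dX (slopeD lam q)).comp (leftD m q.2.1)

/-- The covector `D_2 L_d`, where `L_d = h lam` at the nodes `x` and `m(x, h ξ)`. -/
def finalMom (m : E × E → E) (lam : ℝ × (E × E × ℝ) → ℝ) (q : ℝ × (E × E × ℝ)) : E →L[ℝ] ℝ :=
  (dV (slopeD lam q)).comp (leftD m (q.1 • q.2.2.1))

/-- The equation `(1 + ∂L_d/∂z) p₀ = -D_1 L_d` for the velocity of a discrete step. -/
def IsFlatStep (m : E × E → E) (lam : ℝ × (E × E × ℝ) → ℝ) (q : ℝ × (E × E × ℝ))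
    (p₀ : E →L[ℝ] ℝ) : Prop :=
  stepScale lam q • p₀ = initialMom m lam q

lemma contDiffAt_slopeD {q : ℝ × (E × E × ℝ)} (hlam : ContDiffAt ℝ ∞ lam q) :
    ContDiffAt ℝ ∞ (slopeD lam) q :=
  (contDiffAt_fderiv hlam).clm_comp contDiffAt_const

lemma contDiffAt_stepScale {q : ℝ × (E × E × ℝ)} (hlam : ContDiffAt ℝ ∞ lam q) :
    ContDiffAt ℝ ∞ (stepScale lam) q :=
  contDiffAt_const.add (contDiffAt_fst.mul (ContDiffAt.comp q (g := dZ)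
    (contDiff_dZ (E := E)).contDiffAt (contDiffAt_slopeD hlam)))

lemma contDiffAt_initialMom (hG : IsLocalGroup m N br) {ξ : E} {z : ℝ}
    (hlam : ContDiffAt ℝ ∞ lam (0, (0, ξ, z))) :
    ContDiffAt ℝ ∞ (initialMom m lam) (0, (0, ξ, z)) := by
  have hD := contDiffAt_slopeD hlam
  have hv : ContDiffAt ℝ ∞ (fun q : ℝ × (E × E × ℝ) => q.1 • q.2.2.1) (0, (0, ξ, z)) := by fun_prop
  have hx : ContDiffAt ℝ ∞ (fun q : ℝ × (E × E × ℝ) => q.2.1) (0, (0, ξ, z)) := by fun_prop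
  refine ((ContDiffAt.comp _ (g := dV) (contDiff_dV (E := E)).contDiffAt hD).clm_comp
    (ContDiffAt.comp _ (g := rightD m) ?_ hv)).sub (contDiffAt_fst.smul
      ((ContDiffAt.comp _ (g := dX) (contDiff_dX (E := E)).contDiffAt hD).clm_comp
        (ContDiffAt.comp _ (g := leftD m) hG.contDiffAt_leftD hx)))
  simpa using hG.contDiffAt_rightD

lemma eventually_slopeD_zero {w₀ : E × E × ℝ} (hlam : ContDiffAt ℝ ∞ lam (0, w₀))
    (hlam0 : ∀ᶠ w in 𝓝 w₀, lam (0, w) = Lf w) :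
    ∀ᶠ w in 𝓝 w₀, slopeD lam (0, w) = fderiv ℝ Lf w := by
  filter_upwards [hlam0.eventually_nhds,
    tendsto_prodMk_zero.eventually (eventually_differentiableAt hlam)] with w h1 h2
  have h3 : HasFDerivAt (fun w => lam (0, w)) (slopeD lam (0, w)) w :=
    HasFDerivAt.comp (g := lam) w h2.hasFDerivAt (hasFDerivAt_prodMk_right (0 : ℝ) w)
  exact (h3.congr_of_eventuallyEq (h1.mono fun _ h => h.symm)).fderiv.symm

lemma stepScale_zero (w : E × E × ℝ) : stepScale lam (0, w) = 1 := by simp [stepScale]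

/-- For `h → 0` the step equation becomes the Legendre transform. -/
lemma eventually_initialMom_zero (hG : IsLocalGroup m N br) {w₀ : E × E × ℝ}
    (hlam : ContDiffAt ℝ ∞ lam (0, w₀)) (hlam0 : ∀ᶠ w in 𝓝 w₀, lam (0, w) = Lf w) :
    ∀ᶠ w in 𝓝 w₀, initialMom m lam (0, w) = dV (fderiv ℝ Lf w) := by
  filter_upwards [eventually_slopeD_zero hlam hlam0] with w hw
  simp [initialMom, hw, hG.rightD_zero]

/-- The momentum at which a step starts that has discrete velocity `ξ`. -/
def stepMom (m : E × E → E) (lam : ℝ × (E × E × ℝ) → ℝ) (q : ℝ × (E × E × ℝ)) : E →L[ℝ] ℝ :=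
  (stepScale lam q)⁻¹ • initialMom m lam q

lemma contDiffAt_stepMom (hG : IsLocalGroup m N br) {ξ : E} {z : ℝ}
    (hlam : ContDiffAt ℝ ∞ lam (0, (0, ξ, z))) :
    ContDiffAt ℝ ∞ (stepMom m lam) (0, (0, ξ, z)) :=
  ((contDiffAt_stepScale hlam).inv (by simp [stepScale_zero])).smul (contDiffAt_initialMom hG hlam)

lemma eventually_stepScale_pos {w₀ : E × E × ℝ} (hlam : ContDiffAt ℝ ∞ lam (0, w₀)) :
    ∀ᶠ q in 𝓝 ((0 : ℝ), w₀), 1 / 2 < stepScale lam q :=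
  (contDiffAt_stepScale hlam).continuousAt.eventually
    (lt_mem_nhds (by rw [stepScale_zero]; norm_num))

lemma eventually_isFlatStep_iff {w₀ : E × E × ℝ} (hlam : ContDiffAt ℝ ∞ lam (0, w₀)) :
    ∀ᶠ q in 𝓝 ((0 : ℝ), w₀), ∀ p₀, IsFlatStep m lam q p₀ ↔ stepMom m lam q = p₀ := by
  filter_upwards [eventually_stepScale_pos hlam] with q hq p₀
  have : stepScale lam q ≠ 0 := by linarith
  rw [IsFlatStep, stepMom, inv_smul_eq_iff₀ this, eq_comm]

/-- For small `h`, a step with velocity near `ξ` starts at a momentum near the Legendre transform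
of `ξ`. -/
lemma eventually_momentum_of_isFlatStep (hG : IsLocalGroup m N br) {ξ : E}
    (hlam : ContDiffAt ℝ ∞ lam (0, (0, ξ, z)))
    (hlam0 : ∀ᶠ w in 𝓝 ((0, ξ, z) : E × E × ℝ), lam (0, w) = Lf w) {s : Set (E →L[ℝ] ℝ)}
    (hs : s ∈ 𝓝 (dV (fderiv ℝ Lf (0, ξ, z)))) :
    ∀ᶠ q in 𝓝 ((0 : ℝ), ((0, ξ, z) : E × E × ℝ)), ∀ p₀, IsFlatStep m lam q p₀ → p₀ ∈ s := by
  have h0 : stepMom m lam (0, (0, ξ, z)) = dV (fderiv ℝ Lf (0, ξ, z)) := by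
    rw [stepMom, stepScale_zero, inv_one, one_smul,
      (eventually_initialMom_zero hG hlam hlam0).self_of_nhds]
  have h1 := (contDiffAt_stepMom hG hlam).continuousAt.eventually_mem (by rw [h0]; exact hs)
  filter_upwards [h1, eventually_isFlatStep_iff hlam] with q e1 e2 p₀ hp₀
  rwa [← (e2 p₀).1 hp₀]

lemma eventually_stepMom_zero (hG : IsLocalGroup m N br) {w₀ : E × E × ℝ}
    (hlam : ContDiffAt ℝ ∞ lam (0, w₀)) (hlam0 : ∀ᶠ w in 𝓝 w₀, lam (0, w) = Lf w) :
    ∀ᶠ w in 𝓝 w₀, (w.1, stepMom m lam (0, w), w.2.2) = momPt Lf w := by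
  filter_upwards [eventually_initialMom_zero hG hlam hlam0] with w hw
  rw [momPt, stepMom, stepScale_zero, inv_one, one_smul, hw]

/-- The Legendre velocity of the initial momentum of a step with discrete velocity `ξ`; it is `ξ`
for `h = 0`. -/
def stepVel (m : E × E → E) (lam : ℝ × (E × E × ℝ) → ℝ) (Ξ : FlatState E → E)
    (q : ℝ × (E × E × ℝ)) : E := Ξ (q.2.1, stepMom m lam q, q.2.2.2)

section StepVelocity

variable (hG : IsLocalGroup m N br) (hL : IsLegendre Lf Ξ (0, p, z))
  (hlam : ContDiffAt ℝ ∞ lam (0, velPt Ξ (0, p, z)))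
  (hlam0 : ∀ᶠ w in 𝓝 (velPt Ξ (0, p, z)), lam (0, w) = Lf w)
include hG hL hlam hlam0

lemma tendsto_stepMom : Tendsto (fun q : ℝ × (E × E × ℝ) => (q.2.1, stepMom m lam q, q.2.2.2))
    (𝓝 (0, velPt Ξ (0, p, z))) (𝓝 ((0, p, z) : FlatState E)) := by
  have h1 : ContinuousAt (fun q : ℝ × (E × E × ℝ) => (q.2.1, stepMom m lam q, q.2.2.2))
      (0, velPt Ξ (0, p, z)) := by
    have h2 := (contDiffAt_stepMom hG hlam).continuousAt
    have h3 : Continuous fun q : ℝ × (E × E × ℝ) => q.2.1 := by fun_prop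
    have h4 : Continuous fun q : ℝ × (E × E × ℝ) => q.2.2.2 := by fun_prop
    exact h3.continuousAt.prodMk (h2.prodMk h4.continuousAt)
  have h5 := (eventually_stepMom_zero hG hlam hlam0).self_of_nhds
  rw [hL.momPt_velPt.self_of_nhds] at h5
  have := h1.tendsto
  dsimp only at this
  rwa [h5] at this

lemma contDiffAt_stepVel : ContDiffAt ℝ ∞ (stepVel m lam Ξ) (0, velPt Ξ (0, p, z)) := by
  have h1 := tendsto_stepMom hG hL hlam hlam0
  have h0 : ((velPt Ξ (0, p, z)).1, stepMom m lam (0, velPt Ξ (0, p, z)),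
      (velPt Ξ (0, p, z)).2.2) = ((0, p, z) : FlatState E) := by
    rw [(eventually_stepMom_zero hG hlam hlam0).self_of_nhds, hL.momPt_velPt.self_of_nhds]
  have hx : ContDiffAt ℝ ∞ (fun q : ℝ × (E × E × ℝ) => q.2.1) (0, velPt Ξ (0, p, z)) := by fun_prop
  have hz : ContDiffAt ℝ ∞ (fun q : ℝ × (E × E × ℝ) => q.2.2.2) (0, velPt Ξ (0, p, z)) := by
    fun_prop
  exact ContDiffAt.comp _ (g := Ξ) (by dsimp only; rw [h0]; exact hL.smooth_velocity)
    (hx.prodMk ((contDiffAt_stepMom hG hlam).prodMk hz))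

lemma eventually_stepVel_zero : ∀ᶠ w in 𝓝 (velPt Ξ (0, p, z)), stepVel m lam Ξ (0, w) = w.2.1 := by
  filter_upwards [eventually_stepMom_zero hG hlam hlam0, hL.velPt_momPt] with w h1 h2
  rw [stepVel, h1]
  exact congrArg (fun w => w.2.1) h2

/-- The discrete velocity depends on `stepVel` in a Lipschitz way. -/
lemma exists_norm_sub_le_stepVel [FiniteDimensional ℝ E] : ∃ U ∈ 𝓝 (velPt Ξ (0, p, z)),
    ∀ᶠ h in 𝓝 (0 : ℝ), ∀ x ξ ξ' z, (x, ξ, z) ∈ U → (x, ξ', z) ∈ U →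
      ‖ξ - ξ'‖ ≤ 2 * ‖stepVel m lam Ξ (h, (x, ξ, z)) - stepVel m lam Ξ (h, (x, ξ', z))‖ := by
  set T := stepVel m lam Ξ
  have hT := contDiffAt_stepVel hG hL hlam hlam0
  obtain ⟨K, s, hs, hK⟩ := (contDiffAt_infty.1 (contDiffAt_hadamard hT) 1).exists_lipschitzOnWith
  rw [nhds_prod_eq] at hs
  obtain ⟨t, ht, u, hu, htu⟩ := Filter.mem_prod_iff.1 hs
  have hlim : Tendsto (fun h : ℝ => |h| * K) (𝓝 0) (𝓝 0) := by
    have : Continuous (fun h : ℝ => |h| * K) := by fun_prop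
    simpa using this.tendsto 0
  refine ⟨_, inter_mem hu (eventually_stepVel_zero hG hL hlam hlam0), ?_⟩
  filter_upwards [ht, hlim.eventually (gt_mem_nhds (by norm_num : (0 : ℝ) < 1 / 2))]
    with h h1 h2 x ξ ξ' z' hξ hξ'
  have e1 := hadamard_spec T (h, (x, ξ, z'))
  have e2 := hadamard_spec T (h, (x, ξ', z'))
  have e3 : T (0, (x, ξ, z')) = ξ := hξ.2
  have e4 : T (0, (x, ξ', z')) = ξ' := hξ'.2
  rw [e3] at e1
  rw [e4] at e2
  have e5 : ‖hadamard T (h, (x, ξ, z')) - hadamard T (h, (x, ξ', z'))‖ ≤ K * ‖ξ - ξ'‖ := by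
    refine (hK.norm_sub_le (htu ⟨h1, hξ.1⟩) (htu ⟨h1, hξ'.1⟩)).trans_eq ?_
    simp [Prod.norm_def]
  have e6 : ξ - ξ' = (T (h, (x, ξ, z')) - T (h, (x, ξ', z'))) -
      h • (hadamard T (h, (x, ξ, z')) - hadamard T (h, (x, ξ', z'))) := by
    rw [e1, e2, smul_sub]; abel
  have e7 : ‖h • (hadamard T (h, (x, ξ, z')) - hadamard T (h, (x, ξ', z')))‖ ≤
      1 / 2 * ‖ξ - ξ'‖ := by
    rw [norm_smul, Real.norm_eq_abs]
    calc _ ≤ |h| * (K * ‖ξ - ξ'‖) := by gcongr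
      _ = |h| * K * ‖ξ - ξ'‖ := by ring
      _ ≤ _ := by gcongr
  have e8 : ‖ξ - ξ'‖ ≤ ‖T (h, (x, ξ, z')) - T (h, (x, ξ', z'))‖ +
      ‖h • (hadamard T (h, (x, ξ, z')) - hadamard T (h, (x, ξ', z')))‖ :=
    (congrArg norm e6).trans_le (norm_sub_le _ _)
  linarith

/-- The step equation has a solution near the Legendre velocity. -/
lemma eventually_exists_isFlatStep [FiniteDimensional ℝ E] {V : Set E}
    (hV : V ∈ 𝓝 (Ξ (0, p, z))) :
    ∀ᶠ q in 𝓝 ((0 : ℝ), ((0, p, z) : FlatState E)),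
      ∃ ξ ∈ V, IsFlatStep m lam (q.1, (q.2.1, ξ, q.2.2.2)) q.2.2.1 := by
  set T := stepVel m lam Ξ with hTdef
  have hT := contDiffAt_stepVel hG hL hlam hlam0
  set q₀ : ℝ × (E × E × ℝ) := (0, velPt Ξ (0, p, z)) with hq₀
  have hT0 := eventually_stepVel_zero hG hL hlam hlam0
  let H : ℝ × (E × E × ℝ) → ℝ × (E × E × ℝ) := fun q => (q.1, (q.2.1, T q, q.2.2.2))
  have hH : ContDiffAt ℝ 1 H q₀ := by
    have hx : ContDiffAt ℝ ∞ (fun q : ℝ × (E × E × ℝ) => q.2.1) q₀ := by fun_prop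
    have hz : ContDiffAt ℝ ∞ (fun q : ℝ × (E × E × ℝ) => q.2.2.2) q₀ := by fun_prop
    exact contDiffAt_infty.1 (contDiffAt_fst.prodMk (hx.prodMk (hT.prodMk hz))) 1
  have hstrict := hH.hasStrictFDerivAt one_ne_zero
  -- the differential of `H` is the identity on `{0} × (E × E × ℝ)`, hence it is onto
  have hTd : ∀ w : E × E × ℝ, fderiv ℝ T q₀ (0, w) = w.2.1 := by
    intro w
    have h1 : HasFDerivAt (fun w => T (0, w)) _ (velPt Ξ (0, p, z)) :=
      HasFDerivAt.comp (g := T) _ (hT.differentiableAt (by simp)).hasFDerivAt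
        (hasFDerivAt_prodMk_right (0 : ℝ) _)
    have h2 : HasFDerivAt (fun w : E × E × ℝ => w.2.1) _ (velPt Ξ (0, p, z)) :=
      (hasFDerivAt_snd (𝕜 := ℝ)).fst
    exact congrArg (fun S => S w) (h1.unique (h2.congr_of_eventuallyEq hT0))
  have hHd : ∀ δ, fderiv ℝ H q₀ δ = (δ.1, (δ.2.1, fderiv ℝ T q₀ δ, δ.2.2.2)) := by
    intro δ
    have h1 : HasFDerivAt H _ q₀ := (hasFDerivAt_fst (𝕜 := ℝ)).prodMk
      ((hasFDerivAt_snd (𝕜 := ℝ)).fst.prodMk ((hT.differentiableAt (by simp)).hasFDerivAt.prodMk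
        (hasFDerivAt_snd (𝕜 := ℝ)).snd.snd))
    exact congrArg (fun S => S δ) h1.fderiv
  have hsurj : (fderiv ℝ H q₀).range = ⊤ := by
    rw [LinearMap.range_eq_top]
    intro δ
    refine ⟨(δ.1, (δ.2.1, δ.2.2.1 - fderiv ℝ T q₀ (δ.1, 0), δ.2.2.2)), ?_⟩
    have h1 : ((δ.1, (δ.2.1, δ.2.2.1 - fderiv ℝ T q₀ (δ.1, 0), δ.2.2.2)) : ℝ × (E × E × ℝ)) =
        (δ.1, 0) + (0, (δ.2.1, δ.2.2.1 - fderiv ℝ T q₀ (δ.1, 0), δ.2.2.2)) := by simp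
    show fderiv ℝ H q₀ _ = δ
    rw [hHd, h1, map_add, hTd]
    simp
  have hmap := hstrict.map_nhds_eq_of_surj hsurj
  have hHq₀ : H q₀ = q₀ := by
    show ((0 : ℝ), ((0 : E), T q₀, z)) = (0, (0, Ξ (0, p, z), z))
    rw [show T q₀ = Ξ (0, p, z) from hT0.self_of_nhds]
  rw [hHq₀] at hmap
  have hgood : ∀ᶠ q in 𝓝 q₀, q.2.2.1 ∈ V ∧ momPt Lf (velPt Ξ (q.2.1, stepMom m lam q, q.2.2.2)) =
      (q.2.1, stepMom m lam q, q.2.2.2) ∧ (∀ p₀, IsFlatStep m lam q p₀ ↔ stepMom m lam q = p₀) := by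
    have h1 : Tendsto (fun q : ℝ × (E × E × ℝ) => q.2.2.1) (𝓝 q₀) (𝓝 (Ξ (0, p, z))) := by
      have : Continuous (fun q : ℝ × (E × E × ℝ) => q.2.2.1) := by fun_prop
      exact this.tendsto q₀
    exact (h1.eventually hV).and (((tendsto_stepMom hG hL hlam hlam0).eventually
      hL.momPt_velPt).and (eventually_isFlatStep_iff hlam))
  have himg : H '' {q | q.2.2.1 ∈ V ∧ momPt Lf (velPt Ξ (q.2.1, stepMom m lam q, q.2.2.2)) =
      (q.2.1, stepMom m lam q, q.2.2.2) ∧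
        (∀ p₀, IsFlatStep m lam q p₀ ↔ stepMom m lam q = p₀)} ∈ 𝓝 q₀ := by
    rw [← hmap]; exact image_mem_map hgood
  have hJ : Tendsto (fun q : ℝ × FlatState E => (q.1, velPt Ξ q.2)) (𝓝 (0, (0, p, z))) (𝓝 q₀) :=
    (continuousAt_fst.prodMk (ContinuousAt.comp (g := velPt Ξ)
      (f := fun q : ℝ × FlatState E => q.2) (x := ((0 : ℝ), ((0, p, z) : FlatState E)))
      hL.contDiffAt_velPt.continuousAt continuousAt_snd)).tendsto
  filter_upwards [hJ.eventually himg,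
    (continuous_snd.tendsto ((0 : ℝ), ((0, p, z) : FlatState E))).eventually hL.momPt_velPt]
    with q h1 h2
  obtain ⟨⟨h, x, ξ, z'⟩, ⟨g1, g2, g3⟩, g4⟩ := h1
  obtain ⟨e1, e2, e3, e4⟩ : h = q.1 ∧ x = q.2.1 ∧ T (h, (x, ξ, z')) = Ξ q.2 ∧ z' = q.2.2.2 := by
    simpa [H, velPt, Prod.ext_iff] using g4
  subst e1 e2 e4
  refine ⟨ξ, g1, (g3 _).2 ?_⟩
  have e5 : velPt Ξ (q.2.1, stepMom m lam (q.1, (q.2.1, ξ, q.2.2.2)), q.2.2.2) = velPt Ξ q.2 := by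
    rw [velPt, velPt]; exact congrArg (fun v => (q.2.1, v, q.2.2.2)) e3
  dsimp only at g2
  rw [e5, h2] at g2
  exact (congrArg (fun Y => Y.2.1) g2).symm

end StepVelocity

end FlatStep

/-! ### The local error in a chart -/

section FlatError

variable {E : Type*} [NormedAddCommGroup E] [NormedSpace ℝ E]
  {m N : E × E → E} {br : E →L[ℝ] E →L[ℝ] E} {Lf : E × E × ℝ → ℝ} {Ξ : FlatState E → E}
  {p : E →L[ℝ] ℝ} {z : ℝ} {lam : ℝ × (E × E × ℝ) → ℝ} {ℓ : ℝ × (E × E × ℝ) → ℝ} {r : ℕ}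

/-- A smooth germ is Lipschitz. -/
lemma exists_eventually_norm_sub_le {S F : Type*} [NormedAddCommGroup S] [NormedSpace ℝ S]
    [NormedAddCommGroup F] [NormedSpace ℝ F] {f : S → F} {a : S} (hf : ContDiffAt ℝ ∞ f a) :
    ∃ K : ℝ, 0 ≤ K ∧ ∀ᶠ u in 𝓝 (a, a), ‖f u.1 - f u.2‖ ≤ K * ‖u.1 - u.2‖ := by
  obtain ⟨K, s, hs, hK⟩ := (contDiffAt_infty.1 hf 1).exists_lipschitzOnWith
  refine ⟨K, K.2, ?_⟩
  filter_upwards [prod_mem_nhds hs hs] with u hu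
  exact hK.norm_sub_le hu.1 hu.2

/-- Near a base point, `ℓ` generates a smooth approximation of the exact flow, of order `r + 1`. -/
lemma exists_approxFlow_defect [FiniteDimensional ℝ E] (hG : IsLocalGroup m N br)
    (hL : IsLegendre Lf Ξ (0, p, z)) (hℓ : ContDiffAt ℝ ∞ ℓ (0, velPt Ξ (0, p, z)))
    (hag : FlatAgrees m N br Lf Ξ ℓ (0, p, z) r) :
    ∃ (Φ σ : ℝ × FlatState E → FlatState E) (ζ : ℝ × FlatState E → E) (e : ℝ × FlatState E → ℝ),
      IsApproxFlow (ephField m br Lf Ξ) (0, p, z) (r + 1) Φ σ ∧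
      ContDiffAt ℝ ∞ ζ (0, (0, p, z)) ∧
      (∀ᶠ Y in 𝓝 ((0, p, z) : FlatState E), ζ (0, Y) = Ξ Y) ∧
      (∀ᶠ q in 𝓝 ((0 : ℝ), ((0, p, z) : FlatState E)), (Φ q).1 = m (q.2.1, q.1 • ζ q)) ∧
      IsDefect ℓ Φ ζ (0, p, z) r e := by
  obtain ⟨Φ, σ, hA⟩ := exists_approxFlow (contDiffAt_ephField hG hL) (r + 1)
  obtain ⟨ζ, hζ, hζ0, hX⟩ := exists_discreteVelocity hG hA (Nat.succ_pos r)
  obtain ⟨C, hC⟩ := exists_defect_bound hG hL hℓ hag hA hζ hζ0.self_of_nhds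
    (hX.mono fun q hq => hq.1)
  have hs : ContDiffAt ℝ ∞ (fun q => ℓ (q.1, velArg ζ q) - ((Φ q).2.2 - q.2.2.2))
      (0, (0, p, z)) := by
    have h1 : ContDiffAt ℝ ∞ (fun q : ℝ × FlatState E => q.2.2.2) (0, (0, p, z)) := by fun_prop
    refine (ContDiffAt.comp _ (g := ℓ) ?_ (contDiffAt_velArg hζ)).sub (hA.smooth.snd.snd.sub h1)
    simpa only [velArg, velPt, hζ0.self_of_nhds] using hℓ
  obtain ⟨e, he, he'⟩ := exists_eq_pow_smul hs hC
  exact ⟨Φ, σ, ζ, e, hA, hζ, hζ0, hX.mono fun q hq => hq.2, he, he'⟩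

/-- The final momentum of a step, as a function of its velocity and its initial momentum. In these
variables it is a near-identity map. -/
def transportedMom (m : E × E → E) (lam : ℝ × (E × E × ℝ) → ℝ)
    (u : ℝ × ((E × E × ℝ) × (E →L[ℝ] ℝ))) : E →L[ℝ] ℝ :=
  (stepScale lam (u.1, u.2.1) • u.2.2 +
    u.1 • (dX (slopeD lam (u.1, u.2.1))).comp (leftD m u.2.1.1)).comp
      ((rightD m (u.1 • u.2.1.2.1)).inverse.comp (leftD m (u.1 • u.2.1.2.1)))

lemma transportedMom_zero (hG : IsLocalGroup m N br) (u : (E × E × ℝ) × (E →L[ℝ] ℝ)) :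
    transportedMom m lam (0, u) = u.2 := by
  simp [transportedMom, stepScale_zero, hG.leftD_zero, hG.rightD_zero]

lemma IsFlatStep.finalMom_eq {q : ℝ × (E × E × ℝ)} {p₀ : E →L[ℝ] ℝ} (h : IsFlatStep m lam q p₀)
    (hv : (rightD m (q.1 • q.2.2.1)).IsInvertible) :
    finalMom m lam q = transportedMom m lam (q.1, (q.2, p₀)) := by
  have h1 : stepScale lam q • p₀ + q.1 • (dX (slopeD lam q)).comp (leftD m q.2.1) =
      (dV (slopeD lam q)).comp (rightD m (q.1 • q.2.2.1)) := by
    rw [h, initialMom, sub_add_cancel]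
  have h2 : ∀ w, rightD m (q.1 • q.2.2.1) ((rightD m (q.1 • q.2.2.1)).inverse w) = w :=
    fun w => (hv.inverse_apply_eq.1 rfl).symm
  rw [transportedMom, h1]
  ext w
  simp [finalMom, h2]

lemma contDiffAt_transportedMom [FiniteDimensional ℝ E] (hG : IsLocalGroup m N br) {ξ : E}
    (hlam : ContDiffAt ℝ ∞ lam (0, (0, ξ, z))) :
    ContDiffAt ℝ ∞ (transportedMom m lam) (0, ((0, ξ, z), p)) := by
  set u₀ : ℝ × ((E × E × ℝ) × (E →L[ℝ] ℝ)) := (0, ((0, ξ, z), p))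
  have hq : ContDiffAt ℝ ∞ (fun u : ℝ × ((E × E × ℝ) × (E →L[ℝ] ℝ)) => (u.1, u.2.1)) u₀ := by
    fun_prop
  have hp : ContDiffAt ℝ ∞ (fun u : ℝ × ((E × E × ℝ) × (E →L[ℝ] ℝ)) => u.2.2) u₀ := by fun_prop
  have hx : ContDiffAt ℝ ∞ (fun u : ℝ × ((E × E × ℝ) × (E →L[ℝ] ℝ)) => u.2.1.1) u₀ := by fun_prop
  have hv : ContDiffAt ℝ ∞ (fun u : ℝ × ((E × E × ℝ) × (E →L[ℝ] ℝ)) => u.1 • u.2.1.2.1) u₀ := by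
    fun_prop
  have hv0 : (0 : ℝ) • ξ = 0 := zero_smul ℝ ξ
  have hR : ContDiffAt ℝ ∞ (fun u : ℝ × ((E × E × ℝ) × (E →L[ℝ] ℝ)) =>
      rightD m (u.1 • u.2.1.2.1)) u₀ :=
    ContDiffAt.comp u₀ (g := rightD m) (by simpa [u₀] using hG.contDiffAt_rightD) hv
  have hRi : ContDiffAt ℝ ∞ (fun u : ℝ × ((E × E × ℝ) × (E →L[ℝ] ℝ)) =>
      (rightD m (u.1 • u.2.1.2.1)).inverse) u₀ := by
    refine ContDiffAt.comp u₀ (g := ContinuousLinearMap.inverse) ?_ hR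
    simp only [u₀, hv0, hG.rightD_zero]
    exact contDiffAt_map_inverse (ContinuousLinearEquiv.refl ℝ E)
  exact (((ContDiffAt.comp u₀ (g := stepScale lam) (contDiffAt_stepScale hlam) hq).smul hp).add
    (contDiffAt_fst.smul ((ContDiffAt.comp u₀ (g := dX) (contDiff_dX (E := E)).contDiffAt
      (ContDiffAt.comp u₀ (g := slopeD lam) (contDiffAt_slopeD hlam) hq)).clm_comp
        (ContDiffAt.comp u₀ (g := leftD m) hG.contDiffAt_leftD hx)))).clm_comp
    (hRi.clm_comp (ContDiffAt.comp u₀ (g := leftD m) (by simpa [u₀] using hG.contDiffAt_leftD) hv))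

/-- A discrete step differs from the approximate flow by `O(hʳ⁺¹)`: its velocity is determined up to
`O(hʳ)` by the residuals of the approximate flow in the step equations, and the endpoint depends on
the velocity only through terms with a factor `h`. -/
lemma exists_flatStep_error_approx [FiniteDimensional ℝ E] (hG : IsLocalGroup m N br)
    (hL : IsLegendre Lf Ξ (0, p, z)) (hr : 0 < r)
    (hℓ : ContDiffAt ℝ ∞ ℓ (0, velPt Ξ (0, p, z))) {Φ σ : ℝ × FlatState E → FlatState E}
    {ζ : ℝ × FlatState E → E} {e : ℝ × FlatState E → ℝ}
    (hA : IsApproxFlow (ephField m br Lf Ξ) (0, p, z) (r + 1) Φ σ)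
    (hζ : ContDiffAt ℝ ∞ ζ (0, (0, p, z)))
    (hζ0 : ∀ᶠ Y in 𝓝 ((0, p, z) : FlatState E), ζ (0, Y) = Ξ Y)
    (hX : ∀ᶠ q in 𝓝 ((0 : ℝ), ((0, p, z) : FlatState E)), (Φ q).1 = m (q.2.1, q.1 • ζ q))
    (he : IsDefect ℓ Φ ζ (0, p, z) r e) :
    ∃ C : ℝ, 0 ≤ C ∧ ∀ᶠ u in 𝓝 (((0 : ℝ), ((0, p, z) : FlatState E)), Ξ (0, p, z)),
      0 < u.1.1 →
        IsFlatStep m (hadamard ℓ) (u.1.1, (u.1.2.1, u.2, u.1.2.2.2)) u.1.2.2.1 →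
        ‖m (u.1.2.1, u.1.1 • u.2) - (Φ u.1).1‖ ≤ C * u.1.1 ^ (r + 1) ∧
        ‖finalMom m (hadamard ℓ) (u.1.1, (u.1.2.1, u.2, u.1.2.2.2)) - (Φ u.1).2.1‖ ≤
          C * u.1.1 ^ (r + 1) ∧
        |u.1.2.2.2 + ℓ (u.1.1, (u.1.2.1, u.2, u.1.2.2.2)) - (Φ u.1).2.2| ≤
          C * u.1.1 ^ (r + 1) := by
  have hlam := contDiffAt_hadamard hℓ
  have hlam0 := eventually_hadamard_lagrangian hL hr (Nat.succ_pos r) hℓ hA hζ hζ0 he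
  have hℓ0 := eventually_lagrangian_zero hL hA hζ0 he
  obtain ⟨CR, hCR0, hCR⟩ := exists_stepEquation_residual hG hL hℓ hA hζ hζ0 hX he
  obtain ⟨U, hU, hUT⟩ := exists_norm_sub_le_stepVel hG hL hlam hlam0
  obtain ⟨Km, hKm0, hKm⟩ := exists_eventually_norm_sub_le hG.mul_smooth
  obtain ⟨Kl, hKl0, hKl⟩ := exists_eventually_norm_sub_le hlam
  obtain ⟨KΞ, hKΞ0, hKΞ⟩ := exists_eventually_norm_sub_le hL.smooth_velocity
  obtain ⟨KQ, hKQ0, hKQ⟩ := exists_eventually_norm_sub_le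
    (contDiffAt_hadamard (contDiffAt_transportedMom (p := p) hG hlam))
  set Y₀ : FlatState E := (0, p, z) with hY₀
  set ξ₀ : E := Ξ Y₀ with hξ₀
  have hζt : Tendsto (fun u : (ℝ × FlatState E) × E => ζ u.1) (𝓝 ((0, Y₀), ξ₀)) (𝓝 ξ₀) := by
    have := hζ.continuousAt.tendsto
    rw [hζ0.self_of_nhds] at this
    exact this.comp (continuous_fst.tendsto _)
  have t1 : Tendsto (fun u : (ℝ × FlatState E) × E => u.1) (𝓝 ((0, Y₀), ξ₀)) (𝓝 (0, Y₀)) :=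
    continuous_fst.tendsto _
  have th : Tendsto (fun u : (ℝ × FlatState E) × E => u.1.1) (𝓝 ((0, Y₀), ξ₀)) (𝓝 0) :=
    (continuous_fst.tendsto _).comp t1
  have t2 : Tendsto (fun u : (ℝ × FlatState E) × E => u.2) (𝓝 ((0, Y₀), ξ₀)) (𝓝 ξ₀) :=
    continuous_snd.tendsto _
  have tx : Tendsto (fun u : (ℝ × FlatState E) × E => u.1.2.1) (𝓝 ((0, Y₀), ξ₀)) (𝓝 0) := by
    have : Continuous (fun u : (ℝ × FlatState E) × E => u.1.2.1) := by fun_prop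
    exact this.tendsto ((0, Y₀), ξ₀)
  have tp : Tendsto (fun u : (ℝ × FlatState E) × E => u.1.2.2.1) (𝓝 ((0, Y₀), ξ₀)) (𝓝 p) := by
    have : Continuous (fun u : (ℝ × FlatState E) × E => u.1.2.2.1) := by fun_prop
    exact this.tendsto ((0, Y₀), ξ₀)
  have tz : Tendsto (fun u : (ℝ × FlatState E) × E => u.1.2.2.2) (𝓝 ((0, Y₀), ξ₀)) (𝓝 z) := by
    have : Continuous (fun u : (ℝ × FlatState E) × E => u.1.2.2.2) := by fun_prop
    exact this.tendsto ((0, Y₀), ξ₀)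
  have tw : Tendsto (fun u : (ℝ × FlatState E) × E => (u.1.2.1, u.2, u.1.2.2.2))
      (𝓝 ((0, Y₀), ξ₀)) (𝓝 (velPt Ξ Y₀)) := tx.prodMk_nhds (t2.prodMk_nhds tz)
  have tw' : Tendsto (fun u : (ℝ × FlatState E) × E => (u.1.2.1, ζ u.1, u.1.2.2.2))
      (𝓝 ((0, Y₀), ξ₀)) (𝓝 (velPt Ξ Y₀)) := tx.prodMk_nhds (hζt.prodMk_nhds tz)
  have tq : Tendsto (fun u : (ℝ × FlatState E) × E => (u.1.1, (u.1.2.1, u.2, u.1.2.2.2)))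
      (𝓝 ((0, Y₀), ξ₀)) (𝓝 (0, velPt Ξ Y₀)) := th.prodMk_nhds tw
  have tq' : Tendsto (fun u : (ℝ × FlatState E) × E => (u.1.1, (u.1.2.1, ζ u.1, u.1.2.2.2)))
      (𝓝 ((0, Y₀), ξ₀)) (𝓝 (0, velPt Ξ Y₀)) := th.prodMk_nhds tw'
  have tv : Tendsto (fun u : (ℝ × FlatState E) × E => u.1.1 • u.2) (𝓝 ((0, Y₀), ξ₀)) (𝓝 0) := by
    simpa using th.smul t2
  have tv' : Tendsto (fun u : (ℝ × FlatState E) × E => u.1.1 • ζ u.1) (𝓝 ((0, Y₀), ξ₀)) (𝓝 0) := by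
    simpa using th.smul hζt
  have hAi : ContinuousAt (fun v => (rightD m v).inverse.comp (leftD m v)) 0 := by
    refine ContinuousAt.clm_comp (ContinuousAt.comp (g := ContinuousLinearMap.inverse) ?_
      hG.contDiffAt_rightD.continuousAt) hG.contDiffAt_leftD.continuousAt
    rw [hG.rightD_zero]
    exact (contDiffAt_map_inverse (n := ∞) (ContinuousLinearEquiv.refl ℝ E)).continuousAt
  set cA := ‖rightD m 0‖ + 1
  set cI := ‖(rightD m 0).inverse.comp (leftD m 0)‖ + 1
  have hcA : 0 ≤ cA := by positivity
  have hcI : 0 ≤ cI := by positivity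
  set Cξ := 2 * (KΞ * (2 * (CR + CR * cA)))
  have hCξ : 0 ≤ Cξ := by positivity
  refine ⟨Km * Cξ + (KQ * Cξ + CR * cI) + (Kl * Cξ + (|e (0, Y₀)| + 1)), by positivity, ?_⟩
  filter_upwards [t1.eventually hCR, th.eventually hUT, tw.eventually hU, tw'.eventually hU,
    ((tx.prodMk_nhds tv).prodMk_nhds (tx.prodMk_nhds tv')).eventually hKm,
    (tq.prodMk_nhds tq').eventually hKl,
    ((tendsto_stepMom hG hL hlam hlam0).comp tq').prodMk_nhds
      (tx.prodMk_nhds (tp.prodMk_nhds tz)) |>.eventually hKΞ,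
    ((th.prodMk_nhds (tw.prodMk_nhds tp)).prodMk_nhds
      (th.prodMk_nhds (tw'.prodMk_nhds tp))).eventually hKQ,
    tq.eventually (eventually_isFlatStep_iff hlam), tq'.eventually (eventually_stepScale_pos hlam),
    tw.eventually hℓ0, tw'.eventually hℓ0, t1.eventually hX, t1.eventually he.2,
    th.eventually (gt_mem_nhds one_pos),
    tv'.eventually (eventually_norm_le hG.contDiffAt_rightD.continuousAt),
    tv'.eventually (eventually_norm_le hAi), t1.eventually (eventually_norm_le he.1.continuousAt),
    tv'.eventually hG.eventually_invertible_rightD, tv.eventually hG.eventually_invertible_rightD,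
    tv'.eventually hG.eventually_leftDInv_leftD]
    with u a1 a2 a3 a4 a5 a6 a7 a8 a9 a10 a11 a12 a13 a14 a15 a16 a17 a18 a19 a20 a21 hh hstep
  obtain ⟨⟨h, x, p₀, z₀⟩, ξ⟩ := u
  dsimp only [Function.comp_apply] at *
  set q : ℝ × FlatState E := (h, x, p₀, z₀) with hq
  obtain ⟨R1, R2⟩ := a1 hh
  have hwζ : velArg ζ q = (x, ζ q, z₀) := rfl
  rw [hwζ] at R1 R2 a14
  set lam := hadamard ℓ
  set v := h • ζ q
  set wζ : ℝ × (E × E × ℝ) := (h, (x, ζ q, z₀)) with hwζ'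
  set wξ : ℝ × (E × E × ℝ) := (h, (x, ξ, z₀)) with hwξ'
  have hhr : h ^ (r + 1) ≤ h ^ r := pow_le_pow_of_le_one hh.le a15.le (Nat.le_succ _)
  -- the velocity of the step
  have b1 : ‖stepScale lam wζ • (p₀ - stepMom m lam wζ)‖ ≤ (CR + CR * cA) * h ^ r := by
    have hne : stepScale lam wζ ≠ 0 := by linarith
    have : stepScale lam wζ • (p₀ - stepMom m lam wζ) =
        ((1 + h * dZ (slopeD lam wζ)) • p₀ + h • (dX (slopeD lam wζ)).comp (leftD m x) -
          ((Φ q).2.1.comp (leftDInv m v)).comp (rightD m v)) -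
        (dV (slopeD lam wζ) - (Φ q).2.1.comp (leftDInv m v)).comp (rightD m v) := by
      rw [smul_sub, stepMom, smul_inv_smul₀ hne, initialMom]
      ext η
      simp [stepScale, wζ, v]
      ring
    rw [this, add_mul]
    refine (norm_sub_le _ _).trans (add_le_add (R2.trans (by gcongr)) ?_)
    refine (ContinuousLinearMap.opNorm_comp_le _ _).trans ?_
    calc _ ≤ (CR * h ^ r) * cA := by gcongr
      _ = _ := by ring
  have b2 : ‖p₀ - stepMom m lam wζ‖ ≤ 2 * (CR + CR * cA) * h ^ r := by
    rw [norm_smul, Real.norm_eq_abs, abs_of_pos (by linarith)] at b1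
    nlinarith [norm_nonneg (p₀ - stepMom m lam wζ)]
  have b3 : ‖ξ - ζ q‖ ≤ Cξ * h ^ r := by
    have c1 : stepVel m lam Ξ wξ = Ξ (x, p₀, z₀) := by
      rw [stepVel, (a9 p₀).1 hstep]
    have c2 : stepVel m lam Ξ wζ = Ξ (x, stepMom m lam wζ, z₀) := rfl
    have c3 := a2 x ξ (ζ q) z₀ a3 a4
    rw [c1, c2, norm_sub_rev (Ξ (x, p₀, z₀))] at c3
    have c4 : ‖((x, stepMom m lam wζ, z₀) : FlatState E) - (x, p₀, z₀)‖ =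
        ‖p₀ - stepMom m lam wζ‖ := by
      rw [norm_sub_rev p₀]; simp [Prod.norm_def]
    rw [c4] at a7
    calc _ ≤ _ := c3
      _ ≤ 2 * (KΞ * (2 * (CR + CR * cA) * h ^ r)) := by gcongr; exact a7.trans (by gcongr)
      _ = _ := by ring
  have hpow : h * h ^ r = h ^ (r + 1) := (pow_succ' h r).symm
  have hP : 0 ≤ h ^ (r + 1) := by positivity
  -- the three components of the endpoint
  have n1 : ‖m (x, h • ξ) - (Φ q).1‖ ≤ Km * Cξ * h ^ (r + 1) := by
    rw [a13]
    refine a5.trans ?_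
    have : ‖((x, h • ξ) : E × E) - (x, h • ζ q)‖ = h * ‖ξ - ζ q‖ := by
      rw [Prod.mk_sub_mk, sub_self, ← smul_sub, Prod.norm_mk, norm_zero, norm_smul,
        Real.norm_eq_abs, abs_of_pos hh, max_eq_right (by positivity)]
    rw [this]
    calc _ ≤ Km * (h * (Cξ * h ^ r)) := by gcongr
      _ = _ := by rw [← hpow]; ring
  have n2 : ‖finalMom m lam wξ - (Φ q).2.1‖ ≤ (KQ * Cξ + CR * cI) * h ^ (r + 1) := by
    rw [hstep.finalMom_eq a20]
    have c1 := hadamard_spec (transportedMom m lam) (h, ((x, ξ, z₀), p₀))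
    have c2 := hadamard_spec (transportedMom m lam) (h, ((x, ζ q, z₀), p₀))
    rw [transportedMom_zero hG] at c1 c2
    have c3 : (Φ q).2.1 = (((Φ q).2.1.comp (leftDInv m v)).comp (rightD m v)).comp
        ((rightD m v).inverse.comp (leftD m v)) := by
      have d1 : ∀ w, rightD m v ((rightD m v).inverse w) = w :=
        fun w => (a19.inverse_apply_eq.1 rfl).symm
      ext w
      simp only [ContinuousLinearMap.comp_apply, d1, a21]
    have c4 : ‖transportedMom m lam (h, ((x, ζ q, z₀), p₀)) - (Φ q).2.1‖ ≤
        CR * cI * h ^ (r + 1) := by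
      have : transportedMom m lam (h, ((x, ζ q, z₀), p₀)) - (Φ q).2.1 =
          ((1 + h * dZ (slopeD lam wζ)) • p₀ + h • (dX (slopeD lam wζ)).comp (leftD m x) -
            ((Φ q).2.1.comp (leftDInv m v)).comp (rightD m v)).comp
              ((rightD m v).inverse.comp (leftD m v)) := by
        conv_lhs => rw [c3]
        rw [ContinuousLinearMap.sub_comp]; rfl
      rw [this]
      refine (ContinuousLinearMap.opNorm_comp_le _ _).trans ?_
      calc _ ≤ (CR * h ^ (r + 1)) * cI := by gcongr
        _ = _ := by ring
    have c5 : transportedMom m lam (h, ((x, ξ, z₀), p₀)) -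
        transportedMom m lam (h, ((x, ζ q, z₀), p₀)) =
        h • (hadamard (transportedMom m lam) (h, ((x, ξ, z₀), p₀)) -
          hadamard (transportedMom m lam) (h, ((x, ζ q, z₀), p₀))) := by
      rw [c1, c2, smul_sub]; abel
    have c6 : ‖((h, ((x, ξ, z₀), p₀)) : ℝ × ((E × E × ℝ) × (E →L[ℝ] ℝ))) -
        (h, ((x, ζ q, z₀), p₀))‖ = ‖ξ - ζ q‖ := by simp [Prod.norm_def]
    rw [c6] at a8
    refine (norm_sub_le_norm_sub_add_norm_sub _
      (transportedMom m lam (h, ((x, ζ q, z₀), p₀))) _).trans ?_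
    rw [add_mul]
    refine add_le_add ?_ c4
    rw [c5, norm_smul, Real.norm_eq_abs, abs_of_pos hh]
    calc _ ≤ h * (KQ * (Cξ * h ^ r)) := by gcongr; exact a8.trans (by gcongr)
      _ = _ := by rw [← hpow]; ring
  have n3 : |z₀ + ℓ wξ - (Φ q).2.2| ≤ (Kl * Cξ + (|e (0, Y₀)| + 1)) * h ^ (r + 1) := by
    have c1 : ℓ wξ = h • lam wξ := by rw [hadamard_spec ℓ wξ, a11, zero_add]
    have c2 : ℓ wζ = h • lam wζ := by rw [hadamard_spec ℓ wζ, a12, zero_add]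
    have c3 : z₀ + ℓ wξ - (Φ q).2.2 = h * (lam wξ - lam wζ) + h ^ (r + 1) * e q := by
      have c4 : ℓ wζ - ((Φ q).2.2 - z₀) = h ^ (r + 1) * e q := a14
      rw [smul_eq_mul] at c1 c2
      rw [← c4, mul_sub, ← c1, ← c2]; ring
    have c6 : ‖wξ - wζ‖ = ‖ξ - ζ q‖ := by simp [wξ, wζ, Prod.norm_def]
    rw [c6, Real.norm_eq_abs] at a6
    rw [c3, add_mul]
    refine (abs_add_le _ _).trans (add_le_add ?_ ?_)
    · rw [abs_mul, abs_of_pos hh]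
      calc _ ≤ h * (Kl * (Cξ * h ^ r)) := by gcongr; exact a6.trans (by gcongr)
        _ = _ := by rw [← hpow]; ring
    · rw [abs_mul, abs_of_nonneg hP, mul_comm]
      exact mul_le_mul_of_nonneg_right a18 hP
  have k1 : 0 ≤ Km * Cξ := by positivity
  have k2 : 0 ≤ KQ * Cξ + CR * cI := by positivity
  have k3 : 0 ≤ Kl * Cξ + (|e (0, Y₀)| + 1) := by positivity
  exact ⟨n1.trans (mul_le_mul_of_nonneg_right (by linarith) hP),
    n2.trans (mul_le_mul_of_nonneg_right (by linarith) hP),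
    n3.trans (mul_le_mul_of_nonneg_right (by linarith) hP)⟩

/-- A discrete step differs from the exact flow by `O(hʳ⁺¹)`. -/
lemma exists_flatStep_error [FiniteDimensional ℝ E] (hG : IsLocalGroup m N br)
    (hL : IsLegendre Lf Ξ (0, p, z)) (hr : 0 < r)
    (hℓ : ContDiffAt ℝ ∞ ℓ (0, velPt Ξ (0, p, z))) (hag : FlatAgrees m N br Lf Ξ ℓ (0, p, z) r) :
    ∃ (V : Set (FlatState E)) (C : ℝ), V ∈ 𝓝 ((0, p, z) : FlatState E) ∧ 0 ≤ C ∧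
      ∀ᶠ u in 𝓝 (((0 : ℝ), ((0, p, z) : FlatState E)), Ξ (0, p, z)), 0 < u.1.1 →
        IsFlatStep m (hadamard ℓ) (u.1.1, (u.1.2.1, u.2, u.1.2.2.2)) u.1.2.2.1 →
        ∀ y : ℝ → FlatState E, y 0 = u.1.2 → (∀ t ∈ Icc 0 u.1.1, y t ∈ V ∧
          HasDerivWithinAt y (ephField m br Lf Ξ (y t)) (Icc 0 u.1.1) t) →
        ‖N ((y u.1.1).1, m (u.1.2.1, u.1.1 • u.2))‖ ≤ C * u.1.1 ^ (r + 1) ∧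
        ‖finalMom m (hadamard ℓ) (u.1.1, (u.1.2.1, u.2, u.1.2.2.2)) - (y u.1.1).2.1‖ ≤
          C * u.1.1 ^ (r + 1) ∧
        |u.1.2.2.2 + ℓ (u.1.1, (u.1.2.1, u.2, u.1.2.2.2)) - (y u.1.1).2.2| ≤
          C * u.1.1 ^ (r + 1) := by
  obtain ⟨Φ, σ, ζ, e, hA, hζ, hζ0, hX, he⟩ := exists_approxFlow_defect hG hL hℓ hag
  obtain ⟨C₁, hC₁0, hC₁⟩ := exists_flatStep_error_approx hG hL hr hℓ hA hζ hζ0 hX he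
  obtain ⟨V, C₂, hV, hC₂0, hC₂⟩ := exists_approxFlow_error
    (contDiffAt_infty.1 (contDiffAt_ephField hG hL) 1) hA
  obtain ⟨K, hK0, hK⟩ := exists_eventually_norm_sub_le hG.div_smooth
  obtain ⟨ρ, hρ, hball⟩ := Metric.eventually_nhds_iff_ball.1 hK
  set Y₀ : FlatState E := (0, p, z) with hY₀
  have t1 : Tendsto (fun u : (ℝ × FlatState E) × E => u.1) (𝓝 ((0, Y₀), Ξ Y₀)) (𝓝 (0, Y₀)) :=
    continuous_fst.tendsto _
  have th : Tendsto (fun u : (ℝ × FlatState E) × E => u.1.1) (𝓝 ((0, Y₀), Ξ Y₀)) (𝓝 0) :=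
    (continuous_fst.tendsto _).comp t1
  have hNself : ∀ᶠ x in 𝓝 (0 : E), N (x, x) = 0 := by
    have h1 : Tendsto (fun x : E => (x, (0 : E))) (𝓝 0) (𝓝 (0, 0)) :=
      (Continuous.prodMk_left (0 : E)).tendsto 0
    filter_upwards [h1.eventually hG.div_mul, hG.mul_zero] with x e1 e2
    simpa only [e2] using e1
  have hΦx : Tendsto (fun u : (ℝ × FlatState E) × E => (Φ u.1).1) (𝓝 ((0, Y₀), Ξ Y₀)) (𝓝 0) :=
    ((continuous_snd.tendsto _).comp hA.tendsto_fst).comp t1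
  have hlim : Tendsto (fun u : (ℝ × FlatState E) × E => (C₁ + C₂) * u.1.1 ^ (r + 1))
      (𝓝 ((0, Y₀), Ξ Y₀)) (𝓝 0) := by
    simpa using (th.pow (r + 1)).const_mul (C₁ + C₂)
  refine ⟨{Y | Y ∈ V ∧ N (Y.1, Y.1) = 0}, (K + 1) * (C₁ + C₂), ?_, by positivity, ?_⟩
  · have h1 : Tendsto (fun Y : FlatState E => Y.1) (𝓝 Y₀) (𝓝 0) := continuous_fst.tendsto _
    exact (eventually_mem_set.2 hV).and (h1.eventually hNself)
  filter_upwards [hC₁, t1.eventually hC₂, th.eventually (gt_mem_nhds one_pos),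
    hΦx.eventually (Metric.ball_mem_nhds _ (half_pos hρ)),
    hlim.eventually (gt_mem_nhds (half_pos hρ))]
    with u a1 a2 a3 a4 a5 hh hstep y hy0 hy
  obtain ⟨b1, b2, b3⟩ := a1 hh hstep
  have c0 := a2 hh y hy0 fun t ht => ⟨(hy t ht).1.1, (hy t ht).2⟩
  have hP : 0 ≤ u.1.1 ^ (r + 1) := by positivity
  have c1 : ‖y u.1.1 - Φ u.1‖ ≤ C₂ * u.1.1 ^ (r + 1) :=
    c0.trans (mul_le_mul_of_nonneg_left (pow_le_pow_of_le_one hh.le a3.le (Nat.le_succ _)) hC₂0)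
  have cx : ‖(y u.1.1).1 - (Φ u.1).1‖ ≤ C₂ * u.1.1 ^ (r + 1) :=
    (norm_fst_le (y u.1.1 - Φ u.1)).trans c1
  have cp : ‖(y u.1.1).2.1 - (Φ u.1).2.1‖ ≤ C₂ * u.1.1 ^ (r + 1) :=
    ((norm_fst_le (y u.1.1 - Φ u.1).2).trans (norm_snd_le (y u.1.1 - Φ u.1))).trans c1
  have cz : |(y u.1.1).2.2 - (Φ u.1).2.2| ≤ C₂ * u.1.1 ^ (r + 1) :=
    ((norm_snd_le (y u.1.1 - Φ u.1).2).trans (norm_snd_le (y u.1.1 - Φ u.1))).trans c1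
  have d1 : ‖m (u.1.2.1, u.1.1 • u.2) - (y u.1.1).1‖ ≤ (C₁ + C₂) * u.1.1 ^ (r + 1) := by
    rw [add_mul]
    rw [norm_sub_rev] at cx
    exact (norm_sub_le_norm_sub_add_norm_sub _ _ _).trans (add_le_add b1 cx)
  have hKC : (C₁ + C₂) * u.1.1 ^ (r + 1) ≤ (K + 1) * (C₁ + C₂) * u.1.1 ^ (r + 1) := by
    refine mul_le_mul_of_nonneg_right ?_ hP
    nlinarith [mul_nonneg hK0 (add_nonneg hC₁0 hC₂0)]
  refine ⟨?_, ?_, ?_⟩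
  · have e1 : N ((y u.1.1).1, (y u.1.1).1) = 0 := (hy u.1.1 ⟨hh.le, le_rfl⟩).1.2
    have e2 : ‖(Φ u.1).1‖ < ρ / 2 := by simpa using a4
    have e3 : ‖(y u.1.1).1‖ < ρ := by
      have := norm_le_norm_add_norm_sub' (y u.1.1).1 (Φ u.1).1
      have : C₂ * u.1.1 ^ (r + 1) ≤ (C₁ + C₂) * u.1.1 ^ (r + 1) :=
        mul_le_mul_of_nonneg_right (by linarith) hP
      linarith
    have e4 : ‖m (u.1.2.1, u.1.1 • u.2)‖ < ρ := by
      have := norm_le_norm_add_norm_sub' (m (u.1.2.1, u.1.1 • u.2)) (Φ u.1).1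
      have : C₁ * u.1.1 ^ (r + 1) ≤ (C₁ + C₂) * u.1.1 ^ (r + 1) :=
        mul_le_mul_of_nonneg_right (by linarith) hP
      linarith
    have e5 := hball (((y u.1.1).1, m (u.1.2.1, u.1.1 • u.2)), ((y u.1.1).1, (y u.1.1).1)) (by
      simp only [Metric.mem_ball, Prod.dist_eq, dist_zero_right]
      simp [e3, e4])
    rw [e1, sub_zero] at e5
    refine e5.trans ?_
    have e6 : ‖(((y u.1.1).1, m (u.1.2.1, u.1.1 • u.2)) : E × E) - ((y u.1.1).1, (y u.1.1).1)‖ =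
        ‖m (u.1.2.1, u.1.1 • u.2) - (y u.1.1).1‖ := by simp [Prod.norm_def]
    rw [e6]
    calc _ ≤ K * ((C₁ + C₂) * u.1.1 ^ (r + 1)) := by gcongr
      _ ≤ (K + 1) * (C₁ + C₂) * u.1.1 ^ (r + 1) := by
        rw [← mul_assoc]
        exact mul_le_mul_of_nonneg_right
          (mul_le_mul_of_nonneg_right (by linarith) (by positivity)) hP
  · refine le_trans ?_ hKC
    rw [add_mul]
    rw [norm_sub_rev] at cp
    exact (norm_sub_le_norm_sub_add_norm_sub _ _ _).trans (add_le_add b2 cp)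
  · refine le_trans ?_ hKC
    rw [add_mul]
    rw [abs_sub_comm] at cz
    exact (abs_sub_le _ _ _).trans (add_le_add b3 cz)

/-- Near a base point: `ℓ` vanishes for `h = 0`, and its derivative in `h` is the Lagrangian. -/
lemma eventually_lagrangian_of_agrees [FiniteDimensional ℝ E] (hG : IsLocalGroup m N br)
    (hL : IsLegendre Lf Ξ (0, p, z)) (hr : 0 < r)
    (hℓ : ContDiffAt ℝ ∞ ℓ (0, velPt Ξ (0, p, z))) (hag : FlatAgrees m N br Lf Ξ ℓ (0, p, z) r) :
    ∀ᶠ w in 𝓝 (velPt Ξ (0, p, z)), ℓ (0, w) = 0 ∧ hadamard ℓ (0, w) = Lf w := by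
  obtain ⟨Φ, σ, ζ, e, hA, hζ, hζ0, hX, he⟩ := exists_approxFlow_defect hG hL hℓ hag
  exact (eventually_lagrangian_zero hL hA hζ0 he).and
    (eventually_hadamard_lagrangian hL hr (Nat.succ_pos r) hℓ hA hζ hζ0 he)

end FlatError

/-! ### A retraction as a chart of the group -/

lemma eventually_contMDiffAt {E F M M' : Type*} [NormedAddCommGroup E] [NormedSpace ℝ E]
    [NormedAddCommGroup F] [NormedSpace ℝ F] [TopologicalSpace M] [ChartedSpace E M]
    [IsManifold 𝓘(ℝ, E) ∞ M] [TopologicalSpace M'] [ChartedSpace F M'] [IsManifold 𝓘(ℝ, F) ∞ M']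
    {f : M → M'} {x : M} (hf : ContMDiffAt 𝓘(ℝ, E) 𝓘(ℝ, F) ∞ f x) (n : ℕ) :
    ∀ᶠ y in 𝓝 x, ContMDiffAt 𝓘(ℝ, E) 𝓘(ℝ, F) n f y := by
  have hn : (n : WithTop ℕ∞) ≤ ∞ := by exact_mod_cast le_top
  have h1 : IsManifold 𝓘(ℝ, E) n M := IsManifold.of_le hn
  have h2 : IsManifold 𝓘(ℝ, F) n M' := IsManifold.of_le hn
  exact (contMDiffAt_iff_contMDiffAt_nhds (by simp)).1 (hf.of_le hn)

section GroupChart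

variable {E : Type*} [NormedAddCommGroup E] [NormedSpace ℝ E]
  {G : Type*} [TopologicalSpace G] [ChartedSpace E G] [Group G]

/-- `Rinv` is a smooth local inverse of the retraction `R`: a chart of the group centred at `1`. -/
structure IsGroupChart (R : E → G) (Rinv : G → E) : Prop where
  map_zero : R 0 = 1
  smooth : ContMDiffAt 𝓘(ℝ, E) 𝓘(ℝ, E) ∞ R 0
  smooth_inv : ContMDiffAt 𝓘(ℝ, E) 𝓘(ℝ, E) ∞ Rinv 1
  deriv_zero : HasMFDerivAt 𝓘(ℝ, E) 𝓘(ℝ, E) R 0 (ContinuousLinearMap.id ℝ E)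
  left_inv : ∀ᶠ x in 𝓝 (0 : E), Rinv (R x) = x
  right_inv : ∀ᶠ g in 𝓝 (1 : G), R (Rinv g) = g

lemma IsRetraction.exists_chart [CompleteSpace E] [IsManifold 𝓘(ℝ, E) ∞ G] {R : E → G}
    (hR : IsRetraction R) : ∃ Rinv : G → E, IsGroupChart R Rinv := by
  obtain ⟨U, hU, hs⟩ := hR.smooth
  have hR0 : ContMDiffAt 𝓘(ℝ, E) 𝓘(ℝ, E) ∞ R 0 := hs.contMDiffAt hU
  set φ := extChartAt 𝓘(ℝ, E) (1 : G) with hφ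
  have hφs : ContMDiffAt 𝓘(ℝ, E) 𝓘(ℝ, E) ∞ φ (R 0) := by
    rw [hR.map_zero]; exact contMDiffAt_extChartAt
  have hf : ContDiffAt ℝ ∞ (φ ∘ R) 0 := (hφs.comp 0 hR0).contDiffAt
  have hf' : HasFDerivAt (φ ∘ R) ((ContinuousLinearEquiv.refl ℝ E : E ≃L[ℝ] E) : E →L[ℝ] E) 0 := by
    have := hR.deriv_zero.2
    simp only [writtenInExtChartAt, hR.map_zero, mfld_simps] at this
    exact hasFDerivWithinAt_univ.1 this
  let f := hf.toOpenPartialHomeomorph (φ ∘ R) hf' (by simp)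
  have h0 : (0 : E) ∈ f.source := hf.mem_toOpenPartialHomeomorph_source hf' (by simp)
  have hf0 : f 0 = φ 1 := congrArg φ hR.map_zero
  have hφ1 : ContMDiffAt 𝓘(ℝ, E) 𝓘(ℝ, E) ∞ φ 1 := contMDiffAt_extChartAt
  have hsymm : ContDiffAt ℝ ∞ f.symm (φ 1) := by
    have := hf.to_localInverse hf' (by simp)
    rwa [Function.comp_apply, hR.map_zero] at this
  have hsm : ContMDiffAt 𝓘(ℝ, E) 𝓘(ℝ, E) ∞ (f.symm ∘ φ) 1 := hsymm.contMDiffAt.comp 1 hφ1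
  have hval : (f.symm ∘ φ) 1 = 0 := by
    show f.symm (φ 1) = 0
    rw [← hf0, f.left_inv h0]
  refine ⟨f.symm ∘ φ, hR.map_zero, hR0, hsm, hR.deriv_zero, ?_, ?_⟩
  · filter_upwards [f.open_source.mem_nhds h0] with x hx
    exact f.left_inv hx
  · have h1 : ∀ᶠ g in 𝓝 (1 : G), φ g ∈ f.target := by
      refine hφ1.continuousAt.eventually (f.open_target.mem_nhds ?_)
      rw [← hf0]; exact f.map_source h0
    have h2 : ContinuousAt (R ∘ (f.symm ∘ φ)) 1 :=
      ContinuousAt.comp (by rw [hval]; exact hR0.continuousAt) hsm.continuousAt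
    have h3 : ∀ᶠ g in 𝓝 (1 : G), (R ∘ (f.symm ∘ φ)) g ∈ φ.source := by
      refine h2.eventually (IsOpen.mem_nhds (isOpen_extChartAt_source _) ?_)
      rw [Function.comp_apply, hval, hR.map_zero]
      exact mem_extChartAt_source _
    filter_upwards [h1, h3, extChartAt_source_mem_nhds (I := 𝓘(ℝ, E)) (1 : G)] with g g1 g2 g3
    exact φ.injOn g2 g3 (f.right_inv g1)

namespace IsGroupChart

variable {R : E → G} {Rinv : G → E} (hc : IsGroupChart R Rinv)
include hc

lemma inv_one : Rinv 1 = 0 := by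
  have := hc.left_inv.self_of_nhds
  rwa [hc.map_zero] at this

lemma tendsto : Tendsto R (𝓝 0) (𝓝 1) := by
  have := hc.smooth.continuousAt.tendsto
  rwa [hc.map_zero] at this

lemma tendsto_inv : Tendsto Rinv (𝓝 1) (𝓝 0) := by
  have := hc.smooth_inv.continuousAt.tendsto
  rwa [hc.inv_one] at this

lemma hasMFDerivAt_inv [IsManifold 𝓘(ℝ, E) ∞ G] :
    HasMFDerivAt 𝓘(ℝ, E) 𝓘(ℝ, E) Rinv 1 (ContinuousLinearMap.id ℝ E) := by
  obtain ⟨B, h1⟩ : ∃ B : E →L[ℝ] E, HasMFDerivAt 𝓘(ℝ, E) 𝓘(ℝ, E) Rinv 1 B :=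
    ⟨_, (hc.smooth_inv.mdifferentiableAt (by simp)).hasMFDerivAt⟩
  have h2 : HasMFDerivAt 𝓘(ℝ, E) 𝓘(ℝ, E) (Rinv ∘ R) 0 (B.comp (ContinuousLinearMap.id ℝ E)) :=
    HasMFDerivAt.comp (0 : E) (g := Rinv) (g' := B) (by rw [hc.map_zero]; exact h1) hc.deriv_zero
  have h3 : HasFDerivAt (Rinv ∘ R) (ContinuousLinearMap.id ℝ E) 0 :=
    (hasFDerivAt_id (0 : E)).congr_of_eventuallyEq hc.left_inv
  have h4 : HasFDerivAt (Rinv ∘ R) (B.comp (ContinuousLinearMap.id ℝ E)) 0 :=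
    hasMFDerivAt_iff_hasFDerivAt.1 h2
  have h5 := h4.unique h3
  rw [ContinuousLinearMap.comp_id] at h5
  rwa [h5] at h1

/-- Differentials at `1` may be computed in the chart. -/
lemma hasMFDerivAt_one_iff [IsManifold 𝓘(ℝ, E) ∞ G] {F : Type*} [NormedAddCommGroup F]
    [NormedSpace ℝ F] {f : G → F} {f' : E →L[ℝ] F} :
    HasMFDerivAt 𝓘(ℝ, E) 𝓘(ℝ, F) f 1 f' ↔ HasFDerivAt (fun x => f (R x)) f' 0 := by
  constructor
  · intro h
    have h2 : HasMFDerivAt 𝓘(ℝ, E) 𝓘(ℝ, F) (f ∘ R) 0 _ :=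
      HasMFDerivAt.comp (0 : E) (g := f) (g' := f') (by rw [hc.map_zero]; exact h) hc.deriv_zero
    exact hasMFDerivAt_iff_hasFDerivAt.1 h2
  · intro h
    have h2 : HasMFDerivAt 𝓘(ℝ, E) 𝓘(ℝ, F) ((fun x => f (R x)) ∘ Rinv) 1 _ :=
      HasMFDerivAt.comp (1 : G) (g := fun x => f (R x)) (g' := f')
        (by rw [hc.inv_one]; exact hasMFDerivAt_iff_hasFDerivAt.2 h) hc.hasMFDerivAt_inv
    exact h2.congr_of_eventuallyEq (hc.right_inv.mono fun g hg => by
      show f g = f (R (Rinv g)); rw [hg])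

lemma smooth_fst : ContMDiffAt 𝓘(ℝ, E × E) 𝓘(ℝ, E) ∞ (fun q : E × E => R q.1) (0, 0) :=
  ContMDiffAt.comp (x := ((0 : E), (0 : E))) (g := R) hc.smooth
    (contDiffAt_fst.contMDiffAt)

lemma smooth_snd : ContMDiffAt 𝓘(ℝ, E × E) 𝓘(ℝ, E) ∞ (fun q : E × E => R q.2) (0, 0) :=
  ContMDiffAt.comp (x := ((0 : E), (0 : E))) (g := R) hc.smooth
    (contDiffAt_snd.contMDiffAt)

end IsGroupChart

/-- The group law in the chart `R`. -/
def chartMul (R : E → G) (Rinv : G → E) (q : E × E) : E := Rinv (R q.1 * R q.2)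

/-- The left division `(x, y) ↦ x⁻¹ y` in the chart `R`. -/
def chartDiv (R : E → G) (Rinv : G → E) (q : E × E) : E := Rinv ((R q.1)⁻¹ * R q.2)

/-- The Lie bracket of `G`, as the antisymmetric part of the second differential of the group law
in a chart. -/
def chartBracket (m : E × E → E) : E →L[ℝ] E →L[ℝ] E :=
  fderiv ℝ (leftD m) 0 - (fderiv ℝ (leftD m) 0).flip

lemma IsGroupChart.chartMul_zero {R : E → G} {Rinv : G → E} (hc : IsGroupChart R Rinv) :
    ∀ᶠ x in 𝓝 (0 : E), chartMul R Rinv (x, 0) = x :=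
  hc.left_inv.mono fun x hx => by
    show Rinv (R x * R 0) = x
    rw [hc.map_zero, mul_one, hx]

section

variable [LieGroup 𝓘(ℝ, E) ∞ G] {R : E → G} {Rinv : G → E} (hc : IsGroupChart R Rinv)
include hc

lemma IsGroupChart.tendsto_mul : Tendsto (fun q : E × E => R q.1 * R q.2) (𝓝 (0, 0)) (𝓝 1) := by
  have : IsTopologicalGroup G := topologicalGroup_of_lieGroup 𝓘(ℝ, E) ∞
  have h := ((hc.tendsto.comp (continuous_fst.tendsto ((0 : E), (0 : E)))).mul
    (hc.tendsto.comp (continuous_snd.tendsto ((0 : E), (0 : E)))))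
  simpa using h

lemma IsGroupChart.tendsto_div :
    Tendsto (fun q : E × E => (R q.1)⁻¹ * R q.2) (𝓝 (0, 0)) (𝓝 1) := by
  have : IsTopologicalGroup G := topologicalGroup_of_lieGroup 𝓘(ℝ, E) ∞
  have h := ((hc.tendsto.comp (continuous_fst.tendsto ((0 : E), (0 : E)))).inv.mul
    (hc.tendsto.comp (continuous_snd.tendsto ((0 : E), (0 : E)))))
  simpa using h

lemma IsGroupChart.contDiffAt_chartMul : ContDiffAt ℝ ∞ (chartMul R Rinv) (0, 0) := by
  have h := hc.smooth_fst.mul hc.smooth_snd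
  exact (ContMDiffAt.comp (x := ((0 : E), (0 : E))) (g := Rinv)
    (by simpa [hc.map_zero] using hc.smooth_inv) h).contDiffAt

lemma IsGroupChart.contDiffAt_chartDiv : ContDiffAt ℝ ∞ (chartDiv R Rinv) (0, 0) := by
  have h := hc.smooth_fst.inv.mul hc.smooth_snd
  exact (ContMDiffAt.comp (x := ((0 : E), (0 : E))) (g := Rinv)
    (by simpa [hc.map_zero] using hc.smooth_inv) h).contDiffAt

lemma IsGroupChart.eventually_map_mul :
    ∀ᶠ q in 𝓝 ((0 : E), (0 : E)), R (chartMul R Rinv q) = R q.1 * R q.2 :=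
  hc.tendsto_mul.eventually hc.right_inv

lemma IsGroupChart.eventually_map_div :
    ∀ᶠ q in 𝓝 ((0 : E), (0 : E)), R (chartDiv R Rinv q) = (R q.1)⁻¹ * R q.2 :=
  hc.tendsto_div.eventually hc.right_inv

/-- In the chart, left-invariant vector fields are `x ↦ leftD m x ξ`. -/
lemma IsGroupChart.eventually_mpullback [CompleteSpace E] : ∀ᶠ x in 𝓝 (0 : E), ∀ ξ : E,
    VectorField.mpullback 𝓘(ℝ, E) 𝓘(ℝ, E) R
      (mulInvariantVectorField (I := 𝓘(ℝ, E)) (G := G) ξ) x = leftD (chartMul R Rinv) x ξ := by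
  have hm := hc.contDiffAt_chartMul
  have hRd : ∀ᶠ x in 𝓝 (0 : E), MDifferentiableAt 𝓘(ℝ, E) 𝓘(ℝ, E) R x :=
    (eventually_contMDiffAt hc.smooth 1).mono
      fun x hx => hx.mdifferentiableAt one_ne_zero
  have hRid : ∀ᶠ g in 𝓝 (1 : G), MDifferentiableAt 𝓘(ℝ, E) 𝓘(ℝ, E) Rinv g :=
    (eventually_contMDiffAt hc.smooth_inv 1).mono
      fun x hx => hx.mdifferentiableAt one_ne_zero
  have hx0 : Tendsto (fun x : E => (x, (0 : E))) (𝓝 0) (𝓝 (0, 0)) :=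
    (Continuous.prodMk_left (0 : E)).tendsto 0
  have hprod : ∀ᶠ x in 𝓝 (0 : E), ∀ᶠ u in 𝓝 (0 : E), R (chartMul R Rinv (x, u)) = R x * R u := by
    have := hc.eventually_map_mul
    rw [nhds_prod_eq] at this
    exact this.curry
  filter_upwards [hRd, hc.tendsto.eventually hRid, hc.left_inv.eventually_nhds,
    hc.tendsto.eventually hc.right_inv.eventually_nhds, hprod,
    hx0.eventually (eventually_differentiableAt hm)] with x h1 h2 h3 h4 h5 h6 ξ
  have hleft : Rinv (R x) = x := h3.self_of_nhds
  have hinv : (mfderiv 𝓘(ℝ, E) 𝓘(ℝ, E) R x).IsInvertible := by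
    have e1 : HasMFDerivAt 𝓘(ℝ, E) 𝓘(ℝ, E) (Rinv ∘ R) x _ :=
      HasMFDerivAt.comp x h2.hasMFDerivAt h1.hasMFDerivAt
    have e2 : HasMFDerivAt 𝓘(ℝ, E) 𝓘(ℝ, E) (R ∘ Rinv) (R x) _ :=
      HasMFDerivAt.comp (R x) (g := R) (g' := mfderiv 𝓘(ℝ, E) 𝓘(ℝ, E) R x)
        (by rw [hleft]; exact h1.hasMFDerivAt) h2.hasMFDerivAt
    have e3 := hasMFDerivAt_unique e1 ((hasMFDerivAt_id x).congr_of_eventuallyEq h3)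
    have e4 := hasMFDerivAt_unique e2 ((hasMFDerivAt_id (R x)).congr_of_eventuallyEq h4)
    exact ContinuousLinearMap.IsInvertible.of_inverse (g := mfderiv 𝓘(ℝ, E) 𝓘(ℝ, E) Rinv (R x))
      e4 e3
  rw [VectorField.mpullback_apply]
  refine hinv.inverse_apply_eq.2 ?_
  have hm0 : chartMul R Rinv (x, 0) = x := by
    show Rinv (R x * R 0) = x
    rw [hc.map_zero, mul_one, hleft]
  have d1 : HasFDerivAt (fun u => chartMul R Rinv (x, u)) (leftD (chartMul R Rinv) x) 0 :=
    HasFDerivAt.comp (g := chartMul R Rinv) 0 h6.hasFDerivAt (hasFDerivAt_prodMk_right x 0)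
  have d2 : HasMFDerivAt 𝓘(ℝ, E) 𝓘(ℝ, E) (R ∘ fun u => chartMul R Rinv (x, u)) 0 _ :=
    HasMFDerivAt.comp (0 : E) (g := R) (g' := mfderiv 𝓘(ℝ, E) 𝓘(ℝ, E) R x)
      (by rw [hm0]; exact h1.hasMFDerivAt) (hasMFDerivAt_iff_hasFDerivAt.2 d1)
  have d3 : HasMFDerivAt 𝓘(ℝ, E) 𝓘(ℝ, E) ((fun g => R x * g) ∘ R) 0 _ :=
    HasMFDerivAt.comp (0 : E) (g := fun g => R x * g)
      (g' := mfderiv 𝓘(ℝ, E) 𝓘(ℝ, E) (fun g => R x * g) 1) (by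
        rw [hc.map_zero]
        exact ((contMDiff_mul_left (I := 𝓘(ℝ, E)) (n := ∞) (a := R x)).mdifferentiableAt
          (by simp)).hasMFDerivAt) hc.deriv_zero
  have d4 := hasMFDerivAt_unique d3 (d2.congr_of_eventuallyEq (h5.mono fun u hu => hu.symm))
  exact congrArg (fun S : E →L[ℝ] E => S ξ) d4

lemma IsGroupChart.eventually_bracket [CompleteSpace E] : ∀ᶠ x in 𝓝 (0 : E), ∀ ξ η : E,
    leftD (chartMul R Rinv) x (bracket G ξ η) =
      fderiv ℝ (leftD (chartMul R Rinv)) x (leftD (chartMul R Rinv) x ξ) η -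
        fderiv ℝ (leftD (chartMul R Rinv)) x (leftD (chartMul R Rinv) x η) ξ := by
  have hG3 : LieGroup 𝓘(ℝ, E) (minSmoothness ℝ 3) G := LieGroup.of_le (n := ∞) (by
    rw [minSmoothness_of_isRCLikeNormedField]
    exact ENat.LEInfty.out)
  have hs2 : ∀ᶠ x in 𝓝 (0 : E), ContMDiffAt 𝓘(ℝ, E) 𝓘(ℝ, E) 2 R x :=
    eventually_contMDiffAt hc.smooth 2
  have hM : ContDiffAt ℝ ∞ (leftD (chartMul R Rinv)) 0 := by
    have h : ContDiffAt ℝ ∞ (fun x : E => fderiv ℝ (chartMul R Rinv) (x, 0)) 0 :=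
      ContDiffAt.comp (0 : E) (g := fderiv ℝ (chartMul R Rinv)) (f := fun x : E => (x, (0 : E)))
        (contDiffAt_fderiv hc.contDiffAt_chartMul) (by fun_prop)
    exact h.clm_comp contDiffAt_const
  filter_upwards [hc.eventually_mpullback, hc.eventually_mpullback.eventually_nhds, hs2,
    eventually_differentiableAt hM] with x h1 h2 h3 h4 ξ η
  have e1 := VectorField.mpullback_mlieBracket (f := R) (x₀ := x)
    (mdifferentiableAt_mulInvariantVectorField (I := 𝓘(ℝ, E)) (G := G) ξ)
    (mdifferentiableAt_mulInvariantVectorField (I := 𝓘(ℝ, E)) (G := G) η) h3 (by simp)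
  have e0 : mulInvariantVectorField (I := 𝓘(ℝ, E)) (G := G) (bracket (E := E) G ξ η) =
      VectorField.mlieBracket 𝓘(ℝ, E) (mulInvariantVectorField (I := 𝓘(ℝ, E)) (G := G) ξ)
        (mulInvariantVectorField (I := 𝓘(ℝ, E)) (G := G) η) :=
    mulInvariantVector_mlieBracket (I := 𝓘(ℝ, E)) (G := G) ξ η
  have e2 := h1 (bracket G ξ η)
  rw [← e2]
  refine ((congrArg (fun V => VectorField.mpullback 𝓘(ℝ, E) 𝓘(ℝ, E) R V x) e0).trans e1).trans ?_
  have hbr : VectorField.mlieBracket 𝓘(ℝ, E)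
      (VectorField.mpullback 𝓘(ℝ, E) 𝓘(ℝ, E) R (mulInvariantVectorField (I := 𝓘(ℝ, E)) (G := G) ξ))
      (VectorField.mpullback 𝓘(ℝ, E) 𝓘(ℝ, E) R
        (mulInvariantVectorField (I := 𝓘(ℝ, E)) (G := G) η)) x
      = VectorField.lieBracket ℝ (fun x => leftD (chartMul R Rinv) x ξ)
        (fun x => leftD (chartMul R Rinv) x η) x := by
    rw [← VectorField.mlieBracketWithin_univ, VectorField.mlieBracketWithin_eq_lieBracketWithin]
    refine (Filter.EventuallyEq.lieBracketWithin_vectorField_eq_nhds (h2.mono fun y hy => hy ξ)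
      (h2.mono fun y hy => hy η)).trans ?_
    exact congrFun VectorField.lieBracketWithin_univ x
  refine hbr.trans ?_
  have d : ∀ ξ, HasFDerivAt (fun x => leftD (chartMul R Rinv) x ξ)
      ((fderiv ℝ (leftD (chartMul R Rinv)) x).flip ξ) x := by
    intro ξ
    convert! h4.hasFDerivAt.clm_apply (hasFDerivAt_const ξ x) using 1
    ext; simp
  rw [VectorField.lieBracket, (d ξ).fderiv, (d η).fderiv]
  rfl

lemma IsGroupChart.bracket_eq [CompleteSpace E] (ξ η : E) :
    bracket G ξ η = chartBracket (chartMul R Rinv) ξ η := by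
  have h0 : leftD (chartMul R Rinv) 0 = ContinuousLinearMap.id ℝ E := by
    have h1 : HasFDerivAt (fun u => chartMul R Rinv (0, u)) (leftD (chartMul R Rinv) 0) 0 :=
      HasFDerivAt.comp (g := chartMul R Rinv) 0
        (hc.contDiffAt_chartMul.differentiableAt (by simp)).hasFDerivAt
        (hasFDerivAt_prodMk_right (0 : E) 0)
    refine h1.unique ((hasFDerivAt_id (0 : E)).congr_of_eventuallyEq
      (hc.left_inv.mono fun x hx => ?_))
    show Rinv (R 0 * R x) = x
    rw [hc.map_zero, one_mul, hx]
  have := hc.eventually_bracket.self_of_nhds ξ η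
  simpa [h0, chartBracket] using this

/-- The chart `R` makes `G` a local group on a neighbourhood of `0`. -/
lemma IsGroupChart.isLocalGroup [CompleteSpace E] :
    IsLocalGroup (chartMul R Rinv) (chartDiv R Rinv) (chartBracket (chartMul R Rinv)) where
  mul_smooth := hc.contDiffAt_chartMul
  div_smooth := hc.contDiffAt_chartDiv
  mul_zero := hc.chartMul_zero
  zero_mul := hc.left_inv.mono fun x hx => by
    show Rinv (R 0 * R x) = x
    rw [hc.map_zero, one_mul, hx]
  mul_div := by
    have h2 : Tendsto (fun q : E × E => q.2) (𝓝 (0, 0)) (𝓝 0) := continuous_snd.tendsto _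
    filter_upwards [hc.eventually_map_div, h2.eventually hc.left_inv] with q h1 h2
    show Rinv (R q.1 * R (chartDiv R Rinv q)) = q.2
    rw [h1, mul_inv_cancel_left, h2]
  div_mul := by
    have h2 : Tendsto (fun q : E × E => q.2) (𝓝 (0, 0)) (𝓝 0) := continuous_snd.tendsto _
    filter_upwards [hc.eventually_map_mul, h2.eventually hc.left_inv] with q h1 h2
    show Rinv ((R q.1)⁻¹ * R (chartMul R Rinv q)) = q.2
    rw [h1, inv_mul_cancel_left, h2]
  assoc := by
    have t1 : Tendsto (fun q : E × E × E => (q.1, q.2.1)) (𝓝 (0, 0, 0)) (𝓝 (0, 0)) := by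
      have : Continuous (fun q : E × E × E => (q.1, q.2.1)) := by fun_prop
      exact this.tendsto _
    have t2 : Tendsto (fun q : E × E × E => q.2) (𝓝 (0, 0, 0)) (𝓝 (0, 0)) :=
      continuous_snd.tendsto _
    filter_upwards [t1.eventually hc.eventually_map_mul, t2.eventually hc.eventually_map_mul]
      with q h1 h2
    show Rinv (R (chartMul R Rinv (q.1, q.2.1)) * R q.2.2) =
      Rinv (R q.1 * R (chartMul R Rinv (q.2.1, q.2.2)))
    rw [h1, h2, mul_assoc]
  bracket_eq := hc.eventually_bracket.mono fun x hx ξ η => by rw [← hc.bracket_eq, hx]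

end

end GroupChart

/-! ### The Euler--Poincaré--Herglotz equations in a chart -/

section Velocity

variable {E : Type*} [NormedAddCommGroup E] [NormedSpace ℝ E]
  {G : Type*} [TopologicalSpace G] [ChartedSpace E G] [Group G]

/-- `vel` is the inverse Legendre transform: the velocity as a function of the phase state. -/
structure IsVelocity (L : G → E → ℝ → ℝ) (vel : State E G → E) : Prop where
  smooth : ContMDiff (𝓘(ℝ, E).prod (𝓘(ℝ, E →L[ℝ] ℝ).prod 𝓘(ℝ, ℝ))) 𝓘(ℝ, E) ∞ vel
  momentum_vel : ∀ y, momentum L y.1 (vel y) y.2.2 = y.2.1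
  vel_momentum : ∀ g ξ z, vel (g, momentum L g ξ z, z) = ξ

omit [Group G] in
lemma IsHyperregular.exists_velocity {L : G → E → ℝ → ℝ} (hreg : IsHyperregular L) :
    ∃ vel : State E G → E, IsVelocity L vel := by
  obtain ⟨Φ, hΦ⟩ := hreg
  refine ⟨fun y => (Φ.symm y).2.1, ?_, fun y => ?_, fun g ξ z => ?_⟩
  · exact (contMDiff_fst.comp contMDiff_snd).comp Φ.symm.contMDiff
  · have h := hΦ (Φ.symm y)
    rw [Φ.apply_symm_apply] at h
    have h1 : y.1 = (Φ.symm y).1 := congrArg (fun y => y.1) h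
    have h2 : y.2.1 = _ := congrArg (fun y => y.2.1) h
    have h3 : y.2.2 = (Φ.symm y).2.2 := congrArg (fun y => y.2.2) h
    rw [h1, h3, h2]
  · have h := hΦ (g, ξ, z)
    have h2 : Φ.symm (g, momentum L g ξ z, z) = (g, ξ, z) := by
      rw [← h, Φ.symm_apply_apply]
    show (Φ.symm (g, momentum L g ξ z, z)).2.1 = ξ
    rw [h2]

/-- The Lagrangian in the chart `x ↦ a R(x)`. -/
def chartLagrangian (R : E → G) (L : G → E → ℝ → ℝ) (a : G) (w : E × E × ℝ) : ℝ :=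
  L (a * R w.1) w.2.1 w.2.2

/-- The parametrization of phase space by the chart `x ↦ a R(x)`. -/
def ofChart (R : E → G) (a : G) (Y : FlatState E) : State E G := (a * R Y.1, Y.2.1, Y.2.2)

/-- The coordinates of a phase state in the chart `x ↦ a R(x)`. -/
def toChart (Rinv : G → E) (a : G) (y : State E G) : FlatState E := (Rinv (a⁻¹ * y.1), y.2.1, y.2.2)

/-- The inverse Legendre transform in the chart `x ↦ a R(x)`. -/
def chartVel (R : E → G) (vel : State E G → E) (a : G) (Y : FlatState E) : E := vel (ofChart R a Y)

variable [LieGroup 𝓘(ℝ, E) ∞ G] {R : E → G} {Rinv : G → E}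

lemma IsGroupChart.contMDiffAt_mul_left (hc : IsGroupChart R Rinv) (a : G) :
    ContMDiffAt 𝓘(ℝ, E) 𝓘(ℝ, E) ∞ (fun x => a * R x) 0 :=
  ContMDiffAt.comp (0 : E) (g := fun g => a * g) contMDiff_mul_left.contMDiffAt hc.smooth

lemma IsGroupChart.contDiffAt_chartLagrangian (hc : IsGroupChart R Rinv) {L : G → E → ℝ → ℝ}
    (hL : IsSmoothLagrangian L) (a : G) (ξ : E) (z : ℝ) :
    ContDiffAt ℝ ∞ (chartLagrangian R L a) (0, ξ, z) := by
  have h1 : ContMDiffAt 𝓘(ℝ, E × E × ℝ) 𝓘(ℝ, E) ∞ (fun w : E × E × ℝ => a * R w.1) (0, ξ, z) :=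
    ContMDiffAt.comp (x := ((0, ξ, z) : E × E × ℝ)) (g := fun x => a * R x)
      (hc.contMDiffAt_mul_left a) contDiffAt_fst.contMDiffAt
  have h2 : ContMDiffAt 𝓘(ℝ, E × E × ℝ) 𝓘(ℝ, E) ∞ (fun w : E × E × ℝ => w.2.1) (0, ξ, z) :=
    ContDiffAt.contMDiffAt (by fun_prop)
  have h3 : ContMDiffAt 𝓘(ℝ, E × E × ℝ) 𝓘(ℝ, ℝ) ∞ (fun w : E × E × ℝ => w.2.2) (0, ξ, z) :=
    ContDiffAt.contMDiffAt (by fun_prop)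
  exact (ContMDiffAt.comp (x := ((0, ξ, z) : E × E × ℝ))
    (g := fun x : G × E × ℝ => L x.1 x.2.1 x.2.2) hL.contMDiffAt
    (h1.prodMk (h2.prodMk h3))).contDiffAt

lemma IsGroupChart.contMDiffAt_ofChart (hc : IsGroupChart R Rinv) (a : G) (p : E →L[ℝ] ℝ) (z : ℝ) :
    ContMDiffAt 𝓘(ℝ, FlatState E) (𝓘(ℝ, E).prod (𝓘(ℝ, E →L[ℝ] ℝ).prod 𝓘(ℝ, ℝ))) ∞ (ofChart R a)
      (0, p, z) := by
  have h1 : ContMDiffAt 𝓘(ℝ, FlatState E) 𝓘(ℝ, E) ∞ (fun w : FlatState E => a * R w.1) (0, p, z) :=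
    ContMDiffAt.comp (x := ((0, p, z) : FlatState E)) (g := fun x => a * R x)
      (hc.contMDiffAt_mul_left a) contDiffAt_fst.contMDiffAt
  have h2 : ContMDiffAt 𝓘(ℝ, FlatState E) 𝓘(ℝ, E →L[ℝ] ℝ) ∞ (fun w : FlatState E => w.2.1)
      (0, p, z) := ContDiffAt.contMDiffAt (by fun_prop)
  have h3 : ContMDiffAt 𝓘(ℝ, FlatState E) 𝓘(ℝ, ℝ) ∞ (fun w : FlatState E => w.2.2) (0, p, z) :=
    ContDiffAt.contMDiffAt (by fun_prop)
  exact h1.prodMk (h2.prodMk h3)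

omit [LieGroup 𝓘(ℝ, E) ∞ G] in
lemma IsGroupChart.ofChart_zero (hc : IsGroupChart R Rinv) (a : G) (p : E →L[ℝ] ℝ) (z : ℝ) :
    ofChart R a (0, p, z) = (a, p, z) := by
  simp [ofChart, hc.map_zero]

lemma IsGroupChart.tendsto_ofChart (hc : IsGroupChart R Rinv) (a : G) (p : E →L[ℝ] ℝ) (z : ℝ) :
    Tendsto (ofChart R a) (𝓝 (0, p, z)) (𝓝 (a, p, z)) := by
  have := (hc.contMDiffAt_ofChart a p z).continuousAt.tendsto
  rwa [hc.ofChart_zero] at this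

lemma IsGroupChart.tendsto_toChart (hc : IsGroupChart R Rinv) (a : G) (p : E →L[ℝ] ℝ) (z : ℝ) :
    Tendsto (toChart Rinv a) (𝓝 (a, p, z)) (𝓝 (0, p, z)) := by
  have : IsTopologicalGroup G := topologicalGroup_of_lieGroup 𝓘(ℝ, E) ∞
  have h1 : Tendsto (fun y : State E G => a⁻¹ * y.1) (𝓝 (a, p, z)) (𝓝 1) := by
    have : Continuous (fun y : State E G => a⁻¹ * y.1) := by fun_prop
    simpa using this.tendsto (a, p, z)
  have h2 : Tendsto (fun y : State E G => y.2) (𝓝 (a, p, z)) (𝓝 (p, z)) := continuous_snd.tendsto _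
  exact (hc.tendsto_inv.comp h1).prodMk_nhds h2

lemma IsGroupChart.eventually_ofChart_toChart (hc : IsGroupChart R Rinv) (a : G) (p : E →L[ℝ] ℝ)
    (z : ℝ) : ∀ᶠ y in 𝓝 ((a, p, z) : State E G), ofChart R a (toChart Rinv a y) = y := by
  have : IsTopologicalGroup G := topologicalGroup_of_lieGroup 𝓘(ℝ, E) ∞
  have h1 : Tendsto (fun y : State E G => a⁻¹ * y.1) (𝓝 (a, p, z)) (𝓝 1) := by
    have : Continuous (fun y : State E G => a⁻¹ * y.1) := by fun_prop
    simpa using this.tendsto (a, p, z)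
  filter_upwards [h1.eventually hc.right_inv] with y hy
  simp [ofChart, toChart, hy]

/-- In a chart, the inverse Legendre transform is the velocity of the Lagrangian. -/
lemma IsVelocity.isLegendre (hc : IsGroupChart R Rinv) {L : G → E → ℝ → ℝ}
    (hL : IsSmoothLagrangian L) {vel : State E G → E} (hv : IsVelocity L vel) (a : G)
    (p : E →L[ℝ] ℝ) (z : ℝ) :
    IsLegendre (chartLagrangian R L a) (chartVel R vel a) (0, p, z) := by
  have hs : ContDiffAt ℝ ∞ (chartVel R vel a) (0, p, z) :=
    (ContMDiffAt.comp (x := ((0, p, z) : FlatState E)) (g := vel) hv.smooth.contMDiffAt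
      (hc.contMDiffAt_ofChart a p z)).contDiffAt
  have hLf := hc.contDiffAt_chartLagrangian hL a (chartVel R vel a (0, p, z)) z
  have hmom : ∀ᶠ w in 𝓝 ((0, chartVel R vel a (0, p, z), z) : E × E × ℝ),
      dV (fderiv ℝ (chartLagrangian R L a) w) = momentum L (a * R w.1) w.2.1 w.2.2 := by
    filter_upwards [eventually_differentiableAt hLf] with w hw
    have h1 : HasFDerivAt (fun η : E => ((w.1, η, w.2.2) : E × E × ℝ))
        ((ContinuousLinearMap.inr ℝ E (E × ℝ)).comp (ContinuousLinearMap.inl ℝ E ℝ)) w.2.1 :=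
      HasFDerivAt.comp (g := fun v : E × ℝ => (w.1, v)) w.2.1 (hasFDerivAt_prodMk_right w.1 _)
        (hasFDerivAt_prodMk_left w.2.1 w.2.2)
    have h2 : HasFDerivAt (fun η : E => L (a * R w.1) η w.2.2)
        (dV (fderiv ℝ (chartLagrangian R L a) w)) w.2.1 :=
      HasFDerivAt.comp (g := chartLagrangian R L a) w.2.1 hw.hasFDerivAt h1
    exact h2.fderiv.symm
  refine ⟨hLf, hs, ?_, ?_⟩
  · have t : Tendsto (velPt (chartVel R vel a)) (𝓝 (0, p, z))
        (𝓝 (0, chartVel R vel a (0, p, z), z)) :=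
      (continuousAt_fst.prodMk (hs.continuousAt.prodMk
        (continuous_snd.comp continuous_snd).continuousAt)).tendsto
    filter_upwards [t.eventually hmom] with Y hY
    rw [hY]
    exact hv.momentum_vel (ofChart R a Y)
  · filter_upwards [hmom] with w hw
    rw [hw]
    exact hv.vel_momentum _ _ _

/-- The differential of the chart `x ↦ a R(x)` maps left-invariant fields to left-invariant
fields. -/
lemma IsGroupChart.eventually_hasMFDerivAt_chart [CompleteSpace E] (hc : IsGroupChart R Rinv) :
    ∀ᶠ x in 𝓝 (0 : E), ∀ a : G, ∃ A : E →L[ℝ] E,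
      HasMFDerivAt 𝓘(ℝ, E) 𝓘(ℝ, E) (fun u => a * R u) x A ∧
        ∀ ξ, A (leftD (chartMul R Rinv) x ξ) = leftTranslate (a * R x) ξ := by
  have hRd : ∀ᶠ x in 𝓝 (0 : E), MDifferentiableAt 𝓘(ℝ, E) 𝓘(ℝ, E) R x :=
    (eventually_contMDiffAt hc.smooth 1).mono fun x hx => hx.mdifferentiableAt one_ne_zero
  have hprod : ∀ᶠ x in 𝓝 (0 : E), ∀ᶠ u in 𝓝 (0 : E), R (chartMul R Rinv (x, u)) = R x * R u := by
    have := hc.eventually_map_mul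
    rw [nhds_prod_eq] at this
    exact this.curry
  filter_upwards [hRd, hprod, hc.chartMul_zero,
    hc.isLocalGroup.eventually_hasFDerivAt_mul_right] with x h1 h2 h3 h4 a
  have hm : ∀ (b : G) (g : G), MDifferentiableAt 𝓘(ℝ, E) 𝓘(ℝ, E) (fun g => b * g) g := fun b g =>
    (contMDiff_mul_left (I := 𝓘(ℝ, E)) (n := ∞) (a := b)).mdifferentiableAt (by simp)
  obtain ⟨A, hA⟩ : ∃ A : E →L[ℝ] E, HasMFDerivAt 𝓘(ℝ, E) 𝓘(ℝ, E) (fun u => a * R u) x A :=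
    ⟨_, HasMFDerivAt.comp x (g := fun g => a * g) (hm a (R x)).hasMFDerivAt h1.hasMFDerivAt⟩
  refine ⟨A, hA, fun ξ => ?_⟩
  have d1 : HasMFDerivAt 𝓘(ℝ, E) 𝓘(ℝ, E) (fun u => chartMul R Rinv (x, u)) 0
      (leftD (E := E) (chartMul R Rinv) x) := hasMFDerivAt_iff_hasFDerivAt.2 h4
  have d2 : HasMFDerivAt 𝓘(ℝ, E) 𝓘(ℝ, E) ((fun u => a * R u) ∘ fun u => chartMul R Rinv (x, u))
      0 _ :=
    HasMFDerivAt.comp (0 : E) (g := fun u => a * R u) (g' := A)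
      (by rw [h3]; exact hA) d1
  have d3 : HasMFDerivAt 𝓘(ℝ, E) 𝓘(ℝ, E) ((fun g => a * R x * g) ∘ R) 0 _ :=
    HasMFDerivAt.comp (0 : E) (g := fun g => a * R x * g)
      (g' := mfderiv 𝓘(ℝ, E) 𝓘(ℝ, E) (fun g => a * R x * g) 1) (by
        rw [hc.map_zero]; exact (hm _ 1).hasMFDerivAt) hc.deriv_zero
  have d4 := hasMFDerivAt_unique d3 (d2.congr_of_eventuallyEq (h2.mono fun u hu => by
    show a * R x * R u = a * R (chartMul R Rinv (x, u))
    rw [hu, mul_assoc]))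
  exact (congrArg (fun S : E →L[ℝ] E => S ξ) d4).symm

lemma IsGroupChart.eventually_hasMFDerivAt_inv_chart [CompleteSpace E] (hc : IsGroupChart R Rinv) :
    ∀ᶠ x in 𝓝 (0 : E), ∀ a : G, ∃ B : E →L[ℝ] E,
      HasMFDerivAt 𝓘(ℝ, E) 𝓘(ℝ, E) (fun g => Rinv (a⁻¹ * g)) (a * R x) B ∧
        ∀ ξ, B (leftTranslate (a * R x) ξ) = leftD (chartMul R Rinv) x ξ := by
  have hRid : ∀ᶠ g in 𝓝 (1 : G), MDifferentiableAt 𝓘(ℝ, E) 𝓘(ℝ, E) Rinv g :=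
    (eventually_contMDiffAt hc.smooth_inv 1).mono fun x hx => hx.mdifferentiableAt one_ne_zero
  filter_upwards [hc.tendsto.eventually hRid, hc.left_inv.eventually_nhds,
    hc.eventually_hasMFDerivAt_chart] with x h1 h2 h3 a
  have hm : ∀ (b : G) (g : G), MDifferentiableAt 𝓘(ℝ, E) 𝓘(ℝ, E) (fun g => b * g) g := fun b g =>
    (contMDiff_mul_left (I := 𝓘(ℝ, E)) (n := ∞) (a := b)).mdifferentiableAt (by simp)
  obtain ⟨B, hB⟩ : ∃ B : E →L[ℝ] E,
      HasMFDerivAt 𝓘(ℝ, E) 𝓘(ℝ, E) (fun g => Rinv (a⁻¹ * g)) (a * R x) B :=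
    ⟨_, HasMFDerivAt.comp (a * R x) (g := Rinv) (g' := mfderiv 𝓘(ℝ, E) 𝓘(ℝ, E) Rinv (R x))
      (by rw [inv_mul_cancel_left]; exact h1.hasMFDerivAt) (hm a⁻¹ (a * R x)).hasMFDerivAt⟩
  obtain ⟨A, hA, hA'⟩ := h3 a
  refine ⟨B, hB, fun ξ => ?_⟩
  have d : HasMFDerivAt 𝓘(ℝ, E) 𝓘(ℝ, E) ((fun g => Rinv (a⁻¹ * g)) ∘ fun u => a * R u) x
      (B.comp A) := HasMFDerivAt.comp x hB hA
  have d1 : HasFDerivAt ((fun g => Rinv (a⁻¹ * g)) ∘ fun u => a * R u) (B.comp A) x :=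
    hasMFDerivAt_iff_hasFDerivAt.1 d
  have d2 := d1.unique ((hasFDerivAt_id x).congr_of_eventuallyEq (h2.mono fun u hu => by
    show Rinv (a⁻¹ * (a * R u)) = u
    rw [inv_mul_cancel_left, hu]))
  rw [← hA' ξ]
  exact congrArg (fun S : E →L[ℝ] E => S (leftD (chartMul R Rinv) x ξ)) d2

end Velocity

section Equations

variable {E : Type*} [NormedAddCommGroup E] [NormedSpace ℝ E]

lemma hasDerivWithinAt_dual [FiniteDimensional ℝ E] {P : ℝ → E →L[ℝ] ℝ} {P' : E →L[ℝ] ℝ}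
    {s : Set ℝ} {t : ℝ} (h : ∀ η, HasDerivWithinAt (fun s => P s η) (P' η) s t) :
    HasDerivWithinAt P P' s t := by
  let b := Module.finBasis ℝ E
  let e : (Fin (Module.finrank ℝ E) → ℝ) ≃L[ℝ] (E →L[ℝ] ℝ) :=
    ((b.constr ℝ).trans LinearMap.toContinuousLinearMap).toContinuousLinearEquiv
  have he : ∀ Q : E →L[ℝ] ℝ, e (fun i => Q (b i)) = Q := by
    intro Q
    refine ContinuousLinearMap.coe_injective (b.ext fun i => ?_)
    simp [e]
  have h1 : HasDerivWithinAt (fun s i => P s (b i)) (fun i => P' (b i)) s t :=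
    hasDerivWithinAt_pi.2 fun i => h (b i)
  have h2 := e.hasFDerivAt.comp_hasDerivWithinAt t h1
  have h3 : (e : (Fin (Module.finrank ℝ E) → ℝ) → E →L[ℝ] ℝ) ∘ (fun s i => P s (b i)) = P :=
    funext fun s => he (P s)
  rw [h3] at h2
  simpa [he] using h2

lemma hasDerivWithinAt_fst {F F' : Type*} [NormedAddCommGroup F] [NormedSpace ℝ F]
    [NormedAddCommGroup F'] [NormedSpace ℝ F'] {y : ℝ → F × F'} {v : F × F'} {s : Set ℝ} {t : ℝ}
    (h : HasDerivWithinAt y v s t) : HasDerivWithinAt (fun t => (y t).1) v.1 s t := by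
  simpa using h.hasFDerivWithinAt.fst.hasDerivWithinAt

lemma hasDerivWithinAt_snd {F F' : Type*} [NormedAddCommGroup F] [NormedSpace ℝ F]
    [NormedAddCommGroup F'] [NormedSpace ℝ F'] {y : ℝ → F × F'} {v : F × F'} {s : Set ℝ} {t : ℝ}
    (h : HasDerivWithinAt y v s t) : HasDerivWithinAt (fun t => (y t).2) v.2 s t := by
  simpa using h.hasFDerivWithinAt.snd.hasDerivWithinAt

variable {G : Type*} [TopologicalSpace G] [ChartedSpace E G] [Group G] [LieGroup 𝓘(ℝ, E) ∞ G]
  {R : E → G} {Rinv : G → E} {L : G → E → ℝ → ℝ} {vel : State E G → E}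

/-- The Euler--Poincaré--Herglotz vector field in the chart `x ↦ a R(x)`. -/
def chartField (R : E → G) (Rinv : G → E) (L : G → E → ℝ → ℝ) (vel : State E G → E) (a : G) :
    FlatState E → FlatState E :=
  ephField (chartMul R Rinv) (chartBracket (chartMul R Rinv)) (chartLagrangian R L a)
    (chartVel R vel a)

/-- The momentum component of the field is the right-hand side of the momentum equation. -/
lemma eventually_chartField_momentum [FiniteDimensional ℝ E] (hc : IsGroupChart R Rinv)
    (hL : IsSmoothLagrangian L) (hv : IsVelocity L vel) (a : G) (p : E →L[ℝ] ℝ) (z : ℝ) :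
    ∀ᶠ Y in 𝓝 ((0, p, z) : FlatState E), ∀ η : E,
      (chartField R Rinv L vel a Y).2.1 η =
        Y.2.1 (bracket G (chartVel R vel a Y) η) +
          leftDeriv (fun x => L x (chartVel R vel a Y) Y.2.2) (a * R Y.1) η +
          Y.2.1 η * deriv (fun s => L (a * R Y.1) (chartVel R vel a Y) s) Y.2.2 := by
  have hLeg := hv.isLegendre hc hL a p z
  have hx : Tendsto (fun Y : FlatState E => Y.1) (𝓝 (0, p, z)) (𝓝 0) := continuous_fst.tendsto _
  have hprod : ∀ᶠ x in 𝓝 (0 : E), ∀ᶠ u in 𝓝 (0 : E), R (chartMul R Rinv (x, u)) = R x * R u := by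
    have := hc.eventually_map_mul
    rw [nhds_prod_eq] at this
    exact this.curry
  filter_upwards [hLeg.contDiffAt_velPt.continuousAt.tendsto.eventually
    (eventually_differentiableAt hLeg.smooth_lagrangian), hx.eventually hprod,
    hx.eventually hc.chartMul_zero, hx.eventually hc.isLocalGroup.eventually_hasFDerivAt_mul_right]
    with Y h1 h2 h3 h4 η
  set ξ := chartVel R vel a Y with hξ
  set D := fderiv ℝ (chartLagrangian R L a) (velPt (chartVel R vel a) Y) with hD
  have e1 : leftDeriv (fun x => L x ξ Y.2.2) (a * R Y.1) =
      (dX D).comp (leftD (chartMul R Rinv) Y.1) := by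
    have d1 : HasFDerivAt (fun x : E => ((x, ξ, Y.2.2) : E × E × ℝ))
        (ContinuousLinearMap.inl ℝ E (E × ℝ)) Y.1 := hasFDerivAt_prodMk_left Y.1 (ξ, Y.2.2)
    have d2 : HasFDerivAt (fun x => chartLagrangian R L a (x, ξ, Y.2.2)) (dX D) Y.1 :=
      HasFDerivAt.comp (g := chartLagrangian R L a) Y.1 h1.hasFDerivAt d1
    have d3 : HasFDerivAt (fun u => chartLagrangian R L a (chartMul R Rinv (Y.1, u), ξ, Y.2.2))
        ((dX D).comp (leftD (chartMul R Rinv) Y.1)) 0 :=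
      HasFDerivAt.comp (g := fun x => chartLagrangian R L a (x, ξ, Y.2.2)) (0 : E) (g' := dX D)
        (by rw [h3]; exact d2) h4
    have d4 : HasFDerivAt (fun u => L (a * R Y.1 * R u) ξ Y.2.2)
        ((dX D).comp (leftD (chartMul R Rinv) Y.1)) 0 :=
      d3.congr_of_eventuallyEq (h2.mono fun u hu => by
        show L (a * R Y.1 * R u) ξ Y.2.2 = L (a * R (chartMul R Rinv (Y.1, u))) ξ Y.2.2
        rw [hu, mul_assoc])
    exact (hc.hasMFDerivAt_one_iff (f := fun g => L (a * R Y.1 * g) ξ Y.2.2).2 d4).mfderiv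
  have e2 : deriv (fun s => L (a * R Y.1) ξ s) Y.2.2 = dZ D := by
    have d1 : HasDerivAt (fun s : ℝ => ((Y.1, ξ, s) : E × E × ℝ)) (0, 0, 1) Y.2.2 :=
      (hasDerivAt_const _ _).prodMk ((hasDerivAt_const _ _).prodMk (hasDerivAt_id _))
    have d2 : HasDerivAt (fun s => L (a * R Y.1) ξ s) (D (0, 0, 1)) Y.2.2 :=
      HasFDerivAt.comp_hasDerivAt (l := chartLagrangian R L a) Y.2.2 h1.hasFDerivAt d1
    exact d2.deriv
  rw [e1, e2, hc.bracket_eq]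
  simp [chartField, ephField, ← hξ, ← hD]
  ring

/-- In the chart, Euler--Poincaré--Herglotz solutions are integral curves of `chartField`. -/
lemma eventually_hasDerivWithinAt_toChart [FiniteDimensional ℝ E] (hc : IsGroupChart R Rinv)
    (hL : IsSmoothLagrangian L) (hv : IsVelocity L vel) (a : G) (p : E →L[ℝ] ℝ) (z : ℝ) :
    ∀ᶠ y in 𝓝 ((a, p, z) : State E G), ∀ (T : ℝ) (g : ℝ → G) (ξ : ℝ → E) (z : ℝ → ℝ),
      IsEPHSolution L T g ξ z → ∀ t ∈ Icc 0 T, phaseState L g ξ z t = y →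
        HasDerivWithinAt (fun s => toChart Rinv a (phaseState L g ξ z s))
          (chartField R Rinv L vel a (toChart Rinv a y)) (Icc 0 T) t := by
  have hY := hc.tendsto_toChart a p z
  have hx : Tendsto (fun Y : FlatState E => Y.1) (𝓝 (0, p, z)) (𝓝 0) := continuous_fst.tendsto _
  filter_upwards [hY.eventually (eventually_chartField_momentum hc hL hv a p z),
    hc.eventually_ofChart_toChart a p z,
    (hx.comp hY).eventually hc.eventually_hasMFDerivAt_inv_chart] with y h1 h2 h3 T g ξ z hs t ht hy
  obtain ⟨B, hB, hB'⟩ := h3 a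
  set Y := toChart Rinv a y with hYdef
  have hg : a * R Y.1 = g t := by
    have := congrArg (fun y => y.1) h2
    rw [← hy] at this
    exact this
  have hvel : chartVel R vel a Y = ξ t := by
    rw [chartVel, h2, ← hy]
    exact hv.vel_momentum _ _ _
  have hp : Y.2.1 = momentum L (g t) (ξ t) (z t) := by rw [hYdef, ← hy]; rfl
  have hz : Y.2.2 = z t := by rw [hYdef, ← hy]; rfl
  refine HasDerivWithinAt.prodMk (f₁' := (chartField R Rinv L vel a Y).1) ?_
    (HasDerivWithinAt.prodMk (f₁' := (chartField R Rinv L vel a Y).2.1)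
      (f₂' := (chartField R Rinv L vel a Y).2.2) ?_ ?_)
  · have hB1 : HasMFDerivAt 𝓘(ℝ, E) 𝓘(ℝ, E) (fun g => Rinv (a⁻¹ * g)) (g t) B := by
      rw [← hg]; exact hB
    have d1 : HasMFDerivWithinAt 𝓘(ℝ, ℝ) 𝓘(ℝ, E) ((fun g => Rinv (a⁻¹ * g)) ∘ g) (Icc 0 T) t
        (B.comp (leftVelocity (g t) (ξ t))) :=
      HasMFDerivAt.comp_hasMFDerivWithinAt t hB1 (hs.position_eq t ht)
    have d2 : HasFDerivWithinAt ((fun g => Rinv (a⁻¹ * g)) ∘ g) (B.comp (leftVelocity (g t) (ξ t)))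
      (Icc 0 T) t := hasMFDerivWithinAt_iff_hasFDerivWithinAt.1 d1
    convert! d2.hasDerivWithinAt using 1
    show leftD (chartMul R Rinv) Y.1 (chartVel R vel a Y) = B (leftVelocity (g t) (ξ t) 1)
    rw [leftVelocity, ContinuousLinearMap.toSpanSingleton_apply, one_smul, ← hg, hvel]
    exact (hB' (ξ t)).symm
  · refine hasDerivWithinAt_dual fun η => ?_
    rw [h1, hg, hvel, hp, hz]
    exact hs.momentum_eq t ht η
  · convert! hs.action_eq t ht using 1
    show L (a * R Y.1) (chartVel R vel a Y) Y.2.2 = _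
    rw [hg, hvel, hz]

/-- Integral curves of `chartField` satisfy the Euler--Poincaré--Herglotz equations. -/
lemma eventually_isEPHSolution_ofChart [FiniteDimensional ℝ E] (hc : IsGroupChart R Rinv)
    (hL : IsSmoothLagrangian L) (hv : IsVelocity L vel) (a : G) (p : E →L[ℝ] ℝ) (z : ℝ) :
    ∃ U ∈ 𝓝 ((0, p, z) : FlatState E), ∀ (T : ℝ) (y : ℝ → FlatState E),
      (∀ t ∈ Icc 0 T, y t ∈ U ∧ HasDerivWithinAt y (chartField R Rinv L vel a (y t)) (Icc 0 T) t) →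
      IsEPHSolution L T (fun t => a * R (y t).1) (fun t => chartVel R vel a (y t))
        (fun t => (y t).2.2) := by
  have hx : Tendsto (fun Y : FlatState E => Y.1) (𝓝 (0, p, z)) (𝓝 0) := continuous_fst.tendsto _
  have hmom : ∀ Y : FlatState E, momentum L (a * R Y.1) (chartVel R vel a Y) Y.2.2 = Y.2.1 :=
    fun Y => hv.momentum_vel (ofChart R a Y)
  refine ⟨_, (eventually_chartField_momentum hc hL hv a p z).and
    (hx.eventually hc.eventually_hasMFDerivAt_chart), fun T y hy => ⟨fun t ht => ?_, fun t ht => ?_,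
    fun t ht η => ?_⟩⟩
  · obtain ⟨⟨-, h3⟩, hd⟩ := hy t ht
    obtain ⟨A, hA, hA'⟩ := h3 a
    have d1 : HasMFDerivWithinAt 𝓘(ℝ, ℝ) 𝓘(ℝ, E) (fun t => (y t).1) (Icc 0 T) t
        (ContinuousLinearMap.toSpanSingleton ℝ (chartField R Rinv L vel a (y t)).1) :=
      hasMFDerivWithinAt_iff_hasFDerivWithinAt.2 (hasDerivWithinAt_fst hd).hasFDerivWithinAt
    have d2 : HasMFDerivWithinAt 𝓘(ℝ, ℝ) 𝓘(ℝ, E) ((fun u => a * R u) ∘ fun t => (y t).1) (Icc 0 T) t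
        (A.comp (ContinuousLinearMap.toSpanSingleton ℝ (chartField R Rinv L vel a (y t)).1)) :=
      HasMFDerivAt.comp_hasMFDerivWithinAt t hA d1
    have e : A.comp (ContinuousLinearMap.toSpanSingleton ℝ (chartField R Rinv L vel a (y t)).1) =
        leftVelocity (a * R (y t).1) (chartVel R vel a (y t)) := by
      rw [ContinuousLinearMap.comp_toSpanSingleton, leftVelocity]
      exact congrArg _ (hA' (chartVel R vel a (y t)))
    exact d2.congr_mfderiv e
  · exact hasDerivWithinAt_snd (hasDerivWithinAt_snd (hy t ht).2)
  · obtain ⟨⟨h1, -⟩, hd⟩ := hy t ht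
    have d1 := (hasDerivWithinAt_fst (hasDerivWithinAt_snd hd)).clm_apply
      (hasDerivWithinAt_const t (Icc 0 T) η)
    simp only [hmom]
    rw [← h1]
    simpa using d1

end Equations

/-! ### Exact solutions and extended discrete Lagrangians -/

section ExactSolutions

variable {E : Type*} [NormedAddCommGroup E] [NormedSpace ℝ E]

lemma continuousWithinAt_dual [FiniteDimensional ℝ E] {P : ℝ → E →L[ℝ] ℝ} {s : Set ℝ} {t : ℝ}
    (h : ∀ η, ContinuousWithinAt (fun s => P s η) s t) : ContinuousWithinAt P s t := by
  let b := Module.finBasis ℝ E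
  let e : (Fin (Module.finrank ℝ E) → ℝ) ≃L[ℝ] (E →L[ℝ] ℝ) :=
    ((b.constr ℝ).trans LinearMap.toContinuousLinearMap).toContinuousLinearEquiv
  have he : ∀ Q : E →L[ℝ] ℝ, e (fun i => Q (b i)) = Q := by
    intro Q
    refine ContinuousLinearMap.coe_injective (b.ext fun i => ?_)
    simp [e]
  have h1 : ContinuousWithinAt (fun s i => P s (b i)) s t :=
    continuousWithinAt_pi.2 fun i => h (b i)
  have h2 := e.continuous.continuousAt.comp_continuousWithinAt h1
  have h3 : (e : (Fin (Module.finrank ℝ E) → ℝ) → E →L[ℝ] ℝ) ∘ (fun s i => P s (b i)) = P :=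
    funext fun s => he (P s)
  rwa [h3] at h2

variable {G : Type*} [TopologicalSpace G] [ChartedSpace E G] [Group G]
  {R : E → G} {Rinv : G → E} {L : G → E → ℝ → ℝ} {vel : State E G → E}
  {T : ℝ} {g g' : ℝ → G} {ξ ξ' : ℝ → E} {z z' : ℝ → ℝ}

lemma IsEPHSolution.continuousOn_phaseState [FiniteDimensional ℝ E] (hs : IsEPHSolution L T g ξ z) :
    ContinuousOn (phaseState L g ξ z) (Icc 0 T) := fun t ht =>
  (hs.position_eq t ht).continuousWithinAt.prodMk
    ((continuousWithinAt_dual fun η => (hs.momentum_eq t ht η).continuousWithinAt).prodMk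
      (hs.action_eq t ht).continuousWithinAt)

/-- The equations are autonomous: pieces of solutions, shifted in time, are solutions. -/
lemma IsEPHSolution.shift (hs : IsEPHSolution L T g ξ z) {s h : ℝ} (hs0 : 0 ≤ s) (hsT : s + h ≤ T) :
    IsEPHSolution L h (fun t => g (s + t)) (fun t => ξ (s + t)) (fun t => z (s + t)) := by
  have hmaps : MapsTo (fun t => s + t) (Icc 0 h) (Icc 0 T) := fun t ht =>
    ⟨add_nonneg hs0 ht.1, by linarith [ht.2]⟩
  have hd : ∀ t, HasDerivWithinAt (fun t => s + t) 1 (Icc 0 h) t := fun t =>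
    (hasDerivWithinAt_id t _).const_add s
  refine ⟨fun t ht => ?_, fun t ht => ?_, fun t ht η => ?_⟩
  · have h1 := hs.position_eq (s + t) (hmaps ht)
    have h2 : HasMFDerivWithinAt 𝓘(ℝ, ℝ) 𝓘(ℝ, ℝ) (fun t => s + t) (Icc 0 h) t
        (ContinuousLinearMap.toSpanSingleton ℝ (1 : ℝ)) :=
      hasMFDerivWithinAt_iff_hasFDerivWithinAt.2 (hd t).hasFDerivWithinAt
    refine (HasMFDerivWithinAt.comp (g := g) t h1 h2 hmaps).congr_mfderiv ?_
    refine ContinuousLinearMap.ext_ring ?_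
    show leftVelocity (g (s + t)) (ξ (s + t)) ((1 : ℝ) • (1 : ℝ)) = _
    rw [one_smul]
    rfl
  · have h1 := (hs.action_eq (s + t) (hmaps ht)).scomp t (hd t) hmaps
    rw [one_smul] at h1
    exact h1
  · have h1 := (hs.momentum_eq (s + t) (hmaps ht) η).scomp t (hd t) hmaps
    rw [one_smul] at h1
    exact h1

variable [LieGroup 𝓘(ℝ, E) ∞ G] [FiniteDimensional ℝ E]

lemma contDiffAt_chartField (hc : IsGroupChart R Rinv) (hL : IsSmoothLagrangian L)
    (hv : IsVelocity L vel) (a : G) (p : E →L[ℝ] ℝ) (z : ℝ) :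
    ContDiffAt ℝ ∞ (chartField R Rinv L vel a) (0, p, z) :=
  contDiffAt_ephField hc.isLocalGroup (hv.isLegendre hc hL a p z)

/-- In the chart centred at its initial point, a solution is for a short time an integral curve
near the base point. -/
lemma IsEPHSolution.exists_integralCurve (hc : IsGroupChart R Rinv) (hL : IsSmoothLagrangian L)
    (hv : IsVelocity L vel) (hs : IsEPHSolution L T g ξ z) (hT : 0 < T) {U : Set (FlatState E)}
    {y₀ : State E G} (hy₀ : phaseState L g ξ z 0 = y₀)
    (hU : U ∈ 𝓝 ((0, y₀.2.1, y₀.2.2) : FlatState E)) :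
    ∃ ε, 0 < ε ∧ ε ≤ T ∧ ∀ t ∈ Icc 0 ε, toChart Rinv y₀.1 (phaseState L g ξ z t) ∈ U ∧
      HasDerivWithinAt (fun s => toChart Rinv y₀.1 (phaseState L g ξ z s))
        (chartField R Rinv L vel y₀.1 (toChart Rinv y₀.1 (phaseState L g ξ z t))) (Icc 0 ε) t ∧
      ofChart R y₀.1 (toChart Rinv y₀.1 (phaseState L g ξ z t)) = phaseState L g ξ z t := by
  have hev := (((hc.tendsto_toChart y₀.1 y₀.2.1 y₀.2.2).eventually_mem hU).and
    (eventually_hasDerivWithinAt_toChart hc hL hv y₀.1 y₀.2.1 y₀.2.2)).and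
    (hc.eventually_ofChart_toChart y₀.1 y₀.2.1 y₀.2.2)
  have hcont := hs.continuousOn_phaseState 0 (left_mem_Icc.2 hT.le)
  have hcont' : Tendsto (phaseState L g ξ z) (𝓝[Icc 0 T] 0) (𝓝 (y₀.1, y₀.2.1, y₀.2.2)) := by
    have := hcont.tendsto
    rwa [hy₀] at this
  obtain ⟨δ, hδ, hball⟩ := Metric.mem_nhdsWithin_iff.1 (hcont'.eventually hev)
  refine ⟨min (δ / 2) T, lt_min (half_pos hδ) hT, min_le_right _ _, fun t ht => ?_⟩
  have htT : t ∈ Icc 0 T := ⟨ht.1, ht.2.trans (min_le_right _ _)⟩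
  have hmem : t ∈ Metric.ball (0 : ℝ) δ ∩ Icc 0 T := by
    refine ⟨?_, htT⟩
    rw [Metric.mem_ball, Real.dist_0_eq_abs, abs_of_nonneg ht.1]
    have := ht.2.trans (min_le_left _ _)
    linarith
  obtain ⟨⟨h1, h2⟩, h3⟩ := hball hmem
  exact ⟨h1, (h2 T g ξ z hs t htT rfl).mono (Icc_subset_Icc_right (min_le_right _ _)), h3⟩

/-- Two solutions with the same initial phase state agree for a short time. -/
lemma IsEPHSolution.exists_eqOn (hc : IsGroupChart R Rinv) (hL : IsSmoothLagrangian L)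
    (hv : IsVelocity L vel) (hs : IsEPHSolution L T g ξ z) (hs' : IsEPHSolution L T g' ξ' z')
    (hT : 0 < T) (h0 : phaseState L g ξ z 0 = phaseState L g' ξ' z' 0) :
    ∃ ε, 0 < ε ∧ ε ≤ T ∧ ∀ t ∈ Icc 0 ε, phaseState L g ξ z t = phaseState L g' ξ' z' t := by
  set y₀ := phaseState L g ξ z 0 with hy₀
  obtain ⟨K, U, hU, hK⟩ := (contDiffAt_infty.1
    (contDiffAt_chartField hc hL hv y₀.1 y₀.2.1 y₀.2.2) 1).exists_lipschitzOnWith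
  obtain ⟨ε₁, hε₁, hεT₁, h1⟩ := hs.exists_integralCurve hc hL hv hT hy₀.symm hU
  obtain ⟨ε₂, hε₂, hεT₂, h2⟩ := hs'.exists_integralCurve hc hL hv hT h0.symm hU
  refine ⟨min ε₁ ε₂, lt_min hε₁ hε₂, (min_le_left _ _).trans hεT₁, fun t ht => ?_⟩
  have m1 : ∀ s ∈ Icc 0 t, s ∈ Icc 0 ε₁ := fun s hs =>
    ⟨hs.1, hs.2.trans (ht.2.trans (min_le_left _ _))⟩
  have m2 : ∀ s ∈ Icc 0 t, s ∈ Icc 0 ε₂ := fun s hs =>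
    ⟨hs.1, hs.2.trans (ht.2.trans (min_le_right _ _))⟩
  have key := norm_le_of_norm_deriv_le (δ := 0) (ε := 0) (K := K)
    (b := fun s => toChart Rinv y₀.1 (phaseState L g ξ z s) -
      toChart Rinv y₀.1 (phaseState L g' ξ' z' s)) ht.1 K.2 le_rfl
    (fun s hs => ((h1 s (m1 s hs)).2.1.mono m1).sub ((h2 s (m2 s hs)).2.1.mono m2))
    (by rw [← hy₀, ← h0, sub_self, norm_zero])
    (fun s hs => by
      rw [add_zero]
      exact hK.norm_sub_le (h1 s (m1 s hs)).1 (h2 s (m2 s hs)).1)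
  have heq : toChart Rinv y₀.1 (phaseState L g ξ z t) =
      toChart Rinv y₀.1 (phaseState L g' ξ' z' t) := by
    rw [← sub_eq_zero, ← norm_le_zero_iff]
    simpa using key
  rw [← (h1 t (m1 t (right_mem_Icc.2 ht.1))).2.2, heq, (h2 t (m2 t (right_mem_Icc.2 ht.1))).2.2]

/-- A solution is determined by its initial phase state. -/
lemma IsEPHSolution.phaseState_unique [T2Space G] (hc : IsGroupChart R Rinv)
    (hL : IsSmoothLagrangian L) (hv : IsVelocity L vel) (hs : IsEPHSolution L T g ξ z)
    (hs' : IsEPHSolution L T g' ξ' z')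
    (h0 : phaseState L g ξ z 0 = phaseState L g' ξ' z' 0) :
    ∀ t ∈ Icc 0 T, phaseState L g ξ z t = phaseState L g' ξ' z' t := by
  intro t ht
  have hclosed : IsClosed ({t | phaseState L g ξ z t = phaseState L g' ξ' z' t} ∩ Icc 0 T) := by
    have h1 := (hs.continuousOn_phaseState.prodMk hs'.continuousOn_phaseState
      ).preimage_isClosed_of_isClosed isClosed_Icc (isClosed_diagonal (X := State E G))
    rwa [inter_comm] at h1
  refine IsClosed.Icc_subset_of_forall_exists_gt hclosed h0 ?_ ht
  rintro s ⟨hss, hsT⟩ u (hu : s < u)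
  obtain ⟨ε, hε, -, hεe⟩ := (hs.shift (h := T - s) hsT.1 (by linarith)).exists_eqOn hc hL hv
    (hs'.shift (h := T - s) hsT.1 (by linarith)) (sub_pos.2 hsT.2) (by
      have : phaseState L g ξ z (s + 0) = phaseState L g' ξ' z' (s + 0) := by
        rw [add_zero]; exact hss
      exact this)
  refine ⟨s + min ε (u - s), hεe _ ⟨(lt_min hε (sub_pos.2 hu)).le, min_le_left _ _⟩, ?_, ?_⟩
  · have := lt_min hε (sub_pos.2 hu); linarith
  · have := min_le_right ε (u - s); linarith

end ExactSolutions

section Agreement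

variable {E : Type*} [NormedAddCommGroup E] [NormedSpace ℝ E] [FiniteDimensional ℝ E]
  {G : Type*} [TopologicalSpace G] [ChartedSpace E G] [Group G] [LieGroup 𝓘(ℝ, E) ∞ G]
  {R : E → G} {Rinv : G → E} {L : G → E → ℝ → ℝ} {vel : State E G → E}
  {Ld : ℝ → G → G → ℝ → ℝ} {ℓ : ℝ × G × E × ℝ → ℝ} {W : Set (ℝ × G × E × ℝ)} {r : ℕ}

/-- `ℓ`, smooth on the neighbourhood `W` of `{h = 0}`, is the smooth extension of the discrete
Lagrangian `L_d` across `h = 0`. -/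
structure IsExtension (R : E → G) (Ld : ℝ → G → G → ℝ → ℝ) (ℓ : ℝ × G × E × ℝ → ℝ)
    (W : Set (ℝ × G × E × ℝ)) : Prop where
  isOpen : IsOpen W
  zero_mem : ∀ (g : G) (ξ : E) (z : ℝ), ((0 : ℝ), g, ξ, z) ∈ W
  smooth : ContMDiffOn (𝓘(ℝ, ℝ).prod (𝓘(ℝ, E).prod (𝓘(ℝ, E).prod 𝓘(ℝ, ℝ)))) 𝓘(ℝ, ℝ) ∞ ℓ W
  eq : ∀ (h : ℝ) (g : G) (ξ : E) (z : ℝ), 0 < h → (h, g, ξ, z) ∈ W →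
      Ld h g (g * R (h • ξ)) z = ℓ (h, g, ξ, z)

/-- The discrete Lagrangian in the chart `x ↦ a R(x)`. -/
def chartDiscrete (R : E → G) (ℓ : ℝ × G × E × ℝ → ℝ) (a : G) (q : ℝ × (E × E × ℝ)) : ℝ :=
  ℓ (q.1, a * R q.2.1, q.2.2.1, q.2.2.2)

omit [FiniteDimensional ℝ E] in
lemma IsGroupChart.contMDiffAt_extended (hc : IsGroupChart R Rinv) (a : G) (ξ : E) (z : ℝ) :
    ContMDiffAt 𝓘(ℝ, ℝ × (E × E × ℝ)) (𝓘(ℝ, ℝ).prod (𝓘(ℝ, E).prod (𝓘(ℝ, E).prod 𝓘(ℝ, ℝ)))) ∞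
      (fun q : ℝ × (E × E × ℝ) => (q.1, a * R q.2.1, q.2.2.1, q.2.2.2)) (0, (0, ξ, z)) := by
  set q₀ : ℝ × (E × E × ℝ) := (0, (0, ξ, z)) with hq₀
  have h1 : ContMDiffAt 𝓘(ℝ, ℝ × (E × E × ℝ)) 𝓘(ℝ, E) ∞
      (fun w : ℝ × (E × E × ℝ) => a * R w.2.1) q₀ :=
    ContMDiffAt.comp (x := q₀) (g := fun x => a * R x) (f := fun w : ℝ × (E × E × ℝ) => w.2.1)
      (hc.contMDiffAt_mul_left a) (ContDiffAt.contMDiffAt (by fun_prop))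
  have h0 : ContMDiffAt 𝓘(ℝ, ℝ × (E × E × ℝ)) 𝓘(ℝ, ℝ) ∞ (fun w : ℝ × (E × E × ℝ) => w.1) q₀ :=
    ContDiffAt.contMDiffAt (by fun_prop)
  have h2 : ContMDiffAt 𝓘(ℝ, ℝ × (E × E × ℝ)) 𝓘(ℝ, E) ∞ (fun w : ℝ × (E × E × ℝ) => w.2.2.1) q₀ :=
    ContDiffAt.contMDiffAt (by fun_prop)
  have h3 : ContMDiffAt 𝓘(ℝ, ℝ × (E × E × ℝ)) 𝓘(ℝ, ℝ) ∞ (fun w : ℝ × (E × E × ℝ) => w.2.2.2) q₀ :=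
    ContDiffAt.contMDiffAt (by fun_prop)
  exact h0.prodMk (h1.prodMk (h2.prodMk h3))

omit [FiniteDimensional ℝ E] in
lemma IsExtension.eventually_mem (hc : IsGroupChart R Rinv) (hℓ : IsExtension R Ld ℓ W) (a : G)
    (ξ : E) (z : ℝ) :
    ∀ᶠ q in 𝓝 ((0 : ℝ), ((0, ξ, z) : E × E × ℝ)), (q.1, a * R q.2.1, q.2.2.1, q.2.2.2) ∈ W :=
  (hc.contMDiffAt_extended a ξ z).continuousAt.eventually_mem
    (hℓ.isOpen.mem_nhds (hℓ.zero_mem _ _ _))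

omit [FiniteDimensional ℝ E] in
lemma IsExtension.contDiffAt_chartDiscrete (hc : IsGroupChart R Rinv) (hℓ : IsExtension R Ld ℓ W)
    (a : G) (ξ : E) (z : ℝ) : ContDiffAt ℝ ∞ (chartDiscrete R ℓ a) (0, (0, ξ, z)) :=
  (ContMDiffAt.comp (x := ((0 : ℝ), ((0, ξ, z) : E × E × ℝ))) (g := ℓ)
    (hℓ.smooth.contMDiffAt (hℓ.isOpen.mem_nhds (hℓ.zero_mem _ _ _)))
    (hc.contMDiffAt_extended a ξ z)).contDiffAt

/-- The agreement with the exact discrete Lagrangian, in a chart. -/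
lemma AgreesWithExact.flatAgrees (hc : IsGroupChart R Rinv) (hL : IsSmoothLagrangian L)
    (hv : IsVelocity L vel) (hℓ : IsExtension R Ld ℓ W) (hagree : AgreesWithExact L Ld (r + 1))
    (a : G) (p : E →L[ℝ] ℝ) (z : ℝ) :
    FlatAgrees (chartMul R Rinv) (chartDiv R Rinv) (chartBracket (chartMul R Rinv))
      (chartLagrangian R L a) (chartVel R vel a) (chartDiscrete R ℓ a) (0, p, z) r := by
  have hGloc : LocallyCompactSpace G := Manifold.locallyCompact_of_finiteDimensional 𝓘(ℝ, E)
  have hEprop : ProperSpace E := FiniteDimensional.proper ℝ E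
  have hLeg := hv.isLegendre hc hL a p z
  set ξ₀ := chartVel R vel a (0, p, z) with hξ₀
  obtain ⟨K, hK, hKn⟩ := exists_compact_mem_nhds ((a, ξ₀, z) : G × E × ℝ)
  obtain ⟨C, h₀, hh₀, hC⟩ := hagree K hK
  obtain ⟨U, hU, hsol⟩ := eventually_isEPHSolution_ofChart hc hL hv a p z
  have hdiv := hc.eventually_map_div
  rw [nhds_prod_eq] at hdiv
  obtain ⟨O, hO, hOdiv⟩ := Filter.eventually_prod_self_iff'.1 hdiv
  have hx : Tendsto (fun Y : FlatState E => Y.1) (𝓝 (0, p, z)) (𝓝 0) := continuous_fst.tendsto _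
  have hcf : ∀ᶠ Y in 𝓝 ((0, p, z) : FlatState E), ContinuousAt (chartField R Rinv L vel a) Y :=
    (eventually_differentiableAt (contDiffAt_chartField hc hL hv a p z)).mono
      fun Y hY => hY.continuousAt
  have hK' : ∀ᶠ Y in 𝓝 ((0, p, z) : FlatState E), (a * R Y.1, chartVel R vel a Y, Y.2.2) ∈ K := by
    have h1 : Tendsto (fun Y : FlatState E => (a * R Y.1, chartVel R vel a Y, Y.2.2))
        (𝓝 (0, p, z)) (𝓝 (a, ξ₀, z)) := by
      have h2 := (hc.tendsto_ofChart a p z).fst_nhds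
      exact h2.prodMk_nhds (hLeg.smooth_velocity.continuousAt.tendsto.prodMk_nhds
        ((continuous_snd.comp continuous_snd).tendsto _))
    exact h1.eventually_mem hKn
  refine ⟨{Y | (Y ∈ U ∧ Y.1 ∈ O) ∧ ContinuousAt (chartField R Rinv L vel a) Y},
    {q | (q.1, a * R q.2.1, q.2.2.1, q.2.2.2) ∈ W}, C, ?_, hℓ.eventually_mem hc a ξ₀ z, ?_⟩
  · exact (Filter.Eventually.and (show ∀ᶠ Y in 𝓝 _, Y ∈ U from hU) (hx.eventually_mem hO)).and hcf
  have h1 : Tendsto (fun q : ℝ × FlatState E => q.1) (𝓝 (0, (0, p, z))) (𝓝 0) :=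
    continuous_fst.tendsto _
  have h2 : Tendsto (fun q : ℝ × FlatState E => q.2) (𝓝 (0, (0, p, z))) (𝓝 (0, p, z)) :=
    continuous_snd.tendsto _
  filter_upwards [h1.eventually (gt_mem_nhds hh₀), h2.eventually hK'] with q e1 e2 hq y hy0 hy hmem
  have hq0 : (0 : ℝ) ∈ Icc 0 q.1 := left_mem_Icc.2 hq.le
  have hq1 : q.1 ∈ Icc 0 q.1 := right_mem_Icc.2 hq.le
  have hsolE := hsol q.1 y fun t ht => ⟨(hy t ht).1.1.1, (hy t ht).2⟩
  have hycont : ContinuousOn y (Icc 0 q.1) := fun t ht => (hy t ht).2.continuousWithinAt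
  -- the action increment is the integral of the Lagrangian
  have hint : ∫ t in (0 : ℝ)..q.1, L (a * R (y t).1) (chartVel R vel a (y t)) (y t).2.2 =
      (y q.1).2.2 - (y 0).2.2 := by
    refine intervalIntegral.integral_eq_sub_of_hasDerivAt_of_le
      (f := fun t => (y t).2.2) hq.le (fun t ht => (hsolE.action_eq t ht).continuousWithinAt)
      (fun t ht => (hsolE.action_eq t (Ioo_subset_Icc_self ht)).hasDerivAt
        (Icc_mem_nhds ht.1 ht.2)) ?_
    refine ContinuousOn.intervalIntegrable_of_Icc hq.le fun t ht => ?_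
    have h3 : ContinuousWithinAt (fun t => chartField R Rinv L vel a (y t)) (Icc 0 q.1) t :=
      ContinuousAt.comp_continuousWithinAt (hy t ht).1.2 (hycont t ht)
    exact h3.snd.snd
  have hR : R (chartDiv R Rinv (q.2.1, (y q.1).1)) = (R q.2.1)⁻¹ * R (y q.1).1 := by
    have h3 := (hy 0 hq0).1.1.2
    rw [hy0] at h3
    exact hOdiv _ h3 _ (hy q.1 hq1).1.1.2
  have hend : a * R q.2.1 * R (q.1 • (q.1⁻¹ • chartDiv R Rinv (q.2.1, (y q.1).1))) =
      a * R (y q.1).1 := by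
    rw [smul_inv_smul₀ hq.ne', hR, mul_assoc, mul_inv_cancel_left]
  have h4 := hC q.1 ⟨hq, e1.le⟩ (a * R q.2.1) (a * R (y q.1).1) q.2.2.2 ((y q.1).2.2 - q.2.2.2)
    ⟨_, _, _, hsolE, by rw [hy0]; exact e2, by rw [hy0], rfl, by rw [hy0], by rw [hint, hy0]⟩
  have h5 := hℓ.eq q.1 (a * R q.2.1) (q.1⁻¹ • chartDiv R Rinv (q.2.1, (y q.1).1)) q.2.2.2 hq hmem
  rw [hend] at h5
  rw [h5] at h4
  exact h4

end Agreement

/-! ### The differential of the discrete Lagrangian -/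

section StepDerivative

variable {E : Type*} [NormedAddCommGroup E] [NormedSpace ℝ E]

/-- The differential of `(u, w) ↦ u⁻¹ v w` at `(0, 0)`. -/
lemma IsLocalGroup.eventually_hasFDerivAt_relative [CompleteSpace E] {m N : E × E → E}
    {br : E →L[ℝ] E →L[ℝ] E} (hG : IsLocalGroup m N br) :
    ∀ᶠ v in 𝓝 (0 : E), N (0, m (v, 0)) = v ∧ HasFDerivAt (fun u : E × E => N (u.1, m (v, u.2)))
      ((leftD m v).comp (ContinuousLinearMap.snd ℝ E E) -
        (rightD m v).comp (ContinuousLinearMap.fst ℝ E E)) 0 := by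
  have hin : Tendsto (fun v : E => ((0 : E), v)) (𝓝 0) (𝓝 (0, 0)) :=
    (Continuous.prodMk_right (0 : E)).tendsto 0
  have h0 : ∀ᶠ v in 𝓝 (0 : E), N (0, v) = v := by
    filter_upwards [hin.eventually hG.div_mul, hG.zero_mul] with v h1 h2
    simpa [h2] using h1
  filter_upwards [h0.eventually_nhds, hG.mul_zero, hG.eventually_hasFDerivAt_div,
    hG.eventually_hasFDerivAt_mul_right,
    hin.eventually (eventually_differentiableAt hG.div_smooth)] with v h1 h2 h3 h4 h5
  refine ⟨by rw [h2, h1.self_of_nhds], ?_⟩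
  have hN : HasFDerivAt N (fderiv ℝ N (0, v)) (0, v) := h5.hasFDerivAt
  have hN1 : (fderiv ℝ N (0, v)).comp (ContinuousLinearMap.inl ℝ E E) = -rightD m v :=
    (HasFDerivAt.comp (g := N) (0 : E) hN (hasFDerivAt_prodMk_left (0 : E) v)).unique h3
  have hN2 : (fderiv ℝ N (0, v)).comp (ContinuousLinearMap.inr ℝ E E) =
      ContinuousLinearMap.id ℝ E :=
    (HasFDerivAt.comp (g := N) v hN (hasFDerivAt_prodMk_right (0 : E) v)).unique
      ((hasFDerivAt_id v).congr_of_eventuallyEq h1)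
  have h6 : HasFDerivAt (fun u : E × E => m (v, u.2))
      ((leftD m v).comp (ContinuousLinearMap.snd ℝ E E)) 0 :=
    HasFDerivAt.comp (g := fun w => m (v, w)) (0 : E × E) h4 hasFDerivAt_snd
  have h7 : HasFDerivAt (fun u : E × E => (u.1, m (v, u.2)))
      ((ContinuousLinearMap.fst ℝ E E).prod ((leftD m v).comp (ContinuousLinearMap.snd ℝ E E)))
      0 := hasFDerivAt_fst.prodMk h6
  have h8 := HasFDerivAt.comp (g := N) (f := fun u : E × E => (u.1, m (v, u.2))) (0 : E × E)
    (g' := fderiv ℝ N (0, v)) (by simpa [h2] using hN) h7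
  refine h8.congr_fderiv ?_
  refine ContinuousLinearMap.ext fun u => ?_
  have e1 := DFunLike.congr_fun hN1 u.1
  have e2 := DFunLike.congr_fun hN2 (leftD m v u.2)
  have e3 : ((u.1, leftD m v u.2) : E × E) = (u.1, 0) + (0, leftD m v u.2) := by simp
  show fderiv ℝ N (0, v) (u.1, leftD m v u.2) = leftD m v u.2 - rightD m v u.1
  rw [e3, map_add]
  simp only [ContinuousLinearMap.comp_apply, ContinuousLinearMap.inl_apply,
    ContinuousLinearMap.inr_apply, _root_.neg_apply,
    ContinuousLinearMap.id_apply] at e1 e2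
  rw [e1, e2]; abel

/-- If `ℓ = h lam` near `h = 0`, the differentials satisfy the same relation. -/
lemma eventually_slopeD_eq_smul {ℓ : ℝ × (E × E × ℝ) → ℝ} [FiniteDimensional ℝ E] {w₀ : E × E × ℝ}
    (hℓ : ContDiffAt ℝ ∞ ℓ (0, w₀)) (h0 : ∀ᶠ w in 𝓝 w₀, ℓ (0, w) = 0) :
    ∀ᶠ q in 𝓝 ((0 : ℝ), w₀), slopeD ℓ q = q.1 • slopeD (hadamard ℓ) q := by
  have ht : Tendsto (fun q : ℝ × (E × E × ℝ) => q.2) (𝓝 (0, w₀)) (𝓝 w₀) :=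
    continuous_snd.tendsto _
  filter_upwards [ht.eventually h0.eventually_nhds, eventually_differentiableAt hℓ,
    eventually_differentiableAt (contDiffAt_hadamard hℓ)] with q h1 h2 h3
  have h4 : HasFDerivAt (fun w => ℓ (q.1, w)) (slopeD ℓ q) q.2 :=
    HasFDerivAt.comp (g := ℓ) q.2 h2.hasFDerivAt (hasFDerivAt_prodMk_right q.1 q.2)
  have h5 : HasFDerivAt (fun w => hadamard ℓ (q.1, w)) (slopeD (hadamard ℓ) q) q.2 :=
    HasFDerivAt.comp (g := hadamard ℓ) q.2 h3.hasFDerivAt (hasFDerivAt_prodMk_right q.1 q.2)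
  refine h4.unique ((h5.const_smul q.1).congr_of_eventuallyEq ?_)
  filter_upwards [h1] with w hw
  have := hadamard_spec ℓ (q.1, w)
  rw [this]; simp [hw]

variable {G : Type*} [TopologicalSpace G] [ChartedSpace E G] [Group G]
  {R : E → G} {Rinv : G → E} {L : G → E → ℝ → ℝ} {vel : State E G → E}
  {Ld : ℝ → G → G → ℝ → ℝ} {ℓ : ℝ × G × E × ℝ → ℝ} {W : Set (ℝ × G × E × ℝ)} {r : ℕ}

/-- `D = (D_1 L_d, D_2 L_d, ∂_z L_d)` is the left-trivialized differential of the discrete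
Lagrangian at `(g, g', z)`. -/
def HasStepDeriv (R : E → G) (Ld : ℝ → G → G → ℝ → ℝ) (h : ℝ) (g g' : G) (z : ℝ)
    (D : E × E × ℝ →L[ℝ] ℝ) : Prop :=
  HasFDerivAt (fun u : E × E × ℝ => Ld h (g * R u.1) (g' * R u.2.1) u.2.2) D (0, 0, z)

variable [LieGroup 𝓘(ℝ, E) ∞ G] [FiniteDimensional ℝ E]

/-- The differential of the discrete Lagrangian, computed in the chart: the nodes `a R(x) R(u)` and
`a R(x) R(h ξ) R(w)` have relative velocity `h⁻¹ N(u, m(h ξ, w))`. -/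
lemma IsExtension.eventually_hasStepDeriv (hc : IsGroupChart R Rinv) (hℓ : IsExtension R Ld ℓ W)
    {a : G} {ξ : E} {z : ℝ} (h0 : ∀ᶠ w in 𝓝 (0, ξ, z), chartDiscrete R ℓ a (0, w) = 0) :
    ∀ᶠ q in 𝓝 ((0 : ℝ), ((0, ξ, z) : E × E × ℝ)), 0 < q.1 → ∃ D : E × E × ℝ →L[ℝ] ℝ,
      HasStepDeriv R Ld q.1 (a * R q.2.1) (a * R q.2.1 * R (q.1 • q.2.2.1)) q.2.2.2 D ∧
      dX D = -initialMom (chartMul R Rinv) (hadamard (chartDiscrete R ℓ a)) q ∧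
      dV D = finalMom (chartMul R Rinv) (hadamard (chartDiscrete R ℓ a)) q ∧
      dZ D = stepScale (hadamard (chartDiscrete R ℓ a)) q - 1 := by
  set m := chartMul R Rinv with hm
  set N := chartDiv R Rinv with hN
  set ℓ' := chartDiscrete R ℓ a with hℓ'
  have hG := hc.isLocalGroup
  have hcd := hℓ.contDiffAt_chartDiscrete hc a ξ z
  have tx : Tendsto (fun q : ℝ × (E × E × ℝ) => q.2.1) (𝓝 (0, (0, ξ, z))) (𝓝 0) :=
    Continuous.tendsto' (by fun_prop) _ _ rfl
  have tv : Tendsto (fun q : ℝ × (E × E × ℝ) => q.1 • q.2.2.1) (𝓝 (0, (0, ξ, z))) (𝓝 0) :=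
    Continuous.tendsto' (by fun_prop) _ _ (by simp)
  have tin : Tendsto (fun v : E => (v, (0 : E))) (𝓝 0) (𝓝 (0, 0)) :=
    (Continuous.prodMk_left (0 : E)).tendsto 0
  have tin' : Tendsto (fun v : E => ((0 : E), v)) (𝓝 0) (𝓝 (0, 0)) :=
    (Continuous.prodMk_right (0 : E)).tendsto 0
  filter_upwards [eventually_slopeD_eq_smul hcd h0, eventually_differentiableAt hcd,
    tx.eventually hG.eventually_hasFDerivAt_mul_right, tx.eventually hG.mul_zero,
    tv.eventually hG.eventually_hasFDerivAt_relative, tv.eventually hG.mul_zero,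
    tv.eventually hG.eventually_hasFDerivAt_mul_right,
    (hℓ.eventually_mem hc a ξ z).eventually_nhds,
    tx.eventually (tin.eventually hc.eventually_map_mul.eventually_nhds),
    tv.eventually (tin.eventually hc.eventually_map_mul.eventually_nhds),
    tv.eventually (tin'.eventually hc.eventually_map_div.eventually_nhds)]
    with q e1 e2 e3 e4 e5 e5' e5'' e6 e7 e8 e9 hq
  obtain ⟨h, x, ζ, z⟩ := q
  simp only at hq e1 e2 e3 e4 e5 e5' e5'' e6 e7 e8 e9 ⊢
  obtain ⟨e5a, e5b⟩ := e5
  rw [e5'] at e5a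
  have hsl : HasFDerivAt (fun w => ℓ' (h, w)) (slopeD ℓ' (h, x, ζ, z)) (x, ζ, z) :=
    HasFDerivAt.comp (g := ℓ') (x, ζ, z) e2.hasFDerivAt (hasFDerivAt_prodMk_right h (x, ζ, z))
  -- the coordinates of the pair of varied nodes
  set φ : E × E × ℝ → E × E × ℝ := fun u => (m (x, u.1), h⁻¹ • N (u.1, m (h • ζ, u.2.1)), u.2.2)
  have hφ0 : φ (0, 0, z) = (x, ζ, z) := by
    simp only [φ]
    rw [show m (x, 0) = x from e4, show m (h • ζ, 0) = h • ζ from e5',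
      show N (0, h • ζ) = h • ζ from e5a, inv_smul_smul₀ hq.ne']
  set φ' : E × E × ℝ →L[ℝ] E × E × ℝ :=
    ((leftD m x).comp (ContinuousLinearMap.fst ℝ E (E × ℝ))).prod
      ((h⁻¹ • (((leftD m (h • ζ)).comp (ContinuousLinearMap.snd ℝ E E) -
        (rightD m (h • ζ)).comp (ContinuousLinearMap.fst ℝ E E)).comp
          ((ContinuousLinearMap.fst ℝ E (E × ℝ)).prod
            ((ContinuousLinearMap.fst ℝ E ℝ).comp (ContinuousLinearMap.snd ℝ E (E × ℝ)))))).prod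
        ((ContinuousLinearMap.snd ℝ E ℝ).comp (ContinuousLinearMap.snd ℝ E (E × ℝ))))
  have hφ : HasFDerivAt φ φ' (0, 0, z) := by
    have p1 : HasFDerivAt (fun u : E × E × ℝ => u.1) (ContinuousLinearMap.fst ℝ E (E × ℝ))
        (0, 0, z) := hasFDerivAt_fst
    have p2 : HasFDerivAt (fun u : E × E × ℝ => u.2.1)
        ((ContinuousLinearMap.fst ℝ E ℝ).comp (ContinuousLinearMap.snd ℝ E (E × ℝ))) (0, 0, z) :=
      ((ContinuousLinearMap.fst ℝ E ℝ).comp (ContinuousLinearMap.snd ℝ E (E × ℝ))).hasFDerivAt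
    have p3 : HasFDerivAt (fun u : E × E × ℝ => u.2.2)
        ((ContinuousLinearMap.snd ℝ E ℝ).comp (ContinuousLinearMap.snd ℝ E (E × ℝ))) (0, 0, z) :=
      ((ContinuousLinearMap.snd ℝ E ℝ).comp (ContinuousLinearMap.snd ℝ E (E × ℝ))).hasFDerivAt
    have p4 := HasFDerivAt.comp (g := fun u => m (x, u)) (f := fun u : E × E × ℝ => u.1)
      ((0, 0, z) : E × E × ℝ) e3 p1
    have p5 := HasFDerivAt.comp (g := fun u : E × E => N (u.1, m (h • ζ, u.2)))
      (f := fun u : E × E × ℝ => (u.1, u.2.1)) ((0, 0, z) : E × E × ℝ) e5b (p1.prodMk p2)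
    exact p4.prodMk ((p5.const_smul h⁻¹).prodMk p3)
  have hφt : Tendsto φ (𝓝 (0, 0, z)) (𝓝 (x, ζ, z)) := by
    have := hφ.continuousAt.tendsto
    rwa [hφ0] at this
  refine ⟨(slopeD ℓ' (h, x, ζ, z)).comp φ', ?_, ?_, ?_, ?_⟩
  · have h1 : HasFDerivAt (fun u => ℓ' (h, φ u)) ((slopeD ℓ' (h, x, ζ, z)).comp φ') (0, 0, z) :=
      HasFDerivAt.comp (g := fun w => ℓ' (h, w)) (f := φ) ((0, 0, z) : E × E × ℝ)
        (by rw [hφ0]; exact hsl) hφ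
    refine h1.congr_of_eventuallyEq ?_
    have t1 : Tendsto (fun u : E × E × ℝ => (x, u.1)) (𝓝 (0, 0, z)) (𝓝 (x, 0)) :=
      Continuous.tendsto' (by fun_prop) _ _ rfl
    have t2 : Tendsto (fun u : E × E × ℝ => (h • ζ, u.2.1)) (𝓝 (0, 0, z)) (𝓝 (h • ζ, 0)) :=
      Continuous.tendsto' (by fun_prop) _ _ rfl
    have t3 : Tendsto (fun u : E × E × ℝ => (u.1, m (h • ζ, u.2.1))) (𝓝 (0, 0, z))
        (𝓝 (0, h • ζ)) := by
      have t4 : Tendsto (fun u : E × E × ℝ => u.1) (𝓝 (0, 0, z)) (𝓝 0) :=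
        Continuous.tendsto' (by fun_prop) _ _ rfl
      have t5 : Tendsto (fun u : E × E × ℝ => u.2.1) (𝓝 (0, 0, z)) (𝓝 0) :=
        Continuous.tendsto' (by fun_prop) _ _ rfl
      have t6 := e5''.continuousAt.tendsto
      rw [e5'] at t6
      exact t4.prodMk_nhds (t6.comp t5)
    have t7 : Tendsto (fun u => (h, φ u)) (𝓝 (0, 0, z)) (𝓝 (h, (x, ζ, z))) :=
      tendsto_const_nhds.prodMk_nhds hφt
    filter_upwards [t1.eventually e7, t2.eventually e8, t3.eventually e9, t7.eventually e6]
      with u f1 f2 f3 f4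
    have f5 := hℓ.eq _ _ _ _ hq f4
    simp only [φ] at f5
    rw [smul_inv_smul₀ hq.ne', f3, f2, f1, ← mul_assoc a, mul_assoc _ (R u.1),
      mul_inv_cancel_left, ← mul_assoc] at f5
    rw [f5]
    simp only [hℓ', chartDiscrete, φ]
    rw [f1, mul_assoc]
  all_goals rw [e1]
  · refine ContinuousLinearMap.ext fun u => ?_
    have c1 := covector_apply (slopeD (hadamard ℓ') (h, x, ζ, z)) (leftD m x u)
      (h⁻¹ • (leftD m (h • ζ) 0 - rightD m (h • ζ) u)) 0
    show h * slopeD (hadamard ℓ') (h, x, ζ, z) (leftD m x u,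
      h⁻¹ • (leftD m (h • ζ) 0 - rightD m (h • ζ) u), 0) = -(dV (slopeD (hadamard ℓ') (h, x, ζ, z))
        (rightD m (h • ζ) u) - h * dX (slopeD (hadamard ℓ') (h, x, ζ, z)) (leftD m x u))
    rw [c1, map_zero, zero_sub, map_smul, map_neg, smul_eq_mul]
    field_simp
    ring
  · refine ContinuousLinearMap.ext fun u => ?_
    have c1 := covector_apply (slopeD (hadamard ℓ') (h, x, ζ, z)) (leftD m x 0)
      (h⁻¹ • (leftD m (h • ζ) u - rightD m (h • ζ) 0)) 0
    show h * slopeD (hadamard ℓ') (h, x, ζ, z) (leftD m x 0,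
      h⁻¹ • (leftD m (h • ζ) u - rightD m (h • ζ) 0), 0) = dV (slopeD (hadamard ℓ') (h, x, ζ, z))
        (leftD m (h • ζ) u)
    rw [c1, map_zero, map_zero, map_zero, sub_zero, map_smul, smul_eq_mul]
    field_simp
    ring
  · have c1 := covector_apply (slopeD (hadamard ℓ') (h, x, ζ, z)) (leftD m x 0)
      (h⁻¹ • (leftD m (h • ζ) 0 - rightD m (h • ζ) 0)) 1
    show h * slopeD (hadamard ℓ') (h, x, ζ, z) (leftD m x 0,
      h⁻¹ • (leftD m (h • ζ) 0 - rightD m (h • ζ) 0), 1) =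
        (1 + h * dZ (slopeD (hadamard ℓ') (h, x, ζ, z))) - 1
    rw [c1]
    simp

omit [FiniteDimensional ℝ E] in
/-- The equations of a discrete step in terms of the differential of the discrete Lagrangian. -/
lemma HasStepDeriv.isDiscreteStep_iff (hc : IsGroupChart R Rinv) {h : ℝ} {y₀ y₁ : State E G}
    {D : E × E × ℝ →L[ℝ] ℝ} (hD : HasStepDeriv R Ld h y₀.1 y₁.1 y₀.2.2 D) :
    IsDiscreteStep R Ld h y₀ y₁ ↔ y₁.2.1 = dV D ∧ (1 + dZ D) • y₀.2.1 = -dX D ∧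
      y₁.2.2 = y₀.2.2 + Ld h y₀.1 y₁.1 y₀.2.2 := by
  obtain ⟨g₀, p₀, z₀⟩ := y₀
  obtain ⟨g₁, p₁, z₁⟩ := y₁
  simp only at hD ⊢
  have h2 : HasFDerivAt (fun η : E => generatingFunction R Ld h g₁ p₁ g₀ η z₀) (dV D - p₁) 0 := by
    have h1 : HasFDerivAt (fun η : E => ((0 : E), η, z₀))
        ((ContinuousLinearMap.inr ℝ E (E × ℝ)).comp (ContinuousLinearMap.inl ℝ E ℝ)) 0 :=
      HasFDerivAt.comp (0 : E) (hasFDerivAt_prodMk_right (0 : E) ((0 : E), z₀))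
        (hasFDerivAt_prodMk_left (0 : E) z₀)
    have h3 := HasFDerivAt.comp (0 : E) (f := fun η : E => ((0 : E), η, z₀)) hD h1
    refine ((h3.const_add z₀).sub p₁.hasFDerivAt).congr_of_eventuallyEq
      (Eventually.of_forall fun η => ?_)
    simp [generatingFunction, hc.map_zero]
  have h3 : HasLeftDerivAt (fun g : G => generatingFunction R Ld h g₁ p₁ g 0 z₀) (dX D) g₀ := by
    refine hc.hasMFDerivAt_one_iff.2 ?_
    have h1 := HasFDerivAt.comp (0 : E) (f := fun u : E => (u, ((0 : E), z₀))) hD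
      (hasFDerivAt_prodMk_left (0 : E) ((0 : E), z₀))
    refine (h1.const_add z₀).congr_of_eventuallyEq (Eventually.of_forall fun η => ?_)
    simp [generatingFunction]
  have h4 : HasDerivAt (fun z : ℝ => generatingFunction R Ld h g₁ p₁ g₀ 0 z) (1 + dZ D) z₀ := by
    have h1 : HasDerivAt (fun z : ℝ => ((0 : E), ((0 : E), z))) (0, 0, 1) z₀ :=
      (hasDerivAt_const z₀ (0 : E)).prodMk ((hasDerivAt_const z₀ (0 : E)).prodMk (hasDerivAt_id z₀))
    have h5 := HasFDerivAt.comp_hasDerivAt z₀ (l := fun u : E × E × ℝ =>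
      Ld h (g₀ * R u.1) (g₁ * R u.2.1) u.2.2) (f := fun z => ((0 : E), ((0 : E), z))) hD h1
    refine ((hasDerivAt_id z₀).add h5).congr_of_eventuallyEq (Eventually.of_forall fun z => ?_)
    simp [generatingFunction, hc.map_zero]
  have h5 : generatingFunction R Ld h g₁ p₁ g₀ 0 z₀ = z₀ + Ld h g₀ g₁ z₀ := by
    simp [generatingFunction, hc.map_zero]
  rw [IsDiscreteStep]
  simp only [h5]
  constructor
  · rintro ⟨c, c1, c2, c3, c4⟩
    have d1 := c1.unique h2
    have d2 : c = 1 + dZ D := c3.unique h4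
    have d3 : -(c • p₀) = dX D :=
      (hc.hasMFDerivAt_one_iff.1 c2).unique (hc.hasMFDerivAt_one_iff.1 h3)
    exact ⟨(sub_eq_zero.1 d1.symm).symm, by rw [← d2, ← d3, neg_neg], c4⟩
  · rintro ⟨d1, d2, d3⟩
    refine ⟨1 + dZ D, ?_, ?_, h4, d3⟩
    · subst d1
      rwa [sub_self] at h2
    · rw [d2, neg_neg]; exact h3

end StepDerivative

/-! ### The discrete Herglotz principle -/

section Herglotz

variable {E : Type*} [NormedAddCommGroup E] [NormedSpace ℝ E]
  {G : Type*} [TopologicalSpace G] [ChartedSpace E G] [Group G]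
  {R : E → G} {Rinv : G → E} {Ld : ℝ → G → G → ℝ → ℝ} {h : ℝ} {gs gs' : ℕ → G} {z₀ : ℝ} {N : ℕ}

omit [TopologicalSpace G] [ChartedSpace E G] [Group G] in
lemma herglotzCost_congr : ∀ i, (∀ j ≤ i, gs j = gs' j) →
    herglotzCost Ld h gs z₀ i = herglotzCost Ld h gs' z₀ i
  | 0, _ => rfl
  | i + 1, hj => by
    rw [herglotzCost, herglotzCost, herglotzCost_congr i fun j hij => hj j (by omega),
      hj i (by omega), hj (i + 1) le_rfl]

omit [TopologicalSpace G] [ChartedSpace E G] in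
lemma HasStepDeriv.hasFDerivAt_comp {g g' : G} {z : ℝ} {D : E × E × ℝ →L[ℝ] ℝ}
    (hD : HasStepDeriv R Ld h g g' z D) {a b : E → E} {a' b' : E →L[ℝ] E} {f : E → ℝ}
    {f' : E →L[ℝ] ℝ} (ha : HasFDerivAt a a' 0) (hb : HasFDerivAt b b' 0) (hf : HasFDerivAt f f' 0)
    (ha0 : a 0 = 0) (hb0 : b 0 = 0) (hf0 : f 0 = z) :
    HasFDerivAt (fun u => Ld h (g * R (a u)) (g' * R (b u)) (f u))
      ((dX D).comp a' + (dV D).comp b' + dZ D • f') 0 := by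
  have h1 := HasFDerivAt.comp (g := fun u : E × E × ℝ => Ld h (g * R u.1) (g' * R u.2.1) u.2.2)
    (g' := D) (f := fun u => (a u, b u, f u)) (0 : E) (by rw [ha0, hb0, hf0]; exact hD)
    (ha.prodMk (hb.prodMk hf))
  refine h1.congr_fderiv (ContinuousLinearMap.ext fun u => ?_)
  show D (a' u, b' u, f' u) = dX D (a' u) + dV D (b' u) + dZ D * f' u
  rw [covector_apply, mul_comm]

variable [LieGroup 𝓘(ℝ, E) ∞ G]

omit [TopologicalSpace G] [ChartedSpace E G] [LieGroup 𝓘(ℝ, E) ∞ G] in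
/-- The variation of an interior node changes the final cost by a positive multiple of the
discrete Herglotz expression `(1 + ∂_z L_d) D_2 L_d + D_1 L_d` at that node: the factor is the
product of the `1 + ∂_z L_d` of the later steps. -/
lemma exists_hasFDerivAt_herglotzCost (hR : R 0 = 1) {D : ℕ → E × E × ℝ →L[ℝ] ℝ}
    (hD : ∀ k < N, HasStepDeriv R Ld h (gs k) (gs (k + 1)) (herglotzCost Ld h gs z₀ k) (D k))
    (hpos : ∀ k < N, 0 < 1 + dZ (D k)) {j : ℕ} (hj : j + 1 < N) :
    ∃ c : ℝ, 0 < c ∧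
      HasFDerivAt (fun u => herglotzCost Ld h (Function.update gs (j + 1) (gs (j + 1) * R u)) z₀ N)
        (c • ((1 + dZ (D (j + 1))) • dV (D j) + dX (D (j + 1)))) 0 := by
  set w := (1 + dZ (D (j + 1))) • dV (D j) + dX (D (j + 1))
  set cost : ℕ → E → ℝ := fun i u =>
    herglotzCost Ld h (Function.update gs (j + 1) (gs (j + 1) * R u)) z₀ i with hcost
  have hc0 : ∀ i, cost i 0 = herglotzCost Ld h gs z₀ i := fun i => by
    simp only [hcost, hR, mul_one, Function.update_eq_self]
  have hsucc : ∀ i u, cost (i + 1) u = cost i u +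
      Ld h (Function.update gs (j + 1) (gs (j + 1) * R u) i)
        (Function.update gs (j + 1) (gs (j + 1) * R u) (i + 1)) (cost i u) := fun i u => rfl
  have hj0 : ∀ u, cost j u = herglotzCost Ld h gs z₀ j := fun u =>
    herglotzCost_congr j fun i hi => Function.update_of_ne (by omega) _ _
  have hz : HasFDerivAt (fun _ : E => (0 : E)) (0 : E →L[ℝ] E) 0 := hasFDerivAt_const _ _
  have hid : HasFDerivAt (fun u : E => u) (ContinuousLinearMap.id ℝ E) 0 := hasFDerivAt_id _
  have h1 : HasFDerivAt (cost (j + 1)) (dV (D j)) 0 := by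
    have h2 := (hD j (by omega)).hasFDerivAt_comp hz hid
      (hasFDerivAt_const (herglotzCost Ld h gs z₀ j) (0 : E)) rfl rfl rfl
    refine ((h2.const_add (herglotzCost Ld h gs z₀ j)).congr_fderiv ?_).congr_of_eventuallyEq
      (Eventually.of_forall fun u => ?_)
    · simp
    · rw [hsucc, hj0, Function.update_self, Function.update_of_ne (by omega)]
      simp [hR]
  have h2 : HasFDerivAt (cost (j + 1 + 1)) w 0 := by
    have h3 := (hD (j + 1) hj).hasFDerivAt_comp hid hz h1 rfl rfl (hc0 _)
    refine ((h1.add h3).congr_fderiv ?_).congr_of_eventuallyEq (Eventually.of_forall fun u => ?_)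
    · simp only [w, ContinuousLinearMap.comp_id, ContinuousLinearMap.comp_zero, add_smul, one_smul]
      abel
    · rw [hsucc, Function.update_self, Function.update_of_ne (by omega)]
      simp [hR]
  have h4 : ∀ i, j + 1 + 1 ≤ i → i ≤ N → ∃ c : ℝ, 0 < c ∧ HasFDerivAt (cost i) (c • w) 0 := by
    intro i hi
    induction i, hi using Nat.le_induction with
    | base => exact fun _ => ⟨1, one_pos, by rwa [one_smul]⟩
    | succ i hi ih =>
      intro hiN
      obtain ⟨c, hc, hcd⟩ := ih (by omega)
      have h5 := (hD i (by omega)).hasFDerivAt_comp hz hz hcd rfl rfl (hc0 _)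
      refine ⟨(1 + dZ (D i)) * c, mul_pos (hpos i (by omega)) hc,
        ((hcd.add h5).congr_fderiv ?_).congr_of_eventuallyEq (Eventually.of_forall fun u => ?_)⟩
      · simp only [ContinuousLinearMap.comp_zero, zero_add, add_mul, one_mul, add_smul, mul_smul]
      · rw [hsucc, Function.update_of_ne (by omega), Function.update_of_ne (by omega)]
        simp [hR]
  exact h4 N hj le_rfl

/-- The discrete Herglotz principle and the generating function define the same discrete curves as
soon as `1 + ∂_z L_d > 0` along the curve. -/
lemma discreteHerglotz_iff (hc : IsGroupChart R Rinv)
    (hD : ∀ k < N, ∃ D, HasStepDeriv R Ld h (gs k) (gs (k + 1)) (herglotzCost Ld h gs z₀ k) D ∧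
      0 < 1 + dZ D) :
    DiscreteHerglotzPrinciple (E := E) Ld h N gs z₀ ↔
      ∃ p : ℕ → (E →L[ℝ] ℝ), ∀ k < N, IsDiscreteStep R Ld h
        (gs k, p k, herglotzCost Ld h gs z₀ k)
        (gs (k + 1), p (k + 1), herglotzCost Ld h gs z₀ (k + 1)) := by
  have hD' : ∀ k, ∃ D : E × E × ℝ →L[ℝ] ℝ, k < N →
      HasStepDeriv R Ld h (gs k) (gs (k + 1)) (herglotzCost Ld h gs z₀ k) D ∧ 0 < 1 + dZ D :=
    fun k => by
      by_cases hk : k < N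
      · obtain ⟨D, h1⟩ := hD k hk
        exact ⟨D, fun _ => h1⟩
      · exact ⟨0, fun h => absurd h hk⟩
  choose D hD using hD'
  have hiff : ∀ (p : ℕ → E →L[ℝ] ℝ), ∀ k < N, (IsDiscreteStep R Ld h
      (gs k, p k, herglotzCost Ld h gs z₀ k)
      (gs (k + 1), p (k + 1), herglotzCost Ld h gs z₀ (k + 1)) ↔
        p (k + 1) = dV (D k) ∧ (1 + dZ (D k)) • p k = -dX (D k)) := fun p k hk => by
    rw [HasStepDeriv.isDiscreteStep_iff hc (y₀ := (gs k, p k, herglotzCost Ld h gs z₀ k))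
      (y₁ := (gs (k + 1), p (k + 1), herglotzCost Ld h gs z₀ (k + 1))) (hD k hk).1]
    exact ⟨fun h => ⟨h.1, h.2.1⟩, fun h => ⟨h.1, h.2, rfl⟩⟩
  -- stationarity at an interior node is the discrete Herglotz equation at that node
  have hnode : ∀ j, j + 1 < N → (HasLeftDerivAt (E := E)
      (fun x => herglotzCost Ld h (Function.update gs (j + 1) x) z₀ N - z₀) 0 (gs (j + 1)) ↔
        (1 + dZ (D (j + 1))) • dV (D j) + dX (D (j + 1)) = 0) := fun j hj => by
    obtain ⟨c, hcpos, hcd⟩ := exists_hasFDerivAt_herglotzCost (z₀ := z₀) hc.map_zero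
      (fun k hk => (hD k hk).1) (fun k hk => (hD k hk).2) hj
    have h1 := hcd.sub_const z₀
    refine hc.hasMFDerivAt_one_iff.trans ⟨fun h2 => ?_, fun h2 => ?_⟩
    · exact (smul_eq_zero.1 (h1.unique h2)).resolve_left hcpos.ne'
    · rwa [h2, smul_zero] at h1
  constructor
  · intro hH
    -- `p₀` is determined by the first step, the other momenta are final momenta of the steps
    let p : ℕ → E →L[ℝ] ℝ := fun k => Nat.casesOn k ((1 + dZ (D 0))⁻¹ • -dX (D 0)) fun j => dV (D j)
    refine ⟨p, fun k hk => (hiff p k hk).2 ⟨rfl, ?_⟩⟩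
    cases k with
    | zero => exact smul_inv_smul₀ (hD 0 hk).2.ne' _
    | succ j => exact eq_neg_of_add_eq_zero_left ((hnode j hk).1 (hH (j + 1) j.succ_pos hk))
  · rintro ⟨p, hp⟩ k hk0 hkN
    obtain ⟨j, rfl⟩ := Nat.exists_eq_succ_of_ne_zero hk0.ne'
    have h1 := ((hiff p j (by omega)).1 (hp j (by omega))).1
    have h2 := ((hiff p (j + 1) hkN).1 (hp (j + 1) hkN)).2
    refine (hnode j hkN).2 ?_
    rw [← h1, h2, neg_add_cancel]

end Herglotz

section HerglotzCompact

variable {E : Type*} [NormedAddCommGroup E] [NormedSpace ℝ E] [FiniteDimensional ℝ E]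
  {G : Type*} [TopologicalSpace G] [ChartedSpace E G] [Group G] [LieGroup 𝓘(ℝ, E) ∞ G]
  {R : E → G} {Rinv : G → E} {L : G → E → ℝ → ℝ} {vel : State E G → E}
  {Ld : ℝ → G → G → ℝ → ℝ} {ℓ : ℝ × G × E × ℝ → ℝ} {W : Set (ℝ × G × E × ℝ)} {r : ℕ}

/-- For `h = 0` the discrete Lagrangian vanishes, and its derivative in `h` is the Lagrangian. -/
lemma IsExtension.eventually_chartDiscrete (hc : IsGroupChart R Rinv) (hL : IsSmoothLagrangian L)
    (hv : IsVelocity L vel) (hr : 0 < r) (hℓ : IsExtension R Ld ℓ W)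
    (hagree : AgreesWithExact L Ld (r + 1)) (a : G) (ξ : E) (z : ℝ) :
    ∀ᶠ w in 𝓝 ((0, ξ, z) : E × E × ℝ), chartDiscrete R ℓ a (0, w) = 0 ∧
      hadamard (chartDiscrete R ℓ a) (0, w) = chartLagrangian R L a w := by
  have hξ : velPt (chartVel R vel a) (0, momentum L a ξ z, z) = (0, ξ, z) := by
    rw [velPt, chartVel, hc.ofChart_zero, hv.vel_momentum]
  have h1 := eventually_lagrangian_of_agrees hc.isLocalGroup
    (hv.isLegendre hc hL a (momentum L a ξ z) z) hr
    (hℓ.contDiffAt_chartDiscrete hc a _ z) (hagree.flatAgrees hc hL hv hℓ a (momentum L a ξ z) z)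
  rwa [hξ] at h1

omit [FiniteDimensional ℝ E] in
/-- The coordinates of nearby points in the chart `x ↦ a R(x)`. -/
lemma IsGroupChart.tendsto_chart (hc : IsGroupChart R Rinv) {P : Type*} [TopologicalSpace P] (a : G)
    (b : P) : Tendsto (fun q : ℝ × (G × P) => (q.1, (Rinv (a⁻¹ * q.2.1), q.2.2)))
      (𝓝 (0, (a, b))) (𝓝 (0, (0, b))) := by
  have : IsTopologicalGroup G := topologicalGroup_of_lieGroup 𝓘(ℝ, E) ∞
  have h1 : Tendsto (fun q : ℝ × (G × P) => a⁻¹ * q.2.1) (𝓝 (0, (a, b))) (𝓝 1) :=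
    Continuous.tendsto' (by fun_prop) _ _ (by simp)
  have h2 : Tendsto (fun q : ℝ × (G × P) => q.1) (𝓝 (0, (a, b))) (𝓝 0) := continuous_fst.tendsto _
  have h3 : Tendsto (fun q : ℝ × (G × P) => q.2.2) (𝓝 (0, (a, b))) (𝓝 b) :=
    Continuous.tendsto' (by fun_prop) _ _ rfl
  exact h2.prodMk_nhds ((hc.tendsto_inv.comp h1).prodMk_nhds h3)

omit [FiniteDimensional ℝ E] in
lemma IsGroupChart.eventually_chart (hc : IsGroupChart R Rinv) {P : Type*} [TopologicalSpace P]
    (a : G) (b : P) :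
    ∀ᶠ q : ℝ × (G × P) in 𝓝 (0, (a, b)), a * R (Rinv (a⁻¹ * q.2.1)) = q.2.1 := by
  have : IsTopologicalGroup G := topologicalGroup_of_lieGroup 𝓘(ℝ, E) ∞
  have h1 : Tendsto (fun q : ℝ × (G × P) => a⁻¹ * q.2.1) (𝓝 (0, (a, b))) (𝓝 1) :=
    Continuous.tendsto' (by fun_prop) _ _ (by simp)
  filter_upwards [h1.eventually hc.right_inv] with q hq
  rw [hq, mul_inv_cancel_left]

/-- For small steps with velocities in a compact set, `1 + ∂_z L_d` is positive. -/
lemma IsExtension.eventually_exists_hasStepDeriv (hc : IsGroupChart R Rinv)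
    (hL : IsSmoothLagrangian L) (hv : IsVelocity L vel) (hr : 0 < r) (hℓ : IsExtension R Ld ℓ W)
    (hagree : AgreesWithExact L Ld (r + 1)) {S : Set (G × E × ℝ)} (hS : IsCompact S) :
    ∀ᶠ h in 𝓝 (0 : ℝ), ∀ s ∈ S, 0 < h → ∃ D,
      HasStepDeriv R Ld h s.1 (s.1 * R (h • s.2.1)) s.2.2 D ∧ 0 < 1 + dZ D := by
  refine hS.eventually_forall_of_forall_eventually (x₀ := (0 : ℝ))
    (P := fun h (s : G × E × ℝ) => 0 < h → ∃ D,
      HasStepDeriv R Ld h s.1 (s.1 * R (h • s.2.1)) s.2.2 D ∧ 0 < 1 + dZ D) ?_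
  rintro ⟨a, ξ, z⟩ -
  have h0 := hℓ.eventually_chartDiscrete hc hL hv hr hagree a ξ z
  have h1 := hℓ.eventually_hasStepDeriv hc (h0.mono fun w hw => hw.1)
  have h2 := eventually_stepScale_pos
    (contDiffAt_hadamard (hℓ.contDiffAt_chartDiscrete hc a ξ z))
  filter_upwards [(hc.tendsto_chart a (ξ, z)).eventually h1,
    (hc.tendsto_chart a (ξ, z)).eventually h2, hc.eventually_chart a (ξ, z)]
    with ⟨h, g, ζ, z⟩ e1 e2 e3 hh
  simp only at e1 e2 e3 hh ⊢
  obtain ⟨D, d1, -, -, d4⟩ := e1 hh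
  rw [e3] at d1
  refine ⟨D, d1, ?_⟩
  rw [d4]
  linarith

lemma discreteHerglotz_iff_of_isCompact (hc : IsGroupChart R Rinv)
    (hL : IsSmoothLagrangian L) (hv : IsVelocity L vel) (hr : 0 < r) (hℓ : IsExtension R Ld ℓ W)
    (hagree : AgreesWithExact L Ld (r + 1)) {K : Set (G × ℝ)} {B : Set E} (hK : IsCompact K)
    (hB : IsCompact B) : ∃ h₀ : ℝ, 0 < h₀ ∧ ∀ h ∈ Ioc 0 h₀, ∀ (N : ℕ) (gs : ℕ → G) (z₀ : ℝ),
      (∀ k ≤ N, (gs k, herglotzCost Ld h gs z₀ k) ∈ K) →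
      (∀ k < N, ∃ ξ ∈ B, gs (k + 1) = gs k * R (h • ξ)) →
      (DiscreteHerglotzPrinciple (E := E) Ld h N gs z₀ ↔
        ∃ p : ℕ → (E →L[ℝ] ℝ), ∀ k < N, IsDiscreteStep R Ld h
          (gs k, p k, herglotzCost Ld h gs z₀ k)
          (gs (k + 1), p (k + 1), herglotzCost Ld h gs z₀ (k + 1))) := by
  have hS : IsCompact ((fun q : (G × ℝ) × E => (q.1.1, q.2, q.1.2)) '' (K ×ˢ B)) :=
    (hK.prod hB).image (by fun_prop)
  obtain ⟨ε, hε, hev⟩ := Metric.eventually_nhds_iff.1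
    (hℓ.eventually_exists_hasStepDeriv hc hL hv hr hagree hS)
  refine ⟨ε / 2, half_pos hε, fun h hh N gs z₀ hgK hgB => discreteHerglotz_iff hc fun k hk => ?_⟩
  obtain ⟨ξ, hξ, hg⟩ := hgB k hk
  have h1 := hev (y := h) (by
    rw [Real.dist_0_eq_abs, abs_of_pos hh.1]; linarith [hh.2]) (gs k, ξ, herglotzCost Ld h gs z₀ k)
    ⟨((gs k, herglotzCost Ld h gs z₀ k), ξ), ⟨hgK k hk.le, hξ⟩, rfl⟩ hh.1
  rw [hg]
  exact h1

end HerglotzCompact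

/-! ### Well-posedness and local error on compact sets -/

section LocalStep

lemma eventually_forall_mem_of_eventually_prod {X Y : Type*} [TopologicalSpace X]
    [TopologicalSpace Y] {a : X} {b : Y} {P : X × Y → Prop} (h : ∀ᶠ u in 𝓝 (a, b), P u) :
    ∃ V ∈ 𝓝 b, ∀ᶠ x in 𝓝 a, ∀ y ∈ V, P (x, y) := by
  rw [nhds_prod_eq] at h
  obtain ⟨s, hs, t, ht, hst⟩ := Filter.mem_prod_iff.1 h
  exact ⟨t, ht, Filter.mem_of_superset hs fun x hx y hy => hst ⟨hx, hy⟩⟩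

variable {E : Type*} [NormedAddCommGroup E] [NormedSpace ℝ E] [FiniteDimensional ℝ E]
  {G : Type*} [TopologicalSpace G] [ChartedSpace E G] [Group G] [LieGroup 𝓘(ℝ, E) ∞ G]
  {R : E → G} {Rinv : G → E} {L : G → E → ℝ → ℝ} {vel : State E G → E}
  {Ld : ℝ → G → G → ℝ → ℝ} {ℓ : ℝ × G × E × ℝ → ℝ} {W : Set (ℝ × G × E × ℝ)} {r : ℕ}

/-- Discrete steps in the chart `x ↦ a R(x)`. -/
lemma IsExtension.eventually_isDiscreteStep_iff (hc : IsGroupChart R Rinv)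
    (hℓ : IsExtension R Ld ℓ W) {a : G} {ξ : E} {z : ℝ}
    (h0 : ∀ᶠ w in 𝓝 (0, ξ, z), chartDiscrete R ℓ a (0, w) = 0) :
    ∀ᶠ q in 𝓝 ((0 : ℝ), ((0, ξ, z) : E × E × ℝ)), 0 < q.1 → ∀ (p₀ : E →L[ℝ] ℝ) (y₁ : State E G),
      y₁.1 = a * R q.2.1 * R (q.1 • q.2.2.1) →
      (IsDiscreteStep R Ld q.1 (a * R q.2.1, p₀, q.2.2.2) y₁ ↔
        y₁.2.1 = finalMom (chartMul R Rinv) (hadamard (chartDiscrete R ℓ a)) q ∧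
        IsFlatStep (chartMul R Rinv) (hadamard (chartDiscrete R ℓ a)) q p₀ ∧
        y₁.2.2 = q.2.2.2 + chartDiscrete R ℓ a q) := by
  filter_upwards [hℓ.eventually_hasStepDeriv hc h0, hℓ.eventually_mem hc a ξ z]
    with q e1 e2 hq p₀ y₁ hy₁
  obtain ⟨D, d1, d2, d3, d4⟩ := e1 hq
  rw [← hy₁] at d1
  rw [HasStepDeriv.isDiscreteStep_iff hc (y₀ := (a * R q.2.1, p₀, q.2.2.2)) d1, d2, d3, d4, neg_neg,
    IsFlatStep, add_sub_cancel, hy₁, hℓ.eq _ _ _ _ hq e2]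
  rfl

/-- `y₁` is reached from `y₀` by a discrete step with discrete velocity `ξ`. -/
def IsStepWith (R : E → G) (Ld : ℝ → G → G → ℝ → ℝ) (h : ℝ) (ξ : E) (y₀ y₁ : State E G) : Prop :=
  IsDiscreteStep R Ld h y₀ y₁ ∧ y₁.1 = y₀.1 * R (h • ξ)

omit [FiniteDimensional ℝ E] in
lemma IsGroupChart.tendsto_pair_chart (hc : IsGroupChart R Rinv) (a : G) (p : E →L[ℝ] ℝ) (z : ℝ)
    (ξ : E) :
    Tendsto (fun u : (ℝ × State E G) × E =>
      ((u.1.1, (Rinv (a⁻¹ * u.1.2.1), u.2, u.1.2.2.2)) : ℝ × (E × E × ℝ)))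
      (𝓝 ((0, (a, p, z)), ξ)) (𝓝 (0, (0, ξ, z))) := by
  have h1 : Tendsto (fun u : (ℝ × State E G) × E => (u.1.1, (u.1.2.1, (u.2, u.1.2.2.2))))
      (𝓝 ((0, (a, p, z)), ξ)) (𝓝 (0, (a, (ξ, z)))) :=
    Continuous.tendsto' (by fun_prop) _ _ rfl
  exact (hc.tendsto_chart a (ξ, z)).comp h1

/-- For small `h`, the discrete velocities of the steps from states near `y` that lie in a given
compact set are close to the velocity of `y`: near any other velocity, the step equation forces a
different initial momentum. -/
lemma IsExtension.eventually_velocity_mem (hc : IsGroupChart R Rinv)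
    (hL : IsSmoothLagrangian L) (hv : IsVelocity L vel) (hr : 0 < r) (hℓ : IsExtension R Ld ℓ W)
    (hagree : AgreesWithExact L Ld (r + 1)) {B : Set E} (hB : IsCompact B) (y : State E G)
    {U : Set E} (hU : U ∈ 𝓝 (vel y)) :
    ∀ᶠ q in 𝓝 ((0 : ℝ), y), ∀ ξ ∈ B, 0 < q.1 → ∀ y₁, IsStepWith R Ld q.1 ξ q.2 y₁ → ξ ∈ U := by
  refine hB.eventually_forall_of_forall_eventually (x₀ := ((0 : ℝ), y))
    (P := fun q ξ => 0 < q.1 → ∀ y₁, IsStepWith R Ld q.1 ξ q.2 y₁ → ξ ∈ U) fun ξ _ => ?_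
  obtain ⟨a, p, z⟩ := y
  have tξ : Tendsto (fun u : (ℝ × State E G) × E => u.2) (𝓝 ((0, (a, p, z)), ξ)) (𝓝 ξ) :=
    continuous_snd.tendsto _
  by_cases hξ : ξ = vel (a, p, z)
  · filter_upwards [tξ.eventually_mem (by rwa [hξ])] with u hu _ _ _ using hu
  · have hne : momentum L a ξ z ≠ p := fun hp => hξ (by rw [← hp, hv.vel_momentum])
    have hp : dV (fderiv ℝ (chartLagrangian R L a) (0, ξ, z)) = momentum L a ξ z := by
      have h1 := (hv.isLegendre hc hL a (momentum L a ξ z) z).momentum_velocity.self_of_nhds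
      rwa [velPt, chartVel, hc.ofChart_zero, hv.vel_momentum] at h1
    obtain ⟨s, t, hs, ht, hst⟩ := t2_separation_nhds hne
    have h0 := hℓ.eventually_chartDiscrete hc hL hv hr hagree a ξ z
    have h1 := hℓ.eventually_isDiscreteStep_iff hc (h0.mono fun w hw => hw.1)
    have h2 := eventually_momentum_of_isFlatStep hc.isLocalGroup
      (contDiffAt_hadamard (hℓ.contDiffAt_chartDiscrete hc a ξ z)) (h0.mono fun w hw => hw.2)
      (s := s) (by rwa [hp])
    have tq := hc.tendsto_pair_chart a p z ξ
    have tp : Tendsto (fun u : (ℝ × State E G) × E => u.1.2.2.1) (𝓝 ((0, (a, p, z)), ξ)) (𝓝 p) :=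
      Continuous.tendsto' (by fun_prop) _ _ rfl
    have t1 : Tendsto (fun u : (ℝ × State E G) × E => u.1) (𝓝 ((0, (a, p, z)), ξ))
      (𝓝 (0, (a, p, z))) := continuous_fst.tendsto _
    filter_upwards [tq.eventually h1, tq.eventually h2, tp.eventually_mem ht,
      t1.eventually (hc.eventually_chart a (p, z))]
      with ⟨⟨h, g, p₀, z₀⟩, ζ⟩ e1 e2 e3 e4 hh y₁ hy
    exfalso
    simp only at e1 e2 e3 e4 hh hy
    rw [e4] at e1
    have h3 := ((e1 hh p₀ y₁ hy.2).1 hy.1).2.1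
    exact Set.disjoint_left.1 hst (e2 p₀ h3) e3

/-- Steps exist, with discrete velocity near the velocity. -/
lemma IsExtension.eventually_exists_isStepWith (hc : IsGroupChart R Rinv)
    (hL : IsSmoothLagrangian L) (hv : IsVelocity L vel) (hr : 0 < r) (hℓ : IsExtension R Ld ℓ W)
    (hagree : AgreesWithExact L Ld (r + 1)) (y : State E G) {V : Set E} (hV : V ∈ 𝓝 (vel y)) :
    ∀ᶠ q in 𝓝 ((0 : ℝ), y), 0 < q.1 → ∃ ξ ∈ V, ∃ y₁, IsStepWith R Ld q.1 ξ q.2 y₁ := by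
  obtain ⟨a, p, z⟩ := y
  have hξ : chartVel R vel a (0, p, z) = vel (a, p, z) := by rw [chartVel, hc.ofChart_zero]
  have hLeg := hv.isLegendre hc hL a p z
  have h0 := hℓ.eventually_chartDiscrete hc hL hv hr hagree a (vel (a, p, z)) z
  obtain ⟨V', hV', h1⟩ := eventually_forall_mem_of_eventually_prod
    ((hc.tendsto_pair_chart a p z (vel (a, p, z))).eventually
      (hℓ.eventually_isDiscreteStep_iff hc (h0.mono fun w hw => hw.1)))
  have hpt : velPt (chartVel R vel a) (0, p, z) = (0, vel (a, p, z), z) := by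
    rw [velPt, hξ]
  have h2 := eventually_exists_isFlatStep (lam := hadamard (chartDiscrete R ℓ a)) hc.isLocalGroup
    hLeg (by rw [hpt]; exact contDiffAt_hadamard (hℓ.contDiffAt_chartDiscrete hc a _ z))
    (by rw [hpt]; exact h0.mono fun w hw => hw.2) (V := V ∩ V')
    (by rw [hξ]; exact inter_mem hV hV')
  filter_upwards [h1, (hc.tendsto_chart a (p, z)).eventually h2, hc.eventually_chart a (p, z)]
    with ⟨h, g, p₀, z₀⟩ e1 e2 e3 hh
  obtain ⟨ξ, ⟨hξV, hξV'⟩, hstep⟩ := e2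
  simp only at hstep e3 hh
  have e4 := e1 ξ hξV' hh p₀ (g * R (h • ξ),
    finalMom (chartMul R Rinv) (hadamard (chartDiscrete R ℓ a)) (h, (Rinv (a⁻¹ * g), ξ, z₀)),
    z₀ + chartDiscrete R ℓ a (h, (Rinv (a⁻¹ * g), ξ, z₀)))
  dsimp only at e4
  rw [e3] at e4
  exact ⟨ξ, hξV, _, (e4 rfl).2 ⟨rfl, hstep, rfl⟩, rfl⟩

/-- Two steps from the same state with velocities near the velocity of that state are equal. -/
lemma IsExtension.exists_isStepWith_unique (hc : IsGroupChart R Rinv)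
    (hL : IsSmoothLagrangian L) (hv : IsVelocity L vel) (hr : 0 < r) (hℓ : IsExtension R Ld ℓ W)
    (hagree : AgreesWithExact L Ld (r + 1)) (y : State E G) :
    ∃ U ∈ 𝓝 (vel y), ∀ᶠ q in 𝓝 ((0 : ℝ), y), 0 < q.1 → ∀ ξ ∈ U, ∀ ξ' ∈ U, ∀ y₁ y₁',
      IsStepWith R Ld q.1 ξ q.2 y₁ → IsStepWith R Ld q.1 ξ' q.2 y₁' → y₁ = y₁' := by
  obtain ⟨a, p, z⟩ := y
  have hξ : chartVel R vel a (0, p, z) = vel (a, p, z) := by rw [chartVel, hc.ofChart_zero]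
  have hLeg := hv.isLegendre hc hL a p z
  have h0 := hℓ.eventually_chartDiscrete hc hL hv hr hagree a (vel (a, p, z)) z
  have hpt : velPt (chartVel R vel a) (0, p, z) = (0, vel (a, p, z), z) := by
    rw [velPt, hξ]
  have hlam := contDiffAt_hadamard (hℓ.contDiffAt_chartDiscrete hc a (vel (a, p, z)) z)
  obtain ⟨U₁, hU₁, hLip⟩ := exists_norm_sub_le_stepVel (lam := hadamard (chartDiscrete R ℓ a))
    hc.isLocalGroup hLeg (by rw [hpt]; exact hlam) (by rw [hpt]; exact h0.mono fun w hw => hw.2)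
  rw [hpt] at hU₁
  have tq := hc.tendsto_pair_chart a p z (vel (a, p, z))
  have tw : Tendsto (fun u : (ℝ × State E G) × E =>
      ((Rinv (a⁻¹ * u.1.2.1), u.2, u.1.2.2.2) : E × E × ℝ))
      (𝓝 ((0, (a, p, z)), vel (a, p, z))) (𝓝 (0, vel (a, p, z), z)) := tq.snd_nhds
  obtain ⟨U, hU, h1⟩ := eventually_forall_mem_of_eventually_prod
    (((tq.eventually (hℓ.eventually_isDiscreteStep_iff hc (h0.mono fun w hw => hw.1))).and
      (tq.eventually (eventually_isFlatStep_iff (m := chartMul R Rinv) hlam))).and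
        (tw.eventually_mem hU₁))
  have t1 : Tendsto (fun q : ℝ × State E G => q.1) (𝓝 (0, (a, p, z))) (𝓝 0) :=
    continuous_fst.tendsto _
  refine ⟨U, hU, ?_⟩
  filter_upwards [h1, hc.eventually_chart a (p, z), t1.eventually hLip]
    with ⟨h, g, p₀, z₀⟩ e1 e2 e3 hh ξ hξU ξ' hξU' y₁ y₁' hy hy'
  obtain ⟨⟨f1, f2⟩, f3⟩ := e1 ξ hξU
  obtain ⟨⟨f1', f2'⟩, f3'⟩ := e1 ξ' hξU'
  simp only at e2 hh f1 f1' f2 f2' f3 f3' hy hy' e3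
  rw [e2] at f1 f1'
  obtain ⟨g1, g2, g3⟩ := (f1 hh p₀ y₁ hy.2).1 hy.1
  obtain ⟨g1', g2', g3'⟩ := (f1' hh p₀ y₁' hy'.2).1 hy'.1
  have h4 := e3 _ ξ ξ' z₀ f3 f3'
  rw [stepVel, stepVel, (f2 p₀).1 g2, (f2' p₀).1 g2', sub_self, norm_zero, mul_zero,
    norm_le_zero_iff, sub_eq_zero] at h4
  subst h4
  exact Prod.ext (hy.2.trans hy'.2.symm) (Prod.ext (g1.trans g1'.symm) (g3.trans g3'.symm))

/-- For short times the exact solution exists and stays in the chart. -/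
lemma eventually_exists_flatSolution (hc : IsGroupChart R Rinv)
    (hL : IsSmoothLagrangian L) (hv : IsVelocity L vel) (a : G) (p : E →L[ℝ] ℝ) (z : ℝ)
    {V : Set (FlatState E)} (hV : V ∈ 𝓝 ((0, p, z) : FlatState E)) :
    ∀ᶠ q in 𝓝 ((0 : ℝ), ((a, p, z) : State E G)), 0 < q.1 → ∃ Y : ℝ → FlatState E,
      Y 0 = toChart Rinv a q.2 ∧
      (∀ t ∈ Icc 0 q.1, Y t ∈ V ∧
        HasDerivWithinAt Y (chartField R Rinv L vel a (Y t)) (Icc 0 q.1) t) ∧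
      ∃ (g : ℝ → G) (ξ : ℝ → E) (z : ℝ → ℝ), IsEPHSolution L q.1 g ξ z ∧
        phaseState L g ξ z 0 = q.2 ∧ ∀ t, phaseState L g ξ z t = ofChart R a (Y t) := by
  obtain ⟨U, hU, hsol⟩ := eventually_isEPHSolution_ofChart hc hL hv a p z
  have h1 := eventually_exists_solution
    (contDiffAt_infty.1 (contDiffAt_chartField hc hL hv a p z) 1) (inter_mem hV hU)
  filter_upwards [(hc.tendsto_chart a (p, z)).eventually h1, hc.eventually_chart a (p, z)]
    with q e1 e2 hq
  obtain ⟨Y, hY0, hY⟩ := e1 hq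
  have hph : ∀ t, phaseState L (fun t => a * R (Y t).1) (fun t => chartVel R vel a (Y t))
      (fun t => (Y t).2.2) t = ofChart R a (Y t) := fun t => by
    have h2 := hv.momentum_vel (ofChart R a (Y t))
    exact Prod.ext rfl (Prod.ext h2 rfl)
  refine ⟨Y, hY0, fun t ht => ⟨(hY t ht).1.1, (hY t ht).2⟩, _, _, _,
    hsol q.1 Y fun t ht => ⟨(hY t ht).1.2, (hY t ht).2⟩, ?_, hph⟩
  rw [hph, hY0, ofChart]
  exact Prod.ext e2 rfl

/-- The error of a step with velocity near the velocity of the initial state. -/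
lemma IsExtension.exists_isStepWith_error [T2Space G] (hc : IsGroupChart R Rinv)
    (hL : IsSmoothLagrangian L) (hv : IsVelocity L vel) (hr : 0 < r) (hℓ : IsExtension R Ld ℓ W)
    (hagree : AgreesWithExact L Ld (r + 1)) (y : State E G) :
    ∃ U ∈ 𝓝 (vel y), ∃ C : ℝ, ∀ᶠ q in 𝓝 ((0 : ℝ), y), 0 < q.1 → ∀ ξ ∈ U, ∀ y₁,
      IsStepWith R Ld q.1 ξ q.2 y₁ → ∀ (g : ℝ → G) (ξ : ℝ → E) (z : ℝ → ℝ),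
        IsEPHSolution L q.1 g ξ z → phaseState L g ξ z 0 = q.2 →
          ErrorLE R (C * q.1 ^ (r + 1)) y₁ (phaseState L g ξ z q.1) := by
  obtain ⟨a, p, z⟩ := y
  have hξ : chartVel R vel a (0, p, z) = vel (a, p, z) := by rw [chartVel, hc.ofChart_zero]
  have hLeg := hv.isLegendre hc hL a p z
  have h0 := hℓ.eventually_chartDiscrete hc hL hv hr hagree a (vel (a, p, z)) z
  have hpt : velPt (chartVel R vel a) (0, p, z) = (0, vel (a, p, z), z) := by
    rw [velPt, hξ]
  have hG := hc.isLocalGroup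
  obtain ⟨V, C, hV, hC0, hC⟩ := exists_flatStep_error hG hLeg hr
    (by rw [hpt]; exact hℓ.contDiffAt_chartDiscrete hc a _ z)
    (hagree.flatAgrees hc hL hv hℓ a p z)
  rw [hξ] at hC
  have hdiv := hc.eventually_map_div
  rw [nhds_prod_eq] at hdiv
  obtain ⟨O, hO, hOdiv⟩ := Filter.eventually_prod_self_iff'.1 hdiv
  have tx : Tendsto (fun Y : FlatState E => Y.1) (𝓝 (0, p, z)) (𝓝 0) := continuous_fst.tendsto _
  have tq := hc.tendsto_pair_chart a p z (vel (a, p, z))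
  have tm : Tendsto (fun q : ℝ × (E × E × ℝ) => (q.2.1, q.1 • q.2.2.1))
      (𝓝 (0, (0, vel (a, p, z), z))) (𝓝 (0, 0)) :=
    Continuous.tendsto' (by fun_prop) _ _ (by simp)
  have tu : Tendsto (fun u : (ℝ × State E G) × E => ((u.1.1, toChart Rinv a u.1.2), u.2))
      (𝓝 ((0, (a, p, z)), vel (a, p, z))) (𝓝 ((0, (0, p, z)), vel (a, p, z))) :=
    ((hc.tendsto_chart a (p, z)).comp (continuous_fst.tendsto _)).prodMk_nhds
      (continuous_snd.tendsto _)
  obtain ⟨U, hU, h1⟩ := eventually_forall_mem_of_eventually_prod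
    (((tq.eventually (hℓ.eventually_isDiscreteStep_iff hc (h0.mono fun w hw => hw.1))).and
      (tu.eventually hC)).and (tq.eventually ((tm.eventually hc.eventually_map_mul).and
        ((hG.tendsto_mul.comp tm).eventually_mem hO))))
  refine ⟨U, hU, C, ?_⟩
  filter_upwards [h1, hc.eventually_chart a (p, z),
    eventually_exists_flatSolution hc hL hv a p z (inter_mem hV (tx.eventually_mem hO))]
    with ⟨h, g₀, p₀, z₀⟩ e1 e2 e3 hh ξ hξU y₁ hy g ξs zs hs hs0
  obtain ⟨⟨f1, f2⟩, f3, f4⟩ := e1 ξ hξU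
  simp only at e2 hh f1 f2 f3 f4 hy e3 hs hs0 ⊢
  obtain ⟨Y, hY0, hY, g', ξ', z', hs', hs0', hph⟩ := e3 hh
  rw [e2] at f1
  obtain ⟨g1, g2, g3⟩ := (f1 hh p₀ y₁ hy.2).1 hy.1
  have hhm : h ∈ Icc 0 h := right_mem_Icc.2 hh.le
  rw [hs.phaseState_unique hc hL hv hs' (hs0.trans hs0'.symm) h hhm, hph]
  obtain ⟨k1, k2, k3⟩ := f2 hh g2 Y hY0 fun t ht => ⟨(hY t ht).1.1, (hY t ht).2⟩
  refine ⟨⟨_, k1, ?_⟩, by rw [g1]; exact k2, by rw [g3]; exact k3⟩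
  have h2 := hOdiv _ (hY h hhm).1.2 _ f4
  simp only [Function.comp_apply] at h2
  change y₁.1 = a * R (Y h).1 * R (chartDiv R Rinv ((Y h).1,
    chartMul R Rinv (Rinv (a⁻¹ * g₀), h • ξ)))
  rw [h2, hy.2, f3]
  simp only [mul_assoc, mul_inv_cancel_left]
  rw [← mul_assoc, e2]

end LocalStep

section CompactSteps

/-- A local statement with a constant holds on compact sets. -/
lemma _root_.IsCompact.exists_eventually_forall_of_mono {X : Type*} [TopologicalSpace X] {K : Set X}
    (hK : IsCompact K) {P : ℝ → ℝ → X → Prop} (hmono : ∀ C C' h y, C ≤ C' → P C h y → P C' h y)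
    (hP : ∀ y ∈ K, ∃ C, ∀ᶠ q in 𝓝 ((0 : ℝ), y), P C q.1 q.2) :
    ∃ C, ∀ᶠ h in 𝓝 (0 : ℝ), ∀ y ∈ K, P C h y := by
  refine hK.induction_on (p := fun s => ∃ C, ∀ᶠ h in 𝓝 (0 : ℝ), ∀ y ∈ s, P C h y)
    ⟨0, Eventually.of_forall fun h y hy => hy.elim⟩
    (fun s t hst ⟨C, hC⟩ => ⟨C, hC.mono fun h hh y hy => hh y (hst hy)⟩)
    (fun s t ⟨C, hC⟩ ⟨C', hC'⟩ => ⟨max C C', ?_⟩) fun y hy => ?_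
  · filter_upwards [hC, hC'] with h h1 h2 y hy
    exact hy.elim (fun h3 => hmono _ _ _ _ (le_max_left _ _) (h1 y h3))
      fun h3 => hmono _ _ _ _ (le_max_right _ _) (h2 y h3)
  · obtain ⟨C, hC⟩ := hP y hy
    obtain ⟨V, hV, h1⟩ := eventually_forall_mem_of_eventually_prod hC
    exact ⟨V, mem_nhdsWithin_of_mem_nhds hV, C, h1⟩

variable {E : Type*} [NormedAddCommGroup E] [NormedSpace ℝ E]
  {G : Type*} [TopologicalSpace G] [ChartedSpace E G] [Group G]
  {R : E → G} {Rinv : G → E} {L : G → E → ℝ → ℝ} {vel : State E G → E}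
  {Ld : ℝ → G → G → ℝ → ℝ} {ℓ : ℝ × G × E × ℝ → ℝ} {W : Set (ℝ × G × E × ℝ)} {r : ℕ}

omit [TopologicalSpace G] [ChartedSpace E G] in
lemma ErrorLE.mono {ε ε' : ℝ} {y y' : State E G} (h : ErrorLE R ε y y') (hε : ε ≤ ε') :
    ErrorLE R ε' y y' := by
  obtain ⟨⟨η, h1, h2⟩, h3, h4⟩ := h
  exact ⟨⟨η, h1.trans hε, h2⟩, h3.trans hε, h4.trans hε⟩

/-- What holds for steps of length `h` from the state `y` with discrete velocity in `B`: a step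
exists, the exact solution exists, the step is unique and its error is at most `C h^(r+1)`. -/
structure IsStepRegular (L : G → E → ℝ → ℝ) (R : E → G) (Ld : ℝ → G → G → ℝ → ℝ)
    (vel : State E G → E) (r : ℕ) (B : Set E) (C h : ℝ) (y : State E G) : Prop where
  exists_step : ∃ ξ ∈ Metric.closedBall (vel y) 1, ∃ y₁, IsStepWith R Ld h ξ y y₁
  exists_solution : ∃ (g : ℝ → G) (ξ : ℝ → E) (z : ℝ → ℝ), IsEPHSolution L h g ξ z ∧
    phaseState L g ξ z 0 = y
  unique : ∀ ξ ∈ B, ∀ ξ' ∈ B, ∀ y₁ y₁', IsStepWith R Ld h ξ y y₁ → IsStepWith R Ld h ξ' y y₁' →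
    y₁ = y₁'
  error : ∀ ξ ∈ B, ∀ y₁, IsStepWith R Ld h ξ y y₁ → ∀ (g : ℝ → G) (ξ : ℝ → E) (z : ℝ → ℝ),
    IsEPHSolution L h g ξ z → phaseState L g ξ z 0 = y →
      ErrorLE R (C * h ^ (r + 1)) y₁ (phaseState L g ξ z h)

variable [FiniteDimensional ℝ E] [LieGroup 𝓘(ℝ, E) ∞ G] [T2Space G]

lemma IsExtension.exists_isStepRegular (hc : IsGroupChart R Rinv)
    (hL : IsSmoothLagrangian L) (hv : IsVelocity L vel) (hr : 0 < r) (hℓ : IsExtension R Ld ℓ W)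
    (hagree : AgreesWithExact L Ld (r + 1)) {K : Set (State E G)} (hK : IsCompact K) {B : Set E}
    (hB : IsCompact B) : ∃ C h₀ : ℝ, 0 < h₀ ∧ ∀ h ∈ Ioc 0 h₀, ∀ y ∈ K,
      IsStepRegular L R Ld vel r B C h y := by
  have key : ∃ C, ∀ᶠ h in 𝓝 (0 : ℝ), ∀ y ∈ K, 0 < h → IsStepRegular L R Ld vel r B C h y := by
    refine hK.exists_eventually_forall_of_mono
      (P := fun C h y => 0 < h → IsStepRegular L R Ld vel r B C h y) ?_ fun y _ => ?_
    · intro C C' h y hCC hP hh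
      exact { hP hh with
        error := fun ξ hξ y₁ hy g ξ z hs hs0 => ((hP hh).error _ hξ y₁ hy g ξ z hs hs0).mono
          (mul_le_mul_of_nonneg_right hCC (pow_nonneg hh.le _)) }
    · obtain ⟨U₁, hU₁, h1⟩ := hℓ.exists_isStepWith_unique hc hL hv hr hagree y
      obtain ⟨U₂, hU₂, C, h2⟩ := hℓ.exists_isStepWith_error hc hL hv hr hagree y
      have hvel : Tendsto (fun q : ℝ × State E G => vel q.2) (𝓝 (0, y)) (𝓝 (vel y)) :=
        (hv.smooth.continuous.comp continuous_snd).tendsto _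
      have h3 := hℓ.eventually_exists_isStepWith hc hL hv hr hagree y
        (Metric.closedBall_mem_nhds (vel y) one_half_pos)
      have h4 := hℓ.eventually_velocity_mem hc hL hv hr hagree hB y (inter_mem hU₁ hU₂)
      have h5 := eventually_exists_flatSolution hc hL hv y.1 y.2.1 y.2.2 univ_mem
      refine ⟨C, ?_⟩
      filter_upwards [h1, h2, h3, h4, h5, hvel.eventually (Metric.closedBall_mem_nhds (vel y)
        one_half_pos)] with q e1 e2 e3 e4 e5 e6 hq
      obtain ⟨ξ, hξ, y₁, hy₁⟩ := e3 hq
      obtain ⟨Y, -, -, g, ξ', z, hs, hs0, -⟩ := e5 hq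
      refine ⟨⟨ξ, ?_, y₁, hy₁⟩, ⟨g, ξ', z, hs, hs0⟩, ?_, ?_⟩
      · have h6 := dist_triangle_right ξ (vel q.2) (vel y)
        rw [Metric.mem_closedBall] at hξ ⊢
        linarith
      · exact fun ξ hξ ξ' hξ' y₁ y₁' hy hy' => e1 hq ξ (e4 ξ hξ hq y₁ hy).1 ξ'
          (e4 ξ' hξ' hq y₁' hy').1 y₁ y₁' hy hy'
      · exact fun ξ hξ y₁ hy => e2 hq ξ (e4 ξ hξ hq y₁ hy).2 y₁ hy
  obtain ⟨C, hC⟩ := key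
  obtain ⟨ε, hε, hball⟩ := Metric.eventually_nhds_iff.1 hC
  refine ⟨C, ε / 2, half_pos hε, fun h hh y hy => hball (y := h) ?_ y hy hh.1⟩
  rw [Real.dist_0_eq_abs, abs_of_pos hh.1]; linarith [hh.2]

open scoped Pointwise in
/-- A discrete flow is obtained by choosing steps with velocity at distance at most `1` from the
velocity of the initial state. -/
lemma IsExtension.exists_isDiscreteFlow (hc : IsGroupChart R Rinv)
    (hL : IsSmoothLagrangian L) (hv : IsVelocity L vel) (hr : 0 < r) (hℓ : IsExtension R Ld ℓ W)
    (hagree : AgreesWithExact L Ld (r + 1)) :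
    ∃ F : ℝ → State E G → State E G, IsDiscreteFlow R Ld F := by
  classical
  have hprop : ProperSpace E := FiniteDimensional.proper ℝ E
  have hF : ∀ (h : ℝ) (y : State E G), ∃ y₁,
      (∃ ξ ∈ Metric.closedBall (vel y) 1, ∃ y₁, IsStepWith R Ld h ξ y y₁) →
        ∃ ξ ∈ Metric.closedBall (vel y) 1, IsStepWith R Ld h ξ y y₁ := fun h y => by
    by_cases hy : ∃ ξ ∈ Metric.closedBall (vel y) 1, ∃ y₁, IsStepWith R Ld h ξ y y₁
    · obtain ⟨ξ, hξ, y₁, hy₁⟩ := hy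
      exact ⟨y₁, fun _ => ⟨ξ, hξ, hy₁⟩⟩
    · exact ⟨y, fun h => absurd h hy⟩
  choose F hF using hF
  refine ⟨F, fun K hK => ?_⟩
  obtain ⟨C, h₀, hh₀, hreg⟩ := hℓ.exists_isStepRegular hc hL hv hr hagree hK isCompact_empty
  refine ⟨vel '' K + Metric.closedBall 0 1, h₀,
    (hK.image hv.smooth.continuous).add (isCompact_closedBall 0 1), hh₀, fun h hh y hy => ?_⟩
  obtain ⟨ξ, hξ, hstep⟩ := hF h y (hreg h hh y hy).exists_step
  refine ⟨hstep.1, ξ, ⟨vel y, mem_image_of_mem _ hy, ξ - vel y, ?_, by simp⟩, hstep.2⟩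
  rwa [mem_closedBall_zero_iff, ← mem_closedBall_iff_norm]

lemma IsExtension.isDiscreteFlow_unique (hc : IsGroupChart R Rinv)
    (hL : IsSmoothLagrangian L) (hv : IsVelocity L vel) (hr : 0 < r) (hℓ : IsExtension R Ld ℓ W)
    (hagree : AgreesWithExact L Ld (r + 1)) {F F' : ℝ → State E G → State E G}
    (hF : IsDiscreteFlow R Ld F) (hF' : IsDiscreteFlow R Ld F') {K : Set (State E G)}
    (hK : IsCompact K) : ∃ h₀ : ℝ, 0 < h₀ ∧ ∀ h ∈ Ioc 0 h₀, ∀ y ∈ K, F h y = F' h y := by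
  obtain ⟨B, h₁, hB, hh₁, h1⟩ := hF K hK
  obtain ⟨B', h₂, hB', hh₂, h2⟩ := hF' K hK
  obtain ⟨C, h₀, hh₀, hreg⟩ := hℓ.exists_isStepRegular hc hL hv hr hagree hK (hB.union hB')
  refine ⟨min h₀ (min h₁ h₂), lt_min hh₀ (lt_min hh₁ hh₂), fun h hh y hy => ?_⟩
  have m0 : h ≤ h₀ := hh.2.trans (min_le_left _ _)
  have m1 : h ≤ h₁ := hh.2.trans ((min_le_right _ _).trans (min_le_left _ _))
  have m2 : h ≤ h₂ := hh.2.trans ((min_le_right _ _).trans (min_le_right _ _))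
  obtain ⟨hs, ξ, hξ, he⟩ := h1 h ⟨hh.1, m1⟩ y hy
  obtain ⟨hs', ξ', hξ', he'⟩ := h2 h ⟨hh.1, m2⟩ y hy
  exact (hreg h ⟨hh.1, m0⟩ y hy).unique ξ (Or.inl hξ) ξ' (Or.inr hξ') _ _ ⟨hs, he⟩ ⟨hs', he'⟩

lemma IsExtension.exists_local_error (hc : IsGroupChart R Rinv)
    (hL : IsSmoothLagrangian L) (hv : IsVelocity L vel) (hr : 0 < r) (hℓ : IsExtension R Ld ℓ W)
    (hagree : AgreesWithExact L Ld (r + 1)) {F : ℝ → State E G → State E G}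
    (hF : IsDiscreteFlow R Ld F) {K : Set (State E G)} (hK : IsCompact K) :
    ∃ C h₀ : ℝ, 0 < h₀ ∧ ∀ h ∈ Ioc 0 h₀, ∀ y ∈ K,
      (∃ (g : ℝ → G) (ξ : ℝ → E) (z : ℝ → ℝ), IsEPHSolution L h g ξ z ∧
        phaseState L g ξ z 0 = y) ∧
      ∀ (g : ℝ → G) (ξ : ℝ → E) (z : ℝ → ℝ), IsEPHSolution L h g ξ z →
        phaseState L g ξ z 0 = y →
          ErrorLE R (C * h ^ (r + 1)) (F h y) (phaseState L g ξ z h) := by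
  obtain ⟨B, h₁, hB, hh₁, h1⟩ := hF K hK
  obtain ⟨C, h₀, hh₀, hreg⟩ := hℓ.exists_isStepRegular hc hL hv hr hagree hK hB
  refine ⟨C, min h₀ h₁, lt_min hh₀ hh₁, fun h hh y hy => ?_⟩
  obtain ⟨hs, ξ, hξ, he⟩ := h1 h ⟨hh.1, hh.2.trans (min_le_right _ _)⟩ y hy
  have h2 := hreg h ⟨hh.1, hh.2.trans (min_le_left _ _)⟩ y hy
  exact ⟨h2.exists_solution, h2.error ξ hξ _ ⟨hs, he⟩⟩

end CompactSteps

/-! ### Global error -/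

section FlatStability

variable {E : Type*} [NormedAddCommGroup E] [NormedSpace ℝ E]
  {m N : E × E → E} {br : E →L[ℝ] E →L[ℝ] E} {f : FlatState E → FlatState E}
  {p : E →L[ℝ] ℝ} {z : ℝ}

/-- The left-invariant difference of two states in a chart. -/
def relState (N : E × E → E) (u : FlatState E × FlatState E) : FlatState E :=
  (N (u.1.1, u.2.1), u.2.2 - u.1.2)

/-- Along integral curves, the left-invariant difference grows at most exponentially. -/
lemma IsLocalGroup.exists_stability [FiniteDimensional ℝ E] (hG : IsLocalGroup m N br)
    (hf : ContDiffAt ℝ ∞ f (0, p, z)) :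
    ∃ V ∈ 𝓝 ((0, p, z) : FlatState E), ∃ K : ℝ, 0 ≤ K ∧ ∀ h, 0 ≤ h → ∀ Y Y' : ℝ → FlatState E,
      (∀ t ∈ Icc 0 h, Y t ∈ V ∧ HasDerivWithinAt Y (f (Y t)) (Icc 0 h) t) →
      (∀ t ∈ Icc 0 h, Y' t ∈ V ∧ HasDerivWithinAt Y' (f (Y' t)) (Icc 0 h) t) →
      ‖relState N (Y h, Y' h)‖ ≤ Real.exp (K * h) * ‖relState N (Y 0, Y' 0)‖ := by
  set Y₀ : FlatState E := (0, p, z) with hY₀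
  have hΘ : ContDiffAt ℝ ∞ (relState N) (Y₀, Y₀) := by
    have h1 : ContDiffAt ℝ ∞ (fun u : FlatState E × FlatState E => N (u.1.1, u.2.1)) (Y₀, Y₀) :=
      ContDiffAt.comp (Y₀, Y₀) (g := N) (f := fun u : FlatState E × FlatState E => (u.1.1, u.2.1))
        hG.div_smooth (by fun_prop)
    exact h1.prodMk (by fun_prop)
  set H : FlatState E × FlatState E → FlatState E := fun u =>
    fderiv ℝ (relState N) u (f u.1, f u.2) with hHdef
  have hH : ContDiffAt ℝ ∞ H (Y₀, Y₀) := by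
    have h1 : ContDiffAt ℝ ∞ (fun u : FlatState E × FlatState E => f u.1) (Y₀, Y₀) :=
      ContDiffAt.comp (Y₀, Y₀) (g := f) hf contDiffAt_fst
    have h2 : ContDiffAt ℝ ∞ (fun u : FlatState E × FlatState E => f u.2) (Y₀, Y₀) :=
      ContDiffAt.comp (Y₀, Y₀) (g := f) hf contDiffAt_snd
    exact (contDiffAt_fderiv hΘ).clm_apply (h1.prodMk h2)
  have tdiag : Tendsto (fun Z : FlatState E => (Z, Z)) (𝓝 Y₀) (𝓝 (Y₀, Y₀)) :=
    Continuous.tendsto' (by fun_prop) _ _ rfl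
  have tx : Tendsto (fun Z : FlatState E => Z.1) (𝓝 Y₀) (𝓝 0) := continuous_fst.tendsto _
  have hNself : ∀ᶠ x in 𝓝 (0 : E), N (x, x) = 0 := by
    have h1 : Tendsto (fun x : E => (x, (0 : E))) (𝓝 0) (𝓝 (0, 0)) :=
      (Continuous.prodMk_left (0 : E)).tendsto 0
    filter_upwards [h1.eventually hG.div_mul, hG.mul_zero] with x e1 e2
    simpa [e2] using e1
  -- on the diagonal the relative velocity vanishes
  have hH0 : ∀ᶠ Z in 𝓝 Y₀, H (Z, Z) = 0 := by
    filter_upwards [(tx.eventually hNself).eventually_nhds,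
      tdiag.eventually (eventually_differentiableAt hΘ)] with Z h1 h2
    have h3 : HasFDerivAt (fun Z : FlatState E => relState N (Z, Z)) _ Z :=
      HasFDerivAt.comp (g := relState N) (f := fun Z : FlatState E => (Z, Z)) Z h2.hasFDerivAt
        ((hasFDerivAt_id Z).prodMk (hasFDerivAt_id Z))
    have h4 : HasFDerivAt (fun Z : FlatState E => relState N (Z, Z))
        (0 : FlatState E →L[ℝ] FlatState E) Z := by
      refine (hasFDerivAt_const (0 : FlatState E) Z).congr_of_eventuallyEq ?_
      filter_upwards [h1] with Z hZ
      rw [relState, hZ, sub_self]; rfl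
    exact DFunLike.congr_fun (h3.unique h4) (f Z)
  obtain ⟨K₁, hK₁0, hK₁⟩ := exists_eventually_norm_sub_le hH
  set Ψ : FlatState E × FlatState E → FlatState E := fun u => (m (u.1.1, u.2.1), u.1.2 + u.2.2)
  have hΨ : ContDiffAt ℝ ∞ Ψ (Y₀, 0) := by
    have h1 : ContDiffAt ℝ ∞ (fun u : FlatState E × FlatState E => m (u.1.1, u.2.1)) (Y₀, 0) :=
      ContDiffAt.comp (Y₀, (0 : FlatState E)) (g := m)
        (f := fun u : FlatState E × FlatState E => (u.1.1, u.2.1)) hG.mul_smooth (by fun_prop)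
    exact h1.prodMk (by fun_prop)
  obtain ⟨K₂, hK₂0, hK₂⟩ := exists_eventually_norm_sub_le hΨ
  have t1 : Tendsto (fun u : FlatState E × FlatState E => u.1) (𝓝 (Y₀, Y₀)) (𝓝 Y₀) :=
    continuous_fst.tendsto _
  have tΘ : Tendsto (relState N) (𝓝 (Y₀, Y₀)) (𝓝 0) := by
    have h1 := hΘ.continuousAt.tendsto
    have h2 : relState N (Y₀, Y₀) = 0 := by
      rw [relState, sub_self]
      exact Prod.ext hG.div_self_zero rfl
    rwa [h2] at h1
  have tH : Tendsto (fun u : FlatState E × FlatState E => (u, (u.1, u.1))) (𝓝 (Y₀, Y₀))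
      (𝓝 ((Y₀, Y₀), (Y₀, Y₀))) := tendsto_id.prodMk_nhds (tdiag.comp t1)
  have tΨ : Tendsto (fun u : FlatState E × FlatState E =>
      ((u.1, relState N u), (u.1, (0 : FlatState E)))) (𝓝 (Y₀, Y₀)) (𝓝 ((Y₀, 0), (Y₀, 0))) :=
    (t1.prodMk_nhds tΘ).prodMk_nhds (t1.prodMk_nhds tendsto_const_nhds)
  have tN : Tendsto (fun u : FlatState E × FlatState E => (u.1.1, u.2.1)) (𝓝 (Y₀, Y₀))
      (𝓝 (0, 0)) := Continuous.tendsto' (by fun_prop) _ _ rfl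
  have key : ∀ᶠ u in 𝓝 (Y₀, Y₀), DifferentiableAt ℝ (relState N) u ∧
      ‖H u‖ ≤ K₁ * K₂ * ‖relState N u‖ := by
    filter_upwards [eventually_differentiableAt hΘ, tH.eventually hK₁, t1.eventually hH0,
      tΨ.eventually hK₂, tN.eventually hG.mul_div, t1.eventually (tx.eventually hG.mul_zero)]
      with u e1 e2 e3 e4 e5 e6
    refine ⟨e1, ?_⟩
    have h1 : Ψ (u.1, relState N u) = u.2 := Prod.ext e5 (add_sub_cancel u.1.2 u.2.2)
    have h2 : Ψ (u.1, 0) = u.1 := Prod.ext e6 (add_zero u.1.2)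
    have h3 : ‖u - (u.1, u.1)‖ = ‖u.2 - u.1‖ := by
      rw [Prod.norm_def]
      simp
    have h4 : ‖((u.1, relState N u) : FlatState E × FlatState E) - (u.1, 0)‖ = ‖relState N u‖ := by
      rw [Prod.norm_def]
      simp
    rw [h1, h2, h4] at e4
    rw [e3, sub_zero, h3] at e2
    calc ‖H u‖ ≤ K₁ * ‖u.2 - u.1‖ := e2
      _ ≤ K₁ * (K₂ * ‖relState N u‖) := mul_le_mul_of_nonneg_left e4 hK₁0
      _ = _ := (mul_assoc _ _ _).symm
  rw [nhds_prod_eq] at key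
  obtain ⟨V, hV, hVV⟩ := Filter.eventually_prod_self_iff'.1 key
  refine ⟨V, hV, K₁ * K₂, mul_nonneg hK₁0 hK₂0, fun h hh Y Y' hY hY' => ?_⟩
  have h1 := norm_le_of_norm_deriv_le (b := fun t => relState N (Y t, Y' t))
    (b' := fun t => H (Y t, Y' t)) (ε := 0) hh (mul_nonneg hK₁0 hK₂0) le_rfl
    (fun t ht => HasFDerivAt.comp_hasDerivWithinAt (l := relState N) (f := fun t => (Y t, Y' t)) t
      (hVV _ (hY t ht).1 _ (hY' t ht).1).1.hasFDerivAt ((hY t ht).2.prodMk (hY' t ht).2)) le_rfl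
    (fun t ht => by
      rw [add_zero]
      exact (hVV _ (hY t ht).1 _ (hY' t ht).1).2)
  rw [MulZeroClass.zero_mul, add_zero, mul_comm] at h1
  exact h1

end FlatStability

section GlobalError

variable {E : Type*} [NormedAddCommGroup E] [NormedSpace ℝ E]
  {G : Type*} [TopologicalSpace G] [ChartedSpace E G] [Group G]
  {R : E → G} {Rinv : G → E} {L : G → E → ℝ → ℝ} {vel : State E G → E}
  {Ld : ℝ → G → G → ℝ → ℝ} {ℓ : ℝ × G × E × ℝ → ℝ} {W : Set (ℝ × G × E × ℝ)} {r : ℕ}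

/-- The state with left-invariant difference `w` from `y`. -/
def translate (R : E → G) (y : State E G) (w : FlatState E) : State E G :=
  (y.1 * R w.1, y.2.1 + w.2.1, y.2.2 + w.2.2)

omit [TopologicalSpace G] [ChartedSpace E G] in
lemma errorLE_iff {ε : ℝ} {y y' : State E G} :
    ErrorLE R ε y y' ↔ ∃ w : FlatState E, ‖w‖ ≤ ε ∧ y = translate R y' w := by
  constructor
  · rintro ⟨⟨η, h1, h2⟩, h3, h4⟩
    refine ⟨(η, y.2.1 - y'.2.1, y.2.2 - y'.2.2), ?_, ?_⟩
    · exact norm_prod_le_iff.2 ⟨h1, norm_prod_le_iff.2 ⟨h3, h4⟩⟩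
    · exact Prod.ext h2 (Prod.ext (add_sub_cancel _ _).symm (add_sub_cancel _ _).symm)
  · rintro ⟨w, h1, rfl⟩
    obtain ⟨h2, h3⟩ := norm_prod_le_iff.1 h1
    obtain ⟨h3, h4⟩ := norm_prod_le_iff.1 h3
    refine ⟨⟨w.1, h2, rfl⟩, ?_, ?_⟩
    · rwa [translate, add_sub_cancel_left]
    · rwa [translate, add_sub_cancel_left]

variable [LieGroup 𝓘(ℝ, E) ∞ G]

lemma IsGroupChart.tendsto_translate (hc : IsGroupChart R Rinv) (y : State E G) :
    Tendsto (fun u : State E G × FlatState E => translate R u.1 u.2) (𝓝 (y, 0)) (𝓝 y) := by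
  have : IsTopologicalGroup G := topologicalGroup_of_lieGroup 𝓘(ℝ, E) ∞
  have h1 : Tendsto (fun u : State E G × FlatState E => u.1.1) (𝓝 (y, 0)) (𝓝 y.1) :=
    Continuous.tendsto' (by fun_prop) _ _ rfl
  have h2 : Tendsto (fun u : State E G × FlatState E => u.2.1) (𝓝 (y, 0)) (𝓝 0) :=
    Continuous.tendsto' (by fun_prop) _ _ rfl
  have h3 : Tendsto (fun u : State E G × FlatState E => (u.1.2.1 + u.2.2.1, u.1.2.2 + u.2.2.2))
      (𝓝 (y, 0)) (𝓝 y.2) := Continuous.tendsto' (by fun_prop) _ _ (by simp)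
  have h4 := h1.mul (hc.tendsto.comp h2)
  rw [mul_one] at h4
  exact h4.prodMk_nhds h3

/-- Left-invariant differences compose, up to a factor. -/
lemma IsGroupChart.exists_translate_translate [FiniteDimensional ℝ E] (hc : IsGroupChart R Rinv) :
    ∃ K : ℝ, 0 ≤ K ∧ ∃ ρ : ℝ, 0 < ρ ∧ ∀ w v : FlatState E, ‖w‖ < ρ → ‖v‖ < ρ →
      ∃ w' : FlatState E, ‖w'‖ ≤ ‖w‖ + K * ‖v‖ ∧
        ∀ y : State E G, translate R (translate R y w) v = translate R y w' := by
  obtain ⟨K, hK0, hK⟩ := exists_eventually_norm_sub_le hc.contDiffAt_chartMul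
  have t1 : Tendsto (fun u : FlatState E × FlatState E => (u.1.1, u.2.1)) (𝓝 (0, 0)) (𝓝 (0, 0)) :=
    Continuous.tendsto' (by fun_prop) _ _ rfl
  have t2 : Tendsto (fun u : FlatState E × FlatState E => ((u.1.1, u.2.1), (u.1.1, (0 : E))))
      (𝓝 (0, 0)) (𝓝 ((0, 0), (0, 0))) := Continuous.tendsto' (by fun_prop) _ _ rfl
  have t3 : Tendsto (fun u : FlatState E × FlatState E => u.1.1) (𝓝 (0, 0)) (𝓝 0) :=
    Continuous.tendsto' (by fun_prop) _ _ rfl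
  obtain ⟨ρ, hρ, hball⟩ := Metric.eventually_nhds_iff_ball.1 (((t1.eventually
    hc.eventually_map_mul).and (t2.eventually hK)).and (t3.eventually hc.chartMul_zero))
  refine ⟨max K 1, hK0.trans (le_max_left _ _), ρ, hρ, fun w v hw hv => ?_⟩
  obtain ⟨⟨h1, h2⟩, h3⟩ := hball (w, v) (by
    show (w, v) ∈ Metric.ball (0 : FlatState E × FlatState E) ρ
    rw [mem_ball_zero_iff, Prod.norm_def]
    exact max_lt hw hv)
  simp only at h1 h2 h3
  have hv0 := norm_nonneg v
  refine ⟨(chartMul R Rinv (w.1, v.1), w.2.1 + v.2.1, w.2.2 + v.2.2), ?_, fun y => ?_⟩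
  · refine norm_prod_le_iff.2 ⟨?_, ?_⟩
    · have h4 : ‖((w.1, v.1) : E × E) - (w.1, 0)‖ = ‖v.1‖ := by
        rw [Prod.norm_def]; simp
      rw [h3, h4] at h2
      calc ‖chartMul R Rinv (w.1, v.1)‖ ≤ ‖w.1‖ + ‖chartMul R Rinv (w.1, v.1) - w.1‖ :=
            norm_le_norm_add_norm_sub' _ _
        _ ≤ ‖w‖ + max K 1 * ‖v‖ := add_le_add (norm_fst_le w) (h2.trans
            (mul_le_mul (le_max_left _ _) (norm_fst_le v) (norm_nonneg _)
              (hK0.trans (le_max_left _ _))))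
    · calc ‖w.2 + v.2‖ ≤ ‖w.2‖ + ‖v.2‖ := norm_add_le _ _
        _ ≤ ‖w‖ + 1 * ‖v‖ := by
          rw [one_mul]
          exact add_le_add (norm_snd_le w) (norm_snd_le v)
        _ ≤ _ := add_le_add le_rfl (mul_le_mul_of_nonneg_right (le_max_right _ _) hv0)
  · refine Prod.ext ?_ (Prod.ext (add_assoc _ _ _) (add_assoc _ _ _))
    show y.1 * R w.1 * R v.1 = y.1 * R (chartMul R Rinv (w.1, v.1))
    rw [h1, mul_assoc]

variable [FiniteDimensional ℝ E] [T2Space G]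

/-- Stability of exact solutions near a state: the left-invariant difference grows at most
exponentially. -/
lemma exists_stability (hc : IsGroupChart R Rinv) (hL : IsSmoothLagrangian L)
    (hv : IsVelocity L vel) (y : State E G) :
    ∃ K : ℝ, 0 ≤ K ∧ ∀ᶠ u in 𝓝 (((0 : ℝ), y), (0 : FlatState E)), 0 < u.1.1 →
      ∀ (g : ℝ → G) (ξ : ℝ → E) (z : ℝ → ℝ) (g' : ℝ → G) (ξ' : ℝ → E) (z' : ℝ → ℝ),
        IsEPHSolution L u.1.1 g ξ z → phaseState L g ξ z 0 = u.1.2 →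
        IsEPHSolution L u.1.1 g' ξ' z' → phaseState L g' ξ' z' 0 = translate R u.1.2 u.2 →
        ErrorLE R (Real.exp (K * u.1.1) * ‖u.2‖) (phaseState L g' ξ' z' u.1.1)
          (phaseState L g ξ z u.1.1) := by
  obtain ⟨a, p, z⟩ := y
  obtain ⟨V, hV, K, hK0, hK⟩ := hc.isLocalGroup.exists_stability
    (contDiffAt_chartField hc hL hv a p z)
  have hdiv := hc.eventually_map_div
  rw [nhds_prod_eq] at hdiv
  obtain ⟨O, hO, hOdiv⟩ := Filter.eventually_prod_self_iff'.1 hdiv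
  have tx : Tendsto (fun Y : FlatState E => Y.1) (𝓝 (0, p, z)) (𝓝 0) := continuous_fst.tendsto _
  have hsol := (eventually_exists_flatSolution hc hL hv a p z
    (inter_mem hV (tx.eventually_mem hO))).and (hc.eventually_chart a (p, z))
  have t1 : Tendsto (fun u : (ℝ × State E G) × FlatState E => u.1)
      (𝓝 ((0, (a, p, z)), 0)) (𝓝 (0, (a, p, z))) := continuous_fst.tendsto _
  have t2 : Tendsto (fun u : (ℝ × State E G) × FlatState E => (u.1.1, translate R u.1.2 u.2))
      (𝓝 ((0, (a, p, z)), 0)) (𝓝 (0, (a, p, z))) := by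
    have h1 : Tendsto (fun u : (ℝ × State E G) × FlatState E => (u.1.2, u.2))
      (𝓝 ((0, (a, p, z)), 0)) (𝓝 ((a, p, z), 0)) := Continuous.tendsto' (by fun_prop) _ _ rfl
    have h2 : Tendsto (fun u : (ℝ × State E G) × FlatState E => u.1.1)
      (𝓝 ((0, (a, p, z)), 0)) (𝓝 0) := Continuous.tendsto' (by fun_prop) _ _ rfl
    exact h2.prodMk_nhds ((hc.tendsto_translate _).comp h1)
  have t3 : Tendsto (fun u : (ℝ × State E G) × FlatState E => u.2.1)
      (𝓝 ((0, (a, p, z)), 0)) (𝓝 0) := Continuous.tendsto' (by fun_prop) _ _ rfl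
  have t4 : Tendsto (fun u : (ℝ × State E G) × FlatState E => Rinv (a⁻¹ * u.1.2.1))
      (𝓝 ((0, (a, p, z)), 0)) (𝓝 0) := ((hc.tendsto_chart a (p, z)).comp t1).snd_nhds.fst_nhds
  have t5 : Tendsto (fun u : (ℝ × State E G) × FlatState E =>
      Rinv (a⁻¹ * (translate R u.1.2 u.2).1)) (𝓝 ((0, (a, p, z)), 0)) (𝓝 0) :=
    ((hc.tendsto_chart a (p, z)).comp t2).snd_nhds.fst_nhds
  refine ⟨K, hK0, ?_⟩
  filter_upwards [t1.eventually hsol, t2.eventually hsol, t3.eventually hc.left_inv]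
    with ⟨⟨h, y⟩, w⟩ e1 e2 e3 hh g ξ z g' ξ' z' hs hs0 hs' hs0'
  obtain ⟨e1, e1'⟩ := e1
  obtain ⟨e2, e2'⟩ := e2
  simp only at e1 e1' e2 e2' e3 hh hs hs0 hs' hs0' ⊢
  obtain ⟨Y, hY0, hY, g₁, ξ₁, z₁, f1, f2, f3⟩ := e1 hh
  obtain ⟨Y', hY0', hY', g₁', ξ₁', z₁', f1', f2', f3'⟩ := e2 hh
  have hhm : h ∈ Icc 0 h := right_mem_Icc.2 hh.le
  have h0m : (0 : ℝ) ∈ Icc 0 h := left_mem_Icc.2 hh.le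
  rw [hs.phaseState_unique hc hL hv f1 (hs0.trans f2.symm) h hhm,
    hs'.phaseState_unique hc hL hv f1' (hs0'.trans f2'.symm) h hhm, f3, f3']
  have h1 := hK h hh.le Y Y' (fun t ht => ⟨(hY t ht).1.1, (hY t ht).2⟩)
    fun t ht => ⟨(hY' t ht).1.1, (hY' t ht).2⟩
  have h2 : relState (chartDiv R Rinv) (Y 0, Y' 0) = w := by
    rw [hY0, hY0']
    have h3 : R (Rinv (a⁻¹ * y.1)) = a⁻¹ * y.1 := by
      rw [eq_inv_mul_iff_mul_eq]; exact e1'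
    have h4 : R (Rinv (a⁻¹ * (y.1 * R w.1))) = a⁻¹ * (y.1 * R w.1) := by
      rw [eq_inv_mul_iff_mul_eq]; exact e2'
    refine Prod.ext ?_ (Prod.ext (add_sub_cancel_left _ _) (add_sub_cancel_left _ _))
    show Rinv ((R (Rinv (a⁻¹ * y.1)))⁻¹ * R (Rinv (a⁻¹ * (y.1 * R w.1)))) = w.1
    rw [h3, h4, ← mul_assoc a⁻¹, inv_mul_cancel_left, e3]
  rw [h2] at h1
  refine errorLE_iff.2 ⟨_, h1, Prod.ext ?_ (Prod.ext (add_sub_cancel _ _).symm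
    (add_sub_cancel _ _).symm)⟩
  show a * R (Y' h).1 = a * R (Y h).1 * R (chartDiv R Rinv ((Y h).1, (Y' h).1))
  rw [hOdiv _ (hY h hhm).1.2 _ (hY' h hhm).1.2, mul_assoc, mul_inv_cancel_left]

/-- Stability of exact solutions along a compact set `Γ`, uniformly: the constant also bounds the
admissible size of the perturbation, which stays in a neighbourhood `K` of `Γ`. -/
lemma exists_stability_of_isCompact (hc : IsGroupChart R Rinv) (hL : IsSmoothLagrangian L)
    (hv : IsVelocity L vel) {Γ K : Set (State E G)} (hΓ : IsCompact Γ) (hK : Γ ⊆ interior K) :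
    ∃ C h₀ : ℝ, 0 < C ∧ 0 < h₀ ∧ ∀ h ∈ Ioc 0 h₀, ∀ y ∈ Γ, ∀ w : FlatState E, C * ‖w‖ ≤ 1 →
      translate R y w ∈ K ∧
      ∀ (g : ℝ → G) (ξ : ℝ → E) (z : ℝ → ℝ) (g' : ℝ → G) (ξ' : ℝ → E) (z' : ℝ → ℝ),
        IsEPHSolution L h g ξ z → phaseState L g ξ z 0 = y →
        IsEPHSolution L h g' ξ' z' → phaseState L g' ξ' z' 0 = translate R y w →
        ErrorLE R (Real.exp (C * h) * ‖w‖) (phaseState L g' ξ' z' h) (phaseState L g ξ z h) := by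
  let P : ℝ → ℝ → State E G → Prop := fun C h y => 0 < C ∧ (0 < h → ∀ w : FlatState E,
    C * ‖w‖ ≤ 1 → translate R y w ∈ K ∧
      ∀ (g : ℝ → G) (ξ : ℝ → E) (z : ℝ → ℝ) (g' : ℝ → G) (ξ' : ℝ → E) (z' : ℝ → ℝ),
        IsEPHSolution L h g ξ z → phaseState L g ξ z 0 = y →
        IsEPHSolution L h g' ξ' z' → phaseState L g' ξ' z' 0 = translate R y w →
        ErrorLE R (Real.exp (C * h) * ‖w‖) (phaseState L g' ξ' z' h) (phaseState L g ξ z h))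
  have key : ∃ C, ∀ᶠ h in 𝓝 (0 : ℝ), ∀ y ∈ Γ, P C h y := by
    refine hΓ.exists_eventually_forall_of_mono
      (fun C C' h y hCC hP => ⟨hP.1.trans_le hCC, fun hh w hw => ?_⟩) fun y hy => ?_
    · obtain ⟨h1, h2⟩ := hP.2 hh w
        ((mul_le_mul_of_nonneg_right hCC (norm_nonneg w)).trans hw)
      refine ⟨h1, fun g ξ z g' ξ' z' hs hs0 hs' hs0' => (h2 g ξ z g' ξ' z' hs hs0 hs' hs0').mono ?_⟩
      gcongr
    · obtain ⟨C, hC0, hC⟩ := exists_stability hc hL hv y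
      have hKn : K ∈ 𝓝 y := mem_interior_iff_mem_nhds.1 (hK hy)
      have t2 : Tendsto (fun u : (ℝ × State E G) × FlatState E => translate R u.1.2 u.2)
          (𝓝 ((0, y), 0)) (𝓝 y) := by
        have h1 : Tendsto (fun u : (ℝ × State E G) × FlatState E => (u.1.2, u.2))
          (𝓝 ((0, y), 0)) (𝓝 (y, 0)) := Continuous.tendsto' (by fun_prop) _ _ rfl
        exact (hc.tendsto_translate _).comp h1
      obtain ⟨V, hV, h1⟩ :=
        eventually_forall_mem_of_eventually_prod (hC.and (t2.eventually_mem hKn))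
      obtain ⟨ρ, hρ, hball⟩ := Metric.mem_nhds_iff.1 hV
      refine ⟨max C (2 / ρ), ?_⟩
      filter_upwards [h1] with q hq
      have hpos : 0 < max C (2 / ρ) := lt_max_of_lt_right (by positivity)
      refine ⟨hpos, fun hh w hw => ?_⟩
      have hwV : w ∈ V := by
        refine hball (mem_ball_zero_iff.2 ?_)
        have h2 : 2 / ρ * ‖w‖ ≤ 1 :=
          (mul_le_mul_of_nonneg_right (le_max_right _ _) (norm_nonneg w)).trans hw
        rw [div_mul_eq_mul_div, div_le_one hρ] at h2
        linarith [norm_nonneg w]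
      obtain ⟨h3, h4⟩ := hq w hwV
      refine ⟨h4, fun g ξ z g' ξ' z' hs hs0 hs' hs0' =>
        (h3 hh g ξ z g' ξ' z' hs hs0 hs' hs0').mono ?_⟩
      show Real.exp (C * q.1) * ‖w‖ ≤ _
      gcongr
      exact le_max_left _ _
  obtain ⟨C, hC⟩ := key
  obtain ⟨ε, hε, hball⟩ := Metric.eventually_nhds_iff.1 hC
  refine ⟨max C 1, ε / 2, lt_max_of_lt_right one_pos, half_pos hε, fun h hh y hy w hw => ?_⟩
  obtain ⟨h1, h2⟩ := hball (y := h)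
    (by rw [Real.dist_0_eq_abs, abs_of_pos hh.1]; linarith [hh.2]) y hy
  obtain ⟨h3, h4⟩ := h2 hh.1 w
    ((mul_le_mul_of_nonneg_right (le_max_left _ _) (norm_nonneg w)).trans hw)
  refine ⟨h3, fun g ξ z g' ξ' z' hs hs0 hs' hs0' =>
    (h4 g ξ z g' ξ' z' hs hs0 hs' hs0').mono ?_⟩
  have := hh.1
  gcongr
  exact le_max_left _ _

/-- The local errors, transported by the exact solutions, add up to an error `O(hʳ)`. -/
lemma IsExtension.exists_global_error (hc : IsGroupChart R Rinv)
    (hL : IsSmoothLagrangian L) (hv : IsVelocity L vel) (hr : 0 < r) (hℓ : IsExtension R Ld ℓ W)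
    (hagree : AgreesWithExact L Ld (r + 1)) {F : ℝ → State E G → State E G}
    (hF : IsDiscreteFlow R Ld F) {T : ℝ} {g : ℝ → G} {ξ : ℝ → E} {z : ℝ → ℝ} (hT : 0 < T)
    (hs : IsEPHSolution L T g ξ z) :
    ∃ C h₀ : ℝ, 0 < h₀ ∧ ∀ (N : ℕ) (h : ℝ), h ∈ Ioc 0 h₀ → N * h = T → ∀ k ≤ N,
      ErrorLE R (C * h ^ r) ((F h)^[k] (phaseState L g ξ z 0)) (phaseState L g ξ z (k * h)) := by
  have hGloc : LocallyCompactSpace G := Manifold.locallyCompact_of_finiteDimensional 𝓘(ℝ, E)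
  have hEprop : ProperSpace (E →L[ℝ] ℝ) := FiniteDimensional.proper ℝ _
  set y := phaseState L g ξ z with hy
  have hΓ : IsCompact (y '' Icc 0 T) :=
    isCompact_Icc.image_of_continuousOn hs.continuousOn_phaseState
  obtain ⟨K, hK, hΓK⟩ := exists_compact_superset hΓ
  obtain ⟨C, h₁, hC, hh₁, hstab⟩ := exists_stability_of_isCompact (R := R) hc hL hv hΓ hΓK
  obtain ⟨C₁', h₂, hh₂, hloc'⟩ := hℓ.exists_local_error hc hL hv hr hagree hF hK
  obtain ⟨C₂, hC₂, ρ, hρ, hcomp⟩ := hc.exists_translate_translate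
  set C₁ := max C₁' 0
  have hC₁ : 0 ≤ C₁ := le_max_right _ _
  set A := C₂ * C₁ with hA
  have hA0 : 0 ≤ A := mul_nonneg hC₂ hC₁
  set D := Real.exp (C * T) * (T * A) with hD
  have hD0 : 0 ≤ D := by positivity
  -- the step size for which all the errors below stay in the domains of the estimates
  obtain ⟨h₃, hh₃, h3⟩ : ∃ h₃ : ℝ, 0 < h₃ ∧ ∀ h, 0 < h → h ≤ h₃ →
      C * (D * h) ≤ 1 ∧ Real.exp C * (D * h) < ρ ∧ C₁ * h < ρ ∧ h ≤ 1 := by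
    have c1 : ∀ᶠ h in 𝓝 (0 : ℝ), C * (D * h) < 1 := by
      have : Tendsto (fun h : ℝ => C * (D * h)) (𝓝 0) (𝓝 0) :=
        Continuous.tendsto' (by fun_prop) _ _ (by simp)
      exact this.eventually (gt_mem_nhds one_pos)
    have c2 : ∀ᶠ h in 𝓝 (0 : ℝ), Real.exp C * (D * h) < ρ := by
      have : Tendsto (fun h : ℝ => Real.exp C * (D * h)) (𝓝 0) (𝓝 0) :=
        Continuous.tendsto' (by fun_prop) _ _ (by simp)
      exact this.eventually (gt_mem_nhds hρ)
    have c3 : ∀ᶠ h in 𝓝 (0 : ℝ), C₁ * h < ρ := by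
      have : Tendsto (fun h : ℝ => C₁ * h) (𝓝 0) (𝓝 0) :=
        Continuous.tendsto' (by fun_prop) _ _ (by simp)
      exact this.eventually (gt_mem_nhds hρ)
    obtain ⟨ε, hε, hball⟩ := Metric.eventually_nhds_iff.1
      (((c1.and c2).and c3).and (gt_mem_nhds one_pos))
    refine ⟨ε / 2, half_pos hε, fun h hh hhε => ?_⟩
    obtain ⟨⟨⟨d1, d2⟩, d3⟩, d4⟩ := hball (y := h)
      (by rw [Real.dist_0_eq_abs, abs_of_pos hh]; linarith)
    exact ⟨d1.le, d2, d3, le_of_lt d4⟩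
  refine ⟨D, min h₁ (min h₂ h₃), lt_min hh₁ (lt_min hh₂ hh₃), fun N h hh hNT => ?_⟩
  have hh0 := hh.1
  have m1 : h ≤ h₁ := hh.2.trans (min_le_left _ _)
  have m2 : h ≤ h₂ := hh.2.trans ((min_le_right _ _).trans (min_le_left _ _))
  obtain ⟨s1, s2, s3, s4⟩ := h3 h hh0 (hh.2.trans ((min_le_right _ _).trans (min_le_right _ _)))
  have hpow : h ^ r ≤ h := by
    simpa using pow_le_pow_of_le_one hh0.le s4 hr
  have hkT : ∀ k : ℕ, k ≤ N → (k : ℝ) * h ≤ T := fun k hk => by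
    rw [← hNT]
    exact mul_le_mul_of_nonneg_right (by exact_mod_cast hk) hh0.le
  have hDk : ∀ k : ℕ, k ≤ N → Real.exp (C * (k * h)) * (k * h * A) * h ^ r ≤ D * h ^ r :=
    fun k hk => by
      have := hkT k hk
      rw [hD]
      gcongr
  -- the error after `k` steps: the flow amplifies it by `exp (C h)`, the next step adds `A h^(r+1)`
  have main : ∀ k ≤ N, ∃ w : FlatState E, ‖w‖ ≤ Real.exp (C * (k * h)) * (k * h * A) * h ^ r ∧
      (F h)^[k] (y 0) = translate R (y (k * h)) w := by
    intro k
    induction k with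
    | zero =>
      intro _
      refine ⟨0, by simp, ?_⟩
      simp [translate, hc.map_zero]
    | succ k ih =>
      intro hk
      obtain ⟨w, hw, hFk⟩ := ih (by omega)
      have hwD : ‖w‖ ≤ D * h ^ r := hw.trans (hDk k (by omega))
      have hwD' : ‖w‖ ≤ D * h := hwD.trans (mul_le_mul_of_nonneg_left hpow hD0)
      have hsucc : (k : ℝ) * h + h ≤ T := by
        have := hkT (k + 1) hk
        push_cast at this
        linarith
      have hk0 : (0 : ℝ) ≤ k * h := by positivity
      have hmem : y (k * h) ∈ y '' Icc 0 T := ⟨_, ⟨hk0, by linarith⟩, rfl⟩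
      obtain ⟨b1, b2⟩ := hstab h ⟨hh0, m1⟩ _ hmem w
        ((mul_le_mul_of_nonneg_left hwD' hC.le).trans s1)
      obtain ⟨⟨g', ξ', z', hs', hs0'⟩, b3⟩ := hloc' h ⟨hh0, m2⟩ _ b1
      have b4 := b3 g' ξ' z' hs' hs0'
      have hshift0 : phaseState L (fun t => g (k * h + t)) (fun t => ξ (k * h + t))
          (fun t => z (k * h + t)) 0 = y (k * h) := by
        simp only [hy, phaseState, add_zero]
      have b5 := b2 _ _ _ g' ξ' z' (hs.shift hk0 hsucc) hshift0 hs' hs0'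
      have hshift1 : phaseState L (fun t => g (k * h + t)) (fun t => ξ (k * h + t))
          (fun t => z (k * h + t)) h = y ((k + 1 : ℕ) * h) := by
        have : ((k + 1 : ℕ) : ℝ) * h = k * h + h := by push_cast; ring
        rw [this]
        rfl
      rw [hshift1] at b5
      obtain ⟨w', hw', hb5⟩ := errorLE_iff.1 b5
      obtain ⟨v, hv', hb4⟩ := errorLE_iff.1 b4
      have hv1 : ‖v‖ ≤ C₁ * h ^ (r + 1) :=
        hv'.trans (mul_le_mul_of_nonneg_right (le_max_left _ _) (by positivity))
      have hpow' : h ^ (r + 1) ≤ h := by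
        simpa using pow_le_pow_of_le_one hh0.le s4 (Nat.succ_le_succ (Nat.zero_le r))
      have hvρ : ‖v‖ < ρ := (hv1.trans (mul_le_mul_of_nonneg_left hpow' hC₁)).trans_lt s3
      have hwρ : ‖w'‖ < ρ := by
        refine lt_of_le_of_lt (hw'.trans ?_) s2
        refine mul_le_mul (Real.exp_le_exp.2 ?_) hwD' (norm_nonneg _) (Real.exp_pos _).le
        exact mul_le_of_le_one_right hC.le s4
      obtain ⟨w'', hw'', htr⟩ := hcomp w' v hwρ hvρ
      refine ⟨w'', hw''.trans ?_, ?_⟩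
      · have hexp : Real.exp (C * h) * Real.exp (C * (k * h)) =
            Real.exp (C * ((k + 1 : ℕ) * h)) := by
          rw [← Real.exp_add]; congr 1; push_cast; ring
        have hone : 1 ≤ Real.exp (C * ((k + 1 : ℕ) * h)) := Real.one_le_exp (by positivity)
        calc ‖w'‖ + C₂ * ‖v‖ ≤ Real.exp (C * h) *
              (Real.exp (C * (k * h)) * (k * h * A) * h ^ r) + C₂ * (C₁ * h ^ (r + 1)) :=
              add_le_add (hw'.trans (mul_le_mul_of_nonneg_left hw (Real.exp_pos _).le))
                (mul_le_mul_of_nonneg_left hv1 hC₂)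
          _ = Real.exp (C * ((k + 1 : ℕ) * h)) * (k * h * A * h ^ r) + 1 * (h * A * h ^ r) := by
              rw [← hexp, hA]; ring
          _ ≤ Real.exp (C * ((k + 1 : ℕ) * h)) * (k * h * A * h ^ r) +
              Real.exp (C * ((k + 1 : ℕ) * h)) * (h * A * h ^ r) :=
              add_le_add le_rfl (mul_le_mul_of_nonneg_right hone (by positivity))
          _ = _ := by push_cast; ring
      · rw [Function.iterate_succ_apply', hFk, hb4, hb5, htr]
  intro k hk
  obtain ⟨w, hw, hFk⟩ := main k hk
  exact errorLE_iff.2 ⟨w, hw.trans (hDk k hk), hFk⟩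

end GlobalError

end ContactLGVI

end

theorem mainTheorem6 {E : Type*} [NormedAddCommGroup E] [NormedSpace ℝ E] [FiniteDimensional ℝ E]
    {G : Type*} [TopologicalSpace G] [ChartedSpace E G] [Group G] [LieGroup 𝓘(ℝ, E) ∞ G]
    [T2Space G]
    (L : G → E → ℝ → ℝ) (hL : ContactLGVI.IsSmoothLagrangian L)
    (hreg : ContactLGVI.IsHyperregular L)
    (R : E → G) (hR : ContactLGVI.IsRetraction R)
    (Ld : ℝ → G → G → ℝ → ℝ) (hLd : ContactLGVI.IsSmoothDiscreteLagrangian R Ld)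
    (r : ℕ) (hr : 1 ≤ r) (hagree : ContactLGVI.AgreesWithExact L Ld (r + 1)) :
    -- the steps generated by `S_d` are those of the discrete Herglotz principle
    (∀ (K : Set (G × ℝ)) (B : Set E), IsCompact K → IsCompact B →
      ∃ h₀ : ℝ, 0 < h₀ ∧ ∀ h ∈ Set.Ioc 0 h₀, ∀ (N : ℕ) (gs : ℕ → G) (z₀ : ℝ),
        (∀ k ≤ N, (gs k, ContactLGVI.herglotzCost Ld h gs z₀ k) ∈ K) →
        (∀ k < N, ∃ ξ ∈ B, gs (k + 1) = gs k * R (h • ξ)) →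
        (ContactLGVI.DiscreteHerglotzPrinciple (E := E) Ld h N gs z₀ ↔
          ∃ p : ℕ → (E →L[ℝ] ℝ), ∀ k < N, ContactLGVI.IsDiscreteStep R Ld h
            (gs k, p k, ContactLGVI.herglotzCost Ld h gs z₀ k)
            (gs (k + 1), p (k + 1), ContactLGVI.herglotzCost Ld h gs z₀ (k + 1)))) ∧
    -- the discrete flow exists and is unique, locally uniformly for small steps
    (∃ F : ℝ → ContactLGVI.State E G → ContactLGVI.State E G,
      ContactLGVI.IsDiscreteFlow R Ld F) ∧
    (∀ F F' : ℝ → ContactLGVI.State E G → ContactLGVI.State E G,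
      ContactLGVI.IsDiscreteFlow R Ld F → ContactLGVI.IsDiscreteFlow R Ld F' →
      ∀ K : Set (ContactLGVI.State E G), IsCompact K →
        ∃ h₀ : ℝ, 0 < h₀ ∧ ∀ h ∈ Set.Ioc 0 h₀, ∀ y ∈ K, F h y = F' h y) ∧
    ∀ F : ℝ → ContactLGVI.State E G → ContactLGVI.State E G, ContactLGVI.IsDiscreteFlow R Ld F →
      -- local error
      (∀ K : Set (ContactLGVI.State E G), IsCompact K → ∃ C h₀ : ℝ, 0 < h₀ ∧
        ∀ h ∈ Set.Ioc 0 h₀, ∀ y ∈ K,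
          (∃ (g : ℝ → G) (ξ : ℝ → E) (z : ℝ → ℝ), ContactLGVI.IsEPHSolution L h g ξ z ∧
            ContactLGVI.phaseState L g ξ z 0 = y) ∧
          ∀ (g : ℝ → G) (ξ : ℝ → E) (z : ℝ → ℝ), ContactLGVI.IsEPHSolution L h g ξ z →
            ContactLGVI.phaseState L g ξ z 0 = y →
            ContactLGVI.ErrorLE R (C * h ^ (r + 1)) (F h y)
              (ContactLGVI.phaseState L g ξ z h)) ∧
      -- global error
      (∀ (T : ℝ) (g : ℝ → G) (ξ : ℝ → E) (z : ℝ → ℝ), 0 < T →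
        ContactLGVI.IsEPHSolution L T g ξ z → ∃ C h₀ : ℝ, 0 < h₀ ∧
          ∀ (N : ℕ) (h : ℝ), h ∈ Set.Ioc 0 h₀ → N * h = T → ∀ k ≤ N,
            ContactLGVI.ErrorLE R (C * h ^ r)
              ((F h)^[k] (ContactLGVI.phaseState L g ξ z 0))
              (ContactLGVI.phaseState L g ξ z (k * h))) := by
  obtain ⟨Rinv, hc⟩ := hR.exists_chart
  obtain ⟨vel, hv⟩ := hreg.exists_velocity
  obtain ⟨ℓ, W, hW, hW0, hℓ, hLdℓ⟩ := hLd
  have hext : ContactLGVI.IsExtension R Ld ℓ W := ⟨hW, hW0, hℓ, hLdℓ⟩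
  refine ⟨fun K B hK hB => ?_, ?_, fun F F' hF hF' K hK => ?_, fun F hF => ⟨fun K hK => ?_,
    fun T g ξ z hT hs => ?_⟩⟩
  · exact ContactLGVI.discreteHerglotz_iff_of_isCompact hc hL hv hr hext hagree hK hB
  · exact hext.exists_isDiscreteFlow hc hL hv hr hagree
  · exact hext.isDiscreteFlow_unique hc hL hv hr hagree hF hF' hK
  · exact hext.exists_local_error hc hL hv hr hagree hF hK
  · exact hext.exists_global_error hc hL hv hr hagree hF hT hs
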